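/- Notation: $n\in\mathbb N$; $\langle x\rangle=(1+|x|^2)^{1/2}$ for $x\in\mathbb R^n$; $\alpha,\beta,\gamma,\delta,\dots\in\mathbb N^n$ denote multi-indices, with the usual $|\alpha|$, $\alpha!$ and $\partial^\alpha$; and $m_1,m_2,m_3,m_4,t_1,t_2\in\mathbb R$. Let $\psi=\psi(x,\xi)\in C^\infty(\mathbb R^n\times\mathbb R^n)$ be real-valued and such that, for some $C_1,C_2>0$, $$C_1\langle\xi\rangle\le\langle\nabla_x\psi(x,\xi)\rangle\le C_2\langle\xi\rangle\quad\text{for all }x,\xi\in\mathbb R^n,$$ and such that for all $|\alpha|,|\beta|\ge1$ there are constants with $$|\partial_x^\alpha\psi(x,\xi)|\le C_\alpha\langle\xi\rangle,\qquad |\partial_x^\alpha\partial_\xi^\beta\psi(x,\xi)|\le C_{\alpha\beta}\quad\text{for all }x,\xi\in\mathbb R^n.$$ Let $b=b(y,\xi,z,\eta)\in C^\infty(\mathbb R^{4n})$ and $q=q(x,\eta)\in C^\infty(\mathbb R^n\times\mathbb R^n)$ be complex-valued and satisfy, for all multi-indices and all values of the variables, $$|\partial_y^\alpha\partial_\xi^\beta\partial_z^\gamma\partial_\eta^\delta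 b(y,\xi,z,\eta)|\le C_{\alpha\beta\gamma\delta}\langle y\rangle^{m_1}\langle\xi\rangle^{m_2}\langle z\rangle^{m_3}\langle\eta\rangle^{m_4-|\delta|},\qquad |\partial_x^\alpha\partial_\eta^\beta q(x,\eta)|\le C_{\alpha\beta}\langle x\rangle^{t_1}\langle\eta\rangle^{t_2-|\beta|}.$$ Then, for all $x,z,\xi\in\mathbb R^n$, the oscillatory integral $$c(x,z,\xi)=(2\pi)^{-n}\int_{\mathbb R^n}\int_{\mathbb R^n}e^{i(\psi(y,\xi)-\psi(x,\xi)+(x-y)\cdot\eta)}\,b(y,\xi,z,\eta)\,q(x,\eta)\,dy\,d\eta$$ exists, in the sense that for every $\kappa\in C_0^\infty(\mathbb R^n\times\mathbb R^n)$ equal to $1$ near the origin the integrals with the additional factor $\kappa(\varepsilon y,\varepsilon\eta)$ converge as $\varepsilon\to0^+$, to a limit $c(x,z,\xi)$ independent of $\kappa$. The function $c$ is smooth, and for all $\alpha,\beta,\gamma$ there is a constant $C_{\alpha\beta\gamma}$ with $$|\partial_x^\alpha\partial_z^\beta\partial_\xi^\gamma c(x,z,\xi)|\le C_{\alpha\beta\gamma}\langle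 x\rangle^{m_1+t_1}\langle z\rangle^{m_3}\langle\xi\rangle^{m_2+t_2+m_4}\quad\text{for all }x,z,\xi\in\mathbb R^n.$$ Moreover, there is the asymptotic expansion, improving in $\xi$, $$c(x,z,\xi)\sim\sum_{\alpha,\beta}c_{\alpha\beta}(x,z,\xi),\qquad c_{\alpha\beta}(x,z,\xi)=\frac{i^{-(|\alpha|+|\beta|)}}{\alpha!\,\beta!}\,(\partial_\eta^\alpha q)(x,\nabla_x\psi(x,\xi))\;\partial_y^{\alpha+\beta}\Big[e^{i\Psi(x,y,\xi)}(\partial_\eta^\beta b)(y,\xi,z,\nabla_x\psi(x,\xi))\Big]\Big|_{y=x},$$ where $\Psi(x,y,\xi)=\psi(y,\xi)-\psi(x,\xi)+(x-y)\cdot\nabla_x\psi(x,\xi)$. This means: for all multi-indices $\mu,\nu,\rho$ and all $M\in\mathbb R$ there is $N\in\mathbb N$ such that for every finite set $S$ of pairs $(\alpha,\beta)$ containing all pairs with $|\alpha|+|\beta|<N$ there is a constant $C$ with $$\Big|\partial_x^\mu\partial_z^\nu\partial_\xi^\rho\Big(c-\sum_{(\alpha,\beta)\in S}c_{\alpha\beta}\Big)(x,z,\xi)\Big|\le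 C\langle x\rangle^{m_1+t_1}\langle z\rangle^{m_3}\langle\xi\rangle^{m_2+t_2+m_4-M}\quad\text{for all }x,z,\xi\in\mathbb R^n.$$ -/

import Mathlib

open Filter Topology
open scoped ContDiff

noncomputable section

/-- The Euclidean space of dimension `n`. -/
abbrev Rn (n : ℕ) : Type := EuclideanSpace ℝ (Fin n)

/-- Multi-indices. -/
abbrev MultiIndex (n : ℕ) : Type := Fin n → ℕ

/-- The length of a multi-index, the sum of its entries. -/
def MultiIndex.len {n : ℕ} (α : MultiIndex n) : ℕ := ∑ i, α i

/-- The factorial of a multi-index, the product of the factorials of its entries. -/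
def MultiIndex.fact {n : ℕ} (α : MultiIndex n) : ℕ := ∏ i, (α i).factorial

/-- The bracket `(1 + |x|^2)^(1/2)`. -/
def japanese {n : ℕ} (x : Rn n) : ℝ := Real.sqrt (1 + ‖x‖ ^ 2)

/-- The partial derivative of `f` in the `i`-th coordinate direction. -/
def pderivCoord {n : ℕ} {F : Type*} [NormedAddCommGroup F] [NormedSpace ℝ F]
    (i : Fin n) (f : Rn n → F) : Rn n → F :=
  fun x => fderiv ℝ f x (EuclideanSpace.single i 1)

/-- The iterated partial derivative `∂^α f`. -/
def mderiv {n : ℕ} {F : Type*} [NormedAddCommGroup F] [NormedSpace ℝ F]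
    (α : MultiIndex n) (f : Rn n → F) : Rn n → F :=
  (List.finRange n).foldr (fun i g => (pderivCoord i)^[α i] g) f

/-- The mixed derivative `∂^α ∂^β` of a function of two groups of variables, where `α` belongs
to the first group and `β` to the second. -/
def mderiv₂ {n : ℕ} {F : Type*} [NormedAddCommGroup F] [NormedSpace ℝ F]
    (α β : MultiIndex n) (f : Rn n → Rn n → F) (x y : Rn n) : F :=
  mderiv α (fun x' => mderiv β (fun y' => f x' y') y) x

/-- The mixed derivative of a function of three groups of variables. -/
def mderiv₃ {n : ℕ} {F : Type*} [NormedAddCommGroup F] [NormedSpace ℝ F]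
    (α β γ : MultiIndex n) (f : Rn n → Rn n → Rn n → F) (x y z : Rn n) : F :=
  mderiv α (fun x' => mderiv₂ β γ (f x') y z) x

/-- The mixed derivative of a function of four groups of variables. -/
def mderiv₄ {n : ℕ} {F : Type*} [NormedAddCommGroup F] [NormedSpace ℝ F]
    (α β γ δ : MultiIndex n) (f : Rn n → Rn n → Rn n → Rn n → F) (x y z w : Rn n) : F :=
  mderiv α (fun x' => mderiv₃ β γ δ (f x') y z w) x

/-- The gradient of `ψ(x, ξ)` in the variable `x`. -/
def gradX {n : ℕ} (ψ : Rn n → Rn n → ℝ) (x ξ : Rn n) : Rn n :=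
  gradient (fun x' => ψ x' ξ) x

/-- `Ψ(x, y, ξ) = ψ(y, ξ) - ψ(x, ξ) + (x - y) ⬝ ∇ₓψ(x, ξ)`. -/
def phaseRemainder {n : ℕ} (ψ : Rn n → Rn n → ℝ) (x y ξ : Rn n) : ℝ :=
  ψ y ξ - ψ x ξ + inner ℝ (x - y) (gradX ψ x ξ)

/-- `HasOscIntegral Φ a I` says that the oscillatory integral
`(2π)^(-n) ∬ exp (i Φ(y, η)) a(y, η) dy dη` exists and has the value `I`: the integrals
with amplitudes `a(y, η) κ(ε y, ε η)` converge to `I` as `ε → 0+`, for every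
compactly supported smooth function `κ` which is `1` near the origin. -/
def HasOscIntegral {n : ℕ} (Φ : Rn n → Rn n → ℝ) (a : Rn n → Rn n → ℂ) (I : ℂ) : Prop :=
  ∀ κ : Rn n × Rn n → ℂ, ContDiff ℝ ∞ κ → HasCompactSupport κ →
    (∀ᶠ p in 𝓝 (0 : Rn n × Rn n), κ p = 1) →
    Tendsto
      (fun ε : ℝ => (((2 * Real.pi) ^ n : ℝ) : ℂ)⁻¹ *
        ∫ η : Rn n, ∫ y : Rn n,
          Complex.exp (Complex.I * (Φ y η : ℂ)) * a y η * κ (ε • y, ε • η))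
      (𝓝[>] (0 : ℝ)) (𝓝 I)

/-- The function `c(x, z, ξ)` has the asymptotic expansion `∑ τ(α, β)` over all pairs of
multi-indices, improving in `ξ`, relative to the orders `s₁`, `s₂`, `s₃` in `x`, `z`, `ξ`.
The pairs carry no preferred enumeration: every finite partial sum that contains all
the terms with `|α| + |β| < N` has the required remainder. -/
def ExpansionImprovingInXi {n : ℕ} (s₁ s₂ s₃ : ℝ) (c : Rn n → Rn n → Rn n → ℂ)
    (τ : MultiIndex n → MultiIndex n → Rn n → Rn n → Rn n → ℂ) : Prop :=
  ∀ (μ ν ρ : MultiIndex n) (M : ℝ), ∃ N : ℕ, ∀ S : Finset (MultiIndex n × MultiIndex n),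
    (∀ p : MultiIndex n × MultiIndex n, p.1.len + p.2.len < N → p ∈ S) →
    ∃ C : ℝ, ∀ x z ξ : Rn n,
      ‖mderiv₃ μ ν ρ (fun x' z' ξ' => c x' z' ξ' - ∑ p ∈ S, τ p.1 p.2 x' z' ξ') x z ξ‖
        ≤ C * japanese x ^ s₁ * japanese z ^ s₂ * japanese ξ ^ (s₃ - M)

/-- The term of the expansion with indices `α`, `β`:
`i^(-|α|-|β|) / (α! β!) * (∂_η^α q)(x, ∇ₓψ(x, ξ)) *
∂_y^(α+β) [exp (i Ψ(x, y, ξ)) (∂_η^β b)(y, ξ, z, ∇ₓψ(x, ξ))]` at `y = x`. -/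
def compositionTerm {n : ℕ} (ψ : Rn n → Rn n → ℝ) (b : Rn n → Rn n → Rn n → Rn n → ℂ)
    (q : Rn n → Rn n → ℂ) (α β : MultiIndex n) (x z ξ : Rn n) : ℂ :=
  (Complex.I ^ (α.len + β.len))⁻¹ / ((α.fact : ℂ) * (β.fact : ℂ)) *
    mderiv α (fun η => q x η) (gradX ψ x ξ) *
    mderiv (α + β) (fun y => Complex.exp (Complex.I * (phaseRemainder ψ x y ξ : ℂ)) *
      mderiv β (fun η => b y ξ z η) (gradX ψ x ξ)) x

end

/-!
With `w = y - x` the integral `c` becomes an oscillatory integral with kernel `exp (-i w ⬝ η)` and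
amplitude `exp (i (ψ(x + w, ξ) - ψ(x, ξ))) b(x + w, ξ, z, η) q(x, η)`. A derivative of this amplitude in
`w` or in a parameter costs at most a factor `⟨ξ⟩⟨w⟩`, while derivatives in `η` cost nothing. For such
classes (`Amp`, `PAmp`) integration by parts with `⟨w⟩⁻²(1 - Δ_η)` and `⟨η⟩⁻²(1 - Δ_w)` gives an
absolutely convergent representation, which yields existence, independence of the regularization
(`Amp.exists_hasOsc`) and smoothness in the parameters (`PAmp.contDiff_osc`), together with crude
estimates that lose powers of `⟨ξ⟩` under differentiation (`CompositionData.exists_composition`).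

For the sharp order in `ξ`, split with a cutoff in `η / ⟨ξ⟩`. Since `|∇ₓψ|` is of size `⟨ξ⟩` for large
`ξ`, the phase is not stationary in `w` where `|η|` is small relative to `⟨ξ⟩`, and that part decreases
rapidly in `ξ` (`CompositionData.exists_hasOsc_small`). In the rest, put `y = x + ⟨ξ⟩^(-1/2) u` and
`η = ∇ₓψ(x, ξ) + ⟨ξ⟩ ζ`. The remainder `Ψ` of the phase is quadratic in `y - x` with coefficients of
size `⟨ξ⟩`, so the new amplitude `mainAmp` satisfies estimates uniform in `ξ`
(`CompositionData.amp_mainAmp`), while the kernel becomes `exp (-i ⟨ξ⟩^(1/2) u ⬝ ζ)`. Such an integral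
is a function of the dilation parameter `t = ⟨ξ⟩^(-1/2)` whose derivative is the integral of the
amplitude acted upon by `-i ∑ ∂_{ζ_j} ∂_{u_j}`, and Fourier inversion gives its value at `t = 0`. Taylor's
formula (`Amp.taylor_dilate`) is therefore an expansion of `c` in powers of `⟨ξ⟩^(-1/2)`
(`CompositionData.exists_pointwise_expansion`), and the multinomial formula identifies its `k`-th term
with the sum of the terms `compositionTerm` over `|α| + |β| = k`
(`CompositionData.sum_compositionTerm`).

This controls the remainders without derivatives. Each term is a symbol of order lower by
`(|α| + |β|) / 2` in `ξ` (`CompositionData.jetBound_compositionTerm`), hence the remainders satisfy crude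
estimates in which the loss does not depend on the number of terms. A function that is small of high
order and has second derivatives of bounded growth has a small first derivative, so the remainders
with sufficiently many terms decay to any order with all their derivatives
(`eventually_decay_iteratedFDeriv`). Adding the terms back gives the symbol estimates of `c`.

All estimates are phrased through `JetBound`: a family of functions, indexed by the point in question
and composed with an affine map that carries the scale of the estimate, has derivatives at the origin
bounded by a weight. Products, quotients, compositions and exponentials of families are then handled
once and for all.
-/

noncomputable section

/-! ### Families with uniformly bounded jets -/

section JetBounds

variable {ι κ : Type*} {E F G H : Type} [NormedAddCommGroup E] [NormedSpace ℝ E]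
  [NormedAddCommGroup F] [NormedSpace ℝ F] [NormedAddCommGroup G] [NormedSpace ℝ G]
  [NormedAddCommGroup H] [NormedSpace ℝ H]

/-- A family of functions `g i` is smooth at the origin, and each of its derivatives there is
bounded, uniformly in `i`, by a multiple of the weight `W i`. Symbol estimates at variable points
are statements of this kind about the family of all pull-backs `h ↦ f (p + A p h)`, where the
point `p` is part of the index and the linear map `A p` carries the scale of the estimate. -/
def JetBound (g : ι → E → F) (W : ι → ℝ) : Prop :=
  (∀ i, ContDiffAt ℝ ∞ (g i) 0) ∧
    ∀ k : ℕ, ∃ C : ℝ, 0 ≤ C ∧ ∀ i, ‖iteratedFDeriv ℝ k (g i) 0‖ ≤ C * W i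

theorem ContDiffAt.exists_open_contDiffOn {f : E → F} {x : E} (hf : ContDiffAt ℝ ∞ f x) (n : ℕ) :
    ∃ u : Set E, IsOpen u ∧ x ∈ u ∧ ContDiffOn ℝ n f u := by
  obtain ⟨u, hu, hx, h⟩ := ContDiffWithinAt.contDiffOn' (s := Set.univ) (m := (n : ℕ∞ω))
    (by exact_mod_cast le_top) (by simp) hf.contDiffWithinAt
  exact ⟨u, hu, hx, by simpa using h⟩

theorem ContDiffAt.norm_iteratedFDeriv_comp_le {g : F → G} {f : E → F} {x : E}
    (hg : ContDiffAt ℝ ∞ g (f x)) (hf : ContDiffAt ℝ ∞ f x) {n : ℕ} {C D : ℝ}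
    (hC : ∀ i, i ≤ n → ‖iteratedFDeriv ℝ i g (f x)‖ ≤ C)
    (hD : ∀ i, 1 ≤ i → i ≤ n → ‖iteratedFDeriv ℝ i f x‖ ≤ D ^ i) :
    ‖iteratedFDeriv ℝ n (g ∘ f) x‖ ≤ n.factorial * C * D ^ n := by
  obtain ⟨t, ht, hxt, hgt⟩ := hg.exists_open_contDiffOn n
  obtain ⟨s, hs, hxs, hfs⟩ := hf.exists_open_contDiffOn n
  obtain ⟨u, hus, huo, hxu⟩ := mem_nhds_iff.1 (hf.continuousAt.preimage_mem_nhds (ht.mem_nhds hxt))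
  have ho : IsOpen (s ∩ u) := hs.inter huo
  have hx : x ∈ s ∩ u := ⟨hxs, hxu⟩
  rw [← iteratedFDerivWithin_of_isOpen n ho hx]
  refine norm_iteratedFDerivWithin_comp_le hgt (hfs.mono Set.inter_subset_left) le_rfl
    ht.uniqueDiffOn ho.uniqueDiffOn (fun y hy => hus hy.2) hx ?_ ?_
  · intro i hi
    rw [iteratedFDerivWithin_of_isOpen i ht hxt]
    exact hC i hi
  · intro i h1 hi
    rw [iteratedFDerivWithin_of_isOpen i ho hx]
    exact hD i h1 hi

theorem ContDiffAt.norm_iteratedFDeriv_le_of_bilinear (B : F →L[ℝ] G →L[ℝ] H) {f : E → F}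
    {g : E → G} {x : E} (hf : ContDiffAt ℝ ∞ f x) (hg : ContDiffAt ℝ ∞ g x) (n : ℕ) :
    ‖iteratedFDeriv ℝ n (fun y => B (f y) (g y)) x‖ ≤
      ‖B‖ * ∑ i ∈ Finset.range (n + 1), (n.choose i : ℝ) * ‖iteratedFDeriv ℝ i f x‖ *
        ‖iteratedFDeriv ℝ (n - i) g x‖ := by
  obtain ⟨s, hs, hxs, hfs⟩ := hf.exists_open_contDiffOn n
  obtain ⟨t, ht, hxt, hgt⟩ := hg.exists_open_contDiffOn n
  have ho : IsOpen (s ∩ t) := hs.inter ht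
  have hx : x ∈ s ∩ t := ⟨hxs, hxt⟩
  have := B.norm_iteratedFDerivWithin_le_of_bilinear (hfs.mono Set.inter_subset_left)
    (hgt.mono Set.inter_subset_right) ho.uniqueDiffOn hx (n := n) le_rfl
  simpa only [iteratedFDerivWithin_of_isOpen _ ho hx] using this

namespace JetBound

variable {g g₁ g₂ : ι → E → F} {W W₁ W₂ : ι → ℝ}

theorem congr (h : JetBound g₁ W) (e : ∀ i, g₁ i =ᶠ[𝓝 0] g₂ i) : JetBound g₂ W := by
  refine ⟨fun i => (h.1 i).congr_of_eventuallyEq (e i).symm, fun k => ?_⟩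
  obtain ⟨C, hC0, hC⟩ := h.2 k
  exact ⟨C, hC0, fun i => by rw [← ((e i).iteratedFDeriv (𝕜 := ℝ) k).eq_of_nhds]; exact hC i⟩

theorem congr' (h : JetBound g₁ W) (e : ∀ i x, g₁ i x = g₂ i x) : JetBound g₂ W :=
  h.congr fun i => Eventually.of_forall (e i)

theorem mono (h : JetBound g W₁) (K : ℝ) (hK : ∀ i, W₁ i ≤ K * W₂ i) (h0 : ∀ i, 0 ≤ W₂ i) :
    JetBound g W₂ := by
  refine ⟨h.1, fun k => ?_⟩
  obtain ⟨C, hC0, hC⟩ := h.2 k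
  refine ⟨C * |K|, by positivity, fun i => (hC i).trans ?_⟩
  rw [mul_assoc]
  exact mul_le_mul_of_nonneg_left ((hK i).trans
    (mul_le_mul_of_nonneg_right (le_abs_self K) (h0 i))) hC0

theorem mono_one (h : JetBound g W₁) (hK : ∀ i, W₁ i ≤ W₂ i) : JetBound g W₂ := by
  refine ⟨h.1, fun k => ?_⟩
  obtain ⟨C, hC0, hC⟩ := h.2 k
  exact ⟨C, hC0, fun i => (hC i).trans (mul_le_mul_of_nonneg_left (hK i) hC0)⟩

theorem reindex (h : JetBound g W) (r : κ → ι) : JetBound (fun j => g (r j)) (fun j => W (r j)) := by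
  refine ⟨fun j => h.1 (r j), fun k => ?_⟩
  obtain ⟨C, hC0, hC⟩ := h.2 k
  exact ⟨C, hC0, fun j => hC (r j)⟩

theorem value_le (h : JetBound g W) : ∃ C : ℝ, 0 ≤ C ∧ ∀ i, ‖g i 0‖ ≤ C * W i := by
  simpa using h.2 0

theorem bilinear {f : ι → E → F} {g : ι → E → G} (B : F →L[ℝ] G →L[ℝ] H)
    (hf : JetBound f W₁) (hg : JetBound g W₂) :
    JetBound (fun i x => B (f i x) (g i x)) (fun i => W₁ i * W₂ i) := by
  refine ⟨fun i => ?_, fun k => ?_⟩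
  · exact (B.isBoundedBilinearMap.contDiff.contDiffAt).comp (0 : E) ((hf.1 i).prodMk (hg.1 i))
  · choose Cf hf0 hCf using hf.2
    choose Cg hg0 hCg using hg.2
    refine ⟨‖B‖ * ∑ i ∈ Finset.range (k + 1), (k.choose i : ℝ) * Cf i * Cg (k - i),
      mul_nonneg (norm_nonneg B) (Finset.sum_nonneg fun i _ => mul_nonneg
        (mul_nonneg (Nat.cast_nonneg _) (hf0 i)) (hg0 _)), fun i => ?_⟩
    refine ((hf.1 i).norm_iteratedFDeriv_le_of_bilinear B (hg.1 i) k).trans ?_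
    rw [mul_assoc, Finset.sum_mul]
    refine mul_le_mul_of_nonneg_left (Finset.sum_le_sum fun j _ => ?_) (norm_nonneg B)
    calc (k.choose j : ℝ) * ‖iteratedFDeriv ℝ j (f i) 0‖ * ‖iteratedFDeriv ℝ (k - j) (g i) 0‖
        ≤ (k.choose j : ℝ) * (Cf j * W₁ i) * (Cg (k - j) * W₂ i) := by
          have h1 := hCf j i
          have h2 := hCg (k - j) i
          have h3 := (norm_nonneg _).trans h1
          gcongr
      _ = _ := by ring

theorem add (h₁ : JetBound g₁ W) (h₂ : JetBound g₂ W) :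
    JetBound (fun i x => g₁ i x + g₂ i x) W := by
  refine ⟨fun i => (h₁.1 i).add (h₂.1 i), fun k => ?_⟩
  obtain ⟨C₁, hC0, hC⟩ := h₁.2 k
  obtain ⟨C₂, hD0, hD⟩ := h₂.2 k
  refine ⟨C₁ + C₂, by positivity, fun i => ?_⟩
  have e := iteratedFDeriv_add_apply (i := k) ((h₁.1 i).of_le (by exact_mod_cast le_top))
    ((h₂.1 i).of_le (by exact_mod_cast le_top))
  change ‖iteratedFDeriv ℝ k (g₁ i + g₂ i) 0‖ ≤ _
  rw [e, add_mul]
  exact (norm_add_le _ _).trans (add_le_add (hC i) (hD i))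

/-- Post-composition with continuous linear maps that depend on the index. -/
theorem clm_comp (h : JetBound g W) (A : ι → F →L[ℝ] G) {K : ι → ℝ} (hA : ∀ i, ‖A i‖ ≤ K i) :
    JetBound (fun i x => A i (g i x)) (fun i => K i * W i) := by
  refine ⟨fun i => (A i).contDiff.contDiffAt.comp (0 : E) (h.1 i), fun k => ?_⟩
  obtain ⟨C, hC0, hC⟩ := h.2 k
  refine ⟨C, hC0, fun i => ?_⟩
  have := (A i).iteratedFDeriv_comp_left (h.1 i) (i := k) (by exact_mod_cast le_top)
  change ‖iteratedFDeriv ℝ k (A i ∘ g i) 0‖ ≤ _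
  rw [this]
  refine ((A i).norm_compContinuousMultilinearMap_le _).trans ?_
  calc _ ≤ K i * (C * W i) := mul_le_mul (hA i) (hC i) (norm_nonneg _)
        ((norm_nonneg _).trans (hA i))
    _ = _ := by ring

theorem const_smul (h : JetBound g W) (c : ι → ℝ) {K : ι → ℝ} (hc : ∀ i, |c i| ≤ K i) :
    JetBound (fun i x => c i • g i x) (fun i => K i * W i) :=
  h.clm_comp (fun i => c i • ContinuousLinearMap.id ℝ F) fun i => by
    refine (norm_smul_le (c i) (ContinuousLinearMap.id ℝ F)).trans ?_
    calc _ ≤ |c i| * 1 := mul_le_mul_of_nonneg_left ContinuousLinearMap.norm_id_le (abs_nonneg _)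
      _ ≤ _ := by simpa using hc i

theorem neg (h : JetBound g W) : JetBound (fun i x => -g i x) W := by
  simpa using h.const_smul (fun _ => (-1 : ℝ)) (K := fun _ => 1) (by simp)

theorem sub (h₁ : JetBound g₁ W) (h₂ : JetBound g₂ W) :
    JetBound (fun i x => g₁ i x - g₂ i x) W := by
  simpa [sub_eq_add_neg] using h₁.add h₂.neg

theorem zero : JetBound (fun _ _ => 0 : ι → E → F) W :=
  ⟨fun _ => contDiffAt_const, fun k => ⟨0, le_rfl, fun i => by simp⟩⟩

theorem sum {J : Type*} (s : Finset J) {f : J → ι → E → F}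
    (h : ∀ j ∈ s, JetBound (f j) W) : JetBound (fun i x => ∑ j ∈ s, f j i x) W := by
  classical
  induction s using Finset.induction_on with
  | empty => simpa using zero
  | insert a s ha ih =>
    simp only [Finset.sum_insert ha]
    exact (h a (by simp)).add (ih fun j hj => h j (by simp [hj]))

theorem const {c : ι → F} (hc : ∀ i, ‖c i‖ ≤ W i) : JetBound (fun i (_ : E) => c i) W := by
  refine ⟨fun _ => contDiffAt_const, fun k => ⟨1, zero_le_one, fun i => ?_⟩⟩
  rcases k with _ | k
  · simpa using hc i
  · simpa [iteratedFDeriv_const_of_ne (𝕜 := ℝ) (Nat.succ_ne_zero k) (c i)] using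
      (norm_nonneg _).trans (hc i)

theorem fderiv (h : JetBound g W) : JetBound (fun i => fderiv ℝ (g i)) W := by
  refine ⟨fun i => (h.1 i).fderiv_right (by simp), fun k => ?_⟩
  obtain ⟨C, hC0, hC⟩ := h.2 (k + 1)
  exact ⟨C, hC0, fun i => by rw [norm_iteratedFDeriv_fderiv]; exact hC i⟩

theorem of_fderiv (hs : ∀ i, ContDiffAt ℝ ∞ (g i) 0) {K : ℝ} (hK : 0 ≤ K)
    (hv : ∀ i, ‖g i 0‖ ≤ K * W i) (h : JetBound (fun i => _root_.fderiv ℝ (g i)) W) :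
    JetBound g W := by
  refine ⟨hs, fun k => ?_⟩
  rcases k with _ | k
  · exact ⟨K, hK, fun i => by simpa using hv i⟩
  · obtain ⟨C, hC0, hC⟩ := h.2 k
    exact ⟨C, hC0, fun i => by rw [← norm_iteratedFDeriv_fderiv]; exact hC i⟩

/-- Directional derivatives in bounded directions that may depend on the index. -/
theorem dirDeriv (h : JetBound g W) (d : ι → E) {K : ι → ℝ} (hd : ∀ i, ‖d i‖ ≤ K i) :
    JetBound (fun i x => _root_.fderiv ℝ (g i) x (d i)) (fun i => K i * W i) :=
  h.fderiv.clm_comp (fun i => ContinuousLinearMap.apply ℝ F (d i)) fun i => by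
    refine (ContinuousLinearMap.opNorm_le_bound _ (norm_nonneg (d i)) fun T => ?_).trans (hd i)
    simpa [mul_comm] using T.le_opNorm (d i)

theorem clm {A : ι → E →L[ℝ] F} (hA : ∀ i, ‖A i‖ ≤ W i) : JetBound (fun i x => A i x) W := by
  refine of_fderiv (fun i => (A i).contDiff.contDiffAt) zero_le_one (fun i => ?_) ?_
  · simpa using (norm_nonneg _).trans (hA i)
  · exact (const hA).congr' fun i x => ((A i).fderiv (x := x)).symm

theorem prodMk {f : ι → E → F} {g : ι → E → G} (hf : JetBound f W) (hg : JetBound g W) :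
    JetBound (fun i x => (f i x, g i x)) W := by
  have h1 := hf.clm_comp (fun _ => ContinuousLinearMap.inl ℝ F G) (K := fun _ => 1)
    fun _ => ContinuousLinearMap.opNorm_le_bound _ zero_le_one (by simp)
  have h2 := hg.clm_comp (fun _ => ContinuousLinearMap.inr ℝ F G) (K := fun _ => 1)
    fun _ => ContinuousLinearMap.opNorm_le_bound _ zero_le_one (by simp)
  simpa using h1.add h2

/-- Composition of families: the inner functions fix the origin and have bounded derivatives. -/
theorem comp {f : ι → F → G} {g : ι → E → F} (hf : JetBound f W) (hg : JetBound g fun _ => 1)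
    (h0 : ∀ i, g i 0 = 0) : JetBound (fun i x => f i (g i x)) W := by
  refine ⟨fun i => ?_, fun k => ?_⟩
  · exact ContDiffAt.comp (0 : E) (by rw [h0 i]; exact hf.1 i) (hg.1 i)
  · choose Cf hf0 hCf using hf.2
    choose Cg hg0 hCg using hg.2
    set C := ∑ j ∈ Finset.range (k + 1), Cf j with hCdef
    set D := 1 + ∑ j ∈ Finset.range (k + 1), Cg j with hDdef
    have hD1 : 1 ≤ D := le_add_of_nonneg_right (Finset.sum_nonneg fun j _ => hg0 j)
    refine ⟨k.factorial * C * D ^ k, mul_nonneg (mul_nonneg (Nat.cast_nonneg _)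
      (Finset.sum_nonneg fun j _ => hf0 j)) (by positivity), fun i => ?_⟩
    have key := ContDiffAt.norm_iteratedFDeriv_comp_le (g := f i) (f := g i) (x := 0)
      (by rw [h0 i]; exact hf.1 i) (hg.1 i) (n := k) (C := C * W i) (D := D) ?_ ?_
    · refine key.trans (le_of_eq ?_)
      ring
    · intro j hj
      rw [h0 i]
      refine (hCf j i).trans ?_
      have hjC : Cf j ≤ C := Finset.single_le_sum (f := Cf) (fun j _ => hf0 j)
        (Finset.mem_range.2 (Nat.lt_succ_of_le hj))
      rcases (hf0 j).eq_or_lt with h | h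
      · have h2 := hCf j i
        rw [← h, zero_mul]
        by_cases hW : 0 ≤ W i
        · exact mul_nonneg (Finset.sum_nonneg fun j _ => hf0 j) hW
        · have : C = 0 := Finset.sum_eq_zero fun l _ => by
            by_contra hne
            have hl : 0 < Cf l := lt_of_le_of_ne (hf0 l) (Ne.symm hne)
            have := (norm_nonneg _).trans (hCf l i)
            nlinarith
          simp [this]
      · have : 0 ≤ W i := by
          have := (norm_nonneg _).trans (hCf j i)
          by_contra hW
          nlinarith
        exact mul_le_mul_of_nonneg_right hjC this
    · intro j h1 hj
      have hjD : Cg j ≤ D := (Finset.single_le_sum (f := Cg) (fun j _ => hg0 j)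
        (Finset.mem_range.2 (Nat.lt_succ_of_le hj))).trans (by rw [hDdef]; linarith)
      refine (hCg j i).trans ?_
      rw [mul_one]
      exact hjD.trans (le_self_pow₀ hD1 (by omega))

theorem comp_clm {f : ι → F → G} (hf : JetBound f W) (A : ι → E →L[ℝ] F) (K : ℝ)
    (hA : ∀ i, ‖A i‖ ≤ K) : JetBound (fun i x => f i (A i x)) W := by
  refine hf.comp (g := fun i x => A i x) ?_ fun i => map_zero _
  exact (clm (W := fun _ => K) hA).mono K (by simp) (by simp)

theorem of_contDiffAt {f : E → F} (hf : ContDiffAt ℝ ∞ f 0) :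
    JetBound (fun _ : ι => f) fun _ => 1 :=
  ⟨fun _ => hf, fun k => ⟨‖iteratedFDeriv ℝ k f 0‖, norm_nonneg _, by simp⟩⟩

section Algebra

variable {A : Type} [NormedRing A] [NormedAlgebra ℝ A]

theorem mul {f g : ι → E → A} (hf : JetBound f W₁) (hg : JetBound g W₂) :
    JetBound (fun i x => f i x * g i x) (fun i => W₁ i * W₂ i) :=
  hf.bilinear (ContinuousLinearMap.mul ℝ A) hg

theorem smul {f : ι → E → ℝ} {g : ι → E → F} (hf : JetBound f W₁) (hg : JetBound g W₂) :
    JetBound (fun i x => f i x • g i x) (fun i => W₁ i * W₂ i) :=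
  hf.bilinear (ContinuousLinearMap.lsmul ℝ ℝ) hg

end Algebra

theorem ofReal {f : ι → E → ℝ} (hf : JetBound f W) : JetBound (fun i x => (f i x : ℂ)) W := by
  simpa using hf.clm_comp (fun _ => Complex.ofRealCLM) (K := fun _ => 1) (by simp)

theorem clm_apply {f : ι → E → F →L[ℝ] G} {g : ι → E → F} (hf : JetBound f W₁)
    (hg : JetBound g W₂) : JetBound (fun i x => f i x (g i x)) (fun i => W₁ i * W₂ i) :=
  hf.bilinear (ContinuousLinearMap.id ℝ (F →L[ℝ] G)) hg

theorem inner {n : ℕ} {f g : ι → E → Rn n} (hf : JetBound f W₁) (hg : JetBound g W₂) :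
    JetBound (fun i x => inner ℝ (f i x) (g i x)) (fun i => W₁ i * W₂ i) :=
  hf.bilinear (innerSL ℝ) hg

/-- The increment `(f - f 0) / f 0` of a family that is elliptic at the origin. -/
theorem relIncrement {f : ι → E → ℝ} (hf : JetBound f W) {c : ℝ} (hc : 0 < c)
    (hW : ∀ i, 0 < W i) (hl : ∀ i, c * W i ≤ |f i 0|) :
    JetBound (fun i x => (f i 0)⁻¹ • (f i x - f i 0)) fun _ => 1 := by
  obtain ⟨C, hC0, hC⟩ := hf.value_le
  have h1 : JetBound (fun i x => f i x - f i 0) W := by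
    refine hf.sub ((const (c := fun i => f i 0) (W := fun i => C * W i) hC).mono C
      (fun _ => le_rfl) fun i => (hW i).le)
  refine (h1.const_smul (fun i => (f i 0)⁻¹) (K := fun i => (c * W i)⁻¹) fun i => ?_).mono c⁻¹
    (fun i => ?_) (by simp)
  · rw [abs_inv]
    exact inv_anti₀ (mul_pos hc (hW i)) (hl i)
  · have := (hW i).ne'
    rw [mul_inv, mul_assoc, inv_mul_cancel₀ this]

theorem rpow {f : ι → E → ℝ} (hf : JetBound f W) {c : ℝ} (hc : 0 < c)
    (hW : ∀ i, 0 < W i) (hl : ∀ i, c * W i ≤ f i 0) (s : ℝ) :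
    JetBound (fun i x => f i x ^ s) fun i => f i 0 ^ s := by
  have hpos : ∀ i, 0 < f i 0 := fun i => (mul_pos hc (hW i)).trans_le (hl i)
  have h1 := hf.relIncrement hc hW fun i => (hl i).trans (le_abs_self _)
  have h2 : JetBound (fun (_ : ι) (t : ℝ) => (1 + t) ^ s) fun _ => 1 :=
    of_contDiffAt ((contDiffAt_const.add contDiffAt_id).rpow_const_of_ne (by simp))
  have h3 := h2.comp h1 (by simp)
  have h4 := h3.const_smul (fun i => f i 0 ^ s) (K := fun i => f i 0 ^ s)
    fun i => by rw [abs_of_nonneg (Real.rpow_nonneg (hpos i).le _)]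
  simp only [mul_one] at h4
  refine h4.congr fun i => ?_
  have : ∀ᶠ x in 𝓝 (0 : E), 0 < f i x :=
    (hf.1 i).continuousAt.eventually (lt_mem_nhds (hpos i))
  filter_upwards [this] with x hx
  have hne := (hpos i).ne'
  have e : 1 + (f i 0)⁻¹ • (f i x - f i 0) = f i x / f i 0 := by
    simp only [smul_eq_mul]; field_simp; ring
  rw [e, Real.div_rpow hx.le (hpos i).le, smul_eq_mul]
  field_simp [(Real.rpow_pos_of_pos (hpos i) s).ne']

theorem inv {f : ι → E → ℝ} (hf : JetBound f W) {c : ℝ} (hc : 0 < c)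
    (hW : ∀ i, 0 < W i) (hl : ∀ i, c * W i ≤ f i 0) :
    JetBound (fun i x => (f i x)⁻¹) fun i => (W i)⁻¹ := by
  have h := hf.rpow hc hW hl (-1)
  refine (h.congr' (g₂ := fun i x => (f i x)⁻¹) fun i x => Real.rpow_neg_one _).mono c⁻¹
    (fun i => ?_) fun i => (inv_pos.2 (hW i)).le
  rw [Real.rpow_neg_one, ← mul_inv]
  exact inv_anti₀ (mul_pos hc (hW i)) (hl i)

theorem norm_iteratedFDeriv_comp_smul (f : E → F) {c : ℝ} (hf : ContDiffAt ℝ ∞ f 0) (k : ℕ) :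
    ‖iteratedFDeriv ℝ k (fun x => f (c • x)) 0‖ ≤ |c| ^ k * ‖iteratedFDeriv ℝ k f 0‖ := by
  induction k generalizing F with
  | zero => simp
  | succ k ih =>
    rw [← norm_iteratedFDeriv_fderiv, ← norm_iteratedFDeriv_fderiv]
    have e : _root_.fderiv ℝ (fun x => f (c • x)) =ᶠ[𝓝 0]
        fun x => c • _root_.fderiv ℝ f (c • x) := by
      have h1 : ∀ᶠ y in 𝓝 (0 : E), ContDiffAt ℝ 1 f y :=
        (hf.of_le (by exact_mod_cast le_top)).eventually (by simp)
      have h2 : ∀ᶠ x in 𝓝 (0 : E), ContDiffAt ℝ 1 f (c • x) := by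
        have : Tendsto (fun x : E => c • x) (𝓝 0) (𝓝 0) := by
          simpa using (continuous_const_smul c).tendsto (0 : E)
        exact this.eventually h1
      filter_upwards [h2] with x hx
      have h3 := (hx.differentiableAt (by simp)).hasFDerivAt.comp x
        ((hasFDerivAt_id x).const_smul c)
      rw [show (fun x => f (c • x)) = f ∘ fun x => c • x from rfl]
      refine h3.fderiv.trans ?_
      ext v
      simp
    rw [(e.iteratedFDeriv (𝕜 := ℝ) k).eq_of_nhds]
    have hs : ContDiffAt ℝ ∞ (_root_.fderiv ℝ f) 0 := hf.fderiv_right (by simp)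
    have hs' : ContDiffAt ℝ ∞ (fun x => _root_.fderiv ℝ f (c • x)) 0 :=
      ContDiffAt.comp (0 : E) (by simpa using hs) (contDiffAt_id.const_smul c)
    rw [iteratedFDeriv_const_smul_apply' (hs'.of_le (by exact_mod_cast le_top)), norm_smul,
      pow_succ', mul_assoc]
    exact mul_le_mul_of_nonneg_left (ih _ hs) (norm_nonneg _)

/-- A unimodular exponential of a phase of size `W ≥ 1` has bounded derivatives at the
scale `1 / W`: the first derivative of the rescaled phase is bounded, although the phase is not. -/
theorem cexp {θ : ι → E → ℝ} (h : JetBound θ W) (hW : ∀ i, 1 ≤ W i) :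
    JetBound (fun i x => Complex.exp (Complex.I * (θ i ((W i)⁻¹ • x) : ℂ))) fun _ => 1 := by
  have hθ : JetBound (fun i x => θ i ((W i)⁻¹ • x) - θ i 0) fun i => W i :=
    (h.comp_clm (fun i => (W i)⁻¹ • ContinuousLinearMap.id ℝ E) 1 fun i => by
      refine (norm_smul_le (W i)⁻¹ (ContinuousLinearMap.id ℝ E)).trans ?_
      rw [Real.norm_of_nonneg (inv_nonneg.2 (by linarith [hW i]))]
      exact mul_le_one₀ (inv_le_one_of_one_le₀ (hW i)) (norm_nonneg _)
        ContinuousLinearMap.norm_id_le).sub (by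
      obtain ⟨C, hC0, hC⟩ := h.value_le
      exact (const (c := fun i => θ i 0) (W := fun i => C * W i) hC).mono C
        (fun _ => le_rfl) fun i => by linarith [hW i])
  have h1 : JetBound (fun i x => θ i ((W i)⁻¹ • x) - θ i 0) fun _ => 1 := by
    refine ⟨hθ.1, fun k => ?_⟩
    rcases k with _ | k
    · exact ⟨1, zero_le_one, by simp⟩
    obtain ⟨C, hC0, hC⟩ := h.2 (k + 1)
    refine ⟨C, hC0, fun i => ?_⟩
    have hs : ContDiffAt ℝ ∞ (fun x => θ i ((W i)⁻¹ • x)) 0 :=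
      ContDiffAt.comp (0 : E) (by simpa using h.1 i) (contDiffAt_id.const_smul _)
    have e : iteratedFDeriv ℝ (k + 1) (fun x => θ i ((W i)⁻¹ • x) - θ i 0) 0
        = iteratedFDeriv ℝ (k + 1) (fun x => θ i ((W i)⁻¹ • x)) 0 := by
      simp only [sub_eq_add_neg]
      have e := iteratedFDeriv_add_apply (i := k + 1) (hs.of_le (by exact_mod_cast le_top))
        (contDiffAt_const (c := -θ i 0))
      refine e.trans ?_
      rw [iteratedFDeriv_const_of_ne (𝕜 := ℝ) (Nat.succ_ne_zero k)]
      simp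
    rw [e]
    refine (norm_iteratedFDeriv_comp_smul _ (h.1 i) _).trans ?_
    have hW0 : 0 < W i := by linarith [hW i]
    rw [abs_of_pos (inv_pos.2 hW0)]
    calc (W i)⁻¹ ^ (k + 1) * ‖iteratedFDeriv ℝ (k + 1) (θ i) 0‖
        ≤ (W i)⁻¹ ^ (k + 1) * (C * W i) := by gcongr; exact hC i
      _ = C * (W i)⁻¹ ^ k := by rw [pow_succ]; field_simp
      _ ≤ C * 1 := by
        gcongr
        exact pow_le_one₀ (inv_nonneg.2 hW0.le) (inv_le_one_of_one_le₀ (hW i))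
  have h2 : JetBound (fun (_ : ι) (t : ℝ) => Complex.exp (Complex.I * (t : ℂ))) fun _ => 1 :=
    of_contDiffAt (Complex.contDiff_exp.contDiffAt.comp (0 : ℝ)
      (contDiffAt_const.mul Complex.ofRealCLM.contDiff.contDiffAt))
  have h3 := (h2.comp h1 (by simp)).mul (W₂ := fun _ => 1)
    (const (E := E) (c := fun i => Complex.exp (Complex.I * (θ i 0 : ℂ))) fun i => by
      rw [mul_comm, Complex.norm_exp_ofReal_mul_I])
  simp only [mul_one] at h3
  refine h3.congr' fun i x => ?_
  rw [← Complex.exp_add]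
  push_cast
  ring_nf

end JetBound

end JetBounds

/-! ### Iterated directional derivatives -/

section DirectionalDerivatives

variable {ι : Type*} {E F G : Type} [NormedAddCommGroup E] [NormedSpace ℝ E]
  [NormedAddCommGroup F] [NormedSpace ℝ F] [NormedAddCommGroup G] [NormedSpace ℝ G]

/-- The derivative of `f` in the direction `v`. -/
def dirD (v : E) (f : E → F) : E → F := fun x => fderiv ℝ f x v

/-- The iterated derivative of `f` along a list of directions. -/
def dirDs (L : List E) (f : E → F) : E → F := L.foldr dirD f

@[simp] theorem dirDs_nil (f : E → F) : dirDs [] f = f := rfl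

@[simp] theorem dirDs_cons (v : E) (L : List E) (f : E → F) :
    dirDs (v :: L) f = dirD v (dirDs L f) := rfl

theorem dirDs_append (L L' : List E) (f : E → F) :
    dirDs (L ++ L') f = dirDs L (dirDs L' f) := by
  simp [dirDs, List.foldr_append]

theorem ContDiff.dirD {f : E → F} (hf : ContDiff ℝ ∞ f) (v : E) : ContDiff ℝ ∞ (dirD v f) :=
  (hf.fderiv_right (m := ∞) (by simp)).clm_apply contDiff_const

theorem ContDiff.dirDs {f : E → F} (hf : ContDiff ℝ ∞ f) (L : List E) :
    ContDiff ℝ ∞ (dirDs L f) := by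
  induction L with
  | nil => exact hf
  | cons v L ih => exact ih.dirD v

theorem dirD_comm {f : E → F} (hf : ContDiff ℝ ∞ f) (v w : E) :
    dirD v (dirD w f) = dirD w (dirD v f) := by
  funext x
  have h2 : ∀ u : E, HasFDerivAt (dirD u f)
      ((ContinuousLinearMap.apply ℝ F u).comp (fderiv ℝ (fderiv ℝ f) x)) x := fun u =>
    (ContinuousLinearMap.apply ℝ F u).hasFDerivAt.comp x
      (((hf.fderiv_right (m := ∞) (by simp)).differentiable (by simp)) x).hasFDerivAt
  change fderiv ℝ (dirD w f) x v = fderiv ℝ (dirD v f) x w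
  rw [(h2 w).fderiv, (h2 v).fderiv]
  have hs : IsSymmSndFDerivAt ℝ f x :=
    ContDiffAt.isSymmSndFDerivAt (n := 2)
    ((contDiff_infty.1 hf 2).contDiffAt) (by simp)
  exact hs v w

theorem dirDs_perm {f : E → F} (hf : ContDiff ℝ ∞ f) {L L' : List E} (h : L.Perm L') :
    dirDs L f = dirDs L' f := by
  induction h with
  | nil => rfl
  | cons v _ ih => simp [ih]
  | swap v w L => exact dirD_comm (hf.dirDs L) _ _
  | trans _ _ ih1 ih2 => exact ih1.trans ih2

theorem dirD_comp_affine {f : E → F} (hf : ContDiff ℝ ∞ f) (p : E) (A : G →L[ℝ] E) (v : G) :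
    dirD v (fun h => f (p + A h)) = fun h => dirD (A v) f (p + A h) := by
  funext h
  have h1 : HasFDerivAt (fun h => p + A h) A h := A.hasFDerivAt.const_add p
  have h2 := ((hf.differentiable (by simp)) (p + A h)).hasFDerivAt.comp h h1
  change fderiv ℝ (f ∘ fun h => p + A h) h v = _
  rw [h2.fderiv]
  rfl

theorem dirDs_comp_affine {f : E → F} (hf : ContDiff ℝ ∞ f) (p : E) (A : G →L[ℝ] E)
    (L : List G) :
    dirDs L (fun h => f (p + A h)) = fun h => dirDs (L.map A) f (p + A h) := by
  induction L with
  | nil => rfl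
  | cons v L ih =>
    rw [dirDs_cons, ih, dirD_comp_affine (hf.dirDs _)]
    rfl

theorem dirDs_map_smul {f : E → F} (hf : ContDiff ℝ ∞ f) (c : ℝ) (L : List E) (x : E) :
    dirDs (L.map (c • ·)) f x = c ^ L.length • dirDs L f x := by
  induction L generalizing x with
  | nil => simp
  | cons v L ih =>
    have : dirDs (L.map (c • ·)) f = fun x => c ^ L.length • dirDs L f x := funext ih
    rw [List.map_cons, dirDs_cons, this, dirDs_cons]
    simp only [dirD, List.length_cons]
    have hd := ((hf.dirDs L).differentiable (by simp)) x
    rw [fderiv_fun_const_smul hd, map_smul, smul_apply, smul_smul, pow_succ']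

theorem dirD_sum {J : Type*} (s : Finset J) {f : J → E → F} (hf : ∀ j, ContDiff ℝ ∞ (f j))
    (v : E) : dirD v (fun x => ∑ j ∈ s, f j x) = fun x => ∑ j ∈ s, dirD v (f j) x := by
  funext x
  simp only [dirD]
  rw [fderiv_fun_sum fun j _ => (hf j).differentiable (by simp) x]
  simp

theorem dirD_const_mul {f : E → ℂ} (hf : ContDiff ℝ ∞ f) (c : ℂ) (v : E) :
    dirD v (fun x => c * f x) = fun x => c * dirD v f x := by
  funext x
  simp only [dirD]
  rw [fderiv_const_mul (hf.differentiable (by simp) x)]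
  rfl

theorem dirDs_const_mul {f : E → ℂ} (hf : ContDiff ℝ ∞ f) (c : ℂ) (L : List E) :
    dirDs L (fun x => c * f x) = fun x => c * dirDs L f x := by
  induction L with
  | nil => rfl
  | cons v L ih => rw [dirDs_cons, ih, dirD_const_mul (hf.dirDs L), dirDs_cons]

theorem dirD_mul {f g : E → ℂ} (hf : ContDiff ℝ ∞ f) (hg : ContDiff ℝ ∞ g) (v : E) :
    dirD v (fun x => f x * g x) = fun x => dirD v f x * g x + f x * dirD v g x := by
  funext x
  simp only [dirD]
  rw [fderiv_fun_mul (hf.differentiable (by simp) x) (hg.differentiable (by simp) x)]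
  simp only [add_apply, smul_apply, smul_eq_mul]
  ring

theorem Filter.EventuallyEq.dirD {f g : E → F} {x : E} (h : f =ᶠ[𝓝 x] g) (v : E) :
    dirD v f =ᶠ[𝓝 x] dirD v g := by
  filter_upwards [h.fderiv (𝕜 := ℝ)] with y hy
  simp only [_root_.dirD, hy]

theorem HasCompactSupport.dirD {f : E → F} (h : HasCompactSupport f) (v : E) :
    HasCompactSupport (dirD v f) :=
  (h.fderiv (𝕜 := ℝ)).comp_left (g := fun T : E →L[ℝ] F => T v) rfl

theorem dirDs_ofFn {f : E → F} (hf : ContDiff ℝ ∞ f) (k : ℕ) (v : Fin k → E) (x : E) :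
    dirDs (List.ofFn v) f x = iteratedFDeriv ℝ k f x v := by
  induction k generalizing x with
  | zero => simp
  | succ k ih =>
    rw [List.ofFn_succ, dirDs_cons, iteratedFDeriv_succ_apply_left]
    have e : dirDs (List.ofFn fun i : Fin k => v i.succ) f
        = fun y => iteratedFDeriv ℝ k f y (Fin.tail v) := funext fun y => ih _ y
    rw [e]
    have hd := (hf.differentiable_iteratedFDeriv (m := k) (by exact_mod_cast WithTop.coe_lt_top k))
    simp only [dirD]
    rw [fderiv_continuousMultilinear_apply_const_apply (hd x)]

theorem norm_dirDs_le {f : E → F} (hf : ContDiff ℝ ∞ f) (L : List E) (hL : ∀ v ∈ L, ‖v‖ ≤ 1)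
    (x : E) : ‖dirDs L f x‖ ≤ ‖iteratedFDeriv ℝ L.length f x‖ := by
  have h := dirDs_ofFn hf L.length L.get x
  rw [List.ofFn_get] at h
  rw [h]
  refine (ContinuousMultilinearMap.le_opNorm _ _).trans (mul_le_of_le_one_right (norm_nonneg _) ?_)
  exact Finset.prod_le_one (fun _ _ => norm_nonneg _) fun i _ => hL _ (List.get_mem L i)

theorem JetBound.dirD {g : ι → E → F} {W : ι → ℝ} (h : JetBound g W) (v : E) :
    JetBound (fun i => dirD v (g i)) W := by
  obtain ⟨h1, h2⟩ := h.dirDeriv (fun _ => v) (K := fun _ => ‖v‖) fun _ => le_rfl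
  refine ⟨h1, fun k => ?_⟩
  obtain ⟨C, hC0, hC⟩ := h2 k
  exact ⟨C * ‖v‖, by positivity, fun i => by rw [mul_assoc]; exact hC i⟩

theorem JetBound.dirDs {g : ι → E → F} {W : ι → ℝ} (h : JetBound g W) (L : List E) :
    JetBound (fun i => dirDs L (g i)) W := by
  induction L with
  | nil => exact h
  | cons v L ih => exact ih.dirD v

/-- A finite system of vectors of `E` together with continuous coordinate functionals of norm at
most one. -/
structure CoordFrame (J : Type) (E : Type) [Fintype J] [NormedAddCommGroup E]
    [NormedSpace ℝ E] where
  /-- The vectors of the frame. -/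
  vec : J → E
  /-- The coordinate functionals. -/
  coord : J → E →L[ℝ] ℝ
  sum_coord : ∀ x, ∑ j, coord j x • vec j = x
  abs_coord_le : ∀ j x, |coord j x| ≤ ‖x‖

/-- The standard basis of `ℝⁿ`. -/
def euclFrame (n : ℕ) : CoordFrame (Fin n) (Rn n) where
  vec j := EuclideanSpace.single j 1
  coord j := EuclideanSpace.proj j
  sum_coord x := by
    have := (EuclideanSpace.basisFun (Fin n) ℝ).sum_repr x
    simpa using this
  abs_coord_le j x := by
    simpa using PiLp.norm_apply_le x j

/-- The frame of a product that consists of the two frames of the factors. -/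
def CoordFrame.prod {J K : Type} [Fintype J] [Fintype K] (a : CoordFrame J E)
    (b : CoordFrame K F) : CoordFrame (J ⊕ K) (E × F) where
  vec := Sum.elim (fun j => (a.vec j, 0)) fun k => (0, b.vec k)
  coord := Sum.elim (fun j => (a.coord j).comp (ContinuousLinearMap.fst ℝ E F))
    fun k => (b.coord k).comp (ContinuousLinearMap.snd ℝ E F)
  sum_coord x := by
    rw [Fintype.sum_sum_type]
    ext1
    · simpa [Prod.fst_sum] using a.sum_coord x.1
    · simpa [Prod.snd_sum] using b.sum_coord x.2
  abs_coord_le j x := by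
    rcases j with j | j
    · exact (a.abs_coord_le j x.1).trans (norm_fst_le x)
    · exact (b.abs_coord_le j x.2).trans (norm_snd_le x)

theorem CoordFrame.norm_multilinear_le {J : Type} [Fintype J] (a : CoordFrame J E) {k : ℕ}
    (T : ContinuousMultilinearMap ℝ (fun _ : Fin k => E) F) :
    ‖T‖ ≤ ∑ r : Fin k → J, ‖T fun i => a.vec (r i)‖ := by
  classical
  refine ContinuousMultilinearMap.opNorm_le_bound
    (Finset.sum_nonneg fun _ _ => norm_nonneg _) fun m => ?_
  have e : T m = ∑ r : Fin k → J, (∏ i, a.coord (r i) (m i)) • T fun i => a.vec (r i) := by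
    conv_lhs => rw [show m = fun i => ∑ j, a.coord j (m i) • a.vec j from
      funext fun i => (a.sum_coord (m i)).symm]
    have h1 := T.toMultilinearMap.map_sum (fun i j => a.coord j (m i) • a.vec j)
    have h2 : ∀ r : Fin k → J, T (fun i => a.coord (r i) (m i) • a.vec (r i))
        = (∏ i, a.coord (r i) (m i)) • T fun i => a.vec (r i) := fun r =>
      T.toMultilinearMap.map_smul_univ (fun i => a.coord (r i) (m i)) fun i => a.vec (r i)
    rw [← Finset.sum_congr rfl fun r _ => h2 r]
    exact h1
  rw [e, Finset.sum_mul]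
  refine (norm_sum_le _ _).trans (Finset.sum_le_sum fun r _ => ?_)
  rw [norm_smul, mul_comm, Finset.prod_congr rfl fun _ _ => rfl, norm_prod]
  gcongr with i
  exact a.abs_coord_le _ _

/-- Jet bounds can be checked on the iterated derivatives along the vectors of a frame. -/
theorem JetBound.of_frame {J : Type} [Fintype J] (a : CoordFrame J E) {g : ι → E → F}
    {W : ι → ℝ} (hs : ∀ i, ContDiff ℝ ∞ (g i))
    (h : ∀ L : List J, ∃ C : ℝ, 0 ≤ C ∧ ∀ i, ‖_root_.dirDs (L.map a.vec) (g i) 0‖ ≤ C * W i) :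
    JetBound g W := by
  refine ⟨fun i => (hs i).contDiffAt, fun k => ?_⟩
  choose C hC0 hC using h
  refine ⟨∑ r : Fin k → J, C (List.ofFn r), Finset.sum_nonneg fun _ _ => hC0 _, fun i => ?_⟩
  refine (a.norm_multilinear_le _).trans ?_
  rw [Finset.sum_mul]
  refine Finset.sum_le_sum fun r _ => ?_
  rw [← dirDs_ofFn (hs i)]
  have := hC (List.ofFn r) i
  rwa [List.map_ofFn] at this

end DirectionalDerivatives

/-! ### Derivatives indexed by multi-indices -/

section MultiIndexDerivatives

variable {n : ℕ} {F : Type} [NormedAddCommGroup F] [NormedSpace ℝ F]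

/-- The increasing list of coordinate directions in which `i` occurs `α i` times. -/
def MultiIndex.toList (α : MultiIndex n) : List (Fin n) :=
  (List.finRange n).flatMap fun i => List.replicate (α i) i

/-- The multi-index that counts the entries of a list of coordinate directions. -/
def countIndex (l : List (Fin n)) : MultiIndex n := fun i => l.count i

theorem MultiIndex.count_toList (α : MultiIndex n) (i : Fin n) : α.toList.count i = α i := by
  rw [MultiIndex.toList, List.count_flatMap]
  have : (List.map (List.count i ∘ fun j => List.replicate (α j) j) (List.finRange n))
      = (List.finRange n).map fun j => if j = i then α j else 0 := by
    refine List.map_congr_left fun j _ => ?_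
    simp [List.count_replicate]
  rw [this, ← List.ofFn_eq_map, List.sum_ofFn]
  simp

theorem MultiIndex.length_toList (α : MultiIndex n) : α.toList.length = α.len := by
  rw [MultiIndex.toList, List.length_flatMap, MultiIndex.len]
  simp [← List.ofFn_eq_map, List.sum_ofFn]

theorem perm_toList_countIndex (l : List (Fin n)) : l.Perm (countIndex l).toList := by
  rw [List.perm_iff_count]
  intro i
  rw [MultiIndex.count_toList]
  rfl

theorem mderiv_eq_dirDs (α : MultiIndex n) (f : Rn n → F) :
    mderiv α f = dirDs (α.toList.map (euclFrame n).vec) f := by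
  have hrep : ∀ (k : ℕ) (i : Fin n) (g : Rn n → F),
      (pderivCoord i)^[k] g = dirDs ((List.replicate k i).map (euclFrame n).vec) g := by
    intro k i g
    induction k with
    | zero => rfl
    | succ k ih =>
      rw [Function.iterate_succ_apply', ih, List.replicate_succ]
      rfl
  unfold mderiv MultiIndex.toList
  induction List.finRange n with
  | nil => rfl
  | cons i l ih =>
    rw [List.foldr_cons, ih, List.flatMap_cons, List.map_append, dirDs_append, hrep]

theorem mderiv_add_single {f : Rn n → F} (hf : ContDiff ℝ ∞ f) (α : MultiIndex n) (j : Fin n) :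
    mderiv (α + Pi.single j 1) f = dirD ((euclFrame n).vec j) (mderiv α f) := by
  rw [mderiv_eq_dirDs, mderiv_eq_dirDs, ← dirDs_cons, ← List.map_cons]
  refine dirDs_perm hf (List.Perm.map _ ?_)
  rw [List.perm_iff_count]
  intro i
  rw [MultiIndex.count_toList, List.count_cons, MultiIndex.count_toList]
  by_cases h : i = j
  · subst h; simp
  · simp [h, Ne.symm h]

theorem List.perm_sum_split {A B : Type*} (l : List (A ⊕ B)) :
    l.Perm ((l.filterMap Sum.getLeft?).map Sum.inl ++ (l.filterMap Sum.getRight?).map Sum.inr) := by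
  induction l with
  | nil => simp
  | cons a l ih =>
    rcases a with a | b
    · simpa [List.filterMap_cons] using ih
    · simpa [List.filterMap_cons] using (ih.cons (Sum.inr b)).trans List.perm_middle.symm

variable {E : Type} [NormedAddCommGroup E] [NormedSpace ℝ E]

/-- Mixed derivatives are iterated derivatives on the product space. -/
theorem mderiv_prod {f : Rn n × E → F} (hf : ContDiff ℝ ∞ f) (α : MultiIndex n) (L : List E)
    (x : Rn n) (y : E) :
    mderiv α (fun x' => dirDs L (fun y' => f (x', y')) y) x
      = dirDs (α.toList.map (fun i => ((euclFrame n).vec i, (0 : E))) ++ L.map fun v => (0, v))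
          f (x, y) := by
  have h1 : ∀ x', dirDs L (fun y' => f (x', y')) y = dirDs (L.map fun v => (0, v)) f (x', y) := by
    intro x'
    have := congrFun (dirDs_comp_affine hf (x', 0) (ContinuousLinearMap.inr ℝ (Rn n) E) L) y
    simpa [ContinuousLinearMap.inr_apply, funext (ContinuousLinearMap.inr_apply (R := ℝ)
      (M₁ := Rn n) (M₂ := E))] using this
  simp only [h1]
  rw [mderiv_eq_dirDs, dirDs_append]
  have := congrFun (dirDs_comp_affine (hf.dirDs (L.map fun v => ((0 : Rn n), v))) (0, y)
    (ContinuousLinearMap.inl ℝ (Rn n) E) (α.toList.map (euclFrame n).vec)) x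
  simpa [Function.comp_def] using this

theorem mderiv₂_eq_dirDs {f : Rn n → Rn n → F} (hf : ContDiff ℝ ∞ fun p : Rn n × Rn n => f p.1 p.2)
    (α β : MultiIndex n) (x y : Rn n) :
    mderiv₂ α β f x y = dirDs ((α.toList.map Sum.inl ++ β.toList.map Sum.inr).map
      ((euclFrame n).prod (euclFrame n)).vec) (fun p : Rn n × Rn n => f p.1 p.2) (x, y) := by
  have := mderiv_prod hf α (β.toList.map (euclFrame n).vec) x y
  simp only [← mderiv_eq_dirDs] at this
  rw [mderiv₂, this]
  simp [CoordFrame.prod, Function.comp_def]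

theorem mderiv₃_eq_dirDs {f : Rn n → Rn n → Rn n → F}
    (hf : ContDiff ℝ ∞ fun p : Rn n × Rn n × Rn n => f p.1 p.2.1 p.2.2)
    (α β γ : MultiIndex n) (x y z : Rn n) :
    mderiv₃ α β γ f x y z = dirDs ((α.toList.map Sum.inl ++
      (β.toList.map Sum.inl ++ γ.toList.map Sum.inr).map Sum.inr).map
      ((euclFrame n).prod ((euclFrame n).prod (euclFrame n))).vec)
      (fun p : Rn n × Rn n × Rn n => f p.1 p.2.1 p.2.2) (x, y, z) := by
  have h2 : ∀ x', mderiv₂ β γ (f x') y z = dirDs ((β.toList.map Sum.inl ++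
      γ.toList.map Sum.inr).map ((euclFrame n).prod (euclFrame n)).vec)
      (fun p : Rn n × Rn n => f x' p.1 p.2) (y, z) := fun x' =>
    mderiv₂_eq_dirDs (f := f x') (hf.comp (contDiff_const.prodMk contDiff_id)) β γ y z
  have := mderiv_prod hf α ((β.toList.map Sum.inl ++
      γ.toList.map Sum.inr).map ((euclFrame n).prod (euclFrame n)).vec) x (y, z)
  simp only [mderiv₃, h2]
  rw [this]
  simp [CoordFrame.prod, Function.comp_def]

theorem mderiv₄_eq_dirDs {f : Rn n → Rn n → Rn n → Rn n → F}
    (hf : ContDiff ℝ ∞ fun p : Rn n × Rn n × Rn n × Rn n => f p.1 p.2.1 p.2.2.1 p.2.2.2)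
    (α β γ δ : MultiIndex n) (x y z w : Rn n) :
    mderiv₄ α β γ δ f x y z w = dirDs ((α.toList.map Sum.inl ++
      (β.toList.map Sum.inl ++ (γ.toList.map Sum.inl ++
        δ.toList.map Sum.inr).map Sum.inr).map Sum.inr).map
      ((euclFrame n).prod ((euclFrame n).prod ((euclFrame n).prod (euclFrame n)))).vec)
      (fun p : Rn n × Rn n × Rn n × Rn n => f p.1 p.2.1 p.2.2.1 p.2.2.2) (x, y, z, w) := by
  have h2 : ∀ x', mderiv₃ β γ δ (f x') y z w = dirDs ((β.toList.map Sum.inl ++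
      (γ.toList.map Sum.inl ++ δ.toList.map Sum.inr).map Sum.inr).map
      ((euclFrame n).prod ((euclFrame n).prod (euclFrame n))).vec)
      (fun p : Rn n × Rn n × Rn n => f x' p.1 p.2.1 p.2.2) (y, z, w) := fun x' =>
    mderiv₃_eq_dirDs (f := f x') (hf.comp (contDiff_const.prodMk contDiff_id)) β γ δ y z w
  have := mderiv_prod hf α ((β.toList.map Sum.inl ++
      (γ.toList.map Sum.inl ++ δ.toList.map Sum.inr).map Sum.inr).map
      ((euclFrame n).prod ((euclFrame n).prod (euclFrame n))).vec) x (y, z, w)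
  simp only [mderiv₄, h2]
  rw [this]
  simp [CoordFrame.prod, Function.comp_def]

theorem norm_mderiv₃_le {f : Rn n → Rn n → Rn n → F}
    (hf : ContDiff ℝ ∞ fun p : Rn n × Rn n × Rn n => f p.1 p.2.1 p.2.2)
    (α β γ : MultiIndex n) (x y z : Rn n) :
    ‖mderiv₃ α β γ f x y z‖ ≤ ‖iteratedFDeriv ℝ (α.len + (β.len + γ.len))
      (fun p : Rn n × Rn n × Rn n => f p.1 p.2.1 p.2.2) (x, y, z)‖ := by
  rw [mderiv₃_eq_dirDs hf]
  set l := α.toList.map Sum.inl ++ (β.toList.map Sum.inl ++ γ.toList.map Sum.inr).map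
    (Sum.inr (α := Fin n)) with hl
  have e : (l.map ((euclFrame n).prod ((euclFrame n).prod (euclFrame n))).vec).length
      = α.len + (β.len + γ.len) := by
    simp [hl, MultiIndex.length_toList]
  rw [← e]
  refine norm_dirDs_le hf _ (fun v hv => ?_) _
  obtain ⟨j, -, rfl⟩ := List.mem_map.1 hv
  rcases j with j | j | j <;> simp [CoordFrame.prod, euclFrame, Prod.norm_def]

end MultiIndexDerivatives

/-! ### Derivatives of integrals over the unit interval -/

section UnitIntervalIntegrals

variable {ι : Type*} {E F : Type} [NormedAddCommGroup E] [NormedSpace ℝ E] [ProperSpace E]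
  [NormedAddCommGroup F] [NormedSpace ℝ F]

theorem hasFDerivAt_integral_unitInterval {g : ℝ × E → F} (hg : ContDiff ℝ ∞ g) (x : E) :
    HasFDerivAt (fun h => ∫ s in (0 : ℝ)..1, g (s, h))
      (∫ s in (0 : ℝ)..1, fderiv ℝ (fun h => g (s, h)) x) x := by
  have hfd : ∀ s h, fderiv ℝ (fun h => g (s, h)) h
      = (fderiv ℝ g (s, h)).comp (ContinuousLinearMap.inr ℝ ℝ E) := by
    intro s h
    have h1 : HasFDerivAt (fun h : E => (s, h)) (ContinuousLinearMap.inr ℝ ℝ E) h :=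
      hasFDerivAt_prodMk_right s h
    exact ((hg.differentiable (by simp) (s, h)).hasFDerivAt.comp h h1).fderiv
  have hc : Continuous fun p : ℝ × E => fderiv ℝ (fun h => g (p.1, h)) p.2 := by
    simp only [hfd]
    exact ((hg.continuous_fderiv (by simp)).clm_comp continuous_const)
  obtain ⟨C, hC⟩ := (isCompact_Icc (a := (0 : ℝ)) (b := 1) |>.prod
    (isCompact_closedBall x 1)).exists_bound_of_continuousOn hc.continuousOn
  refine (intervalIntegral.hasFDerivAt_integral_of_dominated_of_fderiv_le (bound := fun _ => C)
    (F := fun h s => g (s, h)) (F' := fun h s => fderiv ℝ (fun h => g (s, h)) h)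
    (Metric.ball_mem_nhds x one_pos) ?_ ?_ ?_ ?_ ?_ ?_)
  · exact Eventually.of_forall fun h =>
      (hg.continuous.comp (by fun_prop : Continuous fun s : ℝ => (s, h))).aestronglyMeasurable
  · exact (hg.continuous.comp (by fun_prop : Continuous fun s : ℝ => (s, x))).intervalIntegrable _ _
  · exact (hc.comp (by fun_prop : Continuous fun s : ℝ => (s, x))).aestronglyMeasurable
  · refine Eventually.of_forall fun s hs h hh => hC (s, h) ⟨?_, ?_⟩
    · rw [Set.uIoc_of_le zero_le_one] at hs
      exact ⟨hs.1.le, hs.2⟩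
    · exact Metric.ball_subset_closedBall hh
  · simp
  · refine Eventually.of_forall fun s _ h _ => ?_
    exact ((hg.comp (by fun_prop : ContDiff ℝ ∞ fun h : E => (s, h))).differentiable
      (by simp) h).hasFDerivAt

theorem norm_iteratedFDeriv_integral_unitInterval_le {g : ℝ × E → F} (hg : ContDiff ℝ ∞ g)
    (x : E) (k : ℕ) {C : ℝ}
    (hC : ∀ s ∈ Set.Icc (0 : ℝ) 1, ‖iteratedFDeriv ℝ k (fun h => g (s, h)) x‖ ≤ C) :
    ‖iteratedFDeriv ℝ k (fun h => ∫ s in (0 : ℝ)..1, g (s, h)) x‖ ≤ C := by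
  induction k generalizing F with
  | zero =>
    simp only [norm_iteratedFDeriv_zero] at hC ⊢
    have := intervalIntegral.norm_integral_le_of_norm_le_const (a := (0 : ℝ)) (b := 1) (C := C)
      (f := fun s => g (s, x)) fun s hs => hC s (by
        rw [Set.uIoc_of_le zero_le_one] at hs
        exact ⟨hs.1.le, hs.2⟩)
    simpa using this
  | succ k ih =>
    rw [← norm_iteratedFDeriv_fderiv]
    have e : fderiv ℝ (fun h => ∫ s in (0 : ℝ)..1, g (s, h))
        = fun h => ∫ s in (0 : ℝ)..1, fderiv ℝ (fun h => g (s, h)) h :=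
      funext fun h => (hasFDerivAt_integral_unitInterval hg h).fderiv
    rw [e]
    have hs : ContDiff ℝ ∞ fun p : ℝ × E => fderiv ℝ (fun h => g (p.1, h)) p.2 :=
      ContDiff.fderiv (m := ∞) (n := ∞) (f := fun (p : ℝ × E) (h : E) => g (p.1, h))
        (hg.comp (by fun_prop)) contDiff_snd (by simp)
    refine ih (g := fun p => fderiv ℝ (fun h => g (p.1, h)) p.2) hs fun s hs' => ?_
    rw [show (fun h => fderiv ℝ (fun h => g (s, h)) h) = fderiv ℝ fun h => g (s, h) from rfl,
      norm_iteratedFDeriv_fderiv]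
    exact hC s hs'

theorem JetBound.integral {g : ι → ℝ × E → F} {W : ι → ℝ} (hg : ∀ i, ContDiff ℝ ∞ (g i))
    (h : JetBound (fun (i : ι × Set.Icc (0 : ℝ) 1) x => g i.1 (i.2, x)) fun i => W i.1)
    {f : ι → E → F} (hf : ∀ i, ContDiffAt ℝ ∞ (f i) 0)
    (e : ∀ i x, f i x = ∫ s in (0 : ℝ)..1, g i (s, x)) : JetBound f W := by
  refine ⟨hf, fun k => ?_⟩
  obtain ⟨C, hC0, hC⟩ := h.2 k
  refine ⟨C, hC0, fun i => ?_⟩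
  rw [show f i = _ from funext (e i)]
  exact norm_iteratedFDeriv_integral_unitInterval_le (hg i) 0 k fun s hs => hC (i, ⟨s, hs⟩)

end UnitIntervalIntegrals

/-! ### The bracket and its powers -/

section Japanese

variable {n : ℕ}

theorem japanese_sq (x : Rn n) : japanese x ^ 2 = 1 + ‖x‖ ^ 2 :=
  Real.sq_sqrt (by positivity)

theorem one_le_japanese (x : Rn n) : 1 ≤ japanese x :=
  Real.one_le_sqrt.2 (by nlinarith [sq_nonneg ‖x‖])

theorem japanese_pos (x : Rn n) : 0 < japanese x := one_pos.trans_le (one_le_japanese x)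

theorem norm_le_japanese (x : Rn n) : ‖x‖ ≤ japanese x :=
  Real.le_sqrt_of_sq_le (by linarith)

theorem japanese_le_one_add_norm (x : Rn n) : japanese x ≤ 1 + ‖x‖ :=
  Real.sqrt_le_iff.2 ⟨by positivity, by nlinarith [norm_nonneg x]⟩

theorem japanese_add_le (x y : Rn n) : japanese (x + y) ≤ 2 * (japanese x * japanese y) := by
  have hx := japanese_pos x
  have hy := japanese_pos y
  refine (sq_le_sq₀ (japanese_pos _).le (by positivity)).1 ?_
  have h2 : ‖x + y‖ ^ 2 ≤ 2 * (‖x‖ ^ 2 + ‖y‖ ^ 2) := by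
    have := pow_le_pow_left₀ (norm_nonneg _) (norm_add_le x y) 2
    nlinarith [sq_nonneg (‖x‖ - ‖y‖)]
  rw [mul_pow, mul_pow, japanese_sq, japanese_sq, japanese_sq]
  nlinarith [mul_nonneg (sq_nonneg ‖x‖) (sq_nonneg ‖y‖), sq_nonneg ‖x‖, sq_nonneg ‖y‖]

theorem japanese_neg (x : Rn n) : japanese (-x) = japanese x := by simp [japanese]

theorem japanese_smul_le {c : ℝ} (hc : |c| ≤ 1) (x : Rn n) : japanese (c • x) ≤ japanese x := by
  apply Real.sqrt_le_sqrt
  rw [norm_smul, mul_pow]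
  have : ‖c‖ ^ 2 ≤ 1 := pow_le_one₀ (norm_nonneg c) hc
  nlinarith [sq_nonneg ‖x‖]

/-- Comparable positive numbers have comparable powers. -/
theorem rpow_le_of_comparable {a b C : ℝ} (ha : 0 < a) (hb : 0 < b) (h1 : a ≤ C * b)
    (h2 : b ≤ C * a) (s : ℝ) : a ^ s ≤ C ^ |s| * b ^ s := by
  have hC : 0 < C := by
    by_contra h
    nlinarith
  rcases le_total 0 s with hs | hs
  · rw [abs_of_nonneg hs, ← Real.mul_rpow hC.le hb.le]
    exact Real.rpow_le_rpow ha.le h1 hs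
  · rw [abs_of_nonpos hs, Real.rpow_neg hC.le, ← Real.inv_rpow hC.le,
      ← Real.mul_rpow (inv_nonneg.2 hC.le) hb.le]
    refine Real.rpow_le_rpow_of_nonpos (by positivity) ?_ hs
    rw [inv_mul_le_iff₀ hC]
    exact h2

/-- Peetre's inequality. -/
theorem japanese_add_rpow_le (x y : Rn n) (s : ℝ) :
    japanese (x + y) ^ s ≤ 2 ^ |s| * (japanese x ^ s * japanese y ^ |s|) := by
  have hx := japanese_pos x
  have hy := japanese_pos y
  have h := rpow_le_of_comparable (japanese_pos (x + y)) hx (C := 2 * japanese y)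
    (by linarith [japanese_add_le x y]) (by
      have := japanese_add_le (x + y) (-y)
      rw [japanese_neg, add_neg_cancel_right] at this
      linarith) s
  rw [Real.mul_rpow zero_le_two hy.le] at h
  linarith

theorem contDiff_japanese : ContDiff ℝ ∞ (japanese (n := n)) :=
  (contDiff_const.add (contDiff_norm_sq ℝ)).sqrt fun x => by positivity

theorem contDiff_japanese_rpow (s : ℝ) : ContDiff ℝ ∞ fun x : Rn n => japanese x ^ s :=
  contDiff_japanese.rpow_const_of_ne fun x => (japanese_pos x).ne'

theorem jetBound_japanese_rpow (s : ℝ) :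
    JetBound (fun x h : Rn n => japanese (x + h) ^ s) fun x => japanese x ^ s := by
  have hx : JetBound (fun x h : Rn n => x + h) japanese := by
    refine (JetBound.const (c := fun x : Rn n => x) norm_le_japanese).add ?_
    exact JetBound.clm (A := fun _ => ContinuousLinearMap.id ℝ (Rn n)) fun x =>
      ContinuousLinearMap.norm_id_le.trans (one_le_japanese x)
  have h1 : JetBound (fun x h : Rn n => 1 + inner ℝ (x + h) (x + h))
      fun x => japanese x * japanese x := by
    refine JetBound.add (JetBound.const fun x => ?_) (hx.inner hx)
    rw [norm_one]
    nlinarith [one_le_japanese x]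
  have h2 := h1.rpow one_pos (fun x => mul_pos (japanese_pos x) (japanese_pos x))
    (fun x => by
      rw [add_zero, real_inner_self_eq_norm_sq, ← japanese_sq]
      nlinarith) (s / 2)
  have e : ∀ y : Rn n, (1 + inner ℝ y y : ℝ) ^ (s / 2) = japanese y ^ s := by
    intro y
    rw [real_inner_self_eq_norm_sq, ← japanese_sq, ← Real.rpow_natCast, ← Real.rpow_mul
      (japanese_pos y).le]
    congr 1
    push_cast
    ring
  simp only [e, add_zero] at h2
  exact h2

end Japanese

/-! ### Symbol estimates as jet bounds -/

section ScaledEstimates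

variable {n : ℕ} {F : Type} [NormedAddCommGroup F] [NormedSpace ℝ F]

/-- Derivatives along eigenvectors `vec j` of a linear map `A` with eigenvalues `c j`. -/
theorem dirDs_map_eigen {J E : Type} [NormedAddCommGroup E] [NormedSpace ℝ E] {f : E → F}
    (hf : ContDiff ℝ ∞ f) {vec : J → E} {c : J → ℝ} {A : E →L[ℝ] E}
    (hA : ∀ j, A (vec j) = c j • vec j) (L : List J) (x : E) :
    dirDs ((L.map vec).map A) f x = (L.map c).prod • dirDs (L.map vec) f x := by
  induction L generalizing x with
  | nil => simp
  | cons j L ih =>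
    have : dirDs ((L.map vec).map A) f = fun x => (L.map c).prod • dirDs (L.map vec) f x :=
      funext ih
    rw [List.map_cons, List.map_cons, dirDs_cons, this, List.map_cons, dirDs_cons, List.prod_cons]
    simp only [dirD]
    have hd := ((hf.dirDs (L.map vec)).differentiable (by simp)) x
    rw [fderiv_fun_const_smul hd, hA, map_smul, smul_apply, smul_smul]

theorem exists_perm_toList₂ (L : List (Fin n ⊕ Fin n)) : ∃ α β : MultiIndex n,
    L.Perm (α.toList.map Sum.inl ++ β.toList.map Sum.inr) :=
  ⟨_, _, (List.perm_sum_split L).trans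
    (((perm_toList_countIndex _).map _).append ((perm_toList_countIndex _).map _))⟩

theorem exists_perm_toList₄ (L : List (Fin n ⊕ (Fin n ⊕ (Fin n ⊕ Fin n)))) :
    ∃ α β γ δ : MultiIndex n, L.Perm (α.toList.map Sum.inl ++
      (β.toList.map Sum.inl ++ (γ.toList.map Sum.inl ++
        δ.toList.map Sum.inr).map Sum.inr).map Sum.inr) := by
  obtain ⟨γ, δ, h2⟩ := exists_perm_toList₂
    ((L.filterMap Sum.getRight?).filterMap Sum.getRight?)
  have h1 := (List.perm_sum_split (L.filterMap Sum.getRight?)).trans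
    (((perm_toList_countIndex _).map _).append (h2.map _))
  exact ⟨_, _, γ, δ, (List.perm_sum_split L).trans
    (((perm_toList_countIndex _).map _).append (h1.map _))⟩

/-- Estimates of mixed derivatives in which each derivative of the second group of variables
carries a factor `σ` are jet bounds for the family rescaled by `σ` in these variables. -/
theorem jetBound_of_mderiv₂ {f : Rn n → Rn n → F}
    (hf : ContDiff ℝ ∞ fun p : Rn n × Rn n => f p.1 p.2) {σ W : Rn n × Rn n → ℝ}
    (h : ∀ α β : MultiIndex n, ∃ C : ℝ, 0 ≤ C ∧ ∀ p : Rn n × Rn n,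
      |σ p| ^ β.len * ‖mderiv₂ α β f p.1 p.2‖ ≤ C * W p) :
    JetBound (fun p h : Rn n × Rn n => f (p.1 + h.1) (p.2 + σ p • h.2)) W := by
  set fr := (euclFrame n).prod (euclFrame n)
  have hA : ∀ p : Rn n × Rn n, ContDiff ℝ ∞
      fun h : Rn n × Rn n => f (p.1 + h.1) (p.2 + σ p • h.2) := fun p =>
    hf.comp (by fun_prop : ContDiff ℝ ∞
      fun h : Rn n × Rn n => (p.1 + h.1, p.2 + σ p • h.2))
  refine JetBound.of_frame fr hA fun L => ?_
  obtain ⟨α, β, hL⟩ := exists_perm_toList₂ L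
  obtain ⟨C, hC0, hC⟩ := h α β
  refine ⟨C, hC0, fun p => ?_⟩
  rw [dirDs_perm (hA p) (hL.map _)]
  set A : Rn n × Rn n →L[ℝ] Rn n × Rn n := (ContinuousLinearMap.fst ℝ _ _).prod
    (σ p • ContinuousLinearMap.snd ℝ _ _)
  have h1 := congrFun (dirDs_comp_affine hf p A
    ((α.toList.map Sum.inl ++ β.toList.map Sum.inr).map fr.vec)) 0
  have h2 := dirDs_map_eigen hf (vec := fr.vec) (c := Sum.elim (fun _ => 1) fun _ => σ p)
    (A := A) (by rintro (j | j) <;> simp [fr, CoordFrame.prod, A])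
    (α.toList.map Sum.inl ++ β.toList.map Sum.inr) p
  rw [map_zero, add_zero] at h1
  rw [show (fun h : Rn n × Rn n => f (p.1 + h.1) (p.2 + σ p • h.2))
    = fun h => (fun q : Rn n × Rn n => f q.1 q.2) (p + A h) from rfl, h1, h2,
    ← mderiv₂_eq_dirDs hf α β p.1 p.2, norm_smul]
  have e : ((α.toList.map Sum.inl ++ β.toList.map Sum.inr).map
      (Sum.elim (fun _ : Fin n => (1 : ℝ)) fun _ : Fin n => σ p)).prod = σ p ^ β.len := by
    simp [Function.comp_def, MultiIndex.length_toList]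
  rw [e, norm_pow]
  exact hC p

/-- The analogue for four groups of variables, of which only the last is rescaled. -/
theorem jetBound_of_mderiv₄ {f : Rn n → Rn n → Rn n → Rn n → F}
    (hf : ContDiff ℝ ∞ fun p : Rn n × Rn n × Rn n × Rn n => f p.1 p.2.1 p.2.2.1 p.2.2.2)
    {σ W : Rn n × Rn n × Rn n × Rn n → ℝ}
    (h : ∀ α β γ δ : MultiIndex n, ∃ C : ℝ, 0 ≤ C ∧ ∀ p : Rn n × Rn n × Rn n × Rn n,
      |σ p| ^ δ.len * ‖mderiv₄ α β γ δ f p.1 p.2.1 p.2.2.1 p.2.2.2‖ ≤ C * W p) :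
    JetBound (fun p h : Rn n × Rn n × Rn n × Rn n => f (p.1 + h.1) (p.2.1 + h.2.1)
      (p.2.2.1 + h.2.2.1) (p.2.2.2 + σ p • h.2.2.2)) W := by
  set fr := (euclFrame n).prod ((euclFrame n).prod ((euclFrame n).prod (euclFrame n)))
  have hA : ∀ p : Rn n × Rn n × Rn n × Rn n, ContDiff ℝ ∞
      fun h : Rn n × Rn n × Rn n × Rn n => f (p.1 + h.1) (p.2.1 + h.2.1)
        (p.2.2.1 + h.2.2.1) (p.2.2.2 + σ p • h.2.2.2) := fun p =>
    hf.comp (by fun_prop : ContDiff ℝ ∞ fun h : Rn n × Rn n × Rn n × Rn n =>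
      (p.1 + h.1, p.2.1 + h.2.1, p.2.2.1 + h.2.2.1, p.2.2.2 + σ p • h.2.2.2))
  refine JetBound.of_frame fr hA fun L => ?_
  obtain ⟨α, β, γ, δ, hL⟩ := exists_perm_toList₄ L
  obtain ⟨C, hC0, hC⟩ := h α β γ δ
  refine ⟨C, hC0, fun p => ?_⟩
  rw [dirDs_perm (hA p) (hL.map _)]
  set l : List (Fin n ⊕ (Fin n ⊕ (Fin n ⊕ Fin n))) := α.toList.map Sum.inl ++
      (β.toList.map Sum.inl ++ (γ.toList.map Sum.inl ++
        δ.toList.map Sum.inr).map Sum.inr).map Sum.inr with hl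
  set A : Rn n × Rn n × Rn n × Rn n →L[ℝ] Rn n × Rn n × Rn n × Rn n :=
    (ContinuousLinearMap.fst ℝ _ _).prod
      (((ContinuousLinearMap.fst ℝ _ _).prod
        (((ContinuousLinearMap.fst ℝ _ _).prod
          (σ p • ContinuousLinearMap.snd ℝ _ _)).comp (ContinuousLinearMap.snd ℝ _ _))).comp
            (ContinuousLinearMap.snd ℝ _ _))
  have h1 := congrFun (dirDs_comp_affine hf p A (l.map fr.vec)) 0
  have h2 := dirDs_map_eigen hf (vec := fr.vec)
    (c := Sum.elim (fun _ => 1) (Sum.elim (fun _ => 1) (Sum.elim (fun _ => 1) fun _ => σ p)))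
    (A := A) (by rintro (j | j | j | j) <;> simp [fr, CoordFrame.prod, A]) l p
  rw [map_zero, add_zero] at h1
  rw [show (fun h : Rn n × Rn n × Rn n × Rn n => f (p.1 + h.1) (p.2.1 + h.2.1)
      (p.2.2.1 + h.2.2.1) (p.2.2.2 + σ p • h.2.2.2))
    = fun h => (fun q : Rn n × Rn n × Rn n × Rn n => f q.1 q.2.1 q.2.2.1 q.2.2.2) (p + A h)
      from rfl, h1, h2, ← mderiv₄_eq_dirDs hf α β γ δ p.1 p.2.1 p.2.2.1 p.2.2.2, norm_smul]
  have e : (l.map (Sum.elim (fun _ : Fin n => (1 : ℝ)) (Sum.elim (fun _ : Fin n => (1 : ℝ))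
      (Sum.elim (fun _ : Fin n => (1 : ℝ)) fun _ : Fin n => σ p)))).prod = σ p ^ δ.len := by
    simp [hl, Function.comp_def, MultiIndex.length_toList]
  rw [e, norm_pow]
  exact hC p

end ScaledEstimates

theorem MultiIndex.toList_add_single {n : ℕ} (α : MultiIndex n) (j : Fin n) :
    (MultiIndex.toList (α + Pi.single j 1)).Perm (j :: α.toList) := by
  rw [List.perm_iff_count]
  intro i
  rw [MultiIndex.count_toList, List.count_cons, MultiIndex.count_toList]
  by_cases h : i = j
  · subst h; simp
  · simp [h, Ne.symm h]

/-! ### Differences and Taylor remainders of the phase -/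

section Phase

variable {n : ℕ}

/-- The gradient map of the phase as a function on the product space. -/
def gradMap (ψ : Rn n → Rn n → ℝ) (p : Rn n × Rn n) : Rn n := gradX ψ p.1 p.2

theorem fderiv_slice_eq {F : Type} [NormedAddCommGroup F] [NormedSpace ℝ F] {f : Rn n × Rn n → F}
    (hf : ContDiff ℝ ∞ f) (x ξ : Rn n) :
    HasFDerivAt (fun x' => f (x', ξ))
      ((fderiv ℝ f (x, ξ)).comp (ContinuousLinearMap.inl ℝ (Rn n) (Rn n))) x :=
  (hf.differentiable (by simp) (x, ξ)).hasFDerivAt.comp x (hasFDerivAt_prodMk_left x ξ)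

theorem hasFDerivAt_gradX {ψ : Rn n → Rn n → ℝ}
    (hψ : ContDiff ℝ ∞ fun p : Rn n × Rn n => ψ p.1 p.2) (x ξ : Rn n) :
    HasFDerivAt (fun x' => ψ x' ξ) (innerSL ℝ (gradX ψ x ξ)) x := by
  have h := (fderiv_slice_eq hψ x ξ).differentiableAt.hasGradientAt.hasFDerivAt
  exact h

theorem gradX_apply {ψ : Rn n → Rn n → ℝ}
    (hψ : ContDiff ℝ ∞ fun p : Rn n × Rn n => ψ p.1 p.2) (x ξ : Rn n) (j : Fin n) :
    gradX ψ x ξ j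
      = dirD (((euclFrame n).prod (euclFrame n)).vec (Sum.inl j))
          (fun p : Rn n × Rn n => ψ p.1 p.2) (x, ξ) := by
  have h1 := (hasFDerivAt_gradX hψ x ξ).unique (fderiv_slice_eq hψ x ξ)
  have h2 := congrArg (fun T : Rn n →L[ℝ] ℝ => T (EuclideanSpace.single j 1)) h1
  simpa [dirD, CoordFrame.prod, euclFrame, EuclideanSpace.inner_single_right] using h2

theorem contDiff_gradMap {ψ : Rn n → Rn n → ℝ}
    (hψ : ContDiff ℝ ∞ fun p : Rn n × Rn n => ψ p.1 p.2) : ContDiff ℝ ∞ (gradMap ψ) := by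
  rw [contDiff_euclidean]
  intro j
  simp only [gradMap, gradX_apply hψ]
  exact hψ.dirD _

/-- The gradient of the phase is a symbol of order one in the frequency, without gain or loss
under differentiation. -/
theorem jetBound_gradMap {ψ : Rn n → Rn n → ℝ}
    (hψ : ContDiff ℝ ∞ fun p : Rn n × Rn n => ψ p.1 p.2)
    (hψ_x : ∀ α : MultiIndex n, 1 ≤ α.len → ∃ C : ℝ, ∀ x ξ : Rn n,
      |mderiv α (fun x' => ψ x' ξ) x| ≤ C * japanese ξ)
    (hψ_xξ : ∀ α β : MultiIndex n, 1 ≤ α.len → 1 ≤ β.len → ∃ C : ℝ, ∀ x ξ : Rn n,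
      |mderiv₂ α β ψ x ξ| ≤ C) :
    JetBound (fun p h : Rn n × Rn n => gradMap ψ (p + h)) fun p => japanese p.2 := by
  set fr := (euclFrame n).prod (euclFrame n)
  have hcomp : ∀ j : Fin n, JetBound (fun p h : Rn n × Rn n => gradMap ψ (p + h) j)
      fun p => japanese p.2 := by
    intro j
    have hs : ContDiff ℝ ∞ (dirD (fr.vec (Sum.inl j)) fun p : Rn n × Rn n => ψ p.1 p.2) :=
      hψ.dirD _
    have := jetBound_of_mderiv₂ (f := fun x ξ => dirD (fr.vec (Sum.inl j))
      (fun p : Rn n × Rn n => ψ p.1 p.2) (x, ξ)) hs (σ := fun _ => 1)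
      (W := fun p => japanese p.2) fun α β => ?_
    · refine this.congr' fun p h => ?_
      simp only [gradMap, gradX_apply hψ, one_smul]
      rfl
    · have e : ∀ p : Rn n × Rn n, mderiv₂ α β (fun x ξ => dirD (fr.vec (Sum.inl j))
          (fun p : Rn n × Rn n => ψ p.1 p.2) (x, ξ)) p.1 p.2
          = mderiv₂ (α + Pi.single j 1) β ψ p.1 p.2 := by
        intro p
        rw [mderiv₂_eq_dirDs hs, mderiv₂_eq_dirDs hψ]
        refine congrFun (?_ : dirDs _ (dirDs [fr.vec (Sum.inl j)] _) = _) _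
        rw [← dirDs_append, ← List.map_singleton, ← List.map_append]
        refine dirDs_perm hψ (List.Perm.map _ ?_)
        refine List.perm_append_comm.trans ?_
        rw [List.singleton_append, ← List.cons_append, ← List.map_cons]
        exact ((α.toList_add_single j).symm.map _).append_right _
      have hlen : 1 ≤ MultiIndex.len (α + Pi.single j 1) := by
        simp [MultiIndex.len, Finset.sum_add_distrib]
      simp only [e, abs_one, one_pow, one_mul]
      rcases Nat.eq_zero_or_pos β.len with hβ | hβ
      · obtain ⟨C, hC⟩ := hψ_x _ hlen
        have hβ0 : β.toList = [] := List.eq_nil_of_length_eq_zero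
          (by rw [MultiIndex.length_toList, hβ])
        refine ⟨|C|, abs_nonneg _, fun p => ?_⟩
        rw [mderiv₂]
        simp only [mderiv_eq_dirDs β, hβ0, List.map_nil, dirDs_nil]
        exact (hC p.1 p.2).trans (mul_le_mul_of_nonneg_right (le_abs_self C) (japanese_pos _).le)
      · obtain ⟨C, hC⟩ := hψ_xξ _ β hlen hβ
        refine ⟨|C|, abs_nonneg _, fun p => ?_⟩
        refine ((hC p.1 p.2).trans (le_abs_self C)).trans ?_
        exact le_mul_of_one_le_right (abs_nonneg C) (one_le_japanese _)
  have hsum := JetBound.sum (F := Rn n) Finset.univ (f := fun (j : Fin n) (p h : Rn n × Rn n) =>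
    gradMap ψ (p + h) j • (EuclideanSpace.single j (1 : ℝ) : Rn n))
    (W := fun p => japanese p.2) fun j _ => by
      have := (hcomp j).smul (W₂ := fun _ => 1) (JetBound.const
        (c := fun _ => (EuclideanSpace.single j (1 : ℝ) : Rn n)) (by simp))
      simpa using this
  refine hsum.congr' fun p h => ?_
  exact (euclFrame n).sum_coord (gradMap ψ (p + h))

/-- Differences of a function along displacements of size `μ ≤ 1` or of unit scale, when its
derivative in the first group of variables has order `W`. -/
theorem jetBound_difference {F E : Type} [NormedAddCommGroup F] [NormedSpace ℝ F]
    [CompleteSpace F] [NormedAddCommGroup E] [NormedSpace ℝ E] [ProperSpace E] {ι : Type*}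
    {f : Rn n × Rn n → F} (hf : ContDiff ℝ ∞ f) {D : Rn n × Rn n → Rn n →L[ℝ] F}
    (hD : ContDiff ℝ ∞ D) (hfD : ∀ x ξ, HasFDerivAt (fun x' => f (x', ξ)) (D (x, ξ)) x)
    {w₀ : Rn n → ℝ} (hjet : JetBound (fun p h : Rn n × Rn n => D (p + h)) fun p => w₀ p.2)
    (x ξ w : ι → Rn n) (X Ξ Z : ι → E →L[ℝ] Rn n) {μ : ι → ℝ} (hX : ∀ i, ‖X i‖ ≤ 1)
    (hΞ : ∀ i, ‖Ξ i‖ ≤ 1) (hZ : ∀ i, ‖Z i‖ ≤ 1) (hZμ : ∀ i, ‖Z i‖ ≤ μ i) (hw : ∀ i, ‖w i‖ ≤ μ i) :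
    JetBound (fun i h => f (x i + X i h + (w i + Z i h), ξ i + Ξ i h)
      - f (x i + X i h, ξ i + Ξ i h)) fun i => w₀ (ξ i) * μ i := by
  refine JetBound.integral (g := fun i sh => D (x i + X i sh.2 + sh.1 • (w i + Z i sh.2),
    ξ i + Ξ i sh.2) (w i + Z i sh.2)) ?_ ?_ ?_ ?_
  · intro i
    exact (hD.comp (by fun_prop : ContDiff ℝ ∞ fun sh : ℝ × E =>
      (x i + X i sh.2 + sh.1 • (w i + Z i sh.2), ξ i + Ξ i sh.2))).clm_apply (by fun_prop)
  · have hDs : JetBound (fun (i : ι × Set.Icc (0 : ℝ) 1) h =>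
        D (x i.1 + X i.1 h + (i.2 : ℝ) • (w i.1 + Z i.1 h), ξ i.1 + Ξ i.1 h))
        fun i => w₀ (ξ i.1) := by
      have h1 := (hjet.reindex fun i : ι × Set.Icc (0 : ℝ) 1 =>
        (x i.1 + (i.2 : ℝ) • w i.1, ξ i.1)).comp_clm
        (fun i => (X i.1 + (i.2 : ℝ) • Z i.1).prod (Ξ i.1)) 2 fun i => ?_
      · refine h1.congr' fun i h => ?_
        congr 1
        ext1
        · simp only [Prod.fst_add, ContinuousLinearMap.prod_apply, add_apply, smul_apply]
          rw [smul_add]; abel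
        · simp
      · refine ContinuousLinearMap.opNorm_le_bound _ zero_le_two fun h => ?_
        have hs : ‖(i.2 : ℝ)‖ ≤ 1 := by
          rw [Real.norm_of_nonneg i.2.2.1]; exact i.2.2.2
        have a1 := (X i.1).le_of_opNorm_le (hX i.1) h
        have a2 := (Z i.1).le_of_opNorm_le (hZ i.1) h
        have a3 := (Ξ i.1).le_of_opNorm_le (hΞ i.1) h
        rw [ContinuousLinearMap.prod_apply, Prod.norm_def]
        refine max_le ?_ (by linarith [norm_nonneg h])
        refine (norm_add_le _ _).trans ?_
        have a4 : ‖((i.2 : ℝ) • Z i.1) h‖ ≤ ‖h‖ := by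
          rw [smul_apply, norm_smul]
          calc _ ≤ 1 * (1 * ‖h‖) := mul_le_mul hs a2 (norm_nonneg _) zero_le_one
            _ = ‖h‖ := by ring
        refine (add_le_add a1 a4).trans (le_of_eq ?_)
        ring
    exact hDs.clm_apply ((JetBound.const (c := fun i : ι × Set.Icc (0 : ℝ) 1 => w i.1)
      fun i => hw i.1).add
        (JetBound.clm (A := fun i : ι × Set.Icc (0 : ℝ) 1 => Z i.1) fun i => hZμ i.1))
  · intro i
    exact ((hf.comp (by fun_prop)).sub (hf.comp (by fun_prop))).contDiffAt
  · intro i h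
    have hd : ∀ s : ℝ, HasDerivAt
        (fun s : ℝ => f (x i + X i h + s • (w i + Z i h), ξ i + Ξ i h))
        (D (x i + X i h + s • (w i + Z i h), ξ i + Ξ i h) (w i + Z i h)) s := by
      intro s
      have h1 : HasDerivAt (fun s : ℝ => x i + X i h + s • (w i + Z i h)) (w i + Z i h) s := by
        simpa using ((hasDerivAt_id s).smul_const (w i + Z i h)).const_add (x i + X i h)
      exact (hfD _ (ξ i + Ξ i h)).comp_hasDerivAt s h1
    rw [intervalIntegral.integral_eq_sub_of_hasDerivAt (fun s _ => hd s)]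
    · simp
    · refine Continuous.intervalIntegrable ?_ _ _
      exact (hD.continuous.comp (by fun_prop)).clm_apply continuous_const

variable {ψ : Rn n → Rn n → ℝ} {E : Type} [NormedAddCommGroup E] [NormedSpace ℝ E]
  [ProperSpace E] {ι : Type*}

theorem jetBound_phaseDifference (hψ : ContDiff ℝ ∞ fun p : Rn n × Rn n => ψ p.1 p.2)
    (hG : JetBound (fun p h : Rn n × Rn n => gradMap ψ (p + h)) fun p => japanese p.2)
    (x ξ w : ι → Rn n) (X Ξ Z : ι → E →L[ℝ] Rn n) {μ : ι → ℝ} (hX : ∀ i, ‖X i‖ ≤ 1)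
    (hΞ : ∀ i, ‖Ξ i‖ ≤ 1) (hZ : ∀ i, ‖Z i‖ ≤ 1) (hZμ : ∀ i, ‖Z i‖ ≤ μ i) (hw : ∀ i, ‖w i‖ ≤ μ i) :
    JetBound (fun i h => ψ (x i + X i h + (w i + Z i h)) (ξ i + Ξ i h)
      - ψ (x i + X i h) (ξ i + Ξ i h)) fun i => japanese (ξ i) * μ i :=
  jetBound_difference (f := fun p => ψ p.1 p.2) hψ
    (D := fun p => innerSL ℝ (gradMap ψ p)) ((innerSL ℝ).contDiff.comp (contDiff_gradMap hψ))
    (fun x ξ => hasFDerivAt_gradX hψ x ξ)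
    ((hG.clm_comp (fun _ => innerSL ℝ) (K := fun _ => ‖(innerSL ℝ : Rn n →L[ℝ] _)‖)
      fun _ => le_rfl).mono _ (fun _ => le_rfl) fun p => (japanese_pos p.2).le)
    x ξ w X Ξ Z hX hΞ hZ hZμ hw

/-- The second order remainder of the phase is quadratic in the displacement. -/
theorem jetBound_phaseRemainder (hψ : ContDiff ℝ ∞ fun p : Rn n × Rn n => ψ p.1 p.2)
    (hG : JetBound (fun p h : Rn n × Rn n => gradMap ψ (p + h)) fun p => japanese p.2)
    (x ξ w : ι → Rn n) (X Ξ Z : ι → E →L[ℝ] Rn n) {μ : ι → ℝ} (hX : ∀ i, ‖X i‖ ≤ 1)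
    (hΞ : ∀ i, ‖Ξ i‖ ≤ 1) (hZ : ∀ i, ‖Z i‖ ≤ 1) (hZμ : ∀ i, ‖Z i‖ ≤ μ i) (hw : ∀ i, ‖w i‖ ≤ μ i) :
    JetBound (fun i h => phaseRemainder ψ (x i + X i h) (x i + X i h + (w i + Z i h)) (ξ i + Ξ i h))
      fun i => japanese (ξ i) * μ i * μ i := by
  have hGs := contDiff_gradMap hψ
  refine JetBound.integral (g := fun i sh => inner ℝ
    (gradMap ψ (x i + X i sh.2 + sh.1 • (w i + Z i sh.2), ξ i + Ξ i sh.2)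
      - gradMap ψ (x i + X i sh.2, ξ i + Ξ i sh.2)) (w i + Z i sh.2)) ?_ ?_ ?_ ?_
  · intro i
    exact ((hGs.comp (by fun_prop)).sub (hGs.comp (by fun_prop))).inner ℝ (by fun_prop)
  · have hGd : JetBound (fun (i : ι × Set.Icc (0 : ℝ) 1) h =>
        gradMap ψ (x i.1 + X i.1 h + (i.2 : ℝ) • (w i.1 + Z i.1 h), ξ i.1 + Ξ i.1 h)
        - gradMap ψ (x i.1 + X i.1 h, ξ i.1 + Ξ i.1 h))
        fun i => japanese (ξ i.1) * μ i.1 := by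
      have hs1 : ∀ i : ι × Set.Icc (0 : ℝ) 1, ‖(i.2 : ℝ)‖ ≤ 1 := fun i => by
        rw [Real.norm_of_nonneg i.2.2.1]; exact i.2.2.2
      have hsZ : ∀ i : ι × Set.Icc (0 : ℝ) 1, ‖(i.2 : ℝ) • Z i.1‖ ≤ ‖Z i.1‖ := fun i =>
        (norm_smul_le (i.2 : ℝ) (Z i.1)).trans
          (mul_le_of_le_one_left (norm_nonneg (Z i.1)) (hs1 i))
      have h1 := jetBound_difference hGs
        (D := fun p => (fderiv ℝ (gradMap ψ) p).comp (ContinuousLinearMap.inl ℝ (Rn n) (Rn n)))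
        ((hGs.fderiv_right (m := ∞) (by simp)).clm_comp contDiff_const)
        (fun x ξ => fderiv_slice_eq hGs x ξ) (w₀ := japanese) ?_
        (fun i : ι × Set.Icc (0 : ℝ) 1 => x i.1) (fun i => ξ i.1) (fun i => (i.2 : ℝ) • w i.1)
        (fun i => X i.1) (fun i => Ξ i.1) (fun i => (i.2 : ℝ) • Z i.1) (μ := fun i => μ i.1)
        (fun i => hX i.1) (fun i => hΞ i.1) (fun i => (hsZ i).trans (hZ i.1))
        (fun i => (hsZ i).trans (hZμ i.1)) fun i => (norm_smul_le _ _).trans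
          ((mul_le_of_le_one_left (norm_nonneg _) (hs1 i)).trans (hw i.1))
      · refine h1.congr' fun i h => ?_
        rw [smul_apply, ← smul_add]
      · have h2 := hG.fderiv.clm_comp (fun _ => (ContinuousLinearMap.compL ℝ (Rn n)
          (Rn n × Rn n) (Rn n)).flip (ContinuousLinearMap.inl ℝ (Rn n) (Rn n)))
          (K := fun _ => ‖(ContinuousLinearMap.compL ℝ (Rn n)
          (Rn n × Rn n) (Rn n)).flip (ContinuousLinearMap.inl ℝ (Rn n) (Rn n))‖) fun _ => le_rfl
        refine (h2.mono _ (fun _ => le_rfl) fun p => (japanese_pos p.2).le).congr' fun p h => ?_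
        simp only [ContinuousLinearMap.flip_apply, ContinuousLinearMap.compL_apply]
        rw [fderiv_comp_add_left]
    exact hGd.inner ((JetBound.const (c := fun i : ι × Set.Icc (0 : ℝ) 1 => w i.1)
      fun i => hw i.1).add
        (JetBound.clm (A := fun i : ι × Set.Icc (0 : ℝ) 1 => Z i.1) fun i => hZμ i.1))
  · intro i
    refine ContDiff.contDiffAt ?_
    exact ((hψ.comp (by fun_prop : ContDiff ℝ ∞ fun h => (x i + X i h + (w i + Z i h),
      ξ i + Ξ i h))).sub (hψ.comp (by fun_prop : ContDiff ℝ ∞ fun h => (x i + X i h,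
      ξ i + Ξ i h)))).add (ContDiff.inner ℝ (by fun_prop) (hGs.comp
        (by fun_prop : ContDiff ℝ ∞ fun h => (x i + X i h, ξ i + Ξ i h))))
  · intro i h
    set a := x i + X i h
    set v := w i + Z i h
    set η := ξ i + Ξ i h
    have hd : ∀ s : ℝ, HasDerivAt (fun s : ℝ => ψ (a + s • v) η - s * inner ℝ (gradMap ψ (a, η)) v)
        (inner ℝ (gradMap ψ (a + s • v, η) - gradMap ψ (a, η)) v) s := by
      intro s
      have h1 : HasDerivAt (fun s : ℝ => a + s • v) v s := by
        simpa using ((hasDerivAt_id s).smul_const v).const_add a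
      have h2 := ((hasFDerivAt_gradX hψ (a + s • v) η).comp_hasDerivAt s h1).sub
        ((hasDerivAt_id s).mul_const (inner ℝ (gradMap ψ (a, η)) v))
      rw [inner_sub_left]
      simpa using! h2
    rw [intervalIntegral.integral_eq_sub_of_hasDerivAt (fun s _ => hd s)]
    · simp only [phaseRemainder, gradMap, one_smul, one_mul, zero_smul, zero_mul, add_zero]
      rw [sub_add_cancel_left, inner_neg_left, real_inner_comm]
      ring
    · refine Continuous.intervalIntegrable ?_ _ _
      exact ((hGs.continuous.comp (by fun_prop)).sub continuous_const).inner continuous_const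

end Phase

/-! ### The oscillating kernel and integration by parts -/

section OscillatoryIntegrals

variable {n : ℕ} {ι : Type*}

/-- The oscillating kernel `exp (-i w ⬝ η)`. -/
def kern (p : Rn n × Rn n) : ℂ := Complex.exp (-Complex.I * ((inner ℝ p.1 p.2 : ℝ) : ℂ))

theorem norm_kern (p : Rn n × Rn n) : ‖kern p‖ = 1 := by
  rw [kern, show -Complex.I * ((inner ℝ p.1 p.2 : ℝ) : ℂ)
    = ((-inner ℝ p.1 p.2 : ℝ) : ℂ) * Complex.I by push_cast; ring]
  exact Complex.norm_exp_ofReal_mul_I _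

theorem contDiff_kern : ContDiff ℝ ∞ (kern (n := n)) :=
  (contDiff_const.mul (Complex.ofRealCLM.contDiff.comp (contDiff_fst.inner ℝ contDiff_snd))).cexp

theorem dirD_kern (d p : Rn n × Rn n) :
    dirD d kern p = -Complex.I * ((inner ℝ d.1 p.2 + inner ℝ p.1 d.2 : ℝ) : ℂ) * kern p := by
  have h1 : HasFDerivAt (fun p : Rn n × Rn n => (inner ℝ p.1 p.2 : ℝ))
      ((fderivInnerCLM ℝ (p.1, p.2)).comp ((ContinuousLinearMap.fst ℝ _ _).prod
        (ContinuousLinearMap.snd ℝ _ _))) p :=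
    hasFDerivAt_fst.inner ℝ hasFDerivAt_snd
  have h2 := ((Complex.ofRealCLM.hasFDerivAt.comp p h1).const_mul (-Complex.I)).cexp
  have h3 : fderiv ℝ kern p = _ := h2.fderiv
  rw [dirD, h3]
  simp [kern, fderivInnerCLM_apply]
  ring

/-- The operator `J (1 - ∑ ∂_{d j}²)`, which reproduces the oscillating kernel when the weight `J`
is the reciprocal of the symbol of the differential operator. -/
def oscOp (d : Fin n → Rn n × Rn n) (J : Rn n × Rn n → ℝ) (a : Rn n × Rn n → ℂ) :
    Rn n × Rn n → ℂ :=
  fun p => (J p : ℂ) * (a p - ∑ j, dirD (d j) (dirD (d j) a) p)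

/-- The operator `⟨w⟩⁻² (1 - Δ_η)`. -/
def oscT : (Rn n × Rn n → ℂ) → Rn n × Rn n → ℂ :=
  oscOp (fun j => (0, (euclFrame n).vec j)) fun p => japanese p.1 ^ (-2 : ℝ)

/-- The operator `⟨η⟩⁻² (1 - Δ_w)`. -/
def oscS : (Rn n × Rn n → ℂ) → Rn n × Rn n → ℂ :=
  oscOp (fun j => ((euclFrame n).vec j, 0)) fun p => japanese p.2 ^ (-2 : ℝ)

section Operators

variable {d : Fin n → Rn n × Rn n} {J : Rn n × Rn n → ℝ} {a b : Rn n × Rn n → ℂ}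

theorem ContDiff.oscOp (ha : ContDiff ℝ ∞ a) (hJ : ContDiff ℝ ∞ J) :
    ContDiff ℝ ∞ (oscOp d J a) :=
  (Complex.ofRealCLM.contDiff.comp hJ).mul
    (ha.sub (ContDiff.sum fun j _ => (ha.dirD (d j)).dirD (d j)))

theorem contDiff_weight_fst : ContDiff ℝ ∞ fun p : Rn n × Rn n => japanese p.1 ^ (-2 : ℝ) :=
  (contDiff_japanese_rpow _).comp contDiff_fst

theorem contDiff_weight_snd : ContDiff ℝ ∞ fun p : Rn n × Rn n => japanese p.2 ^ (-2 : ℝ) :=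
  (contDiff_japanese_rpow _).comp contDiff_snd

theorem Filter.EventuallyEq.oscOp {p : Rn n × Rn n} (h : a =ᶠ[𝓝 p] b) :
    oscOp d J a =ᶠ[𝓝 p] oscOp d J b := by
  have h2 : ∀ᶠ q in 𝓝 p, ∀ j, _root_.dirD (d j) (_root_.dirD (d j) a) q
      = _root_.dirD (d j) (_root_.dirD (d j) b) q :=
    eventually_all.2 fun j => (h.dirD (d j)).dirD (d j)
  filter_upwards [h, h2] with q hq hq2
  simp only [_root_.oscOp, hq, hq2]

theorem oscOp_const_mul (ha : ContDiff ℝ ∞ a) (c : ℂ) :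
    oscOp d J (fun p => c * a p) = fun p => c * oscOp d J a p := by
  funext p
  simp only [oscOp, dirD_const_mul ha, fun j => dirD_const_mul (ha.dirD (d j)) c (d j),
    ← Finset.mul_sum]
  ring

theorem HasCompactSupport.oscOp (ha : HasCompactSupport a) : HasCompactSupport (oscOp d J a) := by
  refine HasCompactSupport.intro (K := tsupport a) ha fun p hp => ?_
  have h : a =ᶠ[𝓝 p] fun _ => 0 := by
    filter_upwards [(isClosed_tsupport a).isOpen_compl.mem_nhds hp] with q hq
    exact image_eq_zero_of_notMem_tsupport hq
  rw [(h.oscOp (d := d) (J := J)).eq_of_nhds]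
  have h0 : ∀ v : Rn n × Rn n, _root_.dirD v (fun _ : Rn n × Rn n => (0 : ℂ)) = fun _ => 0 :=
    fun v => funext fun q => by simp [_root_.dirD]
  simp [_root_.oscOp, h0]

instance : (MeasureTheory.volume : MeasureTheory.Measure (Rn n × Rn n)).IsAddHaarMeasure :=
  MeasureTheory.Measure.prod.instIsAddHaarMeasure _ _

theorem integral_mul_dirD {u f : Rn n × Rn n → ℂ} (hu : ContDiff ℝ ∞ u) (hf : ContDiff ℝ ∞ f)
    (hc : HasCompactSupport f) (v : Rn n × Rn n) :
    ∫ p, u p * dirD v f p = -∫ p, dirD v u p * f p := by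
  refine integral_mul_fderiv_eq_neg_fderiv_mul_of_integrable ?_ ?_ ?_
    (fun p _ => hu.differentiable (by simp) p) fun p _ => hf.differentiable (by simp) p
  · exact ((hu.dirD v).continuous.mul hf.continuous).integrable_of_hasCompactSupport hc.mul_left
  · exact (hu.continuous.mul (hf.dirD v).continuous).integrable_of_hasCompactSupport
      (hc.dirD v).mul_left
  · exact (hu.continuous.mul hf.continuous).integrable_of_hasCompactSupport hc.mul_left

/-- Integration by parts: `oscOp d J` is the transpose of `J (1 - ∑ ∂_{d_j}²)`, which reproduces the
kernel. -/
theorem integral_kern_mul_oscOp (hJ : ContDiff ℝ ∞ J) (ha : ContDiff ℝ ∞ a)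
    (hc : HasCompactSupport a) {c : Fin n → Rn n × Rn n → ℝ} (hcs : ∀ j, ContDiff ℝ ∞ (c j))
    (hk : ∀ j p, dirD (d j) kern p = -Complex.I * (c j p : ℂ) * kern p)
    (hcd : ∀ j p, dirD (d j) (fun q => (c j q : ℂ)) p = 0)
    (hJd : ∀ j p, dirD (d j) (fun q => (J q : ℂ)) p = 0)
    (hJc : ∀ p, J p * (1 + ∑ j, c j p ^ 2) = 1) :
    ∫ p, kern p * oscOp d J a p = ∫ p, kern p * a p := by
  have hJs : ContDiff ℝ ∞ fun p => (J p : ℂ) := Complex.ofRealCLM.contDiff.comp hJ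
  have hcs' : ∀ j, ContDiff ℝ ∞ fun p => (c j p : ℂ) := fun j =>
    Complex.ofRealCLM.contDiff.comp (hcs j)
  have hu : ContDiff ℝ ∞ fun p => kern p * (J p : ℂ) := contDiff_kern.mul hJs
  have h1 : ∀ j, dirD (d j) (fun p => kern p * (J p : ℂ))
      = fun p => -Complex.I * ((c j p : ℂ) * (kern p * (J p : ℂ))) := by
    intro j
    rw [dirD_mul contDiff_kern hJs]
    funext p
    rw [hJd, hk]
    ring
  have h2 : ∀ j, dirD (d j) (dirD (d j) fun p => kern p * (J p : ℂ))
      = fun p => -(c j p : ℂ) ^ 2 * (kern p * (J p : ℂ)) := by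
    intro j
    rw [h1, dirD_const_mul ((hcs' j).mul hu), dirD_mul (hcs' j) hu, h1]
    funext p
    simp only
    rw [hcd]
    linear_combination (c j p : ℂ) ^ 2 * (kern p * (J p : ℂ)) * Complex.I_sq
  have h3 : ∀ j, ∫ p, kern p * (J p : ℂ) * dirD (d j) (dirD (d j) a) p
      = ∫ p, -(c j p : ℂ) ^ 2 * (kern p * (J p : ℂ)) * a p := by
    intro j
    rw [integral_mul_dirD hu (ha.dirD _) (hc.dirD _), integral_mul_dirD (hu.dirD _) ha hc, neg_neg,
      h2]
  have hint : ∀ j, MeasureTheory.Integrable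
      fun p => kern p * (J p : ℂ) * dirD (d j) (dirD (d j) a) p := fun j =>
    (hu.continuous.mul ((ha.dirD _).dirD _).continuous).integrable_of_hasCompactSupport
      ((hc.dirD _).dirD _).mul_left
  have hint' : ∀ j, MeasureTheory.Integrable
      fun p => -(c j p : ℂ) ^ 2 * (kern p * (J p : ℂ)) * a p := fun j =>
    ((((hcs' j).pow 2).neg.mul hu).continuous.mul
      ha.continuous).integrable_of_hasCompactSupport hc.mul_left
  have hint0 : MeasureTheory.Integrable fun p => kern p * (J p : ℂ) * a p :=
    (hu.continuous.mul ha.continuous).integrable_of_hasCompactSupport hc.mul_left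
  calc ∫ p, kern p * oscOp d J a p
      = ∫ p, (kern p * (J p : ℂ) * a p
          - ∑ j, kern p * (J p : ℂ) * dirD (d j) (dirD (d j) a) p) := by
        refine MeasureTheory.integral_congr_ae (Eventually.of_forall fun p => ?_)
        simp only [oscOp, ← Finset.mul_sum]
        ring
    _ = ∫ p, (kern p * (J p : ℂ) * a p - ∑ j, -(c j p : ℂ) ^ 2 * (kern p * (J p : ℂ)) * a p) := by
        rw [MeasureTheory.integral_sub hint0 (MeasureTheory.integrable_finsetSum _ fun j _ => hint j),
          MeasureTheory.integral_sub hint0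
            (MeasureTheory.integrable_finsetSum _ fun j _ => hint' j),
          MeasureTheory.integral_finsetSum _ fun j _ => hint j,
          MeasureTheory.integral_finsetSum _ fun j _ => hint' j]
        simp only [h3]
    _ = ∫ p, kern p * a p := by
        refine MeasureTheory.integral_congr_ae (Eventually.of_forall fun p => ?_)
        simp only [← Finset.sum_mul, Finset.sum_neg_distrib]
        have h := congrArg (fun r : ℝ => (r : ℂ)) (hJc p)
        push_cast at h
        linear_combination (kern p * a p) * h

theorem sum_sq_eq (x : Rn n) : ∑ j, x j ^ 2 = ‖x‖ ^ 2 := by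
  rw [EuclideanSpace.norm_sq_eq]
  simp

theorem japanese_weight (x : Rn n) : japanese x ^ (-2 : ℝ) * (1 + ∑ j, x j ^ 2) = 1 := by
  rw [sum_sq_eq, ← japanese_sq, ← Real.rpow_natCast, ← Real.rpow_add (japanese_pos x)]
  simp

theorem dirD_comp_fst {F : Type} [NormedAddCommGroup F] [NormedSpace ℝ F] {f : Rn n → F}
    (v : Rn n) (p : Rn n × Rn n) (hf : DifferentiableAt ℝ f p.1) :
    dirD (0, v) (fun q : Rn n × Rn n => f q.1) p = 0 := by
  have := hf.hasFDerivAt.comp p hasFDerivAt_fst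
  rw [dirD, show fderiv ℝ (fun q : Rn n × Rn n => f q.1) p = _ from this.fderiv]
  simp

theorem dirD_comp_snd {F : Type} [NormedAddCommGroup F] [NormedSpace ℝ F] {f : Rn n → F}
    (v : Rn n) (p : Rn n × Rn n) (hf : DifferentiableAt ℝ f p.2) :
    dirD (v, 0) (fun q : Rn n × Rn n => f q.2) p = 0 := by
  have := hf.hasFDerivAt.comp p hasFDerivAt_snd
  rw [dirD, show fderiv ℝ (fun q : Rn n × Rn n => f q.2) p = _ from this.fderiv]
  simp

theorem integral_kern_mul_oscT (ha : ContDiff ℝ ∞ a) (hc : HasCompactSupport a) :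
    ∫ p, kern p * oscT a p = ∫ p, kern p * a p := by
  have hs : ∀ j : Fin n, ContDiff ℝ ∞ fun x : Rn n => ((x j : ℝ) : ℂ) := fun j =>
    Complex.ofRealCLM.contDiff.comp (EuclideanSpace.proj (𝕜 := ℝ) j).contDiff
  refine integral_kern_mul_oscOp contDiff_weight_fst ha hc (c := fun j p => p.1 j) ?_ ?_ ?_ ?_ ?_
  · exact fun j => (EuclideanSpace.proj (𝕜 := ℝ) j).contDiff.comp contDiff_fst
  · intro j p
    rw [dirD_kern]
    simp [euclFrame, EuclideanSpace.inner_single_right]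
  · exact fun j p => dirD_comp_fst (f := fun x => ((x j : ℝ) : ℂ)) _ p
      ((hs j).differentiable (by simp) _)
  · exact fun j p => dirD_comp_fst (f := fun x => ((japanese x ^ (-2 : ℝ) : ℝ) : ℂ)) _ p
      ((Complex.ofRealCLM.contDiff.comp (contDiff_japanese_rpow _)).differentiable (by simp) _)
  · exact fun p => japanese_weight p.1

theorem integral_kern_mul_oscS (ha : ContDiff ℝ ∞ a) (hc : HasCompactSupport a) :
    ∫ p, kern p * oscS a p = ∫ p, kern p * a p := by
  have hs : ∀ j : Fin n, ContDiff ℝ ∞ fun x : Rn n => ((x j : ℝ) : ℂ) := fun j =>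
    Complex.ofRealCLM.contDiff.comp (EuclideanSpace.proj (𝕜 := ℝ) j).contDiff
  refine integral_kern_mul_oscOp contDiff_weight_snd ha hc (c := fun j p => p.2 j) ?_ ?_ ?_ ?_ ?_
  · exact fun j => (EuclideanSpace.proj (𝕜 := ℝ) j).contDiff.comp contDiff_snd
  · intro j p
    rw [dirD_kern]
    simp [euclFrame, EuclideanSpace.inner_single_left]
  · exact fun j p => dirD_comp_snd (f := fun x => ((x j : ℝ) : ℂ)) _ p
      ((hs j).differentiable (by simp) _)
  · exact fun j p => dirD_comp_snd (f := fun x => ((japanese x ^ (-2 : ℝ) : ℝ) : ℂ)) _ p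
      ((Complex.ofRealCLM.contDiff.comp (contDiff_japanese_rpow _)).differentiable (by simp) _)
  · exact fun p => japanese_weight p.2

/-- Repeated integration by parts in both groups of variables. -/
def oscST (k l : ℕ) (a : Rn n × Rn n → ℂ) : Rn n × Rn n → ℂ := oscS^[k] (oscT^[l] a)

theorem oscST_induction {P : (Rn n × Rn n → ℂ) → Prop} (hT : ∀ a, P a → P (oscT a))
    (hS : ∀ a, P a → P (oscS a)) (k l : ℕ) (ha : P a) : P (oscST k l a) := by
  have h1 : P (oscT^[l] a) := by
    induction l with
    | zero => exact ha
    | succ l ih => rw [Function.iterate_succ_apply']; exact hT _ ih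
  unfold oscST
  induction k with
  | zero => exact h1
  | succ k ih => rw [Function.iterate_succ_apply']; exact hS _ ih

theorem ContDiff.oscST (ha : ContDiff ℝ ∞ a) (k l : ℕ) : ContDiff ℝ ∞ (oscST k l a) :=
  oscST_induction (P := fun a => ContDiff ℝ ∞ a) (fun _ h => h.oscOp contDiff_weight_fst)
    (fun _ h => h.oscOp contDiff_weight_snd) k l ha

theorem integral_kern_mul_oscST (ha : ContDiff ℝ ∞ a) (hc : HasCompactSupport a) (k l : ℕ) :
    ∫ p, kern p * oscST k l a p = ∫ p, kern p * a p := by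
  refine (oscST_induction (a := a) (P := fun b => ContDiff ℝ ∞ b ∧ HasCompactSupport b ∧
    ∫ p, kern p * b p = ∫ p, kern p * a p) ?_ ?_ k l ⟨ha, hc, rfl⟩).2.2
  · rintro b ⟨h1, h2, h3⟩
    exact ⟨h1.oscOp contDiff_weight_fst, h2.oscOp, (integral_kern_mul_oscT h1 h2).trans h3⟩
  · rintro b ⟨h1, h2, h3⟩
    exact ⟨h1.oscOp contDiff_weight_snd, h2.oscOp, (integral_kern_mul_oscS h1 h2).trans h3⟩

theorem oscST_const_mul (ha : ContDiff ℝ ∞ a) (c : ℂ) (k l : ℕ) :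
    oscST k l (fun p => c * a p) = fun p => c * oscST k l a p := by
  have h1 : ∀ l, ContDiff ℝ ∞ (oscT^[l] a) ∧
      oscT^[l] (fun p => c * a p) = fun p => c * oscT^[l] a p := by
    intro l
    induction l with
    | zero => exact ⟨ha, rfl⟩
    | succ l ih =>
      rw [Function.iterate_succ_apply', Function.iterate_succ_apply', ih.2]
      exact ⟨ih.1.oscOp contDiff_weight_fst, oscOp_const_mul ih.1 c⟩
  unfold oscST
  rw [(h1 l).2]
  have h2 : ∀ k, ContDiff ℝ ∞ (oscS^[k] (oscT^[l] a)) ∧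
      oscS^[k] (fun p => c * oscT^[l] a p) = fun p => c * oscS^[k] (oscT^[l] a) p := by
    intro k
    induction k with
    | zero => exact ⟨(h1 l).1, rfl⟩
    | succ k ih =>
      rw [Function.iterate_succ_apply', Function.iterate_succ_apply', ih.2]
      exact ⟨ih.1.oscOp contDiff_weight_snd, oscOp_const_mul ih.1 c⟩
  exact (h2 k).2

theorem Filter.EventuallyEq.oscST {p : Rn n × Rn n} (h : a =ᶠ[𝓝 p] b) (k l : ℕ) :
    oscST k l a =ᶠ[𝓝 p] oscST k l b := by
  have h1 : ∀ l, oscT^[l] a =ᶠ[𝓝 p] oscT^[l] b := by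
    intro l
    induction l with
    | zero => exact h
    | succ l ih =>
      rw [Function.iterate_succ_apply', Function.iterate_succ_apply']
      exact ih.oscOp
  unfold _root_.oscST
  induction k with
  | zero => exact h1 l
  | succ k ih =>
    rw [Function.iterate_succ_apply', Function.iterate_succ_apply']
    exact ih.oscOp

end Operators

end OscillatoryIntegrals

/-! ### Amplitudes and their oscillatory integrals -/

section Amplitudes

variable {n : ℕ} {ι κ : Type*}

/-- Scaling of the first group of variables. -/
def scaleFst (c : ℝ) : Rn n × Rn n →L[ℝ] Rn n × Rn n :=
  (c • ContinuousLinearMap.fst ℝ (Rn n) (Rn n)).prod (ContinuousLinearMap.snd ℝ (Rn n) (Rn n))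

@[simp] theorem scaleFst_apply (c : ℝ) (h : Rn n × Rn n) : scaleFst c h = (c • h.1, h.2) := rfl

theorem norm_scaleFst_le {c : ℝ} (hc : |c| ≤ 1) : ‖(scaleFst c : Rn n × Rn n →L[ℝ] _)‖ ≤ 1 := by
  refine ContinuousLinearMap.opNorm_le_bound _ zero_le_one fun h => ?_
  rw [one_mul, scaleFst_apply, Prod.norm_def]
  refine max_le ?_ (norm_snd_le h)
  rw [norm_smul]
  exact (mul_le_of_le_one_left (norm_nonneg _) hc).trans (norm_fst_le h)

/-- Families of amplitudes `a i (w, η)` of size `ϖ i ⟨w⟩^τ ⟨η⟩^m`. A derivative in `η` preserves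
this size, a derivative in `w` may cost a factor `ν i ⟨w⟩^σ`. -/
structure Amp (ϖ ν : ι → ℝ) (σ τ m : ℝ) (a : ι → Rn n × Rn n → ℂ) : Prop where
  smooth : ∀ i, ContDiff ℝ ∞ (a i)
  jet : JetBound (fun (i : ι × (Rn n × Rn n)) h =>
      a i.1 (i.2 + scaleFst (ν i.1 * japanese i.2.1 ^ σ)⁻¹ h))
    fun i => ϖ i.1 * japanese i.2.1 ^ τ * japanese i.2.2 ^ m

theorem scale_pos {r : ℝ} (hr : 1 ≤ r) (x : Rn n) (σ : ℝ) : 0 < r * japanese x ^ σ :=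
  mul_pos (by linarith) (Real.rpow_pos_of_pos (japanese_pos x) _)

theorem one_le_scale {r σ : ℝ} (hr : 1 ≤ r) (hσ : 0 ≤ σ) (x : Rn n) : 1 ≤ r * japanese x ^ σ :=
  one_le_mul_of_one_le_of_one_le hr (Real.one_le_rpow (one_le_japanese x) hσ)

theorem abs_inv_scale_le {r σ : ℝ} (hr : 1 ≤ r) (hσ : 0 ≤ σ) (x : Rn n) :
    |(r * japanese x ^ σ)⁻¹| ≤ 1 := by
  rw [abs_of_pos (inv_pos.2 (scale_pos hr x σ))]
  exact inv_le_one_of_one_le₀ (one_le_scale hr hσ x)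

namespace Amp

variable {ϖ ϖ' ν ν' : ι → ℝ} {σ σ' τ τ' m m' : ℝ} {a b : ι → Rn n × Rn n → ℂ}

theorem mono (h : Amp ϖ ν σ τ m a) (K : ℝ) (hϖ : ∀ i, ϖ i ≤ K * ϖ' i) (h0 : ∀ i, 0 ≤ ϖ i)
    (h0' : ∀ i, 0 ≤ ϖ' i)
    (hτ : τ ≤ τ') (hm : m ≤ m') : Amp ϖ' ν σ τ' m' a := by
  refine ⟨h.smooth, h.jet.mono K (fun i => ?_) fun i => ?_⟩
  · have h1 := Real.rpow_le_rpow_of_exponent_le (one_le_japanese i.2.1) hτ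
    have h2 := Real.rpow_le_rpow_of_exponent_le (one_le_japanese i.2.2) hm
    have p1 := Real.rpow_pos_of_pos (japanese_pos i.2.1) τ
    have p2 := Real.rpow_pos_of_pos (japanese_pos i.2.2) m
    have p3 := Real.rpow_pos_of_pos (japanese_pos i.2.1) τ'
    have h3 := hϖ i.1
    have h4 := h0 i.1
    have h5 := h4.trans h3
    calc ϖ i.1 * japanese i.2.1 ^ τ * japanese i.2.2 ^ m
        ≤ (K * ϖ' i.1) * japanese i.2.1 ^ τ' * japanese i.2.2 ^ m' := by
          gcongr
      _ = _ := by ring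
  · exact mul_nonneg (mul_nonneg (h0' i.1) (Real.rpow_nonneg (japanese_pos _).le _))
      (Real.rpow_nonneg (japanese_pos _).le _)

/-- Passing to a finer scale in the first group of variables. -/
theorem rescale (h : Amp ϖ ν σ τ m a) (hν : ∀ i, 1 ≤ ν i) (hνν : ∀ i, ν i ≤ ν' i)
    (hσ : σ ≤ σ') : Amp ϖ ν' σ' τ m a := by
  refine ⟨h.smooth, (h.jet.comp_clm (fun i => scaleFst ((ν i.1 * japanese i.2.1 ^ σ)
    * (ν' i.1 * japanese i.2.1 ^ σ')⁻¹)) 1 fun i => ?_).congr' fun i x => ?_⟩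
  · have p1 := scale_pos (hν i.1) i.2.1 σ
    have p2 := scale_pos ((hν i.1).trans (hνν i.1)) i.2.1 σ'
    refine norm_scaleFst_le ?_
    rw [abs_of_pos (mul_pos p1 (inv_pos.2 p2)), ← div_eq_mul_inv, div_le_one p2]
    have := Real.rpow_le_rpow_of_exponent_le (one_le_japanese i.2.1) hσ
    have h2 := hνν i.1
    have h3 := hν i.1
    have := Real.rpow_pos_of_pos (japanese_pos i.2.1) σ
    gcongr
    linarith
  · have p1 := (scale_pos (hν i.1) i.2.1 σ).ne'
    simp only [scaleFst_apply, smul_smul]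
    rw [← mul_assoc, inv_mul_cancel₀ p1, one_mul]

theorem reindex (h : Amp ϖ ν σ τ m a) (r : κ → ι) :
    Amp (fun j => ϖ (r j)) (fun j => ν (r j)) σ τ m fun j => a (r j) :=
  ⟨fun j => h.smooth (r j), h.jet.reindex fun j : κ × (Rn n × Rn n) => (r j.1, j.2)⟩

theorem sub (ha : Amp ϖ ν σ τ m a) (hb : Amp ϖ ν σ τ m b) :
    Amp ϖ ν σ τ m fun i p => a i p - b i p :=
  ⟨fun i => (ha.smooth i).sub (hb.smooth i), ha.jet.sub hb.jet⟩

theorem sum {J : Type*} (s : Finset J) {f : J → ι → Rn n × Rn n → ℂ}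
    (h : ∀ j ∈ s, Amp ϖ ν σ τ m (f j)) : Amp ϖ ν σ τ m fun i p => ∑ j ∈ s, f j i p :=
  ⟨fun i => ContDiff.sum fun j hj => (h j hj).smooth i, JetBound.sum s fun j hj => (h j hj).jet⟩

theorem mul (ha : Amp ϖ ν σ τ m a) (hb : Amp ϖ' ν σ τ' m' b) :
    Amp (fun i => ϖ i * ϖ' i) ν σ (τ + τ') (m + m') fun i p => a i p * b i p := by
  refine ⟨fun i => (ha.smooth i).mul (hb.smooth i), (ha.jet.mul hb.jet).mono_one fun i => ?_⟩
  rw [Real.rpow_add (japanese_pos _), Real.rpow_add (japanese_pos _)]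
  refine le_of_eq ?_
  ring

theorem const_mul (ha : Amp ϖ ν σ τ m a) (c : ℂ) : Amp ϖ ν σ τ m fun i p => c * a i p := by
  refine ⟨fun i => contDiff_const.mul (ha.smooth i), ?_⟩
  obtain ⟨h1, h2⟩ := (JetBound.const (E := Rn n × Rn n) (W := fun _ => ‖c‖)
    (c := fun _ : ι × (Rn n × Rn n) => c) fun _ => le_rfl).mul ha.jet
  refine ⟨h1, fun k => ?_⟩
  obtain ⟨C, hC0, hC⟩ := h2 k
  exact ⟨C * ‖c‖, by positivity, fun i => by rw [mul_assoc]; exact hC i⟩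

theorem dirD_snd (h : Amp ϖ ν σ τ m a) (v : Rn n) :
    Amp ϖ ν σ τ m fun i => dirD (0, v) (a i) := by
  refine ⟨fun i => (h.smooth i).dirD _, (h.jet.dirD (0, v)).congr' fun i x => ?_⟩
  rw [dirD_comp_affine (h.smooth i.1)]
  simp

theorem dirD_fst (h : Amp ϖ ν σ τ m a) (hν : ∀ i, 1 ≤ ν i) {v : Rn n} (hv : ‖v‖ ≤ 1) :
    Amp (fun i => ϖ i * ν i) ν σ (τ + σ) m fun i => dirD (v, 0) (a i) := by
  refine ⟨fun i => (h.smooth i).dirD _, ((h.jet.dirDeriv (fun i =>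
    ((ν i.1 * japanese i.2.1 ^ σ) • v, 0)) (K := fun i => ν i.1 * japanese i.2.1 ^ σ)
    fun i => ?_).congr' fun i x => ?_).mono_one fun i => ?_⟩
  · have p1 := scale_pos (hν i.1) i.2.1 σ
    simp only [Prod.norm_def, norm_zero, norm_smul, Real.norm_of_nonneg p1.le]
    exact max_le (mul_le_of_le_one_right p1.le hv) p1.le
  · have p1 := (scale_pos (hν i.1) i.2.1 σ).ne'
    refine (congrFun (dirD_comp_affine (h.smooth i.1) i.2 _ _) x).trans ?_
    simp only [scaleFst_apply, smul_smul, inv_mul_cancel₀ p1, one_smul]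
  · rw [Real.rpow_add (japanese_pos _)]
    refine le_of_eq ?_
    ring

theorem weight_fst (h : Amp ϖ ν σ τ m a) (hν : ∀ i, 1 ≤ ν i) (hσ : 0 ≤ σ) (s : ℝ) :
    Amp ϖ ν σ (τ + s) m fun i p => ((japanese p.1 ^ s : ℝ) : ℂ) * a i p := by
  have hA : ∀ i : ι × (Rn n × Rn n), ‖(ν i.1 * japanese i.2.1 ^ σ)⁻¹ •
      ContinuousLinearMap.fst ℝ (Rn n) (Rn n)‖ ≤ 1 := fun i => by
    have h1 := abs_inv_scale_le (hν i.1) hσ i.2.1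
    refine ContinuousLinearMap.opNorm_le_bound _ zero_le_one fun x => ?_
    change ‖(ν i.1 * japanese i.2.1 ^ σ)⁻¹ • x.1‖ ≤ 1 * ‖x‖
    rw [one_mul, norm_smul]
    exact (mul_le_of_le_one_left (norm_nonneg _) h1).trans (norm_fst_le x)
  have h0 := (jetBound_japanese_rpow (n := n) s).reindex fun i : ι × (Rn n × Rn n) => i.2.1
  have h1 := (h0.comp_clm _ 1 hA).ofReal
  refine ⟨fun i => (Complex.ofRealCLM.contDiff.comp
    ((contDiff_japanese_rpow s).comp contDiff_fst)).mul (h.smooth i),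
    ((h1.mul h.jet).mono_one fun i => ?_).congr' fun i x => rfl⟩
  rw [Real.rpow_add (japanese_pos _)]
  refine le_of_eq ?_
  ring

theorem weight_snd (h : Amp ϖ ν σ τ m a) (s : ℝ) :
    Amp ϖ ν σ τ (m + s) fun i p => ((japanese p.2 ^ s : ℝ) : ℂ) * a i p := by
  have h1 := (((jetBound_japanese_rpow (n := n) s).reindex fun i : ι × (Rn n × Rn n) =>
      i.2.2).comp_clm (fun _ => ContinuousLinearMap.snd ℝ (Rn n) (Rn n)) 1 fun i =>
        ContinuousLinearMap.norm_snd_le _ _ _).ofReal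
  refine ⟨fun i => (Complex.ofRealCLM.contDiff.comp
    ((contDiff_japanese_rpow s).comp contDiff_snd)).mul (h.smooth i),
    ((h1.mul h.jet).mono_one fun i => ?_).congr' fun i x => rfl⟩
  rw [Real.rpow_add (japanese_pos _)]
  refine le_of_eq ?_
  ring

theorem norm_vec_le (j : Fin n) : ‖(euclFrame n).vec j‖ ≤ 1 := by simp [euclFrame]

theorem oscT (h : Amp ϖ ν σ τ m a) (hν : ∀ i, 1 ≤ ν i) (hσ : 0 ≤ σ) :
    Amp ϖ ν σ (τ - 2) m fun i => oscT (a i) := by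
  have h1 := (h.sub (Amp.sum Finset.univ fun j _ =>
    (h.dirD_snd ((euclFrame n).vec j)).dirD_snd ((euclFrame n).vec j))).weight_fst hν hσ (-2)
  exact h1

theorem oscS (h : Amp ϖ ν σ τ m a) (hν : ∀ i, 1 ≤ ν i) (hσ : 0 ≤ σ) (h0 : ∀ i, 0 ≤ ϖ i) :
    Amp (fun i => ϖ i * ν i * ν i) ν σ (τ + σ + σ) (m - 2) fun i => oscS (a i) := by
  have hle : ∀ i, ϖ i ≤ 1 * (ϖ i * ν i * ν i) := fun i => by
    have := mul_le_mul_of_nonneg_left (one_le_mul_of_one_le_of_one_le (hν i) (hν i)) (h0 i)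
    linarith
  have h1 := ((h.mono 1 hle h0 (fun i => (h0 i).trans (by linarith [hle i]))
    (by linarith : τ ≤ τ + σ + σ) le_rfl).sub
    (Amp.sum Finset.univ fun j _ => (h.dirD_fst hν (norm_vec_le j)).dirD_fst hν
      (norm_vec_le j))).weight_snd (-2)
  exact h1

theorem oscST (h : Amp ϖ ν σ τ m a) (hν : ∀ i, 1 ≤ ν i) (hσ : 0 ≤ σ) (h0 : ∀ i, 0 ≤ ϖ i)
    (k l : ℕ) : Amp (fun i => ϖ i * ν i ^ (2 * k)) ν σ (τ + 2 * k * σ - 2 * l) (m - 2 * k)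
      fun i => oscST k l (a i) := by
  have h1 : Amp ϖ ν σ (τ - 2 * l) m fun i => _root_.oscT^[l] (a i) := by
    induction l with
    | zero => simpa using h
    | succ l ih =>
      simp only [Function.iterate_succ_apply']
      have := ih.oscT hν hσ
      rwa [show τ - 2 * (l : ℝ) - 2 = τ - 2 * ((l + 1 : ℕ) : ℝ) by push_cast; ring] at this
  unfold _root_.oscST
  induction k with
  | zero => simpa using h1
  | succ k ih =>
    simp only [Function.iterate_succ_apply']
    have := ih.oscS hν hσ fun i => mul_nonneg (h0 i) (pow_nonneg (by linarith [hν i]) _)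
    rw [show τ + 2 * (k : ℝ) * σ - 2 * l + σ + σ = τ + 2 * ((k + 1 : ℕ) : ℝ) * σ - 2 * l by
      push_cast; ring, show m - 2 * (k : ℝ) - 2 = m - 2 * ((k + 1 : ℕ) : ℝ) by push_cast; ring]
      at this
    refine ⟨this.smooth, this.jet.mono_one fun i => le_of_eq ?_⟩
    ring

theorem norm_le (h : Amp ϖ ν σ τ m a) : ∃ C : ℝ, 0 ≤ C ∧ ∀ i p,
    ‖a i p‖ ≤ C * (ϖ i * japanese p.1 ^ τ * japanese p.2 ^ m) := by
  obtain ⟨C, hC0, hC⟩ := h.jet.value_le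
  exact ⟨C, hC0, fun i p => by simpa only [map_zero, add_zero] using hC (i, p)⟩

end Amp

/-- Families of smooth compactly supported cut-offs with uniformly bounded derivatives that are
locally equal to the constant `c` in the limit. -/
structure IsReg (κ : ℝ → Rn n × Rn n → ℂ) (c : ℂ) : Prop where
  smooth : ∀ ε, 0 < ε → ContDiff ℝ ∞ (κ ε)
  compact : ∀ ε, 0 < ε → HasCompactSupport (κ ε)
  jet : JetBound (fun (i : Set.Ioc (0 : ℝ) 1 × (Rn n × Rn n)) h => κ i.1 (i.2 + h)) fun _ => 1
  lim : ∀ p, ∀ᶠ ε in 𝓝[>] (0 : ℝ), κ ε =ᶠ[𝓝 p] fun _ => c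

/-- The oscillatory integral of `exp (-i w ⬝ η) a (w, η)` exists and equals `I`. Regularizers that
tend to an arbitrary constant are admitted, so that the class of regularizers is closed under
differentiation. -/
def HasOsc (a : Rn n × Rn n → ℂ) (I : ℂ) : Prop :=
  ∀ (κ : ℝ → Rn n × Rn n → ℂ) (c : ℂ), IsReg κ c →
    Tendsto (fun ε => ∫ p, kern p * (a p * κ ε p)) (𝓝[>] (0 : ℝ)) (𝓝 (c * I))

theorem IsReg.dirD {κ : ℝ → Rn n × Rn n → ℂ} {c : ℂ} (h : IsReg κ c) (v : Rn n × Rn n) :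
    IsReg (fun ε => dirD v (κ ε)) 0 := by
  refine ⟨fun ε hε => (h.smooth ε hε).dirD v, fun ε hε => (h.compact ε hε).dirD v,
    (h.jet.dirD v).congr' fun i x => ?_, fun p => ?_⟩
  · exact congrFun (dirD_comp_affine (h.smooth i.1 i.1.2.1) i.2 (ContinuousLinearMap.id ℝ _) v) x
  · filter_upwards [h.lim p] with ε hε
    refine (hε.dirD v).trans (Eventually.of_forall fun q => ?_)
    simp [_root_.dirD]

theorem jetBound_translates {E F : Type} [NormedAddCommGroup E] [NormedSpace ℝ E]
    [NormedAddCommGroup F] [NormedSpace ℝ F] {f : E → F} (hf : ContDiff ℝ ∞ f)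
    (hc : HasCompactSupport f) : JetBound (fun p h => f (p + h)) fun _ => 1 := by
  refine ⟨fun p => (hf.comp (by fun_prop)).contDiffAt, fun k => ?_⟩
  have h1 : Continuous (iteratedFDeriv ℝ k f) := hf.continuous_iteratedFDeriv
    (by exact_mod_cast le_top)
  obtain ⟨C, hC⟩ := (hc.iteratedFDeriv (𝕜 := ℝ) k).exists_bound_of_continuous h1
  refine ⟨|C|, abs_nonneg C, fun p => ?_⟩
  rw [iteratedFDeriv_comp_add_left, add_zero, mul_one]
  exact (hC p).trans (le_abs_self C)

/-- Dilations of a cut-off composed with a fixed affine isomorphism are regularizers. -/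
theorem isReg_affine {κ : Rn n × Rn n → ℂ} (hs : ContDiff ℝ ∞ κ) (hc : HasCompactSupport κ)
    (h1 : ∀ᶠ p in 𝓝 0, κ p = 1) (A : (Rn n × Rn n) ≃L[ℝ] Rn n × Rn n) (v : Rn n × Rn n) :
    IsReg (fun ε p => κ (ε • (v + A p))) 1 := by
  refine ⟨fun ε _ => hs.comp (by fun_prop), fun ε hε => ?_, ?_, fun p => ?_⟩
  · exact hc.comp_homeomorph (A.toHomeomorph.trans ((Homeomorph.addLeft v).trans
      (Homeomorph.smulOfNeZero ε hε.ne')))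
  · refine (((jetBound_translates hs hc).reindex fun i : Set.Ioc (0 : ℝ) 1 × (Rn n × Rn n) =>
      (i.1 : ℝ) • (v + A i.2)).comp_clm (fun i => (i.1 : ℝ) • (A : Rn n × Rn n →L[ℝ] Rn n × Rn n))
      ‖(A : Rn n × Rn n →L[ℝ] Rn n × Rn n)‖ fun i => ?_).congr' fun i x => ?_
    · refine (norm_smul_le (i.1 : ℝ) (A : Rn n × Rn n →L[ℝ] Rn n × Rn n)).trans
        (mul_le_of_le_one_left (norm_nonneg (A : Rn n × Rn n →L[ℝ] Rn n × Rn n)) ?_)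
      rw [Real.norm_of_nonneg i.1.2.1.le]
      exact i.1.2.2
    · simp [smul_add, add_assoc]
  · have ht : Tendsto (fun q : ℝ × (Rn n × Rn n) => q.1 • (v + A q.2)) (𝓝 (0, p)) (𝓝 0) := by
      have : Continuous fun q : ℝ × (Rn n × Rn n) => q.1 • (v + A q.2) := by fun_prop
      simpa using this.tendsto (0, p)
    have h2 := ht.eventually h1
    rw [nhds_prod_eq] at h2
    exact h2.curry.filter_mono nhdsWithin_le_nhds

theorem exists_isReg : ∃ κ : ℝ → Rn n × Rn n → ℂ, IsReg κ 1 := by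
  let f : ContDiffBump (0 : Rn n × Rn n) := ⟨1, 2, one_pos, one_lt_two⟩
  refine ⟨_, isReg_affine (κ := fun p => (f p : ℂ)) (Complex.ofRealCLM.contDiff.comp f.contDiff)
    (f.hasCompactSupport.comp_left (g := fun r : ℝ => (r : ℂ)) (by simp)) ?_
    (ContinuousLinearEquiv.refl ℝ _) 0⟩
  filter_upwards [f.eventuallyEq_one] with p hp
  simp [hp]

theorem integrable_japanese {r : ℝ} (hr : r ≤ -(n + 1 : ℝ)) :
    MeasureTheory.Integrable fun w : Rn n => japanese w ^ r := by
  have h := integrable_rpow_neg_one_add_norm_sq (E := Rn n) (μ := MeasureTheory.volume) (r := -r)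
    (by rw [finrank_euclideanSpace_fin]; linarith)
  refine h.congr (Eventually.of_forall fun w => ?_)
  simp only [neg_neg]
  rw [← japanese_sq, ← Real.rpow_natCast, ← Real.rpow_mul (japanese_pos w).le]
  congr 1
  push_cast
  ring

theorem integrable_weight {r s : ℝ} (hr : r ≤ -(n + 1 : ℝ)) (hs : s ≤ -(n + 1 : ℝ)) :
    MeasureTheory.Integrable fun p : Rn n × Rn n => japanese p.1 ^ r * japanese p.2 ^ s :=
  (integrable_japanese hr).mul_prod (integrable_japanese hs)

namespace Amp

variable {ϖ ν : ι → ℝ} {σ τ m : ℝ} {a : ι → Rn n × Rn n → ℂ}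

theorem mul_isReg (h : Amp ϖ ν σ τ m a) (hν : ∀ i, 1 ≤ ν i) (hσ : 0 ≤ σ)
    {κ : ℝ → Rn n × Rn n → ℂ} {c : ℂ} (hκ : IsReg κ c) :
    Amp (fun i : ι × Set.Ioc (0 : ℝ) 1 => ϖ i.1) (fun i => ν i.1) σ τ m
      fun i p => a i.1 p * κ i.2 p := by
  have h1 : Amp (fun _ : ι × Set.Ioc (0 : ℝ) 1 => 1) (fun i => ν i.1) σ 0 0
      fun i p => κ i.2 p := by
    refine ⟨fun i => hκ.smooth _ i.2.2.1, ((hκ.jet.reindex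
      fun i : (ι × Set.Ioc (0 : ℝ) 1) × (Rn n × Rn n) => (i.1.2, i.2)).comp_clm
      (fun i => scaleFst (ν i.1.1 * japanese i.2.1 ^ σ)⁻¹) 1 fun i =>
        norm_scaleFst_le (abs_inv_scale_le (hν _) hσ _)).mono_one fun i => by simp⟩
  have h2 := (h.reindex (Prod.fst : ι × Set.Ioc (0 : ℝ) 1 → ι)).mul h1
  simpa using h2

/-- Absolutely convergent representation of the oscillatory integral. -/
theorem hasOsc_oscST (h : Amp ϖ ν σ τ m a) (hν : ∀ i, 1 ≤ ν i) (hσ : 0 ≤ σ) (h0 : ∀ i, 0 ≤ ϖ i)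
    {k l : ℕ} (hk : m - 2 * k ≤ -(n + 1 : ℝ)) (hl : τ + 2 * k * σ - 2 * l ≤ -(n + 1 : ℝ)) (i : ι) :
    HasOsc (a i) (∫ p, kern p * _root_.oscST k l (a i) p) := by
  intro κ c hκ
  obtain ⟨C, hC0, hC⟩ := ((h.mul_isReg hν hσ hκ).oscST (fun i => hν i.1) hσ (fun i => h0 i.1)
    k l).norm_le
  have hpos : ∀ᶠ ε in 𝓝[>] (0 : ℝ), ε ∈ Set.Ioc (0 : ℝ) 1 := Ioc_mem_nhdsGT one_pos
  rw [← MeasureTheory.integral_const_mul]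
  have ht : Tendsto (fun ε => ∫ p, kern p * _root_.oscST k l (fun p => a i p * κ ε p) p)
      (𝓝[>] (0 : ℝ)) (𝓝 (∫ p, c * (kern p * _root_.oscST k l (a i) p))) := by
    refine MeasureTheory.tendsto_integral_filter_of_dominated_convergence
      (fun p => C * (ϖ i * ν i ^ (2 * k)) * (japanese p.1 ^ (τ + 2 * k * σ - 2 * l)
        * japanese p.2 ^ (m - 2 * k))) ?_ ?_ ?_ ?_
    · filter_upwards [hpos] with ε hε
      exact (contDiff_kern.mul (((h.smooth i).mul (hκ.smooth ε hε.1)).oscST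
        k l)).continuous.aestronglyMeasurable
    · filter_upwards [hpos] with ε hε
      refine Eventually.of_forall fun p => ?_
      rw [norm_mul, norm_kern, one_mul]
      refine (hC (i, ⟨ε, hε⟩) p).trans (le_of_eq ?_)
      ring
    · exact (integrable_weight hl hk).const_mul _
    · refine Eventually.of_forall fun p => ?_
      refine tendsto_nhds_of_eventually_eq ?_
      filter_upwards [hκ.lim p] with ε hε
      have he : (fun q => a i q * κ ε q) =ᶠ[𝓝 p] fun q => c * a i q := by
        filter_upwards [hε] with q hq
        rw [hq, mul_comm]
      rw [(he.oscST k l).eq_of_nhds, oscST_const_mul (h.smooth i)]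
      ring
  refine ht.congr' ?_
  filter_upwards [hpos] with ε hε
  exact integral_kern_mul_oscST ((h.smooth i).mul (hκ.smooth ε hε.1))
    ((hκ.compact ε hε.1).mul_left) k l

/-- Oscillatory integrals of amplitudes exist and are controlled by the weights. -/
theorem exists_hasOsc (h : Amp ϖ ν σ τ m a) (hν : ∀ i, 1 ≤ ν i) (hσ : 0 ≤ σ)
    (h0 : ∀ i, 0 ≤ ϖ i) : ∃ I : ι → ℂ, (∀ i, HasOsc (a i) (I i)) ∧
      ∃ (C : ℝ) (K : ℕ), 0 ≤ C ∧ ∀ i, ‖I i‖ ≤ C * (ϖ i * ν i ^ K) := by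
  obtain ⟨k, hk⟩ := exists_nat_ge ((m + (n + 1)) / 2)
  obtain ⟨l, hl⟩ := exists_nat_ge ((τ + 2 * k * σ + (n + 1)) / 2)
  have hk' : m - 2 * k ≤ -(n + 1 : ℝ) := by linarith
  have hl' : τ + 2 * k * σ - 2 * l ≤ -(n + 1 : ℝ) := by linarith
  refine ⟨fun i => ∫ p, kern p * _root_.oscST k l (a i) p, h.hasOsc_oscST hν hσ h0 hk' hl', ?_⟩
  obtain ⟨C, hC0, hC⟩ := (h.oscST hν hσ h0 k l).norm_le
  refine ⟨C * ∫ p : Rn n × Rn n, japanese p.1 ^ (τ + 2 * k * σ - 2 * l)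
    * japanese p.2 ^ (m - 2 * k), 2 * k, mul_nonneg hC0 (MeasureTheory.integral_nonneg fun p =>
      mul_nonneg (Real.rpow_nonneg (japanese_pos _).le _)
        (Real.rpow_nonneg (japanese_pos _).le _)), fun i => ?_⟩
  refine (MeasureTheory.norm_integral_le_of_norm_le ((integrable_weight hl' hk').const_mul
    (C * (ϖ i * ν i ^ (2 * k)))) (Eventually.of_forall fun p => ?_)).trans (le_of_eq ?_)
  · rw [norm_mul, norm_kern, one_mul]
    refine (hC i p).trans (le_of_eq ?_)
    ring
  · rw [MeasureTheory.integral_const_mul]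
    ring

end Amp

namespace HasOsc

variable {a b : Rn n × Rn n → ℂ} {I I' : ℂ}

theorem unique (h : HasOsc a I) (h' : HasOsc a I') : I = I' := by
  obtain ⟨κ, hκ⟩ := exists_isReg (n := n)
  simpa using tendsto_nhds_unique (h κ 1 hκ) (h' κ 1 hκ)

theorem integrable_reg (ha : ContDiff ℝ ∞ a) {κ : ℝ → Rn n × Rn n → ℂ} {c : ℂ} (hκ : IsReg κ c)
    {ε : ℝ} (hε : 0 < ε) : MeasureTheory.Integrable fun p => kern p * (a p * κ ε p) :=
  (contDiff_kern.continuous.mul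
    (ha.mul (hκ.smooth ε hε)).continuous).integrable_of_hasCompactSupport
    ((hκ.compact ε hε).mul_left).mul_left

theorem add (h : HasOsc a I) (h' : HasOsc b I') (ha : ContDiff ℝ ∞ a) (hb : ContDiff ℝ ∞ b) :
    HasOsc (fun p => a p + b p) (I + I') := by
  intro κ c hκ
  rw [mul_add]
  refine ((h κ c hκ).add (h' κ c hκ)).congr' ?_
  filter_upwards [self_mem_nhdsWithin] with ε hε
  rw [← MeasureTheory.integral_add (integrable_reg ha hκ hε) (integrable_reg hb hκ hε)]
  refine MeasureTheory.integral_congr_ae (Eventually.of_forall fun p => ?_)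
  simp only
  ring

theorem const_mul (h : HasOsc a I) (r : ℂ) : HasOsc (fun p => r * a p) (r * I) := by
  intro κ c hκ
  have := (h κ c hκ).const_mul r
  rw [mul_left_comm] at this
  refine this.congr fun ε => ?_
  rw [← MeasureTheory.integral_const_mul]
  refine MeasureTheory.integral_congr_ae (Eventually.of_forall fun p => ?_)
  simp only
  ring

theorem sub (h : HasOsc a I) (h' : HasOsc b I') (ha : ContDiff ℝ ∞ a) (hb : ContDiff ℝ ∞ b) :
    HasOsc (fun p => a p - b p) (I - I') := by
  have := h.add (h'.const_mul (-1)) ha (contDiff_const.mul hb)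
  simpa [sub_eq_add_neg] using this

theorem zero : HasOsc (fun _ : Rn n × Rn n => 0) 0 := fun κ c _ => by simp

theorem sum {J : Type*} (s : Finset J) {f : J → Rn n × Rn n → ℂ} {L : J → ℂ}
    (h : ∀ j ∈ s, HasOsc (f j) (L j)) (hf : ∀ j ∈ s, ContDiff ℝ ∞ (f j)) :
    HasOsc (fun p => ∑ j ∈ s, f j p) (∑ j ∈ s, L j) := by
  classical
  induction s using Finset.induction_on with
  | empty => simpa using zero
  | insert j s hj ih =>
    simp only [Finset.sum_insert hj]
    exact (h j (by simp)).add (ih (fun i hi => h i (by simp [hi])) fun i hi => hf i (by simp [hi]))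
      (hf j (by simp)) (ContDiff.sum fun i hi => hf i (by simp [hi]))

/-- A factor `w_j` in the amplitude is an `η_j`-derivative. -/
theorem mul_coord (j : Fin n) (ha : ContDiff ℝ ∞ a) (h0 : ∃ J, HasOsc a J)
    (h : HasOsc (dirD (0, (euclFrame n).vec j) a) I) :
    HasOsc (fun p => ((p.1 j : ℝ) : ℂ) * a p) (-Complex.I * I) := by
  intro κ c hκ
  obtain ⟨J, hJ⟩ := h0
  have h1 := ((h κ c hκ).add (hJ _ 0 (hκ.dirD (0, (euclFrame n).vec j)))).const_mul (-Complex.I)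
  rw [zero_mul, add_zero, mul_left_comm] at h1
  refine h1.congr' ?_
  filter_upwards [self_mem_nhdsWithin] with ε hε
  have hk := hκ.smooth ε hε
  have hsa := ha.mul hk
  rw [← MeasureTheory.integral_add (integrable_reg (ha.dirD _) hκ hε)
    (integrable_reg ha (hκ.dirD (0, (euclFrame n).vec j)) hε)]
  have h2 := integral_mul_dirD contDiff_kern hsa (hκ.compact ε hε).mul_left
    (0, (euclFrame n).vec j)
  rw [dirD_mul ha hk] at h2
  simp only [← mul_add]
  rw [h2, ← MeasureTheory.integral_neg, ← MeasureTheory.integral_const_mul]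
  refine MeasureTheory.integral_congr_ae (Eventually.of_forall fun p => ?_)
  simp only [dirD_kern]
  have e : inner ℝ p.1 ((euclFrame n).vec j) = p.1 j := by
    simp [euclFrame, EuclideanSpace.inner_single_right]
  rw [inner_zero_left, zero_add, e]
  linear_combination (-((p.1 j : ℝ) : ℂ) * kern p * (a p * κ ε p)) * Complex.I_sq

end HasOsc

end Amplitudes

/-! ### Smooth dependence on parameters -/

section ParameterDependence

variable {n : ℕ} {ι κ : Type*} {P : Type} [NormedAddCommGroup P] [NormedSpace ℝ P]

/-- Scaling of the parameter and of the first group of variables. -/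
def scaleParam (P : Type) [NormedAddCommGroup P] [NormedSpace ℝ P] (c : ℝ) :
    P × (Rn n × Rn n) →L[ℝ] P × (Rn n × Rn n) :=
  (c • ContinuousLinearMap.fst ℝ P (Rn n × Rn n)).prod
    ((scaleFst c).comp (ContinuousLinearMap.snd ℝ P (Rn n × Rn n)))

@[simp] theorem scaleParam_apply (c : ℝ) (h : P × (Rn n × Rn n)) :
    scaleParam P c h = (c • h.1, (c • h.2.1, h.2.2)) := rfl

/-- Families of amplitudes `a i (p, (w, η))` that depend on a parameter `p`: derivatives in the
parameter and in `w` may cost a factor `ν i p ⟨w⟩^σ`. -/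
structure PAmp (ϖ ν : ι → P → ℝ) (σ τ m : ℝ) (a : ι → P × (Rn n × Rn n) → ℂ) : Prop where
  smooth : ∀ i, ContDiff ℝ ∞ (a i)
  jet : JetBound (fun (j : ι × (P × (Rn n × Rn n))) h =>
      a j.1 (j.2 + scaleParam P (ν j.1 j.2.1 * japanese j.2.2.1 ^ σ)⁻¹ h))
    fun j => ϖ j.1 j.2.1 * japanese j.2.2.1 ^ τ * japanese j.2.2.2 ^ m

/-- Integration of amplitudes over the unit interval. -/
theorem Amp.integral {ϖ ν : κ → ℝ} {σ τ m : ℝ} {b : κ → ℝ × (Rn n × Rn n) → ℂ}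
    {f : κ → Rn n × Rn n → ℂ} (hb : ∀ k, ContDiff ℝ ∞ (b k))
    (h : Amp (fun k : κ × Set.Icc (0 : ℝ) 1 => ϖ k.1) (fun k => ν k.1) σ τ m
      fun k y => b k.1 (k.2, y)) (hf : ∀ k, ContDiff ℝ ∞ (f k))
    (e : ∀ k y, f k y = ∫ s in (0 : ℝ)..1, b k (s, y)) : Amp ϖ ν σ τ m f := by
  refine ⟨hf, JetBound.integral (g := fun i sx => b i.1 (sx.1, i.2
    + scaleFst (ν i.1 * japanese i.2.1 ^ σ)⁻¹ sx.2)) (fun i => (hb i.1).comp (by fun_prop))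
    ?_ (fun i => ((hf i.1).comp (by fun_prop)).contDiffAt) fun i x => e _ _⟩
  exact h.jet.reindex fun i : (κ × (Rn n × Rn n)) × Set.Icc (0 : ℝ) 1 => ((i.1.1, i.2), i.1.2)

namespace PAmp

variable {ϖ ν : ι → P → ℝ} {σ τ m : ℝ} {a : ι → P × (Rn n × Rn n) → ℂ}

theorem dirD (h : PAmp ϖ ν σ τ m a) (hν : ∀ i p, 1 ≤ ν i p) (r : κ → ι) (d : κ → P) :
    PAmp (fun k p => ‖d k‖ * (ϖ (r k) p * ν (r k) p)) (fun k => ν (r k)) σ (τ + σ) m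
      fun k => dirD (d k, 0) (a (r k)) := by
  refine ⟨fun k => (h.smooth _).dirD _, (((h.jet.reindex
    fun j : κ × (P × (Rn n × Rn n)) => (r j.1, j.2)).dirDeriv (fun j =>
    ((ν (r j.1) j.2.1 * japanese j.2.2.1 ^ σ) • d j.1, 0))
    (K := fun j => ν (r j.1) j.2.1 * japanese j.2.2.1 ^ σ * ‖d j.1‖)
    fun j => ?_).congr' fun j x => ?_).mono_one fun j => ?_⟩
  · have p1 := scale_pos (hν (r j.1) j.2.1) j.2.2.1 σ
    simp only [Prod.norm_def, norm_zero, norm_smul, Real.norm_of_nonneg p1.le]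
    exact max_le le_rfl (mul_nonneg p1.le (norm_nonneg _))
  · have p1 := (scale_pos (hν (r j.1) j.2.1) j.2.2.1 σ).ne'
    refine (congrFun (dirD_comp_affine (h.smooth (r j.1)) j.2 _ _) x).trans ?_
    simp only [scaleParam_apply, smul_smul, inv_mul_cancel₀ p1, one_smul, Prod.fst_zero,
      Prod.snd_zero, smul_zero]
    rfl
  · rw [Real.rpow_add (japanese_pos _)]
    refine le_of_eq ?_
    ring

/-- The amplitudes at fixed values of the parameter. -/
theorem slice (h : PAmp ϖ ν σ τ m a) (hν : ∀ i p, 1 ≤ ν i p) (r : κ → ι) (q : κ → P)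
    {N : κ → ℝ} (hN : ∀ k, ν (r k) (q k) ≤ N k) :
    Amp (fun k => ϖ (r k) (q k)) N σ τ m fun k y => a (r k) (q k, y) := by
  refine ⟨fun k => (h.smooth _).comp (by fun_prop), ((h.jet.reindex
    fun j : κ × (Rn n × Rn n) => (r j.1, (q j.1, j.2))).comp_clm (fun j =>
      (ContinuousLinearMap.inr ℝ P (Rn n × Rn n)).comp (scaleFst
        (ν (r j.1) (q j.1) * japanese j.2.1 ^ σ * (N j.1 * japanese j.2.1 ^ σ)⁻¹)))
      1 fun j => ?_).congr' fun j x => ?_⟩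
  · have p1 := scale_pos (hν (r j.1) (q j.1)) j.2.1 σ
    have p2 := scale_pos ((hν (r j.1) (q j.1)).trans (hN j.1)) j.2.1 σ
    refine (ContinuousLinearMap.opNorm_comp_le _ _).trans
      (mul_le_one₀ (ContinuousLinearMap.norm_inr_le_one ℝ P (Rn n × Rn n)) (norm_nonneg _) (norm_scaleFst_le ?_))
    rw [abs_of_pos (mul_pos p1 (inv_pos.2 p2)), ← div_eq_mul_inv, div_le_one p2]
    exact mul_le_mul_of_nonneg_right (hN j.1) (Real.rpow_nonneg (japanese_pos _).le _)
  · have p1 := (scale_pos (hν (r j.1) (q j.1)) j.2.1 σ).ne'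
    simp only [scaleParam_apply, scaleFst_apply, ContinuousLinearMap.comp_apply,
      ContinuousLinearMap.inr_apply, smul_smul, smul_zero, Prod.mk_add_mk, add_zero]
    rw [← mul_assoc, inv_mul_cancel₀ p1, one_mul]

theorem exists_hasOsc (h : PAmp ϖ ν σ τ m a) (hν : ∀ i p, 1 ≤ ν i p) (hσ : 0 ≤ σ)
    (h0 : ∀ i p, 0 ≤ ϖ i p) : ∃ c : ι → P → ℂ, (∀ i p, HasOsc (fun y => a i (p, y)) (c i p)) ∧
      ∃ (C : ℝ) (K : ℕ), 0 ≤ C ∧ ∀ i p, ‖c i p‖ ≤ C * (ϖ i p * ν i p ^ K) := by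
  obtain ⟨I, hI, C, K, hC0, hC⟩ := (h.slice hν (fun j : ι × P => j.1) (fun j => j.2)
    fun _ => le_rfl).exists_hasOsc (fun _ => hν _ _) hσ fun _ => h0 _ _
  exact ⟨fun i p => I (i, p), fun i p => hI (i, p), C, K, hC0, fun i p => hC (i, p)⟩

theorem taylor_remainder {g : P × (Rn n × Rn n) → ℂ} (hg : ContDiff ℝ ∞ g) (p d : P)
    (y : Rn n × Rn n) : g (p + d, y) - g (p, y) - _root_.dirD (d, 0) g (p, y)
      = ∫ s in (0 : ℝ)..1, ((1 - s : ℝ) : ℂ)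
        * _root_.dirD (d, 0) (_root_.dirD (d, 0) g) (p + s • d, y) := by
  have hl : ∀ s : ℝ, HasDerivAt (fun s : ℝ => (p + s • d, y)) (d, (0 : Rn n × Rn n)) s := by
    intro s
    have := ((hasDerivAt_id s).smul_const d).const_add p
    rw [one_smul] at this
    exact this.prodMk (hasDerivAt_const s y)
  have hd : ∀ {f : P × (Rn n × Rn n) → ℂ}, ContDiff ℝ ∞ f → ∀ s : ℝ,
      HasDerivAt (fun s : ℝ => f (p + s • d, y)) (_root_.dirD (d, 0) f (p + s • d, y)) s := by
    intro f hf s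
    exact ((hf.differentiable (by simp)) _).hasFDerivAt.comp_hasDerivAt s (hl s)
  have h1 : ∀ s : ℝ, HasDerivAt (fun s : ℝ => ((1 - s : ℝ) : ℂ)
      * _root_.dirD (d, 0) g (p + s • d, y) + g (p + s • d, y))
      (((1 - s : ℝ) : ℂ) * _root_.dirD (d, 0) (_root_.dirD (d, 0) g) (p + s • d, y)) s := by
    intro s
    have h2 : HasDerivAt (fun s : ℝ => ((1 - s : ℝ) : ℂ)) ((-1 : ℝ) : ℂ) s :=
      ((hasDerivAt_id s).const_sub 1).ofReal_comp
    refine ((h2.mul (hd (hg.dirD (d, 0)) s)).add (hd hg s)).congr_deriv ?_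
    push_cast
    ring
  rw [intervalIntegral.integral_eq_sub_of_hasDerivAt (fun s _ => h1 s)]
  · simp only [sub_self, Complex.ofReal_zero, zero_mul, zero_add, one_smul, sub_zero,
      Complex.ofReal_one, one_mul, zero_smul, add_zero]
    ring
  · refine Continuous.intervalIntegrable ?_ _ _
    exact (Complex.continuous_ofReal.comp (by fun_prop)).mul
      ((((hg.dirD (d, 0)).dirD (d, 0)).continuous).comp (by fun_prop))

/-- Differentiation of oscillatory integrals with respect to a parameter: the remainder of the
first order Taylor expansion of the amplitude is an amplitude with weight `‖d‖ ^ 2`. -/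
theorem hasFDerivAt [FiniteDimensional ℝ P] (h : PAmp ϖ ν σ τ m a) (hν : ∀ i p, 1 ≤ ν i p)
    (hνc : ∀ i, Continuous (ν i)) (hσ : 0 ≤ σ) (h0 : ∀ i p, 0 ≤ ϖ i p)
    (hϖc : ∀ i, Continuous (ϖ i)) {c : ι → P → ℂ}
    (hc : ∀ i p, HasOsc (fun y => a i (p, y)) (c i p)) (i : ι) (p : P) :
    ∃ L : P →L[ℝ] ℂ, HasFDerivAt (c i) L p ∧
      ∀ d, HasOsc (fun y => _root_.dirD (d, 0) (a i) (p, y)) (L d) := by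
  have h1 := h.dirD hν (fun d : P => i) fun d => d
  have hw1 : ∀ (d p : P), 0 ≤ ‖d‖ * (ϖ i p * ν i p) := fun d p =>
    mul_nonneg (norm_nonneg _) (mul_nonneg (h0 i p) (by linarith [hν i p]))
  obtain ⟨c₁, hc₁, C₁, K₁, hC₁0, hC₁⟩ := h1.exists_hasOsc (fun _ => hν i) hσ hw1
  have hs1 : ∀ d : P, ContDiff ℝ ∞ fun y : Rn n × Rn n => _root_.dirD (d, 0) (a i) (p, y) :=
    fun d => ((h.smooth i).dirD _).comp (by fun_prop)
  let L : P →L[ℝ] ℂ := LinearMap.mkContinuous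
    { toFun := fun d => c₁ d p
      map_add' := fun d d' => by
        refine (hc₁ (d + d') p).unique ?_
        convert (hc₁ d p).add (hc₁ d' p) (hs1 d) (hs1 d') using 2 with y
        simp only [_root_.dirD]
        rw [← map_add, Prod.mk_add_mk, add_zero]
      map_smul' := fun r d => by
        refine (hc₁ (r • d) p).unique ?_
        convert (hc₁ d p).const_mul (r : ℂ) using 2 with y
        simp only [_root_.dirD]
        · rw [← Complex.real_smul, ← map_smul, Prod.smul_mk, smul_zero]
        · exact (Complex.real_smul).symm }
    (C₁ * (ϖ i p * ν i p * ν i p ^ K₁)) fun d => by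
      refine (hC₁ d p).trans (le_of_eq ?_)
      ring
  refine ⟨L, ?_, fun d => hc₁ d p⟩
  -- bounds of the weights near the given value of the parameter
  obtain ⟨N, hN⟩ := (isCompact_closedBall p 1).exists_bound_of_continuousOn (hνc i).continuousOn
  obtain ⟨M, hM⟩ := (isCompact_closedBall p 1).exists_bound_of_continuousOn (hϖc i).continuousOn
  have hball : ∀ (d : Metric.closedBall (0 : P) 1) (s : Set.Icc (0 : ℝ) 1),
      p + (s : ℝ) • (d : P) ∈ Metric.closedBall p 1 := fun d s => by
    have hd := mem_closedBall_zero_iff.1 d.2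
    rw [mem_closedBall_iff_norm, add_sub_cancel_left, norm_smul, Real.norm_of_nonneg s.2.1]
    exact mul_le_one₀ s.2.2 (norm_nonneg _) hd
  have hpp := hball ⟨0, by simp⟩ ⟨0, by simp⟩
  have hN1 : 1 ≤ N := (hν i _).trans ((le_abs_self _).trans (hN _ hpp))
  have hM0 : 0 ≤ M := (norm_nonneg _).trans (hM _ hpp)
  have h2 := (h.dirD hν (fun d : Metric.closedBall (0 : P) 1 => i) fun d => d).dirD
    (fun _ => hν i) (fun d => d) fun d => d
  have h3 := h2.slice (fun _ => hν i)
    (fun j : Metric.closedBall (0 : P) 1 × Set.Icc (0 : ℝ) 1 => j.1)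
    (fun j => p + (j.2 : ℝ) • (j.1 : P)) (N := fun _ => N) fun j =>
      (le_abs_self _).trans (hN _ (hball j.1 j.2))
  have h4 : Amp (fun j : Metric.closedBall (0 : P) 1 × Set.Icc (0 : ℝ) 1 =>
      ‖(j.1 : P)‖ ^ 2 * (M * N ^ 2)) (fun _ => N) σ (τ + σ + σ) m fun j y =>
      ((1 - (j.2 : ℝ) : ℝ) : ℂ) * _root_.dirD ((j.1 : P), 0) (_root_.dirD ((j.1 : P), 0) (a i))
        (p + (j.2 : ℝ) • (j.1 : P), y) := by
    refine ⟨fun j => contDiff_const.mul (h3.smooth j), ((JetBound.const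
      (c := fun j : (Metric.closedBall (0 : P) 1 × Set.Icc (0 : ℝ) 1) × (Rn n × Rn n) =>
        ((1 - (j.1.2 : ℝ) : ℝ) : ℂ)) (W := fun _ => 1) fun j => ?_).mul h3.jet).mono_one
        fun j => ?_⟩
    · rw [Complex.norm_real, Real.norm_eq_abs, abs_le]
      constructor <;> linarith [j.1.2.2.1, j.1.2.2.2]
    · have e1 := (le_abs_self _).trans (hN _ (hball j.1.1 j.1.2))
      have e2 := (le_abs_self _).trans (hM _ (hball j.1.1 j.1.2))
      have e3 := h0 i (p + (j.1.2 : ℝ) • (j.1.1 : P))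
      have e4 := hν i (p + (j.1.2 : ℝ) • (j.1.1 : P))
      have e5 := Real.rpow_nonneg (japanese_pos j.2.1).le (τ + σ + σ)
      have e6 := Real.rpow_nonneg (japanese_pos j.2.2).le m
      rw [one_mul]
      refine mul_le_mul_of_nonneg_right (mul_le_mul_of_nonneg_right ?_ e5) e6
      calc _ = ‖(j.1.1 : P)‖ ^ 2 * (ϖ i (p + (j.1.2 : ℝ) • (j.1.1 : P))
            * ν i (p + (j.1.2 : ℝ) • (j.1.1 : P)) ^ 2) := by ring
        _ ≤ _ := by gcongr
  have hsa : ∀ q, ContDiff ℝ ∞ fun y : Rn n × Rn n => a i (q, y) :=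
    fun q => (h.smooth i).comp (by fun_prop)
  have h5 : Amp (fun d : Metric.closedBall (0 : P) 1 => ‖(d : P)‖ ^ 2 * (M * N ^ 2)) (fun _ => N) σ
      (τ + σ + σ) m fun d y => a i (p + d, y) - a i (p, y) - _root_.dirD ((d : P), 0) (a i) (p, y) :=
    Amp.integral (b := fun (d : Metric.closedBall (0 : P) 1) sy => ((1 - sy.1 : ℝ) : ℂ)
        * _root_.dirD ((d : P), 0) (_root_.dirD ((d : P), 0) (a i)) (p + sy.1 • (d : P), sy.2))
      (fun d => (Complex.ofRealCLM.contDiff.comp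
        (contDiff_const.sub contDiff_fst)).mul
        ((((h.smooth i).dirD _).dirD _).comp (by fun_prop))) h4
      (fun d => ((hsa _).sub (hsa _)).sub (hs1 d)) fun d y => taylor_remainder (h.smooth i) p d y
  obtain ⟨I, hI, C, K, hC0, hC⟩ := h5.exists_hasOsc (fun _ => hN1) hσ fun d => by positivity
  rw [hasFDerivAt_iff_isLittleO_nhds_zero]
  refine (Asymptotics.IsBigO.of_bound (g := fun d : P => ‖d‖ ^ 2) (C * (M * N ^ 2 * N ^ K))
    ?_).trans_isLittleO (Asymptotics.isLittleO_norm_pow_id one_lt_two)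
  filter_upwards [Metric.closedBall_mem_nhds (0 : P) one_pos] with d hd
  have e : c i (p + d) - c i p - L d = I ⟨d, hd⟩ := (((hc i (p + d)).sub (hc i p) (hsa _)
    (hsa _)).sub (hc₁ d p) ((hsa _).sub (hsa _)) (hs1 d)).unique (hI ⟨d, hd⟩)
  rw [e, norm_pow, norm_norm]
  refine (hC _).trans (le_of_eq ?_)
  ring

/-- Oscillatory integrals of amplitudes depend smoothly on the parameters. -/
theorem contDiff_osc [FiniteDimensional ℝ P] (k : ℕ) {ι : Type*} {ϖ ν : ι → P → ℝ} {τ : ℝ}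
    {a : ι → P × (Rn n × Rn n) → ℂ} (h : PAmp ϖ ν σ τ m a) (hν : ∀ i p, 1 ≤ ν i p)
    (hνc : ∀ i, Continuous (ν i)) (hσ : 0 ≤ σ) (h0 : ∀ i p, 0 ≤ ϖ i p)
    (hϖc : ∀ i, Continuous (ϖ i)) {c : ι → P → ℂ}
    (hc : ∀ i p, HasOsc (fun y => a i (p, y)) (c i p)) : (∀ i, ContDiff ℝ k (c i)) ∧
      ∃ (C : ℝ) (K : ℕ), 0 ≤ C ∧ ∀ i p, ‖iteratedFDeriv ℝ k (c i) p‖ ≤ C * (ϖ i p * ν i p ^ K) := by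
  induction k generalizing ι τ with
  | zero =>
    obtain ⟨c', hc', C, K, hC0, hC⟩ := h.exists_hasOsc hν hσ h0
    refine ⟨fun i => contDiff_zero.2 (continuous_iff_continuousAt.2 fun p => ?_), C, K, hC0,
      fun i p => ?_⟩
    · obtain ⟨L, hL, -⟩ := h.hasFDerivAt hν hνc hσ h0 hϖc hc i p
      exact hL.continuousAt
    · rw [norm_iteratedFDeriv_zero, (hc i p).unique (hc' i p)]
      exact hC i p
  | succ k ih =>
    choose L hL hL' using h.hasFDerivAt hν hνc hσ h0 hϖc hc
    have hfd : ∀ i, fderiv ℝ (c i) = L i := fun i => funext fun p => (hL i p).fderiv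
    have hw : ∀ (j : ι × P) (p : P), 0 ≤ ‖j.2‖ * (ϖ j.1 p * ν j.1 p) := fun j p =>
      mul_nonneg (norm_nonneg _) (mul_nonneg (h0 _ p) (by linarith [hν j.1 p]))
    obtain ⟨h1, C, K, hC0, hC⟩ := ih (h.dirD hν (fun j : ι × P => j.1) fun j => j.2)
      (fun j => hν _) (fun j => hνc _) hw
      (fun j => continuous_const.mul ((hϖc _).mul (hνc _)))
      (c := fun j p => L j.1 p j.2) fun j p => hL' _ _ _
    have h2 : ∀ i, ContDiff ℝ k (L i) := fun i => contDiff_clm_apply_iff.2 fun d => h1 (i, d)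
    refine ⟨fun i => ?_, C, K + 1, hC0, fun i p => ?_⟩
    · push_cast
      rw [contDiff_succ_iff_fderiv, hfd]
      exact ⟨fun p => (hL i p).differentiableAt, by simp, h2 i⟩
    · rw [← norm_iteratedFDeriv_fderiv, hfd]
      have hw0 : 0 ≤ C * (ϖ i p * ν i p ^ (K + 1)) :=
        mul_nonneg hC0 (mul_nonneg (h0 i p) (pow_nonneg (by linarith [hν i p]) _))
      refine ContinuousMultilinearMap.opNorm_le_bound hw0 fun v => ?_
      refine ContinuousLinearMap.opNorm_le_bound _ (mul_nonneg hw0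
        (Finset.prod_nonneg fun _ _ => norm_nonneg _)) fun d => ?_
      have e := (ContinuousLinearMap.apply ℝ ℂ d).iteratedFDeriv_comp_left
        ((h2 i).contDiffAt (x := p)) (i := k) le_rfl
      have e' : iteratedFDeriv ℝ k (L i) p v d
          = iteratedFDeriv ℝ k (fun p => L i p d) p v := by
        change _ = iteratedFDeriv ℝ k (ContinuousLinearMap.apply ℝ ℂ d ∘ L i) p v
        rw [e]
        rfl
      rw [e']
      refine (ContinuousMultilinearMap.le_opNorm _ v).trans ?_
      refine (mul_le_mul_of_nonneg_right (hC (i, d) p)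
        (Finset.prod_nonneg fun _ _ => norm_nonneg _)).trans (le_of_eq ?_)
      simp only
      ring

end PAmp

end ParameterDependence

/-! ### Oscillatory integrals with linear phase in the covariable -/

section OscillatoryIntegralInstance

variable {n : ℕ}

/-- Oscillatory integrals with a linear phase in `η` in the form of the definition
`HasOscIntegral`, after the translation `y = x + w`. -/
theorem HasOsc.hasOscIntegral {φ : Rn n → ℝ} {A : Rn n → Rn n → ℂ} {x : Rn n} {I : ℂ}
    (hφ : ContDiff ℝ ∞ φ) (hA : ContDiff ℝ ∞ fun p : Rn n × Rn n => A p.1 p.2)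
    (h : HasOsc (fun p => Complex.exp (Complex.I * (φ (x + p.1) : ℂ)) * A (x + p.1) p.2) I) :
    HasOscIntegral (fun y η => φ y + inner ℝ (x - y) η) A
      ((((2 * Real.pi) ^ n : ℝ) : ℂ)⁻¹ * I) := by
  intro κ hs hc h1
  refine Tendsto.const_mul _ ?_
  have hreg := isReg_affine hs hc h1 (ContinuousLinearEquiv.refl ℝ (Rn n × Rn n)) (x, 0)
  have h2 := h _ 1 hreg
  rw [one_mul] at h2
  refine h2.congr' ?_
  filter_upwards [self_mem_nhdsWithin] with ε hε
  have ha : ContDiff ℝ ∞ fun p : Rn n × Rn n =>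
      Complex.exp (Complex.I * (φ (x + p.1) : ℂ)) * A (x + p.1) p.2 :=
    (Complex.contDiff_exp.comp (contDiff_const.mul (Complex.ofRealCLM.contDiff.comp
      (hφ.comp (by fun_prop))))).mul
      (hA.comp (by fun_prop : ContDiff ℝ ∞ fun p : Rn n × Rn n => (x + p.1, p.2)))
  have hi := HasOsc.integrable_reg ha hreg hε
  rw [MeasureTheory.Measure.volume_eq_prod, MeasureTheory.integral_prod_symm _ hi]
  refine MeasureTheory.integral_congr_ae (Eventually.of_forall fun η => ?_)
  simp only
  refine Eq.trans ?_ (MeasureTheory.integral_add_left_eq_self _ x)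
  refine MeasureTheory.integral_congr_ae (Eventually.of_forall fun w => ?_)
  simp only [kern, ContinuousLinearEquiv.refl_apply, Prod.mk_add_mk, zero_add, Prod.smul_mk,
    sub_add_cancel_left, inner_neg_left]
  rw [← mul_assoc, ← mul_assoc, ← Complex.exp_add]
  congr 4
  push_cast
  ring

end OscillatoryIntegralInstance

/-! ### Existence and smoothness of the composition -/

section Symbols

variable {n : ℕ}

/-- The hypotheses on phase and amplitudes, with all estimates in the form of jet bounds. -/
structure CompositionData (ψ : Rn n → Rn n → ℝ) (b : Rn n → Rn n → Rn n → Rn n → ℂ)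
    (q : Rn n → Rn n → ℂ) (m₁ m₂ m₃ m₄ t₁ t₂ : ℝ) : Prop where
  smooth_phase : ContDiff ℝ ∞ fun p : Rn n × Rn n => ψ p.1 p.2
  jet_grad : JetBound (fun p h : Rn n × Rn n => gradMap ψ (p + h)) fun p => japanese p.2
  lower : ∃ C : ℝ, 0 < C ∧ ∀ x ξ : Rn n, C * japanese ξ ≤ japanese (gradX ψ x ξ)
  smooth_left : ContDiff ℝ ∞ fun p : Rn n × Rn n × Rn n × Rn n => b p.1 p.2.1 p.2.2.1 p.2.2.2
  jet_left : JetBound (fun p h : Rn n × Rn n × Rn n × Rn n => b (p.1 + h.1) (p.2.1 + h.2.1)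
    (p.2.2.1 + h.2.2.1) (p.2.2.2 + japanese p.2.2.2 • h.2.2.2)) fun p =>
      japanese p.1 ^ m₁ * japanese p.2.1 ^ m₂ * japanese p.2.2.1 ^ m₃ * japanese p.2.2.2 ^ m₄
  smooth_right : ContDiff ℝ ∞ fun p : Rn n × Rn n => q p.1 p.2
  jet_right : JetBound (fun p h : Rn n × Rn n => q (p.1 + h.1) (p.2 + japanese p.2 • h.2))
    fun p => japanese p.1 ^ t₁ * japanese p.2 ^ t₂

theorem rpow_sub_nat_cancel {r : ℝ} (hr : 0 < r) (m : ℝ) (k : ℕ) :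
    r ^ k * r ^ (m - (k : ℝ)) = r ^ m := by
  rw [← Real.rpow_natCast, ← Real.rpow_add hr]
  congr 1
  ring

/-- The hypotheses in terms of partial derivatives yield the jet bounds. -/
theorem compositionData_of_estimates {m₁ m₂ m₃ m₄ t₁ t₂ : ℝ}
    {ψ : Rn n → Rn n → ℝ}
    (hψ : ContDiff ℝ ∞ (fun p : Rn n × Rn n => ψ p.1 p.2))
    (hψ_grad : ∃ C₁ C₂ : ℝ, 0 < C₁ ∧ 0 < C₂ ∧ ∀ x ξ : Rn n,
      C₁ * japanese ξ ≤ japanese (gradX ψ x ξ) ∧ japanese (gradX ψ x ξ) ≤ C₂ * japanese ξ)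
    (hψ_x : ∀ α : MultiIndex n, 1 ≤ α.len → ∃ C : ℝ, ∀ x ξ : Rn n,
      |mderiv α (fun x' => ψ x' ξ) x| ≤ C * japanese ξ)
    (hψ_xξ : ∀ α β : MultiIndex n, 1 ≤ α.len → 1 ≤ β.len → ∃ C : ℝ, ∀ x ξ : Rn n,
      |mderiv₂ α β ψ x ξ| ≤ C)
    {b : Rn n → Rn n → Rn n → Rn n → ℂ}
    (hb : ContDiff ℝ ∞ (fun p : Rn n × Rn n × Rn n × Rn n => b p.1 p.2.1 p.2.2.1 p.2.2.2))
    (hb_est : ∀ α β γ δ : MultiIndex n, ∃ C : ℝ, ∀ y ξ z η : Rn n,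
      ‖mderiv₄ α β γ δ b y ξ z η‖ ≤
        C * japanese y ^ m₁ * japanese ξ ^ m₂ * japanese z ^ m₃ *
          japanese η ^ (m₄ - (δ.len : ℝ)))
    {q : Rn n → Rn n → ℂ}
    (hq : ContDiff ℝ ∞ (fun p : Rn n × Rn n => q p.1 p.2))
    (hq_est : ∀ α β : MultiIndex n, ∃ C : ℝ, ∀ x η : Rn n,
      ‖mderiv₂ α β q x η‖ ≤ C * japanese x ^ t₁ * japanese η ^ (t₂ - (β.len : ℝ))) :
    CompositionData ψ b q m₁ m₂ m₃ m₄ t₁ t₂ where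
  smooth_phase := hψ
  jet_grad := jetBound_gradMap hψ hψ_x hψ_xξ
  lower := by
    obtain ⟨C₁, C₂, h1, -, h⟩ := hψ_grad
    exact ⟨C₁, h1, fun x ξ => (h x ξ).1⟩
  smooth_left := hb
  jet_left := by
    refine jetBound_of_mderiv₄ hb (σ := fun p => japanese p.2.2.2) fun α β γ δ => ?_
    obtain ⟨C, hC⟩ := hb_est α β γ δ
    refine ⟨|C|, abs_nonneg C, fun p => ?_⟩
    have h1 := japanese_pos p.1
    have h2 := japanese_pos p.2.1
    have h3 := japanese_pos p.2.2.1
    have h4 := japanese_pos p.2.2.2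
    rw [abs_of_pos h4, ← rpow_sub_nat_cancel h4 m₄ δ.len]
    calc _ ≤ japanese p.2.2.2 ^ δ.len * (|C| * japanese p.1 ^ m₁ * japanese p.2.1 ^ m₂ *
          japanese p.2.2.1 ^ m₃ * japanese p.2.2.2 ^ (m₄ - (δ.len : ℝ))) := by
          refine mul_le_mul_of_nonneg_left ((hC _ _ _ _).trans ?_) (by positivity)
          have := le_abs_self C
          gcongr
      _ = _ := by ring
  smooth_right := hq
  jet_right := by
    refine jetBound_of_mderiv₂ hq (σ := fun p => japanese p.2) fun α β => ?_
    obtain ⟨C, hC⟩ := hq_est α β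
    refine ⟨|C|, abs_nonneg C, fun p => ?_⟩
    have h1 := japanese_pos p.1
    have h4 := japanese_pos p.2
    rw [abs_of_pos h4, ← rpow_sub_nat_cancel h4 t₂ β.len]
    calc _ ≤ japanese p.2 ^ β.len * (|C| * japanese p.1 ^ t₁ *
          japanese p.2 ^ (t₂ - (β.len : ℝ))) := by
          refine mul_le_mul_of_nonneg_left ((hC _ _).trans ?_) (by positivity)
          have := le_abs_self C
          gcongr
      _ = _ := by ring

namespace CompositionData

variable {ψ : Rn n → Rn n → ℝ} {b : Rn n → Rn n → Rn n → Rn n → ℂ} {q : Rn n → Rn n → ℂ}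
  {m₁ m₂ m₃ m₄ t₁ t₂ : ℝ} {κ : Type*} {E : Type} [NormedAddCommGroup E] [NormedSpace ℝ E]

/-- Jets of `b` along nonlinear substitutions whose `η`-component moves at the scale `⟨η⟩`. -/
theorem jet_left_comp (D : CompositionData ψ b q m₁ m₂ m₃ m₄ t₁ t₂) (y ξ z η : κ → Rn n)
    {Y X Z H : κ → E → Rn n} (hY : JetBound Y fun _ => 1) (hX : JetBound X fun _ => 1)
    (hZ : JetBound Z fun _ => 1) (hH : JetBound H fun _ => 1) (hY0 : ∀ k, Y k 0 = 0)
    (hX0 : ∀ k, X k 0 = 0) (hZ0 : ∀ k, Z k 0 = 0) (hH0 : ∀ k, H k 0 = 0) :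
    JetBound (fun k h => b (y k + Y k h) (ξ k + X k h) (z k + Z k h)
      (η k + japanese (η k) • H k h)) fun k =>
      japanese (y k) ^ m₁ * japanese (ξ k) ^ m₂ * japanese (z k) ^ m₃ * japanese (η k) ^ m₄ :=
  (D.jet_left.reindex fun k => (y k, ξ k, z k, η k)).comp (hY.prodMk (hX.prodMk (hZ.prodMk hH)))
    fun k => by simp [hY0, hX0, hZ0, hH0]

/-- Jets of `q` along nonlinear substitutions whose `η`-component moves at the scale `⟨η⟩`. -/
theorem jet_right_comp (D : CompositionData ψ b q m₁ m₂ m₃ m₄ t₁ t₂) (x η : κ → Rn n)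
    {X H : κ → E → Rn n} (hX : JetBound X fun _ => 1) (hH : JetBound H fun _ => 1)
    (hX0 : ∀ k, X k 0 = 0) (hH0 : ∀ k, H k 0 = 0) :
    JetBound (fun k h => q (x k + X k h) (η k + japanese (η k) • H k h)) fun k =>
      japanese (x k) ^ t₁ * japanese (η k) ^ t₂ :=
  (D.jet_right.reindex fun k => (x k, η k)).comp (hX.prodMk hH) fun k => by simp [hX0, hH0]

theorem abs_inv_japanese_le (x : Rn n) : |(japanese x)⁻¹| ≤ 1 := by
  rw [abs_of_pos (inv_pos.2 (japanese_pos x))]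
  exact inv_le_one_of_one_le₀ (one_le_japanese x)

/-- The amplitude of the oscillatory integral, as a function of the parameter `(x, z, ξ)` and
of `w = y - x` and `η`. -/
def fullAmp (ψ : Rn n → Rn n → ℝ) (b : Rn n → Rn n → Rn n → Rn n → ℂ) (q : Rn n → Rn n → ℂ)
    (p : (Rn n × Rn n × Rn n) × (Rn n × Rn n)) : ℂ :=
  Complex.exp (Complex.I * ((ψ (p.1.1 + p.2.1) p.1.2.2 - ψ p.1.1 p.1.2.2 : ℝ) : ℂ))
    * (b (p.1.1 + p.2.1) p.1.2.2 p.1.2.1 p.2.2 * q p.1.1 p.2.2)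

theorem contDiff_fullAmp (D : CompositionData ψ b q m₁ m₂ m₃ m₄ t₁ t₂) :
    ContDiff ℝ ∞ (fullAmp ψ b q) :=
  (Complex.contDiff_exp.comp (contDiff_const.mul (Complex.ofRealCLM.contDiff.comp
    ((D.smooth_phase.comp (by fun_prop : ContDiff ℝ ∞
      fun p : (Rn n × Rn n × Rn n) × (Rn n × Rn n) => (p.1.1 + p.2.1, p.1.2.2))).sub
    (D.smooth_phase.comp (by fun_prop : ContDiff ℝ ∞
      fun p : (Rn n × Rn n × Rn n) × (Rn n × Rn n) => (p.1.1, p.1.2.2))))))).mul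
  ((D.smooth_left.comp (by fun_prop : ContDiff ℝ ∞
      fun p : (Rn n × Rn n × Rn n) × (Rn n × Rn n) =>
        (p.1.1 + p.2.1, p.1.2.2, p.1.2.1, p.2.2))).mul
    (D.smooth_right.comp (by fun_prop : ContDiff ℝ ∞
      fun p : (Rn n × Rn n × Rn n) × (Rn n × Rn n) => (p.1.1, p.2.2))))

/-- Derivatives of `ψ(x + w, ξ) - ψ(x, ξ)` have size `⟨ξ⟩⟨w⟩`, so a derivative of the full amplitude
in `w` or in the parameters costs a factor of this size. -/
theorem pamp_fullAmp (D : CompositionData ψ b q m₁ m₂ m₃ m₄ t₁ t₂) :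
    PAmp (fun _ : Unit => fun p : Rn n × Rn n × Rn n =>
        japanese p.1 ^ (m₁ + t₁) * japanese p.2.1 ^ m₃ * japanese p.2.2 ^ m₂)
      (fun _ p => japanese p.2.2) 1 |m₁| (m₄ + t₂) fun _ => fullAmp ψ b q := by
  refine ⟨fun _ => D.contDiff_fullAmp, ?_⟩
  set P := Rn n × Rn n × Rn n
  let V : Unit × (P × (Rn n × Rn n)) → ℝ := fun j =>
    japanese j.2.1.2.2 * japanese j.2.2.1 ^ (1 : ℝ)
  have hV : ∀ j, 1 ≤ V j := fun j => one_le_scale (one_le_japanese _) zero_le_one _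
  have hVi : ∀ j, ‖(V j)⁻¹‖ ≤ 1 := fun j => abs_inv_scale_le (one_le_japanese _) zero_le_one _
  -- the coordinate projections
  let prx := ContinuousLinearMap.fst ℝ P (Rn n × Rn n)
  let px : P × (Rn n × Rn n) →L[ℝ] Rn n := (ContinuousLinearMap.fst ℝ _ _).comp prx
  let pz : P × (Rn n × Rn n) →L[ℝ] Rn n :=
    (ContinuousLinearMap.fst ℝ _ _).comp ((ContinuousLinearMap.snd ℝ _ _).comp prx)
  let pξ : P × (Rn n × Rn n) →L[ℝ] Rn n :=
    (ContinuousLinearMap.snd ℝ _ _).comp ((ContinuousLinearMap.snd ℝ _ _).comp prx)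
  let pw : P × (Rn n × Rn n) →L[ℝ] Rn n :=
    (ContinuousLinearMap.fst ℝ _ _).comp (ContinuousLinearMap.snd ℝ P (Rn n × Rn n))
  let pη : P × (Rn n × Rn n) →L[ℝ] Rn n :=
    (ContinuousLinearMap.snd ℝ _ _).comp (ContinuousLinearMap.snd ℝ P (Rn n × Rn n))
  have hbd : ∀ A : P × (Rn n × Rn n) →L[ℝ] Rn n, (∀ h, ‖A h‖ ≤ ‖h‖) → ‖A‖ ≤ 1 := fun A hA =>
    ContinuousLinearMap.opNorm_le_bound _ zero_le_one fun h => by simpa using hA h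
  have hx : ‖px‖ ≤ 1 := hbd _ fun h => (norm_fst_le h.1).trans (norm_fst_le h)
  have hz : ‖pz‖ ≤ 1 := hbd _ fun h => (norm_fst_le h.1.2).trans
    ((norm_snd_le h.1).trans (norm_fst_le h))
  have hξ : ‖pξ‖ ≤ 1 := hbd _ fun h => (norm_snd_le h.1.2).trans
    ((norm_snd_le h.1).trans (norm_fst_le h))
  have hw : ‖pw‖ ≤ 1 := hbd _ fun h => (norm_fst_le h.2).trans (norm_snd_le h)
  have hη : ‖pη‖ ≤ 1 := hbd _ fun h => (norm_snd_le h.2).trans (norm_snd_le h)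
  have hsc : ∀ {A : P × (Rn n × Rn n) →L[ℝ] Rn n} {c : Unit × (P × (Rn n × Rn n)) → ℝ},
      ‖A‖ ≤ 1 → (∀ j, ‖c j‖ ≤ 1) →
      JetBound (fun (j : Unit × (P × (Rn n × Rn n))) h => (c j • A) h) fun _ => 1 := by
    intro A c hA hc
    refine JetBound.clm (W := fun _ => 1) (A := fun j => c j • A) fun j => ?_
    rw [norm_smul]
    exact mul_le_one₀ (hc j) (norm_nonneg _) hA
  have hiη : ∀ j : Unit × (P × (Rn n × Rn n)), ‖(japanese j.2.2.2)⁻¹‖ ≤ 1 := fun j =>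
    abs_inv_japanese_le _
  have h1 := (jetBound_phaseDifference D.smooth_phase D.jet_grad
    (fun j : Unit × (P × (Rn n × Rn n)) => j.2.1.1) (fun j => j.2.1.2.2) (fun j => j.2.2.1)
    (fun _ => px) (fun _ => pξ) (fun _ => pw) (μ := fun j => japanese j.2.2.1 ^ (1 : ℝ))
    (fun _ => hx) (fun _ => hξ) (fun _ => hw)
    (fun j => hw.trans (by rw [Real.rpow_one]; exact one_le_japanese _))
    (fun j => by rw [Real.rpow_one]; exact norm_le_japanese _)).cexp hV
  have h2 := D.jet_left_comp (fun j : Unit × (P × (Rn n × Rn n)) => j.2.1.1 + j.2.2.1)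
    (fun j => j.2.1.2.2) (fun j => j.2.1.2.1) (fun j => j.2.2.2)
    (Y := fun j h => (V j)⁻¹ • px h + (V j)⁻¹ • pw h) (X := fun j h => (V j)⁻¹ • pξ h)
    (Z := fun j h => (V j)⁻¹ • pz h) (H := fun j h => (japanese j.2.2.2)⁻¹ • pη h)
    ((hsc hx hVi).add (hsc hw hVi)) (hsc hξ hVi) (hsc hz hVi) (hsc hη hiη)
    (by simp) (by simp) (by simp) (by simp)
  have h3 := D.jet_right_comp (fun j : Unit × (P × (Rn n × Rn n)) => j.2.1.1)
    (fun j => j.2.2.2) (X := fun j h => (V j)⁻¹ • px h)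
    (H := fun j h => (japanese j.2.2.2)⁻¹ • pη h) (hsc hx hVi) (hsc hη hiη) (by simp) (by simp)
  refine ((h1.mul (h2.mul h3)).congr' fun j h => ?_).mono (2 ^ |m₁|) (fun j => ?_) fun j => ?_
  · have e1 : japanese j.2.2.2 • (japanese j.2.2.2)⁻¹ • pη h = pη h := by
      rw [smul_smul, mul_inv_cancel₀ (japanese_pos _).ne', one_smul]
    simp only [e1, fullAmp, map_smul]
    rw [add_add_add_comm j.2.1.1 j.2.2.1]
    rfl
  · have e := japanese_add_rpow_le j.2.1.1 j.2.2.1 m₁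
    have p1 := Real.rpow_nonneg (japanese_pos j.2.1.2.2).le m₂
    have p2 := Real.rpow_nonneg (japanese_pos j.2.1.2.1).le m₃
    have p3 := Real.rpow_nonneg (japanese_pos j.2.2.2).le m₄
    have p4 := Real.rpow_nonneg (japanese_pos j.2.1.1).le t₁
    have p5 := Real.rpow_nonneg (japanese_pos j.2.2.2).le t₂
    rw [Real.rpow_add (japanese_pos _), Real.rpow_add (japanese_pos _), one_mul]
    calc _ ≤ (2 ^ |m₁| * (japanese j.2.1.1 ^ m₁ * japanese j.2.2.1 ^ |m₁|))
          * japanese j.2.1.2.2 ^ m₂ * japanese j.2.1.2.1 ^ m₃ * japanese j.2.2.2 ^ m₄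
          * (japanese j.2.1.1 ^ t₁ * japanese j.2.2.2 ^ t₂) := by gcongr
      _ = _ := by ring
  · have := japanese_pos j.2.1.1
    have := japanese_pos j.2.1.2.1
    have := japanese_pos j.2.1.2.2
    have := japanese_pos j.2.2.1
    have := japanese_pos j.2.2.2
    positivity

/-- Existence and smoothness of the oscillatory integral, with estimates that lose powers of
`⟨ξ⟩` in each differentiation. -/
theorem exists_composition (D : CompositionData ψ b q m₁ m₂ m₃ m₄ t₁ t₂) :
    ∃ c : Rn n × Rn n × Rn n → ℂ,
      (∀ p, HasOsc (fun y => fullAmp ψ b q (p, y)) ((((2 * Real.pi) ^ n : ℝ) : ℂ) * c p)) ∧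
      (∀ x z ξ : Rn n, HasOscIntegral (fun y η => ψ y ξ - ψ x ξ + inner ℝ (x - y) η)
        (fun y η => b y ξ z η * q x η) (c (x, z, ξ))) ∧
      ContDiff ℝ ∞ c ∧ ∀ k : ℕ, ∃ (C : ℝ) (K : ℕ), 0 ≤ C ∧ ∀ p, ‖iteratedFDeriv ℝ k c p‖ ≤
        C * (japanese p.1 ^ (m₁ + t₁) * japanese p.2.1 ^ m₃ * japanese p.2.2 ^ m₂
          * japanese p.2.2 ^ K) := by
  have hc1 : ∀ s : ℝ, Continuous fun x : Rn n => japanese x ^ s :=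
    fun s => (contDiff_japanese_rpow s).continuous
  have hA := D.pamp_fullAmp
  have hν : ∀ (_ : Unit) (p : Rn n × Rn n × Rn n), 1 ≤ japanese p.2.2 :=
    fun _ p => one_le_japanese _
  have h0 : ∀ (_ : Unit) (p : Rn n × Rn n × Rn n), 0 ≤
      japanese p.1 ^ (m₁ + t₁) * japanese p.2.1 ^ m₃ * japanese p.2.2 ^ m₂ := fun _ p =>
    mul_nonneg (mul_nonneg (Real.rpow_nonneg (japanese_pos _).le _)
      (Real.rpow_nonneg (japanese_pos _).le _)) (Real.rpow_nonneg (japanese_pos _).le _)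
  obtain ⟨I, hI, -⟩ := hA.exists_hasOsc hν zero_le_one h0
  have hreg := fun k => hA.contDiff_osc k hν
    (fun _ => contDiff_japanese.continuous.comp (continuous_snd.comp continuous_snd)) zero_le_one h0
    (fun _ => (((hc1 _).comp continuous_fst).mul ((hc1 _).comp
      (continuous_fst.comp continuous_snd))).mul ((hc1 _).comp
        (continuous_snd.comp continuous_snd))) hI
  have hs : ContDiff ℝ ∞ (I ()) := contDiff_infty.2 fun k => (hreg k).1 ()
  have hpi : (((2 * Real.pi) ^ n : ℝ) : ℂ) ≠ 0 := by
    have := Real.pi_pos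
    exact_mod_cast (by positivity : ((2 * Real.pi) ^ n : ℝ) ≠ 0)
  refine ⟨fun p => (((2 * Real.pi) ^ n : ℝ) : ℂ)⁻¹ * I () p, fun p => ?_, fun x z ξ => ?_,
    contDiff_const.mul hs, fun k => ?_⟩
  · rw [mul_inv_cancel_left₀ hpi]
    exact hI () p
  · refine HasOsc.hasOscIntegral (φ := fun y => ψ y ξ - ψ x ξ) ?_ ?_ (hI () (x, z, ξ))
    · exact (D.smooth_phase.comp (by fun_prop : ContDiff ℝ ∞ fun y : Rn n => (y, ξ))).sub
        contDiff_const
    · exact (D.smooth_left.comp (by fun_prop : ContDiff ℝ ∞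
        fun p : Rn n × Rn n => (p.1, ξ, z, p.2))).mul
        (D.smooth_right.comp (by fun_prop : ContDiff ℝ ∞ fun p : Rn n × Rn n => (x, p.2)))
  · obtain ⟨-, C, K, hC0, hC⟩ := hreg k
    refine ⟨‖(((2 * Real.pi) ^ n : ℝ) : ℂ)⁻¹‖ * C, K, by positivity, fun p => ?_⟩
    have e := iteratedFDeriv_const_smul_apply' (𝕜 := ℝ) (i := k)
      (a := (((2 * Real.pi) ^ n : ℝ) : ℂ)⁻¹)
      ((hs.of_le (by exact_mod_cast le_top : ((k : ℕ) : ℕ∞ω) ≤ ∞)).contDiffAt (x := p))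
    simp only [smul_eq_mul] at e
    rw [e, norm_smul, mul_assoc]
    exact mul_le_mul_of_nonneg_left (hC () p) (norm_nonneg _)

end CompositionData

end Symbols

/-! ### Fourier inversion for oscillatory integrals -/

section Inversion

variable {n : ℕ}

open FourierTransform MeasureTheory in
/-- Fourier inversion: the oscillatory integral of an amplitude that depends on `η` only. -/
theorem HasOsc.of_snd {g : Rn n → ℂ} (hg : ContDiff ℝ ∞ g) {C m : ℝ}
    (hb : ∀ η, ‖g η‖ ≤ C * japanese η ^ m) {I : ℂ}
    (hI : HasOsc (fun p : Rn n × Rn n => g p.2) I) :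
    I = (((2 * Real.pi) ^ n : ℝ) : ℂ) * g 0 := by
  have hpi := Real.pi_pos
  let φ : ContDiffBump (0 : Rn n) := ⟨1, 2, one_pos, one_lt_two⟩
  have hfs : ContDiff ℝ ∞ fun x : Rn n => (φ x : ℂ) := Complex.ofRealCLM.contDiff.comp φ.contDiff
  have hfc : HasCompactSupport fun x : Rn n => (φ x : ℂ) :=
    φ.hasCompactSupport.comp_left (g := fun r : ℝ => (r : ℂ)) (by simp)
  let f : SchwartzMap (Rn n) ℂ := hfc.toSchwartzMap hfs
  have hf1 : ∀ x, ‖f x‖ ≤ 1 := fun x => by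
    change ‖(φ x : ℂ)‖ ≤ 1
    rw [Complex.norm_real, Real.norm_of_nonneg φ.nonneg]
    exact φ.le_one
  have hf0 : f 0 = 1 := by
    change (φ 0 : ℂ) = 1
    rw [φ.one_of_mem_closedBall (by simp [φ])]
    simp
  have hf0' : ∀ᶠ x in 𝓝 (0 : Rn n), f x = 1 := by
    filter_upwards [φ.eventuallyEq_one] with x hx
    change (φ x : ℂ) = 1
    simp [hx]
  set G : SchwartzMap (Rn n) ℂ := 𝓕 f with hG
  have hGint : ∫ ζ, G ζ = 1 := by
    have h1 : 𝓕⁻ (𝓕 (f : Rn n → ℂ)) = f :=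
      f.continuous.fourierInv_fourier_eq f.integrable (by rw [← SchwartzMap.fourier_coe]; exact
        G.integrable)
    have h2 := congrFun h1 0
    rw [hf0, Real.fourierInv_eq'] at h2
    simpa [hG, SchwartzMap.fourier_coe] using h2
  -- the product regularizer
  have hκs : ContDiff ℝ ∞ fun p : Rn n × Rn n => f p.1 * f p.2 :=
    ((f.smooth ⊤).comp contDiff_fst).mul ((f.smooth ⊤).comp contDiff_snd)
  have hκc : HasCompactSupport fun p : Rn n × Rn n => f p.1 * f p.2 := by
    refine HasCompactSupport.of_support_subset_isCompact
      (hfc.isCompact.prod hfc.isCompact) fun p hp => ?_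
    rw [Function.mem_support, mul_ne_zero_iff] at hp
    exact ⟨subset_tsupport _ hp.1, subset_tsupport _ hp.2⟩
  have hκ1 : ∀ᶠ p in 𝓝 (0 : Rn n × Rn n), f p.1 * f p.2 = 1 := by
    filter_upwards [(continuous_fst.tendsto (0 : Rn n × Rn n)).eventually hf0',
      (continuous_snd.tendsto (0 : Rn n × Rn n)).eventually hf0'] with p h1 h2
    rw [h1, h2, one_mul]
  have hreg := isReg_affine hκs hκc hκ1 (ContinuousLinearEquiv.refl ℝ _) 0
  have hlim := hI _ 1 hreg
  rw [one_mul] at hlim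
  have hdim : Module.finrank ℝ (Rn n) = n := finrank_euclideanSpace_fin
  have hev : ∀ᶠ ε in 𝓝[>] (0 : ℝ), ε ∈ Set.Ioc 0 (2 * Real.pi)⁻¹ :=
    Ioc_mem_nhdsGT (by positivity)
  have hform : ∀ ε : ℝ, 0 < ε → ∫ p : Rn n × Rn n, kern p * (g p.2 *
      (f (ε • (0 + ContinuousLinearEquiv.refl ℝ (Rn n × Rn n) p)).1
        * f (ε • (0 + ContinuousLinearEquiv.refl ℝ (Rn n × Rn n) p)).2))
      = (((2 * Real.pi) ^ n : ℝ) : ℂ) *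
        ∫ ζ, g ((2 * Real.pi * ε) • ζ) * f (ε • (2 * Real.pi * ε) • ζ) * G ζ := by
    intro ε hε
    have hi := HasOsc.integrable_reg (a := fun p : Rn n × Rn n => g p.2) (hg.comp contDiff_snd) hreg hε
    rw [Measure.volume_eq_prod, integral_prod_symm _ hi]
    have h1 : ∀ η : Rn n, ∫ w : Rn n, kern (w, η) * (g (w, η).2 *
        (f (ε • (0 + ContinuousLinearEquiv.refl ℝ (Rn n × Rn n) (w, η))).1
        * f (ε • (0 + ContinuousLinearEquiv.refl ℝ (Rn n × Rn n) (w, η))).2))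
        = g η * f (ε • η) * ((ε ^ n)⁻¹ : ℝ) * G ((2 * Real.pi * ε)⁻¹ • η) := by
      intro η
      have e1 : G ((2 * Real.pi * ε)⁻¹ • η)
          = ∫ v : Rn n, Complex.exp (-Complex.I * ((inner ℝ (ε⁻¹ • v) η : ℝ) : ℂ)) * f v := by
        rw [hG, SchwartzMap.fourier_coe, Real.fourier_eq']
        refine integral_congr_ae (Eventually.of_forall fun v => ?_)
        simp only [smul_eq_mul]
        congr 2
        rw [real_inner_smul_right, real_inner_smul_left]
        push_cast
        have : (Real.pi : ℂ) ≠ 0 := by exact_mod_cast hpi.ne'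
        have : (ε : ℂ) ≠ 0 := by exact_mod_cast hε.ne'
        field_simp
      have e2 := Measure.integral_comp_smul (volume : Measure (Rn n))
        (fun v => Complex.exp (-Complex.I * ((inner ℝ (ε⁻¹ • v) η : ℝ) : ℂ)) * f v) ε
      rw [hdim, abs_of_pos (by positivity), ← e1] at e2
      rw [mul_assoc (g η * f (ε • η)), ← Complex.real_smul, ← e2, ← integral_const_mul]
      refine integral_congr_ae (Eventually.of_forall fun w => ?_)
      simp only [kern, zero_add, ContinuousLinearEquiv.refl_apply, Prod.smul_mk, smul_smul,
        inv_mul_cancel₀ hε.ne', one_smul]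
      ring
    rw [integral_congr_ae (Eventually.of_forall h1)]
    have hR : 0 < 2 * Real.pi * ε := by positivity
    have e3 := Measure.integral_comp_smul (volume : Measure (Rn n))
      (fun η => g η * f (ε • η) * ((ε ^ n)⁻¹ : ℝ) * G ((2 * Real.pi * ε)⁻¹ • η)) (2 * Real.pi * ε)
    rw [hdim, abs_of_pos (by positivity)] at e3
    have e4 : (∫ η : Rn n, g η * f (ε • η) * ((ε ^ n)⁻¹ : ℝ) * G ((2 * Real.pi * ε)⁻¹ • η))
        = (2 * Real.pi * ε) ^ n • ∫ ζ : Rn n, g ((2 * Real.pi * ε) • ζ) *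
          f (ε • (2 * Real.pi * ε) • ζ) * ((ε ^ n)⁻¹ : ℝ) *
          G ((2 * Real.pi * ε)⁻¹ • (2 * Real.pi * ε) • ζ) := by
      rw [e3, smul_smul, mul_inv_cancel₀ (by positivity), one_smul]
    rw [e4, Complex.real_smul, ← integral_const_mul, ← integral_const_mul]
    refine integral_congr_ae (Eventually.of_forall fun ζ => ?_)
    simp only
    rw [smul_smul (2 * Real.pi * ε)⁻¹, inv_mul_cancel₀ hR.ne', one_smul]
    have : (ε : ℂ) ≠ 0 := by exact_mod_cast hε.ne'
    push_cast
    rw [mul_pow _ (ε : ℂ)]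
    field_simp
  refine tendsto_nhds_unique (hlim.congr' ?_) (Tendsto.const_mul _ ?_ :
    Tendsto (fun ε : ℝ => (((2 * Real.pi) ^ n : ℝ) : ℂ) *
        ∫ ζ, g ((2 * Real.pi * ε) • ζ) * f (ε • (2 * Real.pi * ε) • ζ) * G ζ)
      (𝓝[>] (0 : ℝ)) _)
  · filter_upwards [hev] with ε hε using hform ε hε.1
  have h0 : g 0 = ∫ ζ, g 0 * G ζ := by rw [integral_const_mul, hGint, mul_one]
  rw [h0]
  obtain ⟨k, hk⟩ := exists_nat_ge |m|
  refine tendsto_integral_filter_of_dominated_convergence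
    (fun ζ => C * (2 ^ (k - 1) * (‖G ζ‖ + ‖ζ‖ ^ k * ‖G ζ‖))) ?_ ?_ ?_ ?_
  · refine Eventually.of_forall fun ε => Continuous.aestronglyMeasurable ?_
    have := hg.continuous
    have := f.continuous
    have := G.continuous
    fun_prop
  · filter_upwards [hev] with ε hε
    refine Eventually.of_forall fun ζ => ?_
    have hC0 : 0 ≤ C := by
      have := (norm_nonneg _).trans (hb 0)
      have h2 := Real.rpow_pos_of_pos (japanese_pos (0 : Rn n)) m
      by_contra hC
      nlinarith
    have h1 : japanese ((2 * Real.pi * ε) • ζ) ^ m ≤ 2 ^ (k - 1) * (1 + ‖ζ‖ ^ k) := by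
      calc japanese ((2 * Real.pi * ε) • ζ) ^ m
          ≤ japanese ((2 * Real.pi * ε) • ζ) ^ (k : ℝ) :=
            Real.rpow_le_rpow_of_exponent_le (one_le_japanese _) ((le_abs_self m).trans hk)
        _ = japanese ((2 * Real.pi * ε) • ζ) ^ k := Real.rpow_natCast _ _
        _ ≤ (1 + ‖ζ‖) ^ k := by
          refine pow_le_pow_left₀ (japanese_pos _).le ((japanese_smul_le ?_ ζ).trans
            (japanese_le_one_add_norm ζ)) k
          rw [abs_of_pos (by have := hε.1; positivity)]
          calc 2 * Real.pi * ε ≤ 2 * Real.pi * (2 * Real.pi)⁻¹ := by gcongr; exact hε.2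
            _ = 1 := mul_inv_cancel₀ (by positivity)
        _ ≤ _ := by
          have := add_pow_le zero_le_one (norm_nonneg ζ) k
          rwa [one_pow] at this
    rw [norm_mul, norm_mul]
    calc _ ≤ (C * (2 ^ (k - 1) * (1 + ‖ζ‖ ^ k))) * 1 * ‖G ζ‖ := by
          gcongr
          · exact (hb _).trans (mul_le_mul_of_nonneg_left h1 hC0)
          · exact hf1 _
      _ = _ := by ring
  · exact ((G.integrable.norm.add (G.integrable_pow_mul volume k)).const_mul _).const_mul _
  · refine Eventually.of_forall fun ζ => ?_
    have h1 : Continuous fun ε : ℝ => g ((2 * Real.pi * ε) • ζ) * f (ε • (2 * Real.pi * ε) • ζ)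
        * G ζ := by
      have := hg.continuous
      have := f.continuous
      fun_prop
    have h2 := h1.tendsto 0
    simp only [mul_zero, zero_smul, hf0, mul_one] at h2
    exact h2.mono_left nhdsWithin_le_nhds

end Inversion

/-! ### Expansion under dilations -/

section Dilation

variable {n : ℕ} {ι : Type*}

/-- The operator `-i ∑ ∂_{ζ_j} ∂_{u_j}`. -/
def mixedLap (F : Rn n × Rn n → ℂ) : Rn n × Rn n → ℂ := fun p =>
  -Complex.I * ∑ j, dirD (0, (euclFrame n).vec j) (dirD ((euclFrame n).vec j, 0) F) p

theorem ContDiff.mixedLap {F : Rn n × Rn n → ℂ} (hF : ContDiff ℝ ∞ F) :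
    ContDiff ℝ ∞ (mixedLap F) :=
  contDiff_const.mul (ContDiff.sum fun _ _ => (hF.dirD _).dirD _)

variable {W : ι → ℝ} {τ m : ℝ} {F : ι → Rn n × Rn n → ℂ}

theorem Amp.mixedLap {σ : ℝ} (h : Amp W (fun _ => 1) σ τ m F) :
    Amp W (fun _ => 1) σ (τ + σ) m fun i => mixedLap (F i) := by
  have h1 := (Amp.sum Finset.univ fun j _ => ((h.dirD_fst (fun _ => le_rfl)
    (norm_vec_le j)).dirD_snd ((euclFrame n).vec j))).const_mul (-Complex.I)
  simp only [mul_one] at h1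
  exact h1

theorem japanese_smul_sq_le (t : ℝ) (w : Rn n) :
    japanese (t • w) ^ 2 ≤ (1 + t ^ 2) * japanese w ^ 2 := by
  rw [japanese_sq, japanese_sq, norm_smul, mul_pow, Real.norm_eq_abs, sq_abs]
  nlinarith [sq_nonneg t, sq_nonneg ‖w‖]

theorem japanese_smul_rpow_le (t : ℝ) (w : Rn n) (τ : ℝ) :
    japanese (t • w) ^ τ ≤ (1 + t ^ 2) ^ |τ| * japanese w ^ |τ| := by
  have hT : 1 ≤ 1 + t ^ 2 := by nlinarith [sq_nonneg t]
  have h1 : japanese (t • w) ≤ (1 + t ^ 2) * japanese w := by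
    refine (sq_le_sq₀ (japanese_pos _).le (by have := japanese_pos w; positivity)).1 ?_
    refine (japanese_smul_sq_le t w).trans ?_
    rw [mul_pow]
    refine mul_le_mul_of_nonneg_right ?_ (sq_nonneg _)
    nlinarith
  rw [← Real.mul_rpow (by linarith) (japanese_pos w).le]
  exact (Real.rpow_le_rpow_of_exponent_le (one_le_japanese _) (le_abs_self τ)).trans
    (Real.rpow_le_rpow (japanese_pos _).le h1 (abs_nonneg τ))

/-- Dilating the first group of variables by a parameter. -/
theorem Amp.dilate (h : Amp W (fun _ => 1) 2 τ m F) (hW : ∀ i, 0 ≤ W i) :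
    PAmp (fun i t => W i * (1 + t ^ 2) ^ |τ|) (fun _ t => (1 + t ^ 2) ^ 2) 3 |τ| m
      fun i (q : ℝ × (Rn n × Rn n)) => F i (q.1 • q.2.1, q.2.2) := by
  refine ⟨fun i => (h.smooth i).comp (by fun_prop), ?_⟩
  let V : ι × (ℝ × (Rn n × Rn n)) → ℝ := fun j => (1 + j.2.1 ^ 2) ^ 2 * japanese j.2.2.1 ^ (3 : ℝ)
  let c : ι × (ℝ × (Rn n × Rn n)) → ℝ := fun j => japanese (j.2.1 • j.2.2.1) ^ (2 : ℝ) * (V j)⁻¹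
  have hT : ∀ t : ℝ, 1 ≤ 1 + t ^ 2 := fun t => by nlinarith [sq_nonneg t]
  have hV1 : ∀ j, 1 ≤ V j := fun j =>
    one_le_scale (one_le_pow₀ (hT _)) (by norm_num) _
  have hc0 : ∀ j, 0 ≤ c j := fun j => mul_nonneg (Real.rpow_nonneg (japanese_pos _).le _)
    (inv_nonneg.2 (by linarith [hV1 j]))
  have hc : ∀ j, c j * ((1 + j.2.1 ^ 2) * japanese j.2.2.1) ≤ 1 := fun j => by
    have h1 := japanese_smul_sq_le j.2.1 j.2.2.1
    have h2 := japanese_pos j.2.2.1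
    have h3 := hT j.2.1
    have e : V j = (1 + j.2.1 ^ 2) ^ 2 * japanese j.2.2.1 ^ 3 := by
      simp only [V]
      norm_cast
    have hVp : 0 < V j := by linarith [hV1 j]
    simp only [c, Real.rpow_two]
    rw [mul_right_comm, ← div_eq_mul_inv, div_le_one hVp, e]
    calc _ ≤ ((1 + j.2.1 ^ 2) * japanese j.2.2.1 ^ 2) * ((1 + j.2.1 ^ 2) * japanese j.2.2.1) := by
          gcongr
      _ = _ := by ring
  have hcw : ∀ j, ‖c j • j.2.2.1‖ ≤ 1 := fun j => by
    rw [norm_smul, Real.norm_of_nonneg (hc0 j)]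
    refine le_trans (mul_le_mul_of_nonneg_left ?_ (hc0 j)) (hc j)
    nlinarith [norm_le_japanese j.2.2.1, hT j.2.1, japanese_pos j.2.2.1]
  have hct : ∀ j, ‖c j * j.2.1‖ ≤ 1 := fun j => by
    rw [norm_mul, Real.norm_of_nonneg (hc0 j)]
    refine le_trans (mul_le_mul_of_nonneg_left ?_ (hc0 j)) (hc j)
    have h1 := one_le_japanese j.2.2.1
    have h2 : ‖j.2.1‖ ≤ 1 + j.2.1 ^ 2 := by
      rw [Real.norm_eq_abs, ← sq_abs]
      nlinarith [sq_nonneg (|j.2.1| - 1), abs_nonneg j.2.1]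
    nlinarith [hT j.2.1]
  have hcV : ∀ j, ‖c j * (V j)⁻¹‖ ≤ 1 := fun j => by
    have h1 := hc j
    have h2 : (V j)⁻¹ ≤ 1 := inv_le_one_of_one_le₀ (hV1 j)
    have h3 : 0 ≤ (V j)⁻¹ := inv_nonneg.2 (by linarith [hV1 j])
    rw [norm_mul, Real.norm_of_nonneg (hc0 j), Real.norm_of_nonneg h3]
    have h4 : c j ≤ 1 := by
      refine le_trans ?_ h1
      refine le_mul_of_one_le_right (hc0 j) ?_
      exact one_le_mul_of_one_le_of_one_le (hT _) (one_le_japanese _)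
    exact mul_le_one₀ h4 h3 h2
  let pt := ContinuousLinearMap.fst ℝ ℝ (Rn n × Rn n)
  let pw : ℝ × (Rn n × Rn n) →L[ℝ] Rn n :=
    (ContinuousLinearMap.fst ℝ _ _).comp (ContinuousLinearMap.snd ℝ ℝ (Rn n × Rn n))
  let pη : ℝ × (Rn n × Rn n) →L[ℝ] Rn n :=
    (ContinuousLinearMap.snd ℝ _ _).comp (ContinuousLinearMap.snd ℝ ℝ (Rn n × Rn n))
  have npt : ‖pt‖ ≤ 1 := ContinuousLinearMap.norm_fst_le _ _ _
  have npw : ‖pw‖ ≤ 1 := ContinuousLinearMap.opNorm_le_bound _ zero_le_one fun h => by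
    rw [one_mul]
    exact (norm_fst_le h.2).trans (norm_snd_le h)
  have npη : ‖pη‖ ≤ 1 := ContinuousLinearMap.opNorm_le_bound _ zero_le_one fun h => by
    rw [one_mul]
    exact (norm_snd_le h.2).trans (norm_snd_le h)
  have g1 : JetBound (fun (j : ι × (ℝ × (Rn n × Rn n))) h => pt.smulRight (c j • j.2.2.1) h)
      fun _ => 1 := JetBound.clm fun j => by
    rw [ContinuousLinearMap.norm_smulRight_apply]
    exact mul_le_one₀ npt (norm_nonneg _) (hcw j)
  have g2 : JetBound (fun (j : ι × (ℝ × (Rn n × Rn n))) h => ((c j * j.2.1) • pw) h)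
      fun _ => 1 := JetBound.clm fun j => by
    rw [norm_smul]
    exact mul_le_one₀ (hct j) (norm_nonneg _) npw
  have g3 : JetBound (fun (j : ι × (ℝ × (Rn n × Rn n))) h => pt h • ((c j * (V j)⁻¹) • pw) h)
      fun _ => 1 := ((JetBound.clm (A := fun _ => pt) (W := fun _ => 1) fun _ => npt).smul
      (JetBound.clm (A := fun j => (c j * (V j)⁻¹) • pw) (W := fun _ => 1) fun j => by
    rw [norm_smul]
    exact mul_le_one₀ (hcV j) (norm_nonneg _) npw)).mono_one (by simp)
  have g4 : JetBound (fun (j : ι × (ℝ × (Rn n × Rn n))) h => pη h) fun _ => 1 :=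
    JetBound.clm fun j => npη
  have h1 := (h.jet.reindex fun j : ι × (ℝ × (Rn n × Rn n)) =>
    (j.1, (j.2.1 • j.2.2.1, j.2.2.2))).comp (((g1.add g2).add g3).prodMk g4) fun j => by simp
  refine (h1.congr' fun j h => ?_).mono_one fun j => ?_
  · have hne := (Real.rpow_pos_of_pos (japanese_pos (j.2.1 • j.2.2.1)) 2).ne'
    have e : (1 * japanese (j.2.1 • j.2.2.1) ^ (2 : ℝ))⁻¹ * c j = (V j)⁻¹ := by
      simp only [c]
      rw [one_mul, inv_mul_cancel_left₀ hne]
    congr 1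
    refine Prod.ext ?_ rfl
    change j.2.1 • j.2.2.1 + (1 * japanese (j.2.1 • j.2.2.1) ^ (2 : ℝ))⁻¹ •
      (h.1 • c j • j.2.2.1 + (c j * j.2.1) • h.2.1 + h.1 • (c j * (V j)⁻¹) • h.2.1)
      = (j.2.1 + (V j)⁻¹ * h.1) • (j.2.2.1 + (V j)⁻¹ • h.2.1)
    rw [← e]
    module
  · have h1 := japanese_smul_rpow_le j.2.1 j.2.2.1 τ
    have h2 := Real.rpow_nonneg (japanese_pos j.2.2.2).le m
    have h3 := hW j.1
    refine mul_le_mul_of_nonneg_right ?_ h2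
    rw [mul_assoc]
    exact mul_le_mul_of_nonneg_left h1 h3

theorem continuous_dilation_weight (C τ : ℝ) :
    Continuous fun t : ℝ => C * (1 + t ^ 2) ^ |τ| :=
  continuous_const.mul ((by fun_prop : Continuous fun t : ℝ => 1 + t ^ 2).rpow_const
    fun t => Or.inr (abs_nonneg τ))

/-- The oscillatory integral as a function of the dilation parameter: its derivative is the
oscillatory integral of `mixedLap F`. -/
theorem Amp.hasDerivAt_dilate (h : Amp W (fun _ => 1) 2 τ m F) (hW : ∀ i, 0 ≤ W i)
    {H H' : ι → ℝ → ℂ} (hH : ∀ i t, HasOsc (fun p => F i (t • p.1, p.2)) (H i t))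
    (hH' : ∀ i t, HasOsc (fun p => _root_.mixedLap (F i) (t • p.1, p.2)) (H' i t)) (i : ι) (t : ℝ) :
    HasDerivAt (H i) (H' i t) t := by
  have hd := h.dilate hW
  have hν : ∀ (_ : ι) (t : ℝ), 1 ≤ (1 + t ^ 2) ^ 2 := fun _ t =>
    one_le_pow₀ (by nlinarith [sq_nonneg t])
  obtain ⟨L, hL, hL'⟩ := hd.hasFDerivAt hν (fun _ => by fun_prop) (by norm_num)
    (fun i t => mul_nonneg (hW i) (Real.rpow_nonneg (by positivity) _))
    (fun i => continuous_dilation_weight _ _) hH i t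
  have hu : ∀ j : Fin n, Amp W (fun _ => 1) 2 (τ + 2) m
      fun i => dirD ((euclFrame n).vec j, 0) (F i) := fun j => by
    have h1 := h.dirD_fst (fun _ => le_rfl) (Amp.norm_vec_le j)
    simp only [mul_one] at h1
    exact h1
  have key : ∀ {f : Rn n × Rn n → ℂ} (_ : ContDiff ℝ ∞ f),
      ContDiff ℝ ∞ fun p : Rn n × Rn n => f (t • p.1, p.2) := fun hf => hf.comp (by fun_prop)
  have hosc : ∀ {τ' : ℝ} {f : ι → Rn n × Rn n → ℂ}, Amp W (fun _ => 1) 2 τ' m f →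
      ∃ J, HasOsc (fun p => f i (t • p.1, p.2)) J := fun hf => by
    obtain ⟨c, hc, -⟩ := (hf.dilate hW).exists_hasOsc hν (by norm_num)
      (fun i t => mul_nonneg (hW i) (Real.rpow_nonneg (by positivity) _))
    exact ⟨_, hc i t⟩
  choose J hJ using fun j => hosc ((hu j).dirD_snd ((euclFrame n).vec j))
  have e1 : ∀ j : Fin n, dirD (0, (euclFrame n).vec j)
      (fun p : Rn n × Rn n => dirD ((euclFrame n).vec j, 0) (F i) (t • p.1, p.2))
      = fun p => dirD (0, (euclFrame n).vec j) (dirD ((euclFrame n).vec j, 0) (F i))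
        (t • p.1, p.2) := fun j => by
    have := dirD_comp_affine ((h.smooth i).dirD ((euclFrame n).vec j, 0)) 0
      (scaleFst t) (0, (euclFrame n).vec j)
    simpa using this
  have h2 : ∀ j : Fin n, HasOsc (fun p : Rn n × Rn n => ((p.1 j : ℝ) : ℂ)
      * dirD ((euclFrame n).vec j, 0) (F i) (t • p.1, p.2)) (-Complex.I * J j) := fun j => by
    have q1 : ∃ J, HasOsc (fun p : Rn n × Rn n =>
      dirD ((euclFrame n).vec j, 0) (F i) (t • p.1, p.2)) J :=
      hosc (f := fun i => dirD ((euclFrame n).vec j, 0) (F i)) (hu j)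
    have q2 := hJ j
    rw [← e1 j] at q2
    exact HasOsc.mul_coord j (key ((h.smooth i).dirD _)) q1 q2
  have h3 := HasOsc.sum Finset.univ (fun j _ => h2 j) fun j _ =>
    (Complex.ofRealCLM.contDiff.comp (by fun_prop :
      ContDiff ℝ ∞ fun p : Rn n × Rn n => p.1 j)).mul (key ((h.smooth i).dirD _))
  have h4 := (HasOsc.sum Finset.univ (fun j _ => hJ j) fun j _ =>
    key (((h.smooth i).dirD _).dirD _)).const_mul (-Complex.I)
  have e2 : H' i t = -Complex.I * ∑ j, J j := (hH' i t).unique h4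
  have e3 : L 1 = -Complex.I * ∑ j, J j := by
    rw [Finset.mul_sum]
    refine (hL' 1).unique ?_
    convert h3 using 2 with p
    have hsm := h.smooth i
    have h6 : dirD ((1 : ℝ), (0 : Rn n × Rn n)) (fun q : ℝ × (Rn n × Rn n) =>
        F i (q.1 • q.2.1, q.2.2)) (t, p) = fderiv ℝ (F i) (t • p.1, p.2) (p.1, 0) := by
      have l1 : HasDerivAt (fun s : ℝ => (s, p)) ((1 : ℝ), (0 : Rn n × Rn n)) t :=
        (hasDerivAt_id t).prodMk (hasDerivAt_const t p)
      have l2 : HasDerivAt (fun s : ℝ => (s • p.1, p.2)) (p.1, (0 : Rn n)) t := by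
        have := (hasDerivAt_id t).smul_const p.1
        rw [one_smul] at this
        exact this.prodMk (hasDerivAt_const t p.2)
      have d1 := (((hd.smooth i).differentiable (by simp)) (t, p)).hasFDerivAt.comp_hasDerivAt t l1
      have d2 := ((hsm.differentiable (by simp)) (t • p.1, p.2)).hasFDerivAt.comp_hasDerivAt t l2
      exact d1.unique d2
    rw [h6]
    have e4 : ((p.1, 0) : Rn n × Rn n) = ∑ j, p.1 j • ((euclFrame n).vec j, (0 : Rn n)) := by
      have hs : ∑ j, p.1 j • (euclFrame n).vec j = p.1 := (euclFrame n).sum_coord p.1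
      have e5 : ∀ j, p.1 j • ((euclFrame n).vec j, (0 : Rn n))
          = ContinuousLinearMap.inl ℝ (Rn n) (Rn n) (p.1 j • (euclFrame n).vec j) := fun j => by
        simp
      simp only [e5]
      rw [← map_sum, hs, ContinuousLinearMap.inl_apply]
    rw [e4, map_sum]
    refine Finset.sum_congr rfl fun j _ => ?_
    rw [map_smul, Complex.real_smul]
    rfl
  rw [e2, ← e3]
  exact hL.hasDerivAt

/-- Expansion of the oscillatory integral of `F (t w, ζ)` in powers of `t`. -/
theorem Amp.taylor_dilate (N : ℕ) (h : Amp W (fun _ => 1) 2 τ m F) (hW : ∀ i, 0 ≤ W i)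
    {H : ι → ℝ → ℂ} (hH : ∀ i t, HasOsc (fun p => F i (t • p.1, p.2)) (H i t)) :
    ∃ C : ℝ, 0 ≤ C ∧ ∀ i, ∀ t ∈ Set.Icc (0 : ℝ) 1,
      ‖H i t - (((2 * Real.pi) ^ n : ℝ) : ℂ) * ∑ k ∈ Finset.range N,
        ((t ^ k / k.factorial : ℝ) : ℂ) * _root_.mixedLap^[k] (F i) 0‖ ≤ C * W i * t ^ N := by
  have hν : ∀ (_ : ι) (t : ℝ), 1 ≤ (1 + t ^ 2) ^ 2 := fun _ t =>
    one_le_pow₀ (by nlinarith [sq_nonneg t])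
  have hw0 : ∀ (τ : ℝ) (i : ι) (t : ℝ), 0 ≤ W i * (1 + t ^ 2) ^ |τ| := fun τ i t =>
    mul_nonneg (hW i) (Real.rpow_nonneg (by positivity) _)
  induction N generalizing F τ H with
  | zero =>
    obtain ⟨c, hc, C, K, hC0, hC⟩ := (h.dilate hW).exists_hasOsc hν (by norm_num) (hw0 τ)
    refine ⟨C * (2 ^ |τ| * 4 ^ K), by positivity, fun i t ht => ?_⟩
    simp only [Finset.range_zero, Finset.sum_empty, mul_zero, sub_zero, pow_zero, mul_one]
    rw [(hH i t).unique (hc i t)]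
    refine (hC i t).trans ?_
    have h1 : 1 + t ^ 2 ≤ 2 := by nlinarith [ht.1, ht.2]
    have h2 : (1 + t ^ 2) ^ |τ| ≤ 2 ^ |τ| := Real.rpow_le_rpow (by positivity) h1 (abs_nonneg τ)
    have h3 : ((1 + t ^ 2) ^ 2) ^ K ≤ 4 ^ K := by
      refine pow_le_pow_left₀ (by positivity) ?_ K
      nlinarith [sq_nonneg t]
    have h4 := hW i
    calc C * (W i * (1 + t ^ 2) ^ |τ| * ((1 + t ^ 2) ^ 2) ^ K)
        ≤ C * (W i * 2 ^ |τ| * 4 ^ K) := by gcongr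
      _ = _ := by ring
  | succ N ih =>
    obtain ⟨H', hH', -⟩ := (h.mixedLap.dilate hW).exists_hasOsc hν (by norm_num) (hw0 _)
    obtain ⟨C, hC0, hC⟩ := ih h.mixedLap hH'
    have hder := h.hasDerivAt_dilate hW hH hH'
    refine ⟨C, hC0, fun i t ht => ?_⟩
    set P : ℂ := (((2 * Real.pi) ^ n : ℝ) : ℂ)
    set G : ℝ → ℂ := fun s => H i s - P * ∑ k ∈ Finset.range (N + 1),
      ((s ^ k / k.factorial : ℝ) : ℂ) * _root_.mixedLap^[k] (F i) 0 with hG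
    have hG0 : G 0 = 0 := by
      obtain ⟨B, -, hB⟩ := h.norm_le
      have h1 := HasOsc.of_snd (g := fun η => F i (0, η)) ((h.smooth i).comp (by fun_prop))
        (C := B * W i) (m := m) (fun η => by
          have := hB i (0, η)
          simpa [japanese, mul_assoc] using this) (I := H i 0) (by simpa using hH i 0)
      simp only [hG]
      rw [Finset.sum_range_succ', h1]
      simp only [pow_zero, P, Function.iterate_zero, id_eq, Prod.mk_zero_zero]
      simp
    have hGd : ∀ s, HasDerivAt G (H' i s - P * ∑ k ∈ Finset.range N,
        ((s ^ k / k.factorial : ℝ) : ℂ) * _root_.mixedLap^[k] (_root_.mixedLap (F i)) 0) s := by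
      intro s
      refine (hder i s).sub (HasDerivAt.const_mul P ?_)
      simp only [Finset.sum_range_succ' _ N]
      simp only [pow_zero, Nat.factorial_zero, Nat.cast_one, div_one]
      refine HasDerivAt.add_const _ (HasDerivAt.fun_sum fun k _ => ?_)
      rw [Function.iterate_succ_apply]
      refine HasDerivAt.mul_const (HasDerivAt.ofReal_comp ?_) _
      refine ((hasDerivAt_pow (k + 1) s).div_const _).congr_deriv ?_
      rw [Nat.factorial_succ]
      have : (k.factorial : ℝ) ≠ 0 := by exact_mod_cast k.factorial_ne_zero
      push_cast
      field_simp
    have hbound := (convex_Icc (0 : ℝ) t).norm_image_sub_le_of_norm_hasDerivWithin_le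
      (f := G) (C := C * W i * t ^ N) (fun s _ => (hGd s).hasDerivWithinAt) (fun s hs => by
        refine (hC i s ⟨hs.1, hs.2.trans ht.2⟩).trans ?_
        exact mul_le_mul_of_nonneg_left (pow_le_pow_left₀ hs.1 hs.2 N) (mul_nonneg hC0 (hW i)))
      (Set.left_mem_Icc.2 ht.1) (Set.right_mem_Icc.2 ht.1)
    rw [hG0, sub_zero, sub_zero, Real.norm_of_nonneg ht.1] at hbound
    refine hbound.trans (le_of_eq ?_)
    ring

end Dilation

/-! ### Symplectic changes of variables -/

section ChangeOfVariables

variable {n : ℕ}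

theorem IsReg.comp_affine {κ : ℝ → Rn n × Rn n → ℂ} {c : ℂ} (h : IsReg κ c) (v : Rn n × Rn n)
    (A : (Rn n × Rn n) ≃L[ℝ] Rn n × Rn n) : IsReg (fun ε p => κ ε (v + A p)) c := by
  refine ⟨fun ε hε => (h.smooth ε hε).comp (by fun_prop), fun ε hε => ?_, ?_, fun p => ?_⟩
  · exact (h.compact ε hε).comp_homeomorph (A.toHomeomorph.trans (Homeomorph.addLeft v))
  · refine ((h.jet.reindex fun i : Set.Ioc (0 : ℝ) 1 × (Rn n × Rn n) => (i.1, v + A i.2)).comp_clm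
      (fun i => (A : Rn n × Rn n →L[ℝ] Rn n × Rn n)) _ fun i => le_rfl).congr' fun i x => ?_
    simp [add_assoc]
  · have ht : Continuous fun q : Rn n × Rn n => v + A q := by fun_prop
    filter_upwards [h.lim (v + A p)] with ε hε
    exact ht.continuousAt.eventually hε

/-- The linear symplectic change of variables `(w, η) ↦ (r⁻¹ w, r η)`. -/
def symplecticScaling (n : ℕ) {r : ℝ} (hr : r ≠ 0) : (Rn n × Rn n) ≃L[ℝ] Rn n × Rn n :=
  (ContinuousLinearEquiv.smulLeft (R₁ := ℝ) (M₁ := Rn n) (Units.mk0 r⁻¹ (inv_ne_zero hr))).prodCongr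
    (ContinuousLinearEquiv.smulLeft (R₁ := ℝ) (M₁ := Rn n) (Units.mk0 r hr))

theorem symplecticScaling_apply {r : ℝ} (hr : r ≠ 0) (p : Rn n × Rn n) :
    symplecticScaling n hr p = (r⁻¹ • p.1, r • p.2) := rfl

theorem integral_comp_symplecticScaling {f : Rn n × Rn n → ℂ} (hf : Continuous f)
    (hc : HasCompactSupport f) {r : ℝ} (hr : 0 < r) (v : Rn n) :
    ∫ p, f ((0, v) + symplecticScaling n hr.ne' p) = ∫ p, f p := by
  have h1 : Continuous fun p : Rn n × Rn n => f ((0, v) + symplecticScaling n hr.ne' p) := by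
    fun_prop
  have h2 : HasCompactSupport fun p : Rn n × Rn n => f ((0, v) + symplecticScaling n hr.ne' p) :=
    hc.comp_homeomorph ((symplecticScaling n hr.ne').toHomeomorph.trans (Homeomorph.addLeft (0, v)))
  have hdim : Module.finrank ℝ (Rn n) = n := finrank_euclideanSpace_fin
  rw [MeasureTheory.Measure.volume_eq_prod, MeasureTheory.integral_prod _
    (h1.integrable_of_hasCompactSupport h2), MeasureTheory.integral_prod _
    (hf.integrable_of_hasCompactSupport hc)]
  simp only [symplecticScaling_apply, Prod.mk_add_mk, zero_add]
  have e1 : ∀ w : Rn n, ∫ ζ : Rn n, f (r⁻¹ • w, v + r • ζ)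
      = |(r ^ n)⁻¹| • ∫ ζ : Rn n, f (r⁻¹ • w, ζ) := fun w => by
    rw [MeasureTheory.Measure.integral_comp_smul MeasureTheory.volume
      (fun ζ : Rn n => f (r⁻¹ • w, v + ζ)) r, hdim,
      MeasureTheory.integral_add_left_eq_self (fun ζ : Rn n => f (r⁻¹ • w, ζ)) v]
  simp only [e1]
  rw [MeasureTheory.integral_smul, MeasureTheory.Measure.integral_comp_smul MeasureTheory.volume
      (fun w : Rn n => ∫ ζ : Rn n, f (w, ζ)) r⁻¹, hdim, smul_smul, ← abs_mul, inv_pow, inv_inv,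
      inv_mul_cancel₀ (by positivity), abs_one, one_smul]

/-- Oscillatory integrals are invariant under symplectic scalings and translations in `η`. -/
theorem HasOsc.symplecticScaling {g : Rn n × Rn n → ℂ} {I : ℂ} (hg : ContDiff ℝ ∞ g)
    (h : HasOsc g I) {r : ℝ} (hr : 0 < r) (v : Rn n) :
    HasOsc (fun p => Complex.exp (Complex.I * ((inner ℝ p.1 v : ℝ) : ℂ))
      * g (r • p.1, r⁻¹ • (p.2 - v))) I := by
  intro κ c hκ
  refine (h _ c (hκ.comp_affine (0, v) (_root_.symplecticScaling n hr.ne'))).congr' ?_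
  filter_upwards [self_mem_nhdsWithin] with ε hε
  have hs : ContDiff ℝ ∞ fun p : Rn n × Rn n => kern p *
      (Complex.exp (Complex.I * ((inner ℝ p.1 v : ℝ) : ℂ)) * g (r • p.1, r⁻¹ • (p.2 - v)) * κ ε p) :=
    contDiff_kern.mul (((Complex.contDiff_exp.comp (contDiff_const.mul
      (Complex.ofRealCLM.contDiff.comp (contDiff_fst.inner ℝ contDiff_const)))).mul
        (hg.comp (by fun_prop))).mul (hκ.smooth ε hε))
  have hc : HasCompactSupport fun p : Rn n × Rn n => kern p *
      (Complex.exp (Complex.I * ((inner ℝ p.1 v : ℝ) : ℂ)) * g (r • p.1, r⁻¹ • (p.2 - v)) * κ ε p) :=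
    ((hκ.compact ε hε).mul_left).mul_left
  rw [← integral_comp_symplecticScaling hs.continuous hc hr v]
  refine MeasureTheory.integral_congr_ae (Eventually.of_forall fun p => ?_)
  simp only [symplecticScaling_apply, Prod.mk_add_mk, zero_add, add_sub_cancel_left, smul_smul,
    mul_inv_cancel₀ hr.ne', inv_mul_cancel₀ hr.ne', one_smul]
  rw [← mul_assoc (kern _), ← mul_assoc (kern _), ← mul_assoc (kern _)]
  congr 2
  simp only [kern]
  rw [← Complex.exp_add]
  congr 1
  rw [inner_add_right, real_inner_smul_left, real_inner_smul_left, real_inner_smul_right]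
  have : (r : ℂ) ≠ 0 := by exact_mod_cast hr.ne'
  push_cast
  field_simp
  ring

end ChangeOfVariables

/-! ### The part away from zero frequency -/

section MainPart

/-- Jet bounds have to be checked only where the germs do not vanish. -/
theorem JetBound.of_subtype {ι : Type*} {E F : Type} [NormedAddCommGroup E] [NormedSpace ℝ E]
    [NormedAddCommGroup F] [NormedSpace ℝ F] {g : ι → E → F} {W : ι → ℝ} {P : ι → Prop}
    (h : JetBound (fun i : {i // P i} => g i) fun i => W i) (h0 : ∀ i, ¬P i → g i =ᶠ[𝓝 0] 0)
    (hW : ∀ i, 0 ≤ W i) : JetBound g W := by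
  refine ⟨fun i => ?_, fun k => ?_⟩
  · by_cases hi : P i
    · exact h.1 ⟨i, hi⟩
    · exact contDiffAt_const.congr_of_eventuallyEq (h0 i hi)
  · obtain ⟨C, hC0, hC⟩ := h.2 k
    refine ⟨C, hC0, fun i => ?_⟩
    by_cases hi : P i
    · exact hC ⟨i, hi⟩
    · rw [((h0 i hi).iteratedFDeriv (𝕜 := ℝ) k).eq_of_nhds,
        show (0 : E → F) = fun _ => 0 from rfl, iteratedFDeriv_fun_zero]
      simpa using mul_nonneg hC0 (hW i)

theorem JetBound.clm_bounded {ι : Type*} {E F : Type} [NormedAddCommGroup E] [NormedSpace ℝ E]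
    [NormedAddCommGroup F] [NormedSpace ℝ F] {A : ι → E →L[ℝ] F} {K : ℝ} (hA : ∀ i, ‖A i‖ ≤ K) :
    JetBound (fun i x => A i x) fun _ => 1 :=
  (JetBound.clm (W := fun _ => K) hA).mono K (by simp) (by simp)

variable {n : ℕ} {ψ : Rn n → Rn n → ℝ} {b : Rn n → Rn n → Rn n → Rn n → ℂ}
  {q : Rn n → Rn n → ℂ} {m₁ m₂ m₃ m₄ t₁ t₂ : ℝ} {κ : Type*}

/-- The amplitude of the part of the oscillatory integral away from `η = 0`, in the variables
`u = ⟨ξ⟩^(1/2) (y - x)` and `ζ = (η - ∇ₓψ) / ⟨ξ⟩`. -/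
def mainAmp (χ : Rn n → ℝ) (ψ : Rn n → Rn n → ℝ) (b : Rn n → Rn n → Rn n → Rn n → ℂ)
    (q : Rn n → Rn n → ℂ) (x z ξ : Rn n) (p : Rn n × Rn n) : ℂ :=
  ((1 - χ ((japanese ξ)⁻¹ • gradX ψ x ξ + p.2) : ℝ) : ℂ) *
    (Complex.exp (Complex.I *
      (phaseRemainder ψ x (x + japanese ξ ^ (-(1 / 2) : ℝ) • p.1) ξ : ℂ)) *
    (b (x + japanese ξ ^ (-(1 / 2) : ℝ) • p.1) ξ z (gradX ψ x ξ + japanese ξ • p.2) *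
      q x (gradX ψ x ξ + japanese ξ • p.2)))

theorem contDiff_phaseRemainder (hψ : ContDiff ℝ ∞ fun p : Rn n × Rn n => ψ p.1 p.2)
    (x ξ : Rn n) : ContDiff ℝ ∞ fun y => phaseRemainder ψ x y ξ := by
  refine ((hψ.comp (by fun_prop : ContDiff ℝ ∞ fun y : Rn n => (y, ξ))).sub contDiff_const).add ?_
  exact (contDiff_const.sub contDiff_id).inner ℝ contDiff_const

namespace CompositionData

theorem contDiff_mainAmp (D : CompositionData ψ b q m₁ m₂ m₃ m₄ t₁ t₂) {χ : Rn n → ℝ}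
    (hχ : ContDiff ℝ ∞ χ) (x z ξ : Rn n) : ContDiff ℝ ∞ (mainAmp χ ψ b q x z ξ) :=
  (Complex.ofRealCLM.contDiff.comp (contDiff_const.sub (hχ.comp (by fun_prop)))).mul
    ((Complex.contDiff_exp.comp (contDiff_const.mul (Complex.ofRealCLM.contDiff.comp
      ((contDiff_phaseRemainder D.smooth_phase x ξ).comp (by fun_prop))))).mul
    ((D.smooth_left.comp (by fun_prop : ContDiff ℝ ∞ fun p : Rn n × Rn n =>
        (x + japanese ξ ^ (-(1 / 2) : ℝ) • p.1, ξ, z, gradX ψ x ξ + japanese ξ • p.2))).mul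
      (D.smooth_right.comp (by fun_prop : ContDiff ℝ ∞ fun p : Rn n × Rn n =>
        (x, gradX ψ x ξ + japanese ξ • p.2)))))

theorem norm_gradX_le (D : CompositionData ψ b q m₁ m₂ m₃ m₄ t₁ t₂) :
    ∃ C : ℝ, 0 ≤ C ∧ ∀ x ξ, ‖gradX ψ x ξ‖ ≤ C * japanese ξ := by
  obtain ⟨C, hC0, hC⟩ := D.jet_grad.value_le
  exact ⟨C, hC0, fun x ξ => by simpa [gradMap] using hC (x, ξ)⟩

set_option maxHeartbeats 400000 in
/-- In the rescaled variables the main part is an amplitude, uniformly in `x`, `z`, `ξ`: the phase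
remainder is quadratic in `y - x` with coefficients of size `⟨ξ⟩`, hence of size `|u|²`, and `η` is of
size at least `⟨ξ⟩` on the support. -/
theorem amp_mainAmp (D : CompositionData ψ b q m₁ m₂ m₃ m₄ t₁ t₂)
    (χ : ContDiffBump (0 : Rn n)) (x z ξ : κ → Rn n) :
    Amp (fun k => japanese (x k) ^ (m₁ + t₁) * japanese (z k) ^ m₃
        * japanese (ξ k) ^ (m₂ + t₂ + m₄)) (fun _ => 1) 2 |m₁| (|m₄| + |t₂|)
      fun k => mainAmp χ ψ b q (x k) (z k) (ξ k) := by
  refine ⟨fun k => D.contDiff_mainAmp χ.contDiff _ _ _, ?_⟩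
  let lam : κ → ℝ := fun k => japanese (ξ k) ^ (-(1 / 2) : ℝ)
  let η : κ × (Rn n × Rn n) → Rn n := fun j => gradX ψ (x j.1) (ξ j.1) + japanese (ξ j.1) • j.2.2
  let V : κ × (Rn n × Rn n) → ℝ := fun j => 1 * japanese j.2.1 ^ (2 : ℝ)
  have hV : ∀ j, 1 ≤ V j := fun j => one_le_scale le_rfl (by norm_num) _
  have hVi : ∀ j, ‖(V j)⁻¹‖ ≤ 1 := fun j => abs_inv_scale_le le_rfl (by norm_num) _
  have hl0 : ∀ k, 0 < lam k := fun k => Real.rpow_pos_of_pos (japanese_pos _) _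
  have hl1 : ∀ k, lam k ≤ 1 := fun k =>
    Real.rpow_le_one_of_one_le_of_nonpos (one_le_japanese _) (by norm_num)
  have hla : ∀ k, ‖lam k‖ ≤ 1 := fun k => by rw [Real.norm_of_nonneg (hl0 k).le]; exact hl1 k
  have hl2 : ∀ k, japanese (ξ k) * (lam k * lam k) = 1 := fun k => by
    simp only [lam]
    rw [← Real.rpow_add (japanese_pos _)]
    nth_rewrite 1 [← Real.rpow_one (japanese (ξ k))]
    rw [← Real.rpow_add (japanese_pos _)]
    norm_num
  let pu := ContinuousLinearMap.fst ℝ (Rn n) (Rn n)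
  let pζ := ContinuousLinearMap.snd ℝ (Rn n) (Rn n)
  have npu : ‖pu‖ ≤ 1 := ContinuousLinearMap.norm_fst_le _ _ _
  have npζ : ‖pζ‖ ≤ 1 := ContinuousLinearMap.norm_snd_le _ _ _
  have hsm : ∀ {ι : Type _} {A : Rn n × Rn n →L[ℝ] Rn n} {c : ι → ℝ} {K : ℝ},
      ‖A‖ ≤ 1 → (∀ j, ‖c j‖ ≤ K) → ∀ j, ‖c j • A‖ ≤ K := by
    intro ι A c K hA hc j
    rw [norm_smul]
    exact (mul_le_of_le_one_right (norm_nonneg _) hA).trans (hc j)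
  have h1 := ((jetBound_phaseRemainder D.smooth_phase D.jet_grad
    (fun j : κ × (Rn n × Rn n) => x j.1) (fun j => ξ j.1) (fun j => lam j.1 • j.2.1)
    (fun _ => (0 : Rn n × Rn n →L[ℝ] Rn n)) (fun _ => (0 : Rn n × Rn n →L[ℝ] Rn n))
    (fun j => lam j.1 • pu)
    (μ := fun j => lam j.1 * japanese j.2.1) (by simp) (by simp)
    (hsm npu fun j => hla _) (fun j => by
      rw [norm_smul, Real.norm_of_nonneg (hl0 _).le]
      exact mul_le_mul_of_nonneg_left (npu.trans (one_le_japanese _)) (hl0 _).le)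
    (fun j => by
      rw [norm_smul, Real.norm_of_nonneg (hl0 _).le]
      exact mul_le_mul_of_nonneg_left (norm_le_japanese _) (hl0 _).le)).mono_one
      (W₂ := V) fun j => le_of_eq (by
        simp only [V, Real.rpow_two]
        linear_combination (japanese j.2.1 ^ 2) * hl2 j.1)).cexp hV
  have h2 : JetBound (fun (j : κ × (Rn n × Rn n)) h => 1 -
      χ ((japanese (ξ j.1))⁻¹ • gradX ψ (x j.1) (ξ j.1) + j.2.2 + pζ h)) fun _ => 1 := by
    have e1 : JetBound (fun (_ : κ × (Rn n × Rn n)) (_ : Rn n × Rn n) => (1 : ℝ)) fun _ => 1 :=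
      JetBound.const fun _ => by simp
    have e2 := (jetBound_translates (f := fun v : Rn n => χ v) χ.contDiff
      χ.hasCompactSupport).reindex fun j : κ × (Rn n × Rn n) =>
        (japanese (ξ j.1))⁻¹ • gradX ψ (x j.1) (ξ j.1) + j.2.2
    exact e1.sub (e2.comp_clm (fun _ => pζ) 1 fun _ => npζ)
  have hη : ∀ j, η j = japanese (ξ j.1) • ((japanese (ξ j.1))⁻¹ • gradX ψ (x j.1) (ξ j.1)
      + j.2.2) := fun j => by
    rw [smul_add, smul_smul, mul_inv_cancel₀ (japanese_pos _).ne', one_smul]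
  -- outside of this set the amplitude vanishes
  let S : κ × (Rn n × Rn n) → Prop := fun j =>
    χ.rIn ≤ ‖(japanese (ξ j.1))⁻¹ • gradX ψ (x j.1) (ξ j.1) + j.2.2‖
  have hS : ∀ j, S j → japanese (ξ j.1) ≤ χ.rIn⁻¹ * japanese (η j) := fun j hj => by
    have h3 := norm_le_japanese (η j)
    rw [hη j, norm_smul, Real.norm_of_nonneg (japanese_pos _).le, ← hη j] at h3
    rw [← div_eq_inv_mul, le_div_iff₀ χ.rIn_pos]
    exact (mul_le_mul_of_nonneg_left hj (japanese_pos _).le).trans h3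
  have hr : ∀ j : {j // S j}, ‖japanese (ξ j.1.1) * (japanese (η j.1))⁻¹‖ ≤ χ.rIn⁻¹ := fun j => by
    rw [Real.norm_of_nonneg (mul_nonneg (japanese_pos _).le (inv_nonneg.2 (japanese_pos _).le)),
      ← div_eq_mul_inv, div_le_iff₀ (japanese_pos _)]
    exact hS j.1 j.2
  have hVl : ∀ j : {j // S j}, ‖lam j.1.1 * (V j.1)⁻¹‖ ≤ 1 := fun j => by
    rw [norm_mul]
    exact mul_le_one₀ (hla _) (norm_nonneg _) (hVi _)
  have h3 := D.jet_left_comp (fun j : {j // S j} => x j.1.1 + lam j.1.1 • j.1.2.1)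
    (fun j => ξ j.1.1) (fun j => z j.1.1) (fun j => η j.1)
    (JetBound.clm_bounded (hsm npu hVl)) (JetBound.zero (E := Rn n × Rn n)) JetBound.zero
    (JetBound.clm_bounded (hsm npζ hr)) (by simp) (by simp) (by simp) (by simp)
  have h4 := D.jet_right_comp (fun j : {j // S j} => x j.1.1) (fun j => η j.1)
    (JetBound.zero (E := Rn n × Rn n)) (JetBound.clm_bounded (hsm npζ hr)) (by simp) (by simp)
  obtain ⟨C, hC0, hC⟩ := D.norm_gradX_le
  -- the size of `η` on the support
  set K : ℝ := 2 + C + χ.rIn⁻¹ with hK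
  have hr0 := inv_pos.2 χ.rIn_pos
  have hup : ∀ j, japanese (η j) ≤ K * japanese j.2.2 * japanese (ξ j.1) := fun j => by
    have e1 := japanese_le_one_add_norm (η j)
    have e2 : ‖η j‖ ≤ C * japanese (ξ j.1) + japanese (ξ j.1) * ‖j.2.2‖ := by
      refine (norm_add_le _ _).trans (add_le_add (hC _ _) ?_)
      rw [norm_smul, Real.norm_of_nonneg (japanese_pos _).le]
    have e3 := one_le_japanese (ξ j.1)
    have e4 := one_le_japanese j.2.2
    have e5 : ‖j.2.2‖ ≤ japanese j.2.2 := norm_le_japanese j.2.2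
    have e6 : japanese (ξ j.1) ≤ japanese j.2.2 * japanese (ξ j.1) :=
      le_mul_of_one_le_left (by linarith) e4
    have e8 : 1 ≤ japanese j.2.2 * japanese (ξ j.1) := by linarith
    have e9 := mul_le_mul_of_nonneg_left e6 hC0
    have e10 := mul_le_mul_of_nonneg_right e5 (japanese_pos (ξ j.1)).le
    have e11 : 0 ≤ χ.rIn⁻¹ * (japanese j.2.2 * japanese (ξ j.1)) := by positivity
    rw [hK]
    linarith
  have hlow : ∀ j, S j → japanese (ξ j.1) ≤ K * japanese j.2.2 * japanese (η j) := fun j hj => by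
    refine (hS j hj).trans (mul_le_mul_of_nonneg_right ?_ (japanese_pos _).le)
    have e4 := one_le_japanese j.2.2
    calc χ.rIn⁻¹ ≤ K := by rw [hK]; linarith
      _ ≤ K * japanese j.2.2 := le_mul_of_one_le_right (by rw [hK]; positivity) e4
  have hηs : ∀ (s : ℝ) j, S j →
      japanese (η j) ^ s ≤ K ^ |s| * (japanese (ξ j.1) ^ s * japanese j.2.2 ^ |s|) :=
    fun s j hj => by
      have e := rpow_le_of_comparable (japanese_pos (η j)) (japanese_pos (ξ j.1)) (hup j)
        (hlow j hj) s
      rw [Real.mul_rpow (by rw [hK]; positivity) (japanese_pos _).le] at e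
      linarith
  refine JetBound.of_subtype (P := S) ((((h2.ofReal.reindex Subtype.val).mul
    ((h1.reindex Subtype.val).mul (h3.mul h4))).congr' fun j h => ?_).mono
    (2 ^ |m₁| * (K ^ |m₄| * K ^ |t₂|)) (fun j => ?_) fun j => ?_) (fun j hj => ?_) fun j => ?_
  · have e1 : japanese (η j.1) • (japanese (ξ j.1.1) * (japanese (η j.1))⁻¹) • pζ h
        = japanese (ξ j.1.1) • h.2 := by
      rw [smul_smul]
      congr 1
      have := (japanese_pos (η j.1)).ne'
      field_simp
    have eu : x j.1.1 + lam j.1.1 • j.1.2.1 + (lam j.1.1 * (V j.1)⁻¹) • h.1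
        = x j.1.1 + lam j.1.1 • (j.1.2.1 + (V j.1)⁻¹ • h.1) := by module
    have eu' : x j.1.1 + (lam j.1.1 • j.1.2.1 + lam j.1.1 • (V j.1)⁻¹ • h.1)
        = x j.1.1 + lam j.1.1 • (j.1.2.1 + (V j.1)⁻¹ • h.1) := by module
    have eη : η j.1 + japanese (ξ j.1.1) • h.2
        = gradX ψ (x j.1.1) (ξ j.1.1) + japanese (ξ j.1.1) • (j.1.2.2 + h.2) := by
      simp only [η]
      module
    change ((1 - χ ((japanese (ξ j.1.1))⁻¹ • gradX ψ (x j.1.1) (ξ j.1.1) + j.1.2.2 + h.2) : ℝ) : ℂ)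
      * (Complex.exp (Complex.I * (phaseRemainder ψ (x j.1.1 + 0) (x j.1.1 + 0
        + (lam j.1.1 • j.1.2.1 + lam j.1.1 • (V j.1)⁻¹ • h.1)) (ξ j.1.1 + 0) : ℂ))
      * (b (x j.1.1 + lam j.1.1 • j.1.2.1 + (lam j.1.1 * (V j.1)⁻¹) • h.1) (ξ j.1.1 + 0)
          (z j.1.1 + 0) (η j.1 + japanese (η j.1) • (japanese (ξ j.1.1) * (japanese (η j.1))⁻¹) •
            pζ h) * q (x j.1.1 + 0) (η j.1 + japanese (η j.1) •
              (japanese (ξ j.1.1) * (japanese (η j.1))⁻¹) • pζ h))) = _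
    rw [e1, eu, eη, add_zero, add_zero, add_zero, eu', add_assoc _ j.1.2.2]
    rfl
  · have f1 : japanese (x j.1.1 + lam j.1.1 • j.1.2.1) ^ m₁
        ≤ 2 ^ |m₁| * (japanese (x j.1.1) ^ m₁ * japanese j.1.2.1 ^ |m₁|) := by
      refine (japanese_add_rpow_le _ _ _).trans ?_
      have := Real.rpow_le_rpow (japanese_pos _).le (japanese_smul_le (hla j.1.1) j.1.2.1)
        (abs_nonneg m₁)
      have := Real.rpow_nonneg (japanese_pos (x j.1.1)).le m₁
      gcongr
    have f2 := hηs m₄ j.1 j.2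
    have f3 := hηs t₂ j.1 j.2
    have p1 := japanese_pos (x j.1.1)
    have p2 := japanese_pos (z j.1.1)
    have p3 := japanese_pos (ξ j.1.1)
    have p4 := japanese_pos (x j.1.1 + lam j.1.1 • j.1.2.1)
    have p5 := japanese_pos (η j.1)
    have p6 := japanese_pos j.1.2.1
    have p7 := japanese_pos j.1.2.2
    have hK0 : 0 < K := by rw [hK]; positivity
    rw [one_mul, one_mul, Real.rpow_add p1, Real.rpow_add p3, Real.rpow_add p3, Real.rpow_add p7]
    calc _ ≤ 2 ^ |m₁| * (japanese (x j.1.1) ^ m₁ * japanese j.1.2.1 ^ |m₁|)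
          * japanese (ξ j.1.1) ^ m₂ * japanese (z j.1.1) ^ m₃
          * (K ^ |m₄| * (japanese (ξ j.1.1) ^ m₄ * japanese j.1.2.2 ^ |m₄|))
          * (japanese (x j.1.1) ^ t₁
            * (K ^ |t₂| * (japanese (ξ j.1.1) ^ t₂ * japanese j.1.2.2 ^ |t₂|))) := by gcongr
      _ = _ := by ring
  · have p1 := japanese_pos (x j.1.1)
    have p2 := japanese_pos (z j.1.1)
    have p3 := japanese_pos (ξ j.1.1)
    have p6 := japanese_pos j.1.2.1
    have p7 := japanese_pos j.1.2.2
    positivity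
  · have ho : ∀ᶠ v in 𝓝 ((japanese (ξ j.1))⁻¹ • gradX ψ (x j.1) (ξ j.1) + j.2.2), χ v = 1 :=
      χ.eventuallyEq_one_of_mem_ball (by simpa [S] using hj)
    have ht : Tendsto (fun h : Rn n × Rn n => (japanese (ξ j.1))⁻¹ • gradX ψ (x j.1) (ξ j.1)
        + (j.2 + scaleFst (V j)⁻¹ h).2) (𝓝 0)
        (𝓝 ((japanese (ξ j.1))⁻¹ • gradX ψ (x j.1) (ξ j.1) + j.2.2)) := by
      refine Continuous.tendsto' (by fun_prop) _ _ ?_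
      simp
    filter_upwards [ht.eventually ho] with h hh
    simp only [mainAmp, Pi.zero_apply]
    rw [hh]
    simp
  · have p1 := japanese_pos (x j.1)
    have p2 := japanese_pos (z j.1)
    have p3 := japanese_pos (ξ j.1)
    have p6 := japanese_pos j.2.1
    have p7 := japanese_pos j.2.2
    positivity

end CompositionData

end MainPart

/-! ### Nonstationary phase near zero frequency -/

section Splitting

variable {n : ℕ} {ψ : Rn n → Rn n → ℝ} {b : Rn n → Rn n → Rn n → Rn n → ℂ}
  {q : Rn n → Rn n → ℂ} {m₁ m₂ m₃ m₄ t₁ t₂ : ℝ} {κ : Type*}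

/-- The factor `exp (i (ψ(x + w, ξ) - ψ(x, ξ)))` of the amplitude. -/
def waveFactor (ψ : Rn n → Rn n → ℝ) (x ξ w : Rn n) : ℂ :=
  Complex.exp (Complex.I * ((ψ (x + w) ξ - ψ x ξ : ℝ) : ℂ))

theorem norm_waveFactor (x ξ w : Rn n) : ‖waveFactor ψ x ξ w‖ = 1 := by
  rw [waveFactor, mul_comm, Complex.norm_exp_ofReal_mul_I]

theorem contDiff_waveFactor (hψ : ContDiff ℝ ∞ fun p : Rn n × Rn n => ψ p.1 p.2) (x ξ : Rn n) :
    ContDiff ℝ ∞ (waveFactor ψ x ξ) :=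
  Complex.contDiff_exp.comp (contDiff_const.mul (Complex.ofRealCLM.contDiff.comp
    ((hψ.comp (by fun_prop : ContDiff ℝ ∞ fun w : Rn n => (x + w, ξ))).sub contDiff_const)))

/-- The amplitude of the part of the oscillatory integral near `η = 0`, without the factor
that oscillates in `w`. -/
def smallAmp (χ : Rn n → ℝ) (b : Rn n → Rn n → Rn n → Rn n → ℂ) (q : Rn n → Rn n → ℂ)
    (x z ξ : Rn n) (p : Rn n × Rn n) : ℂ :=
  (χ ((japanese ξ)⁻¹ • p.2) : ℂ) * (b (x + p.1) ξ z p.2 * q x p.2)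

/-- The splitting of the full amplitude by the cutoff `χ (η / ⟨ξ⟩)`. In the first part the linear term
of the phase is separated, which leaves `phaseRemainder`. -/
theorem fullAmp_eq (χ : Rn n → ℝ) (x z ξ : Rn n) (p : Rn n × Rn n) :
    CompositionData.fullAmp ψ b q ((x, z, ξ), p)
      = Complex.exp (Complex.I * ((inner ℝ p.1 (gradX ψ x ξ) : ℝ) : ℂ))
        * mainAmp χ ψ b q x z ξ (japanese ξ ^ (-(1 / 2) : ℝ) • japanese ξ • p.1,
            (japanese ξ)⁻¹ • (p.2 - gradX ψ x ξ))
        + waveFactor ψ x ξ p.1 * smallAmp χ b q x z ξ p := by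
  have hp := japanese_pos ξ
  have e1 : japanese ξ ^ (-(1 / 2) : ℝ) • japanese ξ ^ (-(1 / 2) : ℝ) • japanese ξ • p.1 = p.1 := by
    rw [smul_smul, smul_smul, ← Real.rpow_add hp]
    nth_rewrite 2 [← Real.rpow_one (japanese ξ)]
    rw [← Real.rpow_add hp]
    norm_num
  have e2 : gradX ψ x ξ + japanese ξ • (japanese ξ)⁻¹ • (p.2 - gradX ψ x ξ) = p.2 := by
    rw [smul_smul, mul_inv_cancel₀ hp.ne', one_smul, add_sub_cancel]
  have e3 : (japanese ξ)⁻¹ • gradX ψ x ξ + (japanese ξ)⁻¹ • (p.2 - gradX ψ x ξ)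
      = (japanese ξ)⁻¹ • p.2 := by
    rw [← smul_add, add_sub_cancel]
  have e4 : waveFactor ψ x ξ p.1 = Complex.exp (Complex.I * ((inner ℝ p.1 (gradX ψ x ξ) : ℝ) : ℂ))
      * Complex.exp (Complex.I * (phaseRemainder ψ x (x + p.1) ξ : ℂ)) := by
    rw [waveFactor, ← Complex.exp_add, phaseRemainder, sub_add_cancel_left, inner_neg_left]
    congr 1
    push_cast
    ring
  simp only [mainAmp, smallAmp, e1, e2, e3]
  change waveFactor ψ x ξ p.1 * (b (x + p.1) ξ z p.2 * q x p.2) = _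
  rw [e4]
  push_cast
  ring

/-- The gradient in `w` of the phase `ψ(x + w, ξ) - ψ(x, ξ) - w ⬝ η`. -/
def phaseGrad (ψ : Rn n → Rn n → ℝ) (x ξ : Rn n) (p : Rn n × Rn n) : Rn n :=
  gradX ψ (x + p.1) ξ - p.2

theorem contDiff_phaseGrad (hψ : ContDiff ℝ ∞ fun p : Rn n × Rn n => ψ p.1 p.2) (x ξ : Rn n) :
    ContDiff ℝ ∞ (phaseGrad ψ x ξ) :=
  ((contDiff_gradMap hψ).comp (by fun_prop :
    ContDiff ℝ ∞ fun p : Rn n × Rn n => (x + p.1, ξ))).sub contDiff_snd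

theorem dirD_kern_mul_waveFactor (hψ : ContDiff ℝ ∞ fun p : Rn n × Rn n => ψ p.1 p.2)
    (x ξ v : Rn n) (p : Rn n × Rn n) :
    dirD (v, 0) (fun p => kern p * waveFactor ψ x ξ p.1) p
      = Complex.I * ((inner ℝ (phaseGrad ψ x ξ p) v : ℝ) : ℂ)
        * (kern p * waveFactor ψ x ξ p.1) := by
  have h1 : HasFDerivAt (fun q : Rn n × Rn n => ψ (x + q.1) ξ - ψ x ξ)
      ((innerSL ℝ (gradX ψ (x + p.1) ξ)).comp (ContinuousLinearMap.fst ℝ _ _)) p :=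
    ((hasFDerivAt_gradX hψ (x + p.1) ξ).comp p (hasFDerivAt_fst.const_add x)).sub_const _
  have h2 : HasFDerivAt (fun q : Rn n × Rn n => waveFactor ψ x ξ q.1) _ p :=
    ((Complex.ofRealCLM.hasFDerivAt.comp p h1).const_mul Complex.I).cexp
  have h3 : dirD (v, 0) (fun q : Rn n × Rn n => waveFactor ψ x ξ q.1) p
      = Complex.I * ((inner ℝ (gradX ψ (x + p.1) ξ) v : ℝ) : ℂ) * waveFactor ψ x ξ p.1 := by
    rw [dirD, h2.fderiv]
    simp [waveFactor]
    ring
  have hs : ContDiff ℝ ∞ fun q : Rn n × Rn n => waveFactor ψ x ξ q.1 :=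
    (contDiff_waveFactor hψ x ξ).comp contDiff_fst
  rw [dirD_mul contDiff_kern hs]
  simp only
  rw [dirD_kern, h3, phaseGrad, inner_sub_left, inner_zero_right, real_inner_comm v p.2]
  push_cast
  ring

/-- The components of the vector field `∇Φ / |∇Φ|²`, where `∇Φ` is the gradient of the phase. -/
def phaseField (ψ : Rn n → Rn n → ℝ) (x ξ : Rn n) (j : Fin n) (p : Rn n × Rn n) : ℝ :=
  inner ℝ (phaseGrad ψ x ξ p) ((euclFrame n).vec j)
    * (inner ℝ (phaseGrad ψ x ξ p) (phaseGrad ψ x ξ p))⁻¹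

/-- The transpose of the operator `-i |∇Φ|⁻² ∇Φ ⬝ ∇`, which reproduces `exp (i Φ)`. -/
def phaseOp (ψ : Rn n → Rn n → ℝ) (x ξ : Rn n) (B : Rn n × Rn n → ℂ) (p : Rn n × Rn n) : ℂ :=
  Complex.I * ∑ j, dirD ((euclFrame n).vec j, 0)
    (fun p => (phaseField ψ x ξ j p : ℂ) * B p) p

theorem sum_inner_vec_sq (v : Rn n) :
    ∑ j, inner ℝ v ((euclFrame n).vec j) * inner ℝ v ((euclFrame n).vec j) = inner ℝ v v := by
  have h : ∀ j, inner ℝ v ((euclFrame n).vec j) = v j := fun j => by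
    simp [euclFrame, EuclideanSpace.inner_single_right]
  simp only [h, ← sq, sum_sq_eq, real_inner_self_eq_norm_sq]

/-- Families of amplitudes that vanish for `|η| > ρ ⟨ξ⟩`. -/
structure SmallAmp (ϖ : κ → ℝ) (τ m ρ : ℝ) (ξ : κ → Rn n) (B : κ → Rn n × Rn n → ℂ) : Prop where
  amp : Amp ϖ (fun _ => 1) 0 τ m B
  zero : ∀ k p, ρ * japanese (ξ k) < ‖p.2‖ → B k p = 0

theorem SmallAmp.eventually_zero {ϖ : κ → ℝ} {τ m ρ : ℝ} {ξ : κ → Rn n}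
    {B : κ → Rn n × Rn n → ℂ} (h : SmallAmp ϖ τ m ρ ξ B) {k : κ} {p : Rn n × Rn n}
    (hp : ρ * japanese (ξ k) < ‖p.2‖) : B k =ᶠ[𝓝 p] 0 := by
  have hc : Continuous fun p : Rn n × Rn n => ‖p.2‖ := by fun_prop
  filter_upwards [(isOpen_lt continuous_const hc).mem_nhds hp] with p' hp'
  exact h.zero k p' hp'

namespace CompositionData

/-- For `|η| ≤ ρ ⟨ξ⟩` the gradient of the phase is of order one in `⟨ξ⟩`. -/
theorem jet_phaseGrad (D : CompositionData ψ b q m₁ m₂ m₃ m₄ t₁ t₂) {ρ : ℝ}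
    (x ξ : κ → Rn n) (p : κ → Rn n × Rn n) {c : κ → ℝ}
    (hp : ∀ k, ‖(p k).2‖ ≤ ρ * japanese (ξ k)) (hc : ∀ k, |c k| ≤ 1) :
    JetBound (fun k h => phaseGrad ψ (x k) (ξ k) (p k + scaleFst (c k) h))
      fun k => japanese (ξ k) := by
  have h1 := (D.jet_grad.reindex fun k => (x k + (p k).1, ξ k)).comp_clm
    (fun k => (ContinuousLinearMap.inl ℝ (Rn n) (Rn n)).comp ((ContinuousLinearMap.fst ℝ (Rn n)
      (Rn n)).comp (scaleFst (c k)))) 1 fun k =>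
    (ContinuousLinearMap.opNorm_comp_le _ _).trans (mul_le_one₀
      (ContinuousLinearMap.norm_inl_le_one ℝ (Rn n) (Rn n)) (norm_nonneg _)
      ((ContinuousLinearMap.opNorm_comp_le _ _).trans (mul_le_one₀
        (ContinuousLinearMap.norm_fst_le _ _ _) (norm_nonneg _) (norm_scaleFst_le (hc k)))))
  have h2 := (JetBound.const (E := Rn n × Rn n) (c := fun k => (p k).2)
    (W := fun k => ρ * japanese (ξ k)) hp).mono (W₂ := fun k => japanese (ξ k)) ρ
    (fun _ => le_rfl) fun k => (japanese_pos _).le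
  have h3 := JetBound.clm (ι := κ) (A := fun _ => ContinuousLinearMap.snd ℝ (Rn n) (Rn n))
    (W := fun k => japanese (ξ k))
    fun k => (ContinuousLinearMap.norm_snd_le ℝ (Rn n) (Rn n)).trans (one_le_japanese _)
  refine (h1.sub (h2.add h3)).congr' fun k h => ?_
  simp [phaseGrad, gradMap, add_assoc]

variable {ρ : ℝ} {x ξ : κ → Rn n} {ϖ : κ → ℝ} {τ m : ℝ} {B : κ → Rn n × Rn n → ℂ}

theorem norm_phaseGrad_ge (hlow : ∀ k y, 2 * ρ * japanese (ξ k) ≤ ‖gradX ψ y (ξ k)‖) (k : κ)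
    {p : Rn n × Rn n} (hp : ‖p.2‖ ≤ ρ * japanese (ξ k)) :
    ρ * japanese (ξ k) ≤ ‖phaseGrad ψ (x k) (ξ k) p‖ := by
  have h1 := hlow k (x k + p.1)
  have h2 := norm_sub_norm_le (gradX ψ (x k + p.1) (ξ k)) p.2
  rw [phaseGrad]
  linarith

theorem inner_phaseGrad_pos (hρ : 0 < ρ)
    (hlow : ∀ k y, 2 * ρ * japanese (ξ k) ≤ ‖gradX ψ y (ξ k)‖) (k : κ)
    {p : Rn n × Rn n} (hp : ‖p.2‖ ≤ ρ * japanese (ξ k)) :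
    ρ ^ 2 * (japanese (ξ k) * japanese (ξ k))
      ≤ inner ℝ (phaseGrad ψ (x k) (ξ k) p) (phaseGrad ψ (x k) (ξ k) p) := by
  have h1 := norm_phaseGrad_ge (x := x) hlow k hp
  have h2 := mul_pos hρ (japanese_pos (ξ k))
  rw [real_inner_self_eq_norm_sq]
  nlinarith

/-- The gradient of the phase has size at least `ρ ⟨ξ⟩` where `|η| ≤ ρ ⟨ξ⟩`, so multiplication by a
component of the vector field gains a factor `⟨ξ⟩⁻¹`. -/
theorem smallAmp_phaseField (D : CompositionData ψ b q m₁ m₂ m₃ m₄ t₁ t₂) (hρ : 0 < ρ)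
    (hlow : ∀ k y, 2 * ρ * japanese (ξ k) ≤ ‖gradX ψ y (ξ k)‖) (hϖ : ∀ k, 0 ≤ ϖ k)
    (h : SmallAmp ϖ τ m ρ ξ B) (j : Fin n) :
    SmallAmp (fun k => ϖ k * (japanese (ξ k))⁻¹) τ m ρ ξ
      fun k p => (phaseField ψ (x k) (ξ k) j p : ℂ) * B k p := by
  have hpos := fun k p hp => inner_phaseGrad_pos (ψ := ψ) (x := x) hρ hlow k (p := p) hp
  refine ⟨⟨fun k => contDiff_iff_contDiffAt.2 fun p => ?_, ?_⟩, fun k p hp => by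
    rw [h.zero k p hp, mul_zero]⟩
  · by_cases hp : ‖p.2‖ ≤ ρ * japanese (ξ k)
    · have hG := (contDiff_phaseGrad D.smooth_phase (x k) (ξ k)).contDiffAt (x := p)
      have hne : inner ℝ (phaseGrad ψ (x k) (ξ k) p) (phaseGrad ψ (x k) (ξ k) p) ≠ 0 := by
        have := hpos k p hp
        have h2 := japanese_pos (ξ k)
        have : 0 < ρ ^ 2 * (japanese (ξ k) * japanese (ξ k)) := by positivity
        linarith
      exact (Complex.ofRealCLM.contDiff.contDiffAt.comp p ((hG.inner ℝ contDiffAt_const).mul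
        ((hG.inner ℝ hG).inv hne))).mul (h.amp.smooth k).contDiffAt
    · refine contDiffAt_const (c := (0 : ℂ)).congr_of_eventuallyEq ?_
      filter_upwards [h.eventually_zero (not_le.1 hp)] with p' hp'
      rw [hp', Pi.zero_apply, mul_zero]
  · have hG := D.jet_phaseGrad (fun i : {i : κ × (Rn n × Rn n) // ‖i.2.2‖ ≤ ρ * japanese (ξ i.1)} =>
      x i.1.1) (fun i => ξ i.1.1) (fun i => i.1.2)
      (c := fun i => (1 * japanese i.1.2.1 ^ (0 : ℝ))⁻¹) (fun i => i.2)
      fun i => abs_inv_scale_le le_rfl le_rfl _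
    have h1 := hG.inner (JetBound.const (E := Rn n × Rn n)
      (c := fun _ : {i : κ × (Rn n × Rn n) // ‖i.2.2‖ ≤ ρ * japanese (ξ i.1)} =>
        (euclFrame n).vec j) (W := fun _ => 1) fun _ => Amp.norm_vec_le j)
    have h2 := (hG.inner hG).inv (c := ρ ^ 2) (by positivity)
      (fun i => mul_pos (japanese_pos _) (japanese_pos _)) fun i => by
        rw [map_zero, add_zero]
        exact hpos _ _ i.2
    refine JetBound.of_subtype (P := fun i => ‖i.2.2‖ ≤ ρ * japanese (ξ i.1))
      ((((h1.mul h2).ofReal.mul (h.amp.jet.reindex Subtype.val)).mono_one fun i => le_of_eq ?_).congr'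
        fun i h => rfl) (fun i hi => ?_) fun i => ?_
    · have := (japanese_pos (ξ i.1.1)).ne'
      field_simp
    · have ht : Tendsto (fun h : Rn n × Rn n => i.2
          + scaleFst (1 * japanese i.2.1 ^ (0 : ℝ))⁻¹ h) (𝓝 0) (𝓝 i.2) :=
        Continuous.tendsto' (by fun_prop) _ _ (by simp)
      filter_upwards [ht.eventually (h.eventually_zero (not_le.1 hi))] with p' hp'
      rw [hp', Pi.zero_apply, mul_zero, Pi.zero_apply]
    · have h1 := hϖ i.1
      have h2 := japanese_pos (ξ i.1)
      have h3 := japanese_pos i.2.1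
      have h4 := japanese_pos i.2.2
      positivity

theorem smallAmp_phaseOp (D : CompositionData ψ b q m₁ m₂ m₃ m₄ t₁ t₂) (hρ : 0 < ρ)
    (hlow : ∀ k y, 2 * ρ * japanese (ξ k) ≤ ‖gradX ψ y (ξ k)‖) (hϖ : ∀ k, 0 ≤ ϖ k)
    (h : SmallAmp ϖ τ m ρ ξ B) : SmallAmp (fun k => ϖ k * (japanese (ξ k))⁻¹) τ m ρ ξ
      fun k => phaseOp ψ (x k) (ξ k) (B k) := by
  have h1 := fun j => D.smallAmp_phaseField (x := x) hρ hlow hϖ h j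
  refine ⟨?_, fun k p hp => ?_⟩
  · have h2 := (Amp.sum Finset.univ fun j _ => (h1 j).amp.dirD_fst (fun _ => le_rfl)
      (Amp.norm_vec_le j)).const_mul Complex.I
    simp only [mul_one, add_zero] at h2
    exact h2
  · rw [phaseOp, Finset.sum_eq_zero, mul_zero]
    intro j _
    have h2 := ((h1 j).eventually_zero hp).dirD ((euclFrame n).vec j, 0)
    rw [h2.eq_of_nhds]
    simp [dirD]

theorem integrable_kern_waveFactor_mul (D : CompositionData ψ b q m₁ m₂ m₃ m₄ t₁ t₂)
    (h : Amp ϖ (fun _ => 1) 0 τ m B) (hτ : τ ≤ -(n + 1 : ℝ)) (hm : m ≤ -(n + 1 : ℝ))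
    (x ξ : κ → Rn n) (k : κ) :
    MeasureTheory.Integrable fun p => kern p * waveFactor ψ (x k) (ξ k) p.1 * B k p := by
  obtain ⟨C, hC0, hC⟩ := h.norm_le
  refine ((integrable_weight hτ hm).const_mul (C * ϖ k)).mono'
    (((contDiff_kern.mul ((contDiff_waveFactor D.smooth_phase (x k) (ξ k)).comp
      contDiff_fst)).mul (h.smooth k)).continuous.aestronglyMeasurable)
    (Eventually.of_forall fun p => ?_)
  rw [norm_mul, norm_mul, norm_kern, norm_waveFactor, one_mul, one_mul]
  refine (hC k p).trans (le_of_eq ?_)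
  ring

/-- Integration by parts along the vector field `∇Φ / |∇Φ|²`. -/
theorem integral_phaseOp (D : CompositionData ψ b q m₁ m₂ m₃ m₄ t₁ t₂) (hρ : 0 < ρ)
    (hlow : ∀ k y, 2 * ρ * japanese (ξ k) ≤ ‖gradX ψ y (ξ k)‖) (hϖ : ∀ k, 0 ≤ ϖ k)
    (h : SmallAmp ϖ τ m ρ ξ B) (hτ : τ ≤ -(n + 1 : ℝ)) (hm : m ≤ -(n + 1 : ℝ)) (k : κ) :
    ∫ p, kern p * waveFactor ψ (x k) (ξ k) p.1 * phaseOp ψ (x k) (ξ k) (B k) p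
      = ∫ p, kern p * waveFactor ψ (x k) (ξ k) p.1 * B k p := by
  have h1 := fun j => D.smallAmp_phaseField (x := x) hρ hlow hϖ h j
  set u : Rn n × Rn n → ℂ := fun p => kern p * waveFactor ψ (x k) (ξ k) p.1 with hu
  have hus : ContDiff ℝ ∞ u := contDiff_kern.mul
    ((contDiff_waveFactor D.smooth_phase (x k) (ξ k)).comp contDiff_fst)
  have hdu : ∀ j p, dirD ((euclFrame n).vec j, 0) u p = Complex.I
      * ((inner ℝ (phaseGrad ψ (x k) (ξ k) p) ((euclFrame n).vec j) : ℝ) : ℂ) * u p := fun j p =>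
    dirD_kern_mul_waveFactor D.smooth_phase (x k) (ξ k) _ p
  have hd : ∀ j, Amp (fun k => ϖ k * (japanese (ξ k))⁻¹) (fun _ => 1) 0 τ m fun k =>
      dirD ((euclFrame n).vec j, 0) fun p => (phaseField ψ (x k) (ξ k) j p : ℂ) * B k p := fun j => by
    have h2 := (h1 j).amp.dirD_fst (fun _ => le_rfl) (Amp.norm_vec_le j)
    simp only [mul_one, add_zero] at h2
    exact h2
  have hi1 := fun j => D.integrable_kern_waveFactor_mul (hd j) hτ hm x ξ k
  have hi2 := fun j => D.integrable_kern_waveFactor_mul (h1 j).amp hτ hm x ξ k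
  -- the vector field has bounded pairing with the gradient of the phase
  have hi3 : ∀ j, MeasureTheory.Integrable fun p => dirD ((euclFrame n).vec j, 0) u p
      * ((phaseField ψ (x k) (ξ k) j p : ℂ) * B k p) := fun j => by
    refine (D.integrable_kern_waveFactor_mul h.amp hτ hm x ξ k).mono
      ((hus.dirD _).mul ((h1 j).amp.smooth k)).continuous.aestronglyMeasurable
      (Eventually.of_forall fun p => ?_)
    have e1 : |inner ℝ (phaseGrad ψ (x k) (ξ k) p) ((euclFrame n).vec j)
        * phaseField ψ (x k) (ξ k) j p| ≤ 1 := by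
      have e2 := abs_real_inner_le_norm (phaseGrad ψ (x k) (ξ k) p) ((euclFrame n).vec j)
      have e3 := e2.trans (mul_le_of_le_one_right (norm_nonneg _) (Amp.norm_vec_le j))
      rw [phaseField, ← mul_assoc, abs_mul, abs_inv, real_inner_self_eq_norm_sq,
        abs_of_nonneg (sq_nonneg ‖phaseGrad ψ (x k) (ξ k) p‖), ← div_eq_mul_inv, abs_mul, ← sq]
      exact div_le_one_of_le₀ (pow_le_pow_left₀ (abs_nonneg _) e3 2) (sq_nonneg _)
    rw [abs_mul] at e1
    calc _ = (|inner ℝ (phaseGrad ψ (x k) (ξ k) p) ((euclFrame n).vec j)|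
          * |phaseField ψ (x k) (ξ k) j p|) * ‖u p * B k p‖ := by
          simp only [hdu, norm_mul, Complex.norm_I, Complex.norm_real, Real.norm_eq_abs, one_mul]
          ring
      _ ≤ _ := mul_le_of_le_one_left (norm_nonneg _) e1
  have hibp : ∀ j, ∫ p, u p * dirD ((euclFrame n).vec j, 0)
      (fun p => (phaseField ψ (x k) (ξ k) j p : ℂ) * B k p) p
      = -∫ p, dirD ((euclFrame n).vec j, 0) u p * ((phaseField ψ (x k) (ξ k) j p : ℂ) * B k p) :=
    fun j => integral_mul_fderiv_eq_neg_fderiv_mul_of_integrable (hi3 j) (hi1 j) (hi2 j)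
      (fun p _ => hus.differentiable (by simp) p)
      fun p _ => ((h1 j).amp.smooth k).differentiable (by simp) p
  calc ∫ p, u p * phaseOp ψ (x k) (ξ k) (B k) p
      = Complex.I * ∑ j, ∫ p, u p * dirD ((euclFrame n).vec j, 0)
          (fun p => (phaseField ψ (x k) (ξ k) j p : ℂ) * B k p) p := by
        rw [← MeasureTheory.integral_finsetSum _ fun j _ => hi1 j,
          ← MeasureTheory.integral_const_mul]
        refine MeasureTheory.integral_congr_ae (Eventually.of_forall fun p => ?_)
        simp only [phaseOp, Finset.mul_sum]
        refine Finset.sum_congr rfl fun j _ => ?_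
        ring
    _ = ∫ p, u p * B k p := by
        simp only [hibp]
        rw [Finset.sum_neg_distrib, ← MeasureTheory.integral_finsetSum _ fun j _ => hi3 j,
          ← MeasureTheory.integral_neg, ← MeasureTheory.integral_const_mul]
        refine MeasureTheory.integral_congr_ae (Eventually.of_forall fun p => ?_)
        simp only
        by_cases hp : ‖p.2‖ ≤ ρ * japanese (ξ k)
        · have hpos := inner_phaseGrad_pos (ψ := ψ) (x := x) hρ hlow k hp
          have hne : inner ℝ (phaseGrad ψ (x k) (ξ k) p) (phaseGrad ψ (x k) (ξ k) p) ≠ 0 := by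
            have h2 := japanese_pos (ξ k)
            have : 0 < ρ ^ 2 * (japanese (ξ k) * japanese (ξ k)) := by positivity
            linarith
          have e : ∑ j, inner ℝ (phaseGrad ψ (x k) (ξ k) p) ((euclFrame n).vec j)
              * phaseField ψ (x k) (ξ k) j p = 1 := by
            simp only [phaseField, ← mul_assoc]
            rw [← Finset.sum_mul, sum_inner_vec_sq, mul_inv_cancel₀ hne]
          have e' : ∑ j, dirD ((euclFrame n).vec j, 0) u p
              * ((phaseField ψ (x k) (ξ k) j p : ℂ) * B k p) = Complex.I * (u p * B k p) := by
            have e2 : ((∑ j, inner ℝ (phaseGrad ψ (x k) (ξ k) p) ((euclFrame n).vec j)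
              * phaseField ψ (x k) (ξ k) j p : ℝ) : ℂ) = 1 := by rw [e]; simp
            rw [← mul_one (Complex.I * (u p * B k p)), ← e2]
            push_cast
            rw [Finset.mul_sum]
            refine Finset.sum_congr rfl fun j _ => ?_
            rw [hdu]
            ring
          rw [e']
          linear_combination (-(u p * B k p)) * Complex.I_sq
        · rw [h.zero k p (not_le.1 hp)]
          simp

/-- Nonstationary phase: each integration by parts along the gradient of the phase gains a factor
`⟨ξ⟩⁻¹`. -/
theorem norm_integral_smallAmp_le (M : ℕ) (D : CompositionData ψ b q m₁ m₂ m₃ m₄ t₁ t₂) (hρ : 0 < ρ)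
    (hlow : ∀ k y, 2 * ρ * japanese (ξ k) ≤ ‖gradX ψ y (ξ k)‖) (hϖ : ∀ k, 0 ≤ ϖ k)
    (h : SmallAmp ϖ τ m ρ ξ B) (hτ : τ ≤ -(n + 1 : ℝ)) (hm : m ≤ -(n + 1 : ℝ)) :
    ∃ C : ℝ, 0 ≤ C ∧ ∀ k, ‖∫ p, kern p * waveFactor ψ (x k) (ξ k) p.1 * B k p‖
      ≤ C * (ϖ k * (japanese (ξ k))⁻¹ ^ M) := by
  induction M generalizing ϖ B with
  | zero =>
    obtain ⟨C, hC0, hC⟩ := h.amp.norm_le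
    refine ⟨C * ∫ p : Rn n × Rn n, japanese p.1 ^ τ * japanese p.2 ^ m, mul_nonneg hC0
      (MeasureTheory.integral_nonneg fun p => mul_nonneg (Real.rpow_nonneg (japanese_pos _).le _)
        (Real.rpow_nonneg (japanese_pos _).le _)), fun k => ?_⟩
    refine (MeasureTheory.norm_integral_le_of_norm_le ((integrable_weight hτ hm).const_mul
      (C * ϖ k)) (Eventually.of_forall fun p => ?_)).trans (le_of_eq ?_)
    · rw [norm_mul, norm_mul, norm_kern, norm_waveFactor, one_mul, one_mul]
      refine (hC k p).trans (le_of_eq ?_)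
      ring
    · rw [MeasureTheory.integral_const_mul]
      ring
  | succ M ih =>
    obtain ⟨C, hC0, hC⟩ := ih (fun k => mul_nonneg (hϖ k) (inv_nonneg.2 (japanese_pos _).le))
      (D.smallAmp_phaseOp (x := x) hρ hlow hϖ h)
    refine ⟨C, hC0, fun k => ?_⟩
    rw [← D.integral_phaseOp hρ hlow hϖ h hτ hm k]
    refine (hC k).trans (le_of_eq ?_)
    ring

end CompositionData

end Splitting

/-! ### The expansion without derivatives -/

section PointwiseExpansion

variable {n : ℕ} {ψ : Rn n → Rn n → ℝ} {b : Rn n → Rn n → Rn n → Rn n → ℂ}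
  {q : Rn n → Rn n → ℂ} {m₁ m₂ m₃ m₄ t₁ t₂ : ℝ} {κ : Type*}

theorem oscT_mul_fst {e : Rn n → ℂ} (he : ContDiff ℝ ∞ e) {B : Rn n × Rn n → ℂ}
    (hB : ContDiff ℝ ∞ B) : oscT (fun p => e p.1 * B p) = fun p => e p.1 * oscT B p := by
  have he' : ContDiff ℝ ∞ fun p : Rn n × Rn n => e p.1 := he.comp contDiff_fst
  have h1 : ∀ (v : Rn n) {f : Rn n × Rn n → ℂ}, ContDiff ℝ ∞ f →
      dirD (0, v) (fun p => e p.1 * f p) = fun p => e p.1 * dirD (0, v) f p := by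
    intro v f hf
    rw [dirD_mul he' hf]
    funext p
    rw [dirD_comp_fst v p (he.differentiable (by simp) p.1), zero_mul, zero_add]
  funext p
  simp only [oscT, oscOp]
  simp only [h1 _ hB, h1 _ (hB.dirD _)]
  rw [← Finset.mul_sum]
  ring

theorem iterate_oscT_mul_fst {e : Rn n → ℂ} (he : ContDiff ℝ ∞ e) {B : Rn n × Rn n → ℂ}
    (hB : ContDiff ℝ ∞ B) (l : ℕ) : ContDiff ℝ ∞ (oscT^[l] B) ∧
      oscT^[l] (fun p => e p.1 * B p) = fun p => e p.1 * oscT^[l] B p := by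
  induction l with
  | zero => exact ⟨hB, rfl⟩
  | succ l ih =>
    simp only [Function.iterate_succ_apply', ih.2]
    exact ⟨ih.1.oscOp contDiff_weight_fst, oscT_mul_fst he ih.1⟩

theorem SmallAmp.iterate_oscT {ϖ : κ → ℝ} {τ m ρ : ℝ} {ξ : κ → Rn n} {B : κ → Rn n × Rn n → ℂ}
    (h : SmallAmp ϖ τ m ρ ξ B) (l : ℕ) :
    SmallAmp ϖ (τ - 2 * l) m ρ ξ fun k => oscT^[l] (B k) := by
  induction l with
  | zero => simpa using h
  | succ l ih =>
    simp only [Function.iterate_succ_apply']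
    refine ⟨?_, fun k p hp => ?_⟩
    · have := ih.amp.oscT (fun _ => le_rfl) le_rfl
      rwa [show τ - 2 * (l : ℝ) - 2 = τ - 2 * ((l + 1 : ℕ) : ℝ) by push_cast; ring] at this
    · have h1 := (ih.eventually_zero hp).oscOp (d := fun j => (0, (euclFrame n).vec j))
        (J := fun p => japanese p.1 ^ (-2 : ℝ))
      refine h1.eq_of_nhds.trans ?_
      have : ∀ v : Rn n × Rn n, dirD v (0 : Rn n × Rn n → ℂ) = 0 := fun v => by
        funext p
        simp [dirD]
      simp [oscOp, this]

namespace CompositionData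

theorem amp_waveFactor (D : CompositionData ψ b q m₁ m₂ m₃ m₄ t₁ t₂) (x ξ : κ → Rn n) :
    Amp (fun _ => 1) (fun k => japanese (ξ k)) 1 0 0
      fun k p => waveFactor ψ (x k) (ξ k) p.1 := by
  refine ⟨fun k => (contDiff_waveFactor D.smooth_phase _ _).comp contDiff_fst, ?_⟩
  have h1 := (jetBound_phaseDifference D.smooth_phase D.jet_grad
    (fun j : κ × (Rn n × Rn n) => x j.1) (fun j => ξ j.1) (fun j => j.2.1)
    (fun _ => (0 : Rn n × Rn n →L[ℝ] Rn n)) (fun _ => (0 : Rn n × Rn n →L[ℝ] Rn n))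
    (fun _ => ContinuousLinearMap.fst ℝ (Rn n) (Rn n)) (μ := fun j => japanese j.2.1 ^ (1 : ℝ))
    (by simp) (by simp) (fun _ => ContinuousLinearMap.norm_fst_le ℝ (Rn n) (Rn n))
    (fun j => (ContinuousLinearMap.norm_fst_le ℝ (Rn n) (Rn n)).trans
      (by rw [Real.rpow_one]; exact one_le_japanese _))
    (fun j => by rw [Real.rpow_one]; exact norm_le_japanese _)).cexp
    fun j => one_le_scale (one_le_japanese _) zero_le_one _
  refine (h1.congr' fun j h => ?_).mono_one fun j => by simp
  simp [waveFactor]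

/-- Where `|η| ≤ ρ ⟨ξ⟩` the order in `η` can be lowered to any `m₀`, at the expense of powers of `⟨ξ⟩`. -/
theorem smallAmp_smallAmp (D : CompositionData ψ b q m₁ m₂ m₃ m₄ t₁ t₂)
    (χ : ContDiffBump (0 : Rn n)) (x z ξ : κ → Rn n) (m₀ : ℝ) :
    SmallAmp (fun k => japanese (x k) ^ (m₁ + t₁) * japanese (z k) ^ m₃
        * japanese (ξ k) ^ (m₂ + |m₄ + t₂ - m₀|)) |m₁| m₀ χ.rOut ξ
      fun k => smallAmp χ b q (x k) (z k) (ξ k) := by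
  have hzero : ∀ k (p : Rn n × Rn n), χ.rOut * japanese (ξ k) < ‖p.2‖ →
      smallAmp χ b q (x k) (z k) (ξ k) p = 0 := fun k p hp => by
    rw [smallAmp, χ.zero_of_le_dist, Complex.ofReal_zero, zero_mul]
    rw [dist_zero_right, norm_smul, Real.norm_of_nonneg (inv_nonneg.2 (japanese_pos _).le),
      ← div_eq_inv_mul, le_div_iff₀ (japanese_pos _)]
    exact hp.le
  have hsmooth : ∀ k, ContDiff ℝ ∞ (smallAmp χ b q (x k) (z k) (ξ k)) := fun k =>
    (Complex.ofRealCLM.contDiff.comp (χ.contDiff.comp (by fun_prop))).mul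
      ((D.smooth_left.comp (by fun_prop : ContDiff ℝ ∞ fun p : Rn n × Rn n =>
        (x k + p.1, ξ k, z k, p.2))).mul
      (D.smooth_right.comp (by fun_prop : ContDiff ℝ ∞ fun p : Rn n × Rn n => (x k, p.2))))
  refine ⟨⟨hsmooth, ?_⟩, hzero⟩
  let S : κ × (Rn n × Rn n) → Prop := fun j => ‖j.2.2‖ ≤ χ.rOut * japanese (ξ j.1)
  let V : κ × (Rn n × Rn n) → ℝ := fun j => (1 * japanese j.2.1 ^ (0 : ℝ))⁻¹
  have hV : ∀ j, ‖V j‖ ≤ 1 := fun j => abs_inv_scale_le le_rfl le_rfl _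
  have hsm : ∀ {A : Rn n × Rn n →L[ℝ] Rn n} {c : {j // S j} → ℝ},
      ‖A‖ ≤ 1 → (∀ j, ‖c j‖ ≤ 1) → ∀ j, ‖c j • A‖ ≤ 1 := by
    intro A c hA hc j
    rw [norm_smul]
    exact mul_le_one₀ (hc j) (norm_nonneg _) hA
  let pw := ContinuousLinearMap.fst ℝ (Rn n) (Rn n)
  let pη := ContinuousLinearMap.snd ℝ (Rn n) (Rn n)
  have npw : ‖pw‖ ≤ 1 := ContinuousLinearMap.norm_fst_le _ _ _
  have npη : ‖pη‖ ≤ 1 := ContinuousLinearMap.norm_snd_le _ _ _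
  have h1 := ((jetBound_translates (f := fun v : Rn n => χ v) χ.contDiff
    χ.hasCompactSupport).reindex fun j : {j // S j} => (japanese (ξ j.1.1))⁻¹ • j.1.2.2).comp_clm
      (fun j => (japanese (ξ j.1.1))⁻¹ • pη) 1 (hsm npη fun j => abs_inv_japanese_le _)
  have h2 := D.jet_left_comp (fun j : {j // S j} => x j.1.1 + j.1.2.1)
    (fun j => ξ j.1.1) (fun j => z j.1.1) (fun j => j.1.2.2)
    (JetBound.clm_bounded (hsm npw fun j => hV j.1)) (JetBound.zero (E := Rn n × Rn n))
    JetBound.zero (JetBound.clm_bounded (A := fun j => (japanese j.1.2.2)⁻¹ • pη)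
      (hsm npη fun j => abs_inv_japanese_le _)) (by simp) (by simp) (by simp) (by simp)
  have h3 := D.jet_right_comp (fun j : {j // S j} => x j.1.1) (fun j => j.1.2.2)
    (JetBound.zero (E := Rn n × Rn n)) (JetBound.clm_bounded
      (A := fun j => (japanese j.1.2.2)⁻¹ • pη) (hsm npη fun j => abs_inv_japanese_le _))
    (by simp) (by simp)
  have hr := χ.rOut_pos
  refine JetBound.of_subtype (P := S) (((h1.ofReal.mul (h2.mul h3)).congr' fun j h => ?_).mono
    (2 ^ |m₁| * (1 + χ.rOut) ^ |m₄ + t₂ - m₀|) (fun j => ?_) fun j => ?_) (fun j hj => ?_)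
    fun j => ?_
  · have e1 : japanese j.1.2.2 • ((japanese j.1.2.2)⁻¹ • pη) h = h.2 := by
      change japanese j.1.2.2 • (japanese j.1.2.2)⁻¹ • h.2 = h.2
      rw [smul_smul, mul_inv_cancel₀ (japanese_pos _).ne', one_smul]
    change ((χ ((japanese (ξ j.1.1))⁻¹ • j.1.2.2 + (japanese (ξ j.1.1))⁻¹ • h.2) : ℝ) : ℂ)
      * (b (x j.1.1 + j.1.2.1 + V j.1 • h.1) (ξ j.1.1 + 0) (z j.1.1 + 0)
        (j.1.2.2 + japanese j.1.2.2 • ((japanese j.1.2.2)⁻¹ • pη) h) * q (x j.1.1 + 0)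
        (j.1.2.2 + japanese j.1.2.2 • ((japanese j.1.2.2)⁻¹ • pη) h)) = _
    rw [e1, ← smul_add, add_zero, add_zero, add_zero, add_assoc]
    rfl
  · have f1 := japanese_add_rpow_le (x j.1.1) j.1.2.1 m₁
    have p1 := japanese_pos (x j.1.1)
    have p2 := japanese_pos (z j.1.1)
    have p3 := japanese_pos (ξ j.1.1)
    have p5 := japanese_pos j.1.2.2
    have p6 := japanese_pos j.1.2.1
    have f2 : japanese j.1.2.2 ^ (m₄ + t₂)
        ≤ japanese j.1.2.2 ^ m₀ * ((1 + χ.rOut) ^ |m₄ + t₂ - m₀|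
          * japanese (ξ j.1.1) ^ |m₄ + t₂ - m₀|) := by
      have hj : ‖j.1.2.2‖ ≤ χ.rOut * japanese (ξ j.1.1) := j.2
      have h4 : japanese j.1.2.2 ≤ (1 + χ.rOut) * japanese (ξ j.1.1) := by
        have := japanese_le_one_add_norm j.1.2.2
        have := one_le_japanese (ξ j.1.1)
        linarith
      rw [← Real.mul_rpow (by positivity) p3.le]
      calc japanese j.1.2.2 ^ (m₄ + t₂)
          = japanese j.1.2.2 ^ m₀ * japanese j.1.2.2 ^ (m₄ + t₂ - m₀) := by
            rw [← Real.rpow_add p5]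
            congr 1
            ring
        _ ≤ japanese j.1.2.2 ^ m₀ * japanese j.1.2.2 ^ |m₄ + t₂ - m₀| := by
            gcongr
            · exact one_le_japanese _
            · exact le_abs_self _
        _ ≤ _ := by gcongr
    rw [one_mul]
    calc _ = japanese (x j.1.1 + j.1.2.1) ^ m₁ * japanese (ξ j.1.1) ^ m₂
          * japanese (z j.1.1) ^ m₃ * japanese (x j.1.1) ^ t₁ * japanese j.1.2.2 ^ (m₄ + t₂) := by
          rw [Real.rpow_add p5]
          ring
      _ ≤ (2 ^ |m₁| * (japanese (x j.1.1) ^ m₁ * japanese j.1.2.1 ^ |m₁|))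
          * japanese (ξ j.1.1) ^ m₂ * japanese (z j.1.1) ^ m₃ * japanese (x j.1.1) ^ t₁
          * (japanese j.1.2.2 ^ m₀ * ((1 + χ.rOut) ^ |m₄ + t₂ - m₀|
            * japanese (ξ j.1.1) ^ |m₄ + t₂ - m₀|)) := by gcongr
      _ = _ := by
          rw [Real.rpow_add p1, Real.rpow_add p3]
          ring
  · have p1 := japanese_pos (x j.1.1)
    have p2 := japanese_pos (z j.1.1)
    have p3 := japanese_pos (ξ j.1.1)
    have p5 := japanese_pos j.1.2.2
    have p6 := japanese_pos j.1.2.1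
    positivity
  · have ht : Tendsto (fun h : Rn n × Rn n => j.2 + scaleFst (V j) h) (𝓝 0) (𝓝 j.2) :=
      Continuous.tendsto' (by fun_prop) _ _ (by simp)
    have hc : Continuous fun p : Rn n × Rn n => ‖p.2‖ := by fun_prop
    filter_upwards [ht.eventually ((isOpen_lt continuous_const hc).mem_nhds (not_le.1 hj))]
      with h hh
    exact hzero _ _ hh
  · have p1 := japanese_pos (x j.1)
    have p2 := japanese_pos (z j.1)
    have p3 := japanese_pos (ξ j.1)
    have p5 := japanese_pos j.2.2
    have p6 := japanese_pos j.2.1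
    positivity

/-- The part of the oscillatory integral near `η = 0` is rapidly decreasing in `ξ`. -/
theorem exists_hasOsc_small (D : CompositionData ψ b q m₁ m₂ m₃ m₄ t₁ t₂)
    (χ : ContDiffBump (0 : Rn n)) (x z ξ : κ → Rn n)
    (hlow : ∀ k y, 2 * χ.rOut * japanese (ξ k) ≤ ‖gradX ψ y (ξ k)‖) :
    ∃ J : κ → ℂ, (∀ k, HasOsc (fun p => waveFactor ψ (x k) (ξ k) p.1
        * smallAmp χ b q (x k) (z k) (ξ k) p) (J k)) ∧
      ∀ M : ℝ, ∃ C : ℝ, 0 ≤ C ∧ ∀ k, ‖J k‖ ≤ C * (japanese (x k) ^ (m₁ + t₁)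
        * japanese (z k) ^ m₃ * japanese (ξ k) ^ (-M)) := by
  set m₀ : ℝ := -(n + 1 : ℝ) with hm₀
  obtain ⟨l, hl⟩ := exists_nat_ge ((|m₁| + (n + 1)) / 2)
  have hl' : |m₁| - 2 * l ≤ -(n + 1 : ℝ) := by linarith
  have hB := D.smallAmp_smallAmp χ x z ξ m₀
  have hϖ : ∀ k, 0 ≤ japanese (x k) ^ (m₁ + t₁) * japanese (z k) ^ m₃
        * japanese (ξ k) ^ (m₂ + |m₄ + t₂ - m₀|) := fun k => by
    have p1 := japanese_pos (x k)
    have p2 := japanese_pos (z k)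
    have p3 := japanese_pos (ξ k)
    positivity
  have hA := (D.amp_waveFactor x ξ).mul (hB.amp.rescale (σ' := 1) (fun _ => le_rfl)
    (fun k => one_le_japanese (ξ k)) zero_le_one)
  have hosc := fun k => hA.hasOsc_oscST (k := 0) (l := l) (fun k => one_le_japanese (ξ k))
    zero_le_one (fun k => by rw [one_mul]; exact hϖ k) (by simp [hm₀])
    (by simpa using hl') k
  refine ⟨_, hosc, fun M => ?_⟩
  obtain ⟨N, hN⟩ := exists_nat_ge (M + (m₂ + |m₄ + t₂ - m₀|))
  obtain ⟨C, hC0, hC⟩ := norm_integral_smallAmp_le (x := x) N D χ.rOut_pos hlow hϖ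
    (hB.iterate_oscT l) hl' le_rfl
  refine ⟨C, hC0, fun k => ?_⟩
  have e : ∀ p, kern p * oscST 0 l (fun p => waveFactor ψ (x k) (ξ k) p.1
      * smallAmp χ b q (x k) (z k) (ξ k) p) p
      = kern p * waveFactor ψ (x k) (ξ k) p.1 * oscT^[l] (smallAmp χ b q (x k) (z k) (ξ k)) p :=
    fun p => by
      have h1 := (iterate_oscT_mul_fst (contDiff_waveFactor D.smooth_phase (x k) (ξ k))
        (hB.amp.smooth k) l).2
      simp only [oscST, Function.iterate_zero, id_eq]
      rw [h1, mul_assoc]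
  rw [MeasureTheory.integral_congr_ae (Eventually.of_forall e)]
  refine (hC k).trans (mul_le_mul_of_nonneg_left ?_ hC0)
  have p1 := japanese_pos (x k)
  have p2 := japanese_pos (z k)
  have p3 := japanese_pos (ξ k)
  rw [mul_assoc]
  refine mul_le_mul_of_nonneg_left ?_ (by positivity)
  rw [← Real.rpow_natCast, Real.inv_rpow p3.le, ← Real.rpow_neg p3.le, ← Real.rpow_add p3]
  exact Real.rpow_le_rpow_of_exponent_le (one_le_japanese _) (by linarith)

/-- The pointwise expansion in powers of `⟨ξ⟩^(-1/2)`, for large `ξ`. -/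
theorem exists_pointwise_expansion (D : CompositionData ψ b q m₁ m₂ m₃ m₄ t₁ t₂)
    {c : Rn n × Rn n × Rn n → ℂ}
    (hc : ∀ p, HasOsc (fun y => fullAmp ψ b q (p, y)) ((((2 * Real.pi) ^ n : ℝ) : ℂ) * c p)) :
    ∃ (R : ℝ) (χ : ContDiffBump (0 : Rn n)), 1 ≤ R ∧
      (∀ x ξ, R ≤ japanese ξ → 2 * χ.rOut * japanese ξ ≤ ‖gradX ψ x ξ‖) ∧
      ∀ N : ℕ, ∃ C : ℝ, 0 ≤ C ∧ ∀ x z ξ, R ≤ japanese ξ →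
        ‖c (x, z, ξ) - ∑ k ∈ Finset.range N,
          (((japanese ξ ^ (-(1 / 2) : ℝ)) ^ k / k.factorial : ℝ) : ℂ)
            * mixedLap^[k] (mainAmp χ ψ b q x z ξ) 0‖ ≤
        C * (japanese x ^ (m₁ + t₁) * japanese z ^ m₃
          * japanese ξ ^ (m₂ + t₂ + m₄ - (N : ℝ) / 2)) := by
  obtain ⟨C₁, hC₁, hlow⟩ := D.lower
  let χ : ContDiffBump (0 : Rn n) := ⟨C₁ / 8, C₁ / 4, by positivity, by linarith⟩
  have hgrad : ∀ x ξ, max 1 (2 / C₁) ≤ japanese ξ → 2 * χ.rOut * japanese ξ ≤ ‖gradX ψ x ξ‖ := by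
    intro x ξ hξ
    have h1 := hlow x ξ
    have h2 := (le_max_right _ _).trans hξ
    rw [div_le_iff₀ hC₁] at h2
    have h3 : 0 < C₁ * japanese ξ := mul_pos hC₁ (japanese_pos ξ)
    have h4 := pow_le_pow_left₀ h3.le h1 2
    rw [japanese_sq (gradX ψ x ξ)] at h4
    have h5 : (2 * χ.rOut * japanese ξ) ^ 2 ≤ ‖gradX ψ x ξ‖ ^ 2 := by
      change (2 * (C₁ / 4) * japanese ξ) ^ 2 ≤ _
      nlinarith
    exact (pow_le_pow_iff_left₀ (by change 0 ≤ 2 * (C₁ / 4) * japanese ξ; nlinarith)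
      (norm_nonneg _) two_ne_zero).1 h5
  refine ⟨max 1 (2 / C₁), χ, le_max_left _ _, hgrad, fun N => ?_⟩
  let κ := {p : Rn n × Rn n × Rn n // max 1 (2 / C₁) ≤ japanese p.2.2}
  let x : κ → Rn n := fun k => k.1.1
  let z : κ → Rn n := fun k => k.1.2.1
  let ξ : κ → Rn n := fun k => k.1.2.2
  have hF := D.amp_mainAmp χ x z ξ
  have hW : ∀ k : κ, 0 ≤ japanese (x k) ^ (m₁ + t₁) * japanese (z k) ^ m₃
      * japanese (ξ k) ^ (m₂ + t₂ + m₄) := fun k => by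
    have p1 := japanese_pos (x k)
    have p2 := japanese_pos (z k)
    have p3 := japanese_pos (ξ k)
    positivity
  obtain ⟨H, hH, -⟩ := (hF.dilate hW).exists_hasOsc (fun _ t => one_le_pow₀
    (by nlinarith [sq_nonneg t])) (by norm_num) fun k t =>
      mul_nonneg (hW k) (Real.rpow_nonneg (by positivity) _)
  obtain ⟨C, hC0, hC⟩ := hF.taylor_dilate N hW hH
  obtain ⟨J, hJ, hJ'⟩ := D.exists_hasOsc_small χ x z ξ fun k y => hgrad y _ k.2
  obtain ⟨C', hC'0, hC'⟩ := hJ' (-(m₂ + t₂ + m₄ - (N : ℝ) / 2))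
  set P : ℂ := (((2 * Real.pi) ^ n : ℝ) : ℂ) with hP
  have hP0 : P ≠ 0 := by
    have := Real.pi_pos
    rw [hP]
    exact Complex.ofReal_ne_zero.2 (by positivity)
  refine ⟨‖P‖⁻¹ * (C + C'), by positivity, fun x₀ z₀ ξ₀ hξ => ?_⟩
  let k : κ := ⟨(x₀, z₀, ξ₀), hξ⟩
  set lam := japanese ξ₀ ^ (-(1 / 2) : ℝ) with hlam
  have hl : lam ∈ Set.Icc (0 : ℝ) 1 := ⟨(Real.rpow_pos_of_pos (japanese_pos _) _).le,
    Real.rpow_le_one_of_one_le_of_nonpos (one_le_japanese _) (by norm_num)⟩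
  have hsm : ContDiff ℝ ∞ fun p : Rn n × Rn n => mainAmp χ ψ b q x₀ z₀ ξ₀ (lam • p.1, p.2) :=
    (hF.smooth k).comp (by fun_prop)
  -- the oscillatory integral is the sum of the two parts
  have h1 := (hH k lam).symplecticScaling hsm (japanese_pos ξ₀) (gradX ψ x₀ ξ₀)
  have hs1 : ContDiff ℝ ∞ fun p : Rn n × Rn n =>
      Complex.exp (Complex.I * ((inner ℝ p.1 (gradX ψ x₀ ξ₀) : ℝ) : ℂ)) *
        mainAmp χ ψ b q x₀ z₀ ξ₀ (lam • japanese ξ₀ • p.1,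
          (japanese ξ₀)⁻¹ • (p.2 - gradX ψ x₀ ξ₀)) :=
    (Complex.contDiff_exp.comp (contDiff_const.mul (Complex.ofRealCLM.contDiff.comp
      (contDiff_fst.inner ℝ contDiff_const)))).mul ((hF.smooth k).comp (by fun_prop))
  have hs2 : ContDiff ℝ ∞ fun p : Rn n × Rn n => waveFactor ψ x₀ ξ₀ p.1
      * smallAmp χ b q x₀ z₀ ξ₀ p :=
    ((contDiff_waveFactor D.smooth_phase x₀ ξ₀).comp contDiff_fst).mul
      ((D.smallAmp_smallAmp χ x z ξ 0).amp.smooth k)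
  have h2 := HasOsc.add h1 (hJ k) hs1 hs2
  have h3 : P * c (x₀, z₀, ξ₀) = H k lam + J k := by
    refine (hc (x₀, z₀, ξ₀)).unique ?_
    refine (congrArg (fun f => HasOsc f (H k lam + J k)) (funext fun p => ?_)).mp h2
    exact (fullAmp_eq χ x₀ z₀ ξ₀ p).symm
  set T₀ := ∑ k ∈ Finset.range N, ((lam ^ k / k.factorial : ℝ) : ℂ)
    * mixedLap^[k] (mainAmp χ ψ b q x₀ z₀ ξ₀) 0
  have h4 : c (x₀, z₀, ξ₀) - T₀ = P⁻¹ * ((H k lam - P * T₀) + J k) := by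
    have : c (x₀, z₀, ξ₀) = P⁻¹ * (H k lam + J k) := by
      rw [← h3, inv_mul_cancel_left₀ hP0]
    rw [this]
    field_simp
    ring
  have h5 := hC k lam hl
  have h6 := hC' k
  have p3 := japanese_pos ξ₀
  have e1 : japanese ξ₀ ^ (m₂ + t₂ + m₄) * lam ^ N
      = japanese ξ₀ ^ (m₂ + t₂ + m₄ - (N : ℝ) / 2) := by
    rw [hlam, ← Real.rpow_natCast, ← Real.rpow_mul p3.le, ← Real.rpow_add p3]
    congr 1
    ring
  rw [neg_neg] at h6
  rw [h4, norm_mul, norm_inv, mul_assoc]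
  refine mul_le_mul_of_nonneg_left ((norm_add_le _ _).trans ?_) (by positivity)
  rw [add_mul]
  refine add_le_add (h5.trans (le_of_eq ?_)) h6
  change C * (japanese x₀ ^ (m₁ + t₁) * japanese z₀ ^ m₃ * japanese ξ₀ ^ (m₂ + t₂ + m₄)) * lam ^ N
    = _
  rw [← e1]
  ring

end CompositionData

end PointwiseExpansion

/-! ### Iterates of a sum of shifts -/

section MultinomialIteration

theorem prod_factorial_add_single {J : Type*} [Fintype J] [DecidableEq J] (γ : J → ℕ) (j : J) :
    ∏ i, ((γ + Pi.single j 1 : J → ℕ) i).factorial = (γ j + 1) * ∏ i, (γ i).factorial := by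
  rw [Fintype.prod_eq_mul_prod_compl j, Fintype.prod_eq_mul_prod_compl j, ← mul_assoc]
  congr 1
  · simp [Nat.factorial_succ]
  · refine Finset.prod_congr rfl fun i hi => ?_
    have : i ≠ j := by simpa using hi
    simp [this]

/-- Reindexing along `γ ↦ γ + e_j`; the indices with `γ j = 0` that are not reached have coefficient
zero. -/
theorem sum_piAntidiag_succ {J V : Type*} [Fintype J] [DecidableEq J] [AddCommGroup V]
    [Module ℂ V] (T : (J → ℕ) → V) (k : ℕ) (j : J) :
    ∑ γ ∈ Finset.piAntidiag Finset.univ k,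
      ((∏ i, (γ i).factorial : ℕ) : ℂ)⁻¹ • T (γ + Pi.single j 1)
    = ∑ γ ∈ Finset.piAntidiag Finset.univ (k + 1),
      ((γ j : ℂ) * ((∏ i, (γ i).factorial : ℕ) : ℂ)⁻¹) • T γ := by
  refine Finset.sum_of_injOn (fun γ : J → ℕ => γ + Pi.single j 1) (add_left_injective _).injOn ?_ ?_ ?_
  · intro γ hγ
    simp only [Finset.mem_coe, Finset.mem_piAntidiag, Finset.mem_univ, implies_true, and_true]
      at hγ ⊢
    simp only [Pi.add_apply]
    rw [Finset.sum_add_distrib, hγ]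
    simp
  · intro γ hγ hn
    rcases Nat.eq_zero_or_pos (γ j) with h | h
    · simp [h]
    · refine absurd ⟨γ - Pi.single j 1, ?_, ?_⟩ hn
      · simp only [Finset.mem_coe, Finset.mem_piAntidiag, Finset.mem_univ, implies_true, and_true]
          at hγ ⊢
        have e : γ - Pi.single j 1 + Pi.single j 1 = γ := by
          ext i
          by_cases hi : i = j
          · subst hi; simp; omega
          · simp [hi]
        have : Finset.univ.sum (γ - Pi.single j 1 + Pi.single j 1) = k + 1 := by rw [e, hγ]
        simp only [Pi.add_apply] at this
        rw [Finset.sum_add_distrib] at this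
        simpa using this
      · ext i
        by_cases hi : i = j
        · subst hi; simp; omega
        · simp [hi]
  · intro γ _
    have h0 : ((∏ i, (γ i).factorial : ℕ) : ℂ) ≠ 0 := by
      exact_mod_cast (Finset.prod_pos fun i _ => Nat.factorial_pos (γ i)).ne'
    have h1 : ((γ j : ℂ) + 1) ≠ 0 := by exact_mod_cast Nat.succ_ne_zero (γ j)
    congr 1
    rw [prod_factorial_add_single]
    simp only [Pi.add_apply, Pi.single_eq_same]
    push_cast at h0 ⊢
    field_simp

/-- The powers of an operator that sends `T γ` to the multiple by `a` of the sum of the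
neighbours of `T γ`. -/
theorem iterate_eq_sum_piAntidiag {J V : Type*} [Fintype J] [DecidableEq J] [AddCommGroup V]
    [Module ℂ V] {T : (J → ℕ) → V} {L : V → V} {a : ℂ}
    (hL : ∀ (s : Finset (J → ℕ)) (c : (J → ℕ) → ℂ),
      L (∑ γ ∈ s, c γ • T γ) = ∑ γ ∈ s, c γ • a • ∑ j, T (γ + Pi.single j 1)) (k : ℕ) :
    L^[k] (T 0) = ∑ γ ∈ Finset.piAntidiag Finset.univ k,
      (a ^ k * k.factorial * ((∏ i, (γ i).factorial : ℕ) : ℂ)⁻¹) • T γ := by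
  induction k with
  | zero => simp
  | succ k ih =>
    rw [Function.iterate_succ_apply', ih, hL]
    have e1 : ∀ γ : J → ℕ, (a ^ k * k.factorial * ((∏ i, (γ i).factorial : ℕ) : ℂ)⁻¹) •
        a • ∑ j, T (γ + Pi.single j 1) = ∑ j, (a ^ (k + 1) * k.factorial) •
          (((∏ i, (γ i).factorial : ℕ) : ℂ)⁻¹ • T (γ + Pi.single j 1)) := fun γ => by
      rw [smul_smul, Finset.smul_sum]
      refine Finset.sum_congr rfl fun j _ => ?_
      rw [smul_smul]
      congr 1
      ring
    simp only [e1]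
    rw [Finset.sum_comm]
    simp only [← Finset.smul_sum, sum_piAntidiag_succ]
    rw [Finset.sum_comm, Finset.smul_sum]
    refine Finset.sum_congr rfl fun γ hγ => ?_
    rw [← Finset.sum_smul, smul_smul, ← Finset.sum_mul]
    congr 1
    have : (∑ j, (γ j : ℂ)) = k + 1 := by
      have := (Finset.mem_piAntidiag.1 hγ).1
      exact_mod_cast this
    rw [this, Nat.factorial_succ]
    push_cast
    ring

end MultinomialIteration

/-! ### Powers of the mixed Laplacian on products -/

section LeibnizTerms

variable {n : ℕ}

/-- The terms that arise when powers of the operator `mixedLap` are applied to the product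
`A (y, η) * Q η`: in each factor of the operator the derivative in `η` falls either on `Q`, which
is counted by `α`, or on `A`, which is counted by `β`. -/
def leibnizTerm (A : Rn n × Rn n → ℂ) (Q : Rn n → ℂ) (α β : MultiIndex n) : Rn n × Rn n → ℂ :=
  fun p => mderiv α Q p.2 * mderiv (α + β) (fun y => mderiv β (fun η => A (y, η)) p.2) p.1

variable {A : Rn n × Rn n → ℂ} {Q : Rn n → ℂ}

theorem contDiff_mderiv {F : Type} [NormedAddCommGroup F] [NormedSpace ℝ F] {f : Rn n → F}
    (hf : ContDiff ℝ ∞ f) (α : MultiIndex n) : ContDiff ℝ ∞ (mderiv α f) := by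
  rw [mderiv_eq_dirDs]
  exact hf.dirDs _

theorem mderiv_mderiv_eq_dirDs (hA : ContDiff ℝ ∞ A) (α β : MultiIndex n) (p : Rn n × Rn n) :
    mderiv α (fun y => mderiv β (fun η => A (y, η)) p.2) p.1 =
      dirDs (α.toList.map (fun i => ((euclFrame n).vec i, (0 : Rn n)))
        ++ β.toList.map fun i => ((0 : Rn n), (euclFrame n).vec i)) A p := by
  have := mderiv_prod hA α (β.toList.map (euclFrame n).vec) p.1 p.2
  simp only [← mderiv_eq_dirDs] at this
  rw [this, List.map_map]
  rfl

theorem contDiff_mderiv_mderiv (hA : ContDiff ℝ ∞ A) (α β : MultiIndex n) :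
    ContDiff ℝ ∞ fun p : Rn n × Rn n =>
      mderiv α (fun y => mderiv β (fun η => A (y, η)) p.2) p.1 := by
  simp only [mderiv_mderiv_eq_dirDs hA]
  exact hA.dirDs _

theorem dirD_fst_mderiv_mderiv (hA : ContDiff ℝ ∞ A) (α β : MultiIndex n) (j : Fin n) :
    dirD ((euclFrame n).vec j, 0) (fun p : Rn n × Rn n =>
      mderiv α (fun y => mderiv β (fun η => A (y, η)) p.2) p.1) = fun p : Rn n × Rn n =>
      mderiv (α + Pi.single j 1) (fun y => mderiv β (fun η => A (y, η)) p.2) p.1 := by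
  simp only [mderiv_mderiv_eq_dirDs hA]
  rw [← dirDs_cons]
  refine dirDs_perm hA ?_
  have := (MultiIndex.toList_add_single α j).symm.map fun i => ((euclFrame n).vec i, (0 : Rn n))
  rw [List.map_cons] at this
  exact this.append_right _

theorem dirD_snd_mderiv_mderiv (hA : ContDiff ℝ ∞ A) (α β : MultiIndex n) (j : Fin n) :
    dirD (0, (euclFrame n).vec j) (fun p : Rn n × Rn n =>
      mderiv α (fun y => mderiv β (fun η => A (y, η)) p.2) p.1) = fun p : Rn n × Rn n =>
      mderiv α (fun y => mderiv (β + Pi.single j 1) (fun η => A (y, η)) p.2) p.1 := by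
  simp only [mderiv_mderiv_eq_dirDs hA]
  rw [← dirDs_cons]
  refine dirDs_perm hA ?_
  have := (MultiIndex.toList_add_single β j).symm.map fun i => ((0 : Rn n), (euclFrame n).vec i)
  rw [List.map_cons] at this
  exact List.perm_middle.symm.trans (this.append_left _)

theorem dirD_fst_mul_snd {f : Rn n × Rn n → ℂ} {g : Rn n → ℂ} (hf : ContDiff ℝ ∞ f)
    (hg : ContDiff ℝ ∞ g) (v : Rn n) :
    dirD (v, 0) (fun p : Rn n × Rn n => g p.2 * f p) = fun p => g p.2 * dirD (v, 0) f p := by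
  rw [dirD_mul (f := fun p : Rn n × Rn n => g p.2) (hg.comp contDiff_snd) hf]
  funext p
  rw [dirD_comp_snd v p (hg.differentiable (by simp) _), zero_mul, zero_add]

theorem dirD_snd_mul_snd {f : Rn n × Rn n → ℂ} {g : Rn n → ℂ} (hf : ContDiff ℝ ∞ f)
    (hg : ContDiff ℝ ∞ g) (v : Rn n) :
    dirD (0, v) (fun p : Rn n × Rn n => g p.2 * f p)
      = fun p => dirD v g p.2 * f p + g p.2 * dirD (0, v) f p := by
  rw [dirD_mul (f := fun p : Rn n × Rn n => g p.2) (hg.comp contDiff_snd) hf]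
  funext p
  congr 2
  have := congrFun (dirD_comp_affine hg 0 (ContinuousLinearMap.snd ℝ (Rn n) (Rn n)) (0, v)) p
  simpa using this

theorem contDiff_leibnizTerm (hA : ContDiff ℝ ∞ A) (hQ : ContDiff ℝ ∞ Q) (α β : MultiIndex n) :
    ContDiff ℝ ∞ (leibnizTerm A Q α β) :=
  ((contDiff_mderiv hQ α).comp contDiff_snd).mul (contDiff_mderiv_mderiv hA _ _)

theorem mixedLap_leibnizTerm (hA : ContDiff ℝ ∞ A) (hQ : ContDiff ℝ ∞ Q) (α β : MultiIndex n)
    (p : Rn n × Rn n) :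
    mixedLap (leibnizTerm A Q α β) p = -Complex.I * ∑ j,
      (leibnizTerm A Q (α + Pi.single j 1) β p + leibnizTerm A Q α (β + Pi.single j 1) p) := by
  rw [mixedLap]
  congr 1
  refine Finset.sum_congr rfl fun j _ => ?_
  unfold leibnizTerm
  rw [dirD_fst_mul_snd (contDiff_mderiv_mderiv hA _ _) (contDiff_mderiv hQ α),
    dirD_fst_mderiv_mderiv hA, dirD_snd_mul_snd (contDiff_mderiv_mderiv hA _ _)
    (contDiff_mderiv hQ α), dirD_snd_mderiv_mderiv hA, ← mderiv_add_single hQ]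
  simp only [add_assoc, add_comm (Pi.single j 1) β]

theorem mixedLap_sum {J : Type*} (s : Finset J) {F : J → Rn n × Rn n → ℂ}
    (hF : ∀ j, ContDiff ℝ ∞ (F j)) (c : J → ℂ) (p : Rn n × Rn n) :
    mixedLap (∑ i ∈ s, c i • F i) p = ∑ i ∈ s, c i * mixedLap (F i) p := by
  have e : (∑ i ∈ s, c i • F i) = fun p => ∑ i ∈ s, c i * F i p := by
    funext p
    simp [Finset.sum_apply]
  have h1 : ∀ v : Rn n × Rn n, ∀ G : J → Rn n × Rn n → ℂ, (∀ j, ContDiff ℝ ∞ (G j)) →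
      dirD v (fun p => ∑ i ∈ s, c i * G i p) = fun p => ∑ i ∈ s, c i * dirD v (G i) p := by
    intro v G hG
    rw [dirD_sum s fun j => contDiff_const.mul (hG j)]
    funext p
    exact Finset.sum_congr rfl fun i _ => by rw [dirD_const_mul (hG i)]
  rw [e, mixedLap]
  simp only [h1 _ F hF, h1 _ _ fun i => (hF i).dirD _]
  rw [Finset.sum_comm, Finset.mul_sum]
  refine Finset.sum_congr rfl fun i _ => ?_
  rw [mixedLap, ← Finset.mul_sum]
  ring

/-- The pairs of multi-indices of total length `k`. -/
def indexPairs (n k : ℕ) : Finset (MultiIndex n × MultiIndex n) :=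
  (Finset.piAntidiag (Finset.univ : Finset (Fin n ⊕ Fin n)) k).map
    (Equiv.sumArrowEquivProdArrow (Fin n) (Fin n) ℕ).toEmbedding

theorem mem_indexPairs {k : ℕ} {p : MultiIndex n × MultiIndex n} :
    p ∈ indexPairs n k ↔ p.1.len + p.2.len = k := by
  rw [indexPairs, Finset.mem_map_equiv, Finset.mem_piAntidiag]
  simp [MultiIndex.len, Fintype.sum_sum_type, Equiv.sumArrowEquivProdArrow]

/-- The multinomial formula for the powers of `mixedLap` on a product. -/
theorem iterate_mixedLap_mul (hA : ContDiff ℝ ∞ A) (hQ : ContDiff ℝ ∞ Q) (k : ℕ)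
    (p : Rn n × Rn n) :
    mixedLap^[k] (fun p => A p * Q p.2) p = ∑ γ ∈ indexPairs n k,
      ((-Complex.I) ^ k * k.factorial * ((γ.1.fact : ℂ) * (γ.2.fact : ℂ))⁻¹) *
        leibnizTerm A Q γ.1 γ.2 p := by
  let T : (Fin n ⊕ Fin n → ℕ) → Rn n × Rn n → ℂ := fun γ =>
    leibnizTerm A Q (fun i => γ (Sum.inl i)) fun i => γ (Sum.inr i)
  have hT : ∀ γ, ContDiff ℝ ∞ (T γ) := fun γ => contDiff_leibnizTerm hA hQ _ _
  have h0 : (fun p : Rn n × Rn n => A p * Q p.2) = T 0 := by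
    funext p
    have e : ∀ (F : Type) [NormedAddCommGroup F] [NormedSpace ℝ F] (f : Rn n → F),
        mderiv (0 : MultiIndex n) f = f := by
      intro F _ _ f
      have : MultiIndex.toList (0 : MultiIndex n) = [] := by
        rw [← List.length_eq_zero_iff, MultiIndex.length_toList]
        simp [MultiIndex.len]
      rw [mderiv_eq_dirDs, this]
      rfl
    change A p * Q p.2 = mderiv 0 Q p.2 * mderiv (0 + 0) (fun y => mderiv 0 (fun η => A (y, η)) p.2)
      p.1
    rw [add_zero, e, e, e, mul_comm]
  have hL : ∀ (s : Finset (Fin n ⊕ Fin n → ℕ)) (c : (Fin n ⊕ Fin n → ℕ) → ℂ),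
      mixedLap (∑ γ ∈ s, c γ • T γ)
        = ∑ γ ∈ s, c γ • (-Complex.I) • ∑ j, T (γ + Pi.single j 1) := by
    intro s c
    funext p
    rw [mixedLap_sum s hT, Finset.sum_apply]
    refine Finset.sum_congr rfl fun γ _ => ?_
    simp only [Pi.smul_apply, smul_eq_mul, Finset.sum_apply]
    congr 1
    simp only [T]
    rw [mixedLap_leibnizTerm hA hQ, Fintype.sum_sum_type, Finset.sum_add_distrib]
    have a1 : ∀ j : Fin n, (fun i => (γ + Pi.single (Sum.inl j) 1 : Fin n ⊕ Fin n → ℕ) (Sum.inl i))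
        = (fun i => γ (Sum.inl i)) + Pi.single j 1 := fun j => by
      ext i; simp [Pi.single_apply]
    have a2 : ∀ j : Fin n, (fun i => (γ + Pi.single (Sum.inl j) 1 : Fin n ⊕ Fin n → ℕ) (Sum.inr i))
        = fun i => γ (Sum.inr i) := fun j => by
      ext i; simp
    have a3 : ∀ j : Fin n, (fun i => (γ + Pi.single (Sum.inr j) 1 : Fin n ⊕ Fin n → ℕ) (Sum.inl i))
        = fun i => γ (Sum.inl i) := fun j => by
      ext i; simp
    have a4 : ∀ j : Fin n, (fun i => (γ + Pi.single (Sum.inr j) 1 : Fin n ⊕ Fin n → ℕ) (Sum.inr i))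
        = (fun i => γ (Sum.inr i)) + Pi.single j 1 := fun j => by
      ext i; simp [Pi.single_apply]
    simp only [a1, a2, a3, a4]
  rw [h0, iterate_eq_sum_piAntidiag hL, Finset.sum_apply, indexPairs, Finset.sum_map]
  refine Finset.sum_congr rfl fun γ _ => ?_
  simp only [Pi.smul_apply, smul_eq_mul]
  have : ((∏ i, (γ i).factorial : ℕ) : ℂ) =
      ((MultiIndex.fact fun i : Fin n => γ (Sum.inl i) : ℕ) : ℂ) *
        ((MultiIndex.fact fun i : Fin n => γ (Sum.inr i) : ℕ) : ℂ) := by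
    rw [Fintype.prod_sum_type]
    push_cast [MultiIndex.fact]
    rfl
  rw [this]
  rfl

theorem mixedLap_comp_scale {F : Rn n × Rn n → ℂ} (hF : ContDiff ℝ ∞ F) (p₀ : Rn n × Rn n)
    (a r : ℝ) :
    mixedLap (fun p => F (p₀ + (a • p.1, r • p.2)))
      = fun p => ((a * r : ℝ) : ℂ) * mixedLap F (p₀ + (a • p.1, r • p.2)) := by
  let B : Rn n × Rn n →L[ℝ] Rn n × Rn n :=
    (a • ContinuousLinearMap.id ℝ (Rn n)).prodMap (r • ContinuousLinearMap.id ℝ (Rn n))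
  funext p
  change mixedLap (fun p => F (p₀ + B p)) p = _ * mixedLap F (p₀ + B p)
  simp only [mixedLap]
  rw [mul_left_comm]
  congr 1
  rw [Finset.mul_sum]
  refine Finset.sum_congr rfl fun j _ => ?_
  rw [dirD_comp_affine hF, dirD_comp_affine (hF.dirD _)]
  have e1 : B ((euclFrame n).vec j, 0) = a • ((euclFrame n).vec j, (0 : Rn n)) := by
    simp [B]
  have e2 : B (0, (euclFrame n).vec j) = r • ((0 : Rn n), (euclFrame n).vec j) := by
    simp [B]
  have hs : ∀ (c : ℝ) (v : Rn n × Rn n) (G : Rn n × Rn n → ℂ),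
      dirD (c • v) G = fun p => (c : ℂ) * dirD v G p := fun c v G => by
    funext p
    simp [dirD]
  rw [e1, e2, hs, hs, dirD_const_mul (hF.dirD _)]
  push_cast
  ring

theorem ContDiff.iterate_mixedLap {F : Rn n × Rn n → ℂ} (hF : ContDiff ℝ ∞ F) (k : ℕ) :
    ContDiff ℝ ∞ (_root_.mixedLap^[k] F) := by
  induction k with
  | zero => exact hF
  | succ k ih => rw [Function.iterate_succ_apply']; exact ih.mixedLap

theorem iterate_mixedLap_comp_scale {F : Rn n × Rn n → ℂ} (hF : ContDiff ℝ ∞ F)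
    (p₀ : Rn n × Rn n) (a r : ℝ) (k : ℕ) :
    mixedLap^[k] (fun p => F (p₀ + (a • p.1, r • p.2)))
      = fun p => ((a * r : ℝ) : ℂ) ^ k * mixedLap^[k] F (p₀ + (a • p.1, r • p.2)) := by
  induction k with
  | zero => simp
  | succ k ih =>
    rw [Function.iterate_succ_apply', ih, Function.iterate_succ_apply']
    have hs : ContDiff ℝ ∞ fun p : Rn n × Rn n => mixedLap^[k] F (p₀ + (a • p.1, r • p.2)) :=
      (hF.iterate_mixedLap k).comp (by fun_prop)
    have := fun p => mixedLap_sum (Finset.univ : Finset Unit) (fun _ => hs)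
      (fun _ => ((a * r : ℝ) : ℂ) ^ k) p
    simp only [Finset.univ_unique, Finset.sum_singleton] at this
    funext p
    refine (this p).trans ?_
    rw [mixedLap_comp_scale (hF.iterate_mixedLap k), pow_succ]
    ring

theorem Filter.EventuallyEq.mixedLap {F G : Rn n × Rn n → ℂ} {p : Rn n × Rn n}
    (h : F =ᶠ[𝓝 p] G) : _root_.mixedLap F =ᶠ[𝓝 p] _root_.mixedLap G := by
  have h1 : ∀ᶠ p' in 𝓝 p, ∀ j, _root_.dirD (0, (euclFrame n).vec j)
      (_root_.dirD ((euclFrame n).vec j, 0) F) p' = _root_.dirD (0, (euclFrame n).vec j)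
      (_root_.dirD ((euclFrame n).vec j, 0) G) p' :=
    eventually_all.2 fun j => (h.dirD _).dirD _
  filter_upwards [h1] with p' hp
  simp only [_root_.mixedLap, hp]

theorem Filter.EventuallyEq.iterate_mixedLap {F G : Rn n × Rn n → ℂ} {p : Rn n × Rn n}
    (h : F =ᶠ[𝓝 p] G) (k : ℕ) : _root_.mixedLap^[k] F =ᶠ[𝓝 p] _root_.mixedLap^[k] G := by
  induction k with
  | zero => exact h
  | succ k ih => simp only [Function.iterate_succ_apply']; exact ih.mixedLap

end LeibnizTerms

/-! ### Identification of the terms of the expansion -/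

section Identification

variable {n : ℕ} {ψ : Rn n → Rn n → ℝ} {b : Rn n → Rn n → Rn n → Rn n → ℂ} {q : Rn n → Rn n → ℂ}
  {m₁ m₂ m₃ m₄ t₁ t₂ : ℝ}

/-- The term of order `k` of the expansion in powers of `⟨ξ⟩^(-1/2)` is the sum of the terms
`compositionTerm` with `|α| + |β| = k`: the scales `⟨ξ⟩^(-1/2)` in `u` and `⟨ξ⟩` in `ζ` cancel the power
of `⟨ξ⟩` in front, and the cutoff is absent near the base point. -/
theorem CompositionData.sum_compositionTerm (D : CompositionData ψ b q m₁ m₂ m₃ m₄ t₁ t₂)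
    (χ : ContDiffBump (0 : Rn n)) (x z ξ : Rn n)
    (h : 2 * χ.rOut * japanese ξ ≤ ‖gradX ψ x ξ‖) (k : ℕ) :
    (((japanese ξ ^ (-(1 / 2) : ℝ)) ^ k / k.factorial : ℝ) : ℂ)
        * mixedLap^[k] (mainAmp χ ψ b q x z ξ) 0
      = ∑ γ ∈ indexPairs n k, compositionTerm ψ b q γ.1 γ.2 x z ξ := by
  set lam := japanese ξ ^ (-(1 / 2) : ℝ) with hlam
  have p0 := japanese_pos ξ
  have hl : lam * (lam * japanese ξ) = 1 := by
    rw [hlam]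
    nth_rewrite 3 [← Real.rpow_one (japanese ξ)]
    rw [← Real.rpow_add p0, ← Real.rpow_add p0]
    norm_num
  let A : Rn n × Rn n → ℂ := fun p =>
    Complex.exp (Complex.I * (phaseRemainder ψ x p.1 ξ : ℂ)) * b p.1 ξ z p.2
  let Q : Rn n → ℂ := fun η => q x η
  have hbs : ContDiff ℝ ∞ fun p : Rn n × Rn n => b p.1 ξ z p.2 :=
    D.smooth_left.comp (by fun_prop : ContDiff ℝ ∞ fun p : Rn n × Rn n => (p.1, ξ, z, p.2))
  have hA : ContDiff ℝ ∞ A :=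
    (Complex.contDiff_exp.comp (contDiff_const.mul (Complex.ofRealCLM.contDiff.comp
      ((contDiff_phaseRemainder D.smooth_phase x ξ).comp contDiff_fst)))).mul hbs
  have hQ : ContDiff ℝ ∞ Q := D.smooth_right.comp (by fun_prop : ContDiff ℝ ∞ fun η => (x, η))
  -- near the base point the cutoff is absent
  have hev : mainAmp χ ψ b q x z ξ =ᶠ[𝓝 0] fun p => (fun p : Rn n × Rn n => A p * Q p.2)
      ((x, gradX ψ x ξ) + (lam • p.1, japanese ξ • p.2)) := by
    have ht : Tendsto (fun p : Rn n × Rn n => ‖(japanese ξ)⁻¹ • gradX ψ x ξ + p.2‖) (𝓝 0)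
        (𝓝 ‖(japanese ξ)⁻¹ • gradX ψ x ξ‖) :=
      Continuous.tendsto' (by fun_prop) _ _ (by simp)
    have hlt : χ.rOut < ‖(japanese ξ)⁻¹ • gradX ψ x ξ‖ := by
      rw [norm_smul, norm_inv, Real.norm_of_nonneg p0.le, ← div_eq_inv_mul, lt_div_iff₀ p0]
      refine lt_of_lt_of_le ?_ h
      nlinarith [mul_pos χ.rOut_pos p0]
    filter_upwards [ht.eventually (lt_mem_nhds hlt)] with p hp
    have hz : χ ((japanese ξ)⁻¹ • gradX ψ x ξ + p.2) = 0 :=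
      χ.zero_of_le_dist (by simpa using hp.le)
    simp only [mainAmp, hz, A, Q, Prod.mk_add_mk]
    simp [mul_assoc, hlam]
  rw [(hev.iterate_mixedLap k).eq_of_nhds, iterate_mixedLap_comp_scale
    (F := fun p : Rn n × Rn n => A p * Q p.2) (hA.mul (hQ.comp contDiff_snd))]
  simp only [iterate_mixedLap_mul hA hQ, Prod.fst_zero, Prod.snd_zero, smul_zero]
  rw [show (x, gradX ψ x ξ) + ((0 : Rn n), (0 : Rn n)) = (x, gradX ψ x ξ) by simp, Finset.mul_sum,
    Finset.mul_sum]
  refine Finset.sum_congr rfl fun γ hγ => ?_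
  have hlen := mem_indexPairs.1 hγ
  have e1 : mderiv (γ.1 + γ.2) (fun y => mderiv γ.2 (fun η => A (y, η)) (gradX ψ x ξ)) x =
      mderiv (γ.1 + γ.2) (fun y => Complex.exp (Complex.I * (phaseRemainder ψ x y ξ : ℂ)) *
        mderiv γ.2 (fun η => b y ξ z η) (gradX ψ x ξ)) x := by
    congr 1
    funext y
    simp only [A, mderiv_eq_dirDs]
    have hbη : ContDiff ℝ ∞ fun η => b y ξ z η :=
      hbs.comp (by fun_prop : ContDiff ℝ ∞ fun η : Rn n => (y, η))
    rw [dirDs_const_mul hbη]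
  rw [leibnizTerm, compositionTerm, e1, hlen]
  have hk : (k.factorial : ℂ) ≠ 0 := by exact_mod_cast (Nat.factorial_pos k).ne'
  have hI : (Complex.I ^ k)⁻¹ = (-Complex.I) ^ k := by
    rw [← inv_pow, Complex.inv_I]
  have hl' : (lam : ℂ) ^ k * ((lam * japanese ξ : ℝ) : ℂ) ^ k = 1 := by
    rw [← mul_pow, ← Complex.ofReal_mul, hl]
    simp
  rw [hI]
  simp only [Q]
  push_cast at hl' ⊢
  rw [div_eq_mul_inv, div_eq_mul_inv]
  linear_combination (exp := 1) ((k.factorial : ℂ) * (k.factorial : ℂ)⁻¹ * (-Complex.I) ^ k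
    * ((γ.1.fact : ℂ) * (γ.2.fact : ℂ))⁻¹ * mderiv γ.1 (fun η => q x η) (gradX ψ x ξ)
    * mderiv (γ.1 + γ.2) (fun y => Complex.exp (Complex.I * (phaseRemainder ψ x y ξ : ℂ)) *
        mderiv γ.2 (fun η => b y ξ z η) (gradX ψ x ξ)) x) * hl'
    + ((-Complex.I) ^ k
    * ((γ.1.fact : ℂ) * (γ.2.fact : ℂ))⁻¹ * mderiv γ.1 (fun η => q x η) (gradX ψ x ξ)
    * mderiv (γ.1 + γ.2) (fun y => Complex.exp (Complex.I * (phaseRemainder ψ x y ξ : ℂ)) *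
        mderiv γ.2 (fun η => b y ξ z η) (gradX ψ x ξ)) x) * (mul_inv_cancel₀ hk)

end Identification

/-! ### Jets of partial derivatives -/

section SymbolEstimates

variable {n : ℕ} {ι : Type*} {E : Type} [NormedAddCommGroup E] [NormedSpace ℝ E]

theorem len_add (α β : MultiIndex n) : (α + β).len = α.len + β.len := by
  simp [MultiIndex.len, Finset.sum_add_distrib]

theorem mderiv_comp_add {f : Rn n → ℂ} (hf : ContDiff ℝ ∞ f) (α : MultiIndex n) (a y : Rn n) :
    mderiv α (fun y => f (a + y)) y = mderiv α f (a + y) := by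
  rw [mderiv_eq_dirDs, mderiv_eq_dirDs]
  have := congrFun (dirDs_comp_affine hf a (ContinuousLinearMap.id ℝ (Rn n))
    (α.toList.map (euclFrame n).vec)) y
  simpa using this

theorem dirDs_snd_scale {f : E → Rn n → ℂ} (hf : ContDiff ℝ ∞ fun p : E × Rn n => f p.1 p.2)
    (η : Rn n) (c : ℝ) (α : MultiIndex n) (p : E × Rn n) :
    dirDs ((α.toList.map (euclFrame n).vec).map (ContinuousLinearMap.inr ℝ E (Rn n)))
      (fun p : E × Rn n => f p.1 (η + c • p.2)) p
      = c ^ α.len • mderiv α (f p.1) (η + c • p.2) := by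
  have h1 : ContDiff ℝ ∞ fun p : E × Rn n => f p.1 (η + c • p.2) :=
    hf.comp (by fun_prop : ContDiff ℝ ∞ fun p : E × Rn n => (p.1, η + c • p.2))
  have h2 := congrFun (dirDs_comp_affine h1 (p.1, 0) (ContinuousLinearMap.inr ℝ E (Rn n))
    (α.toList.map (euclFrame n).vec)) p.2
  simp only [ContinuousLinearMap.inr_apply, Prod.mk_add_mk, add_zero, zero_add] at h2
  rw [← h2]
  have h3 : ContDiff ℝ ∞ (f p.1) := hf.comp (by fun_prop : ContDiff ℝ ∞ fun y : Rn n => (p.1, y))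
  have h4 := congrFun (dirDs_comp_affine h3 η (c • ContinuousLinearMap.id ℝ (Rn n))
    (α.toList.map (euclFrame n).vec)) p.2
  refine h4.trans ?_
  rw [mderiv_eq_dirDs, ← MultiIndex.length_toList, ← List.length_map (euclFrame n).vec,
    ← dirDs_map_smul h3]
  rfl

/-- Derivatives in a group of variables that moves at the scale `c` gain a factor `c⁻¹` each. -/
theorem JetBound.mderiv_comp {f : ι → E → Rn n → ℂ} {W c : ι → ℝ}
    (hs : ∀ i, ContDiff ℝ ∞ fun p : E × Rn n => f i p.1 p.2) (η : ι → Rn n) (hc : ∀ i, 0 < c i)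
    {H : ι → E → Rn n} (hH : JetBound H fun _ => 1) (hH0 : ∀ i, H i 0 = 0)
    (hf : JetBound (fun i (p : E × Rn n) => f i p.1 (η i + c i • p.2)) W) (α : MultiIndex n) :
    JetBound (fun i h => mderiv α (f i h) (η i + c i • H i h))
      fun i => (c i ^ α.len)⁻¹ * W i := by
  have h1 := (hf.dirDs ((α.toList.map (euclFrame n).vec).map
    (ContinuousLinearMap.inr ℝ E (Rn n)))).const_smul (fun i => (c i ^ α.len)⁻¹)
    (K := fun i => (c i ^ α.len)⁻¹) fun i => (abs_of_pos (inv_pos.2 (pow_pos (hc i) _))).le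
  have h2 := h1.comp ((JetBound.clm_bounded (A := fun _ : ι => ContinuousLinearMap.id ℝ E)
    (K := 1) fun _ => ContinuousLinearMap.norm_id_le).prodMk hH) fun i => by simp [hH0]
  refine h2.congr' fun i h => ?_
  rw [dirDs_snd_scale (hs i), smul_smul, inv_mul_cancel₀ (pow_pos (hc i) _).ne', one_smul]
  rfl

end SymbolEstimates

/-! ### Symbol estimates for the terms of the expansion -/

section TermEstimates

variable {n : ℕ} {ψ : Rn n → Rn n → ℝ} {b : Rn n → Rn n → Rn n → Rn n → ℂ} {q : Rn n → Rn n → ℂ}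
  {m₁ m₂ m₃ m₄ t₁ t₂ : ℝ}

namespace CompositionData

/-- The increment of the gradient of the phase, measured at the scale of the frequency. -/
theorem jet_gradIncrement (D : CompositionData ψ b q m₁ m₂ m₃ m₄ t₁ t₂) :
    JetBound (fun p h : Rn n × Rn n => (japanese (gradX ψ p.1 p.2))⁻¹ •
      (gradX ψ (p.1 + h.1) (p.2 + h.2) - gradX ψ p.1 p.2)) fun _ => 1 := by
  obtain ⟨C, hC, hlow⟩ := D.lower
  have h1 := D.jet_grad.sub ((D.jet_grad.comp_clm (fun _ => (0 : Rn n × Rn n →L[ℝ] Rn n × Rn n)) 1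
    (by simp)))
  refine ((h1.const_smul (fun p => (japanese (gradX ψ p.1 p.2))⁻¹)
    (K := fun p => (japanese (gradX ψ p.1 p.2))⁻¹)
    fun p => (abs_of_pos (inv_pos.2 (japanese_pos _))).le).congr' fun p h => ?_).mono C⁻¹
    (fun p => ?_) fun _ => zero_le_one
  · simp [gradMap]
  · rw [mul_one, inv_mul_eq_div, div_le_iff₀ (japanese_pos _), inv_mul_eq_div, le_div_iff₀ hC]
    linarith [hlow p.1 p.2]

/-- The gradient of the phase is comparable to the frequency. -/
theorem japanese_gradX_rpow_le (D : CompositionData ψ b q m₁ m₂ m₃ m₄ t₁ t₂) (s : ℝ) :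
    ∃ K : ℝ, 0 ≤ K ∧ ∀ x ξ, japanese (gradX ψ x ξ) ^ s ≤ K * japanese ξ ^ s := by
  obtain ⟨C₁, hC₁, hlow⟩ := D.lower
  obtain ⟨C₂, hC₂, hup⟩ := D.norm_gradX_le
  refine ⟨(1 + C₂ + C₁⁻¹) ^ |s|, by positivity, fun x ξ => ?_⟩
  have e1 := one_le_japanese ξ
  have e2 := japanese_pos (gradX ψ x ξ)
  refine rpow_le_of_comparable (japanese_pos _) (japanese_pos _) ?_ ?_ s
  · have h1 := japanese_le_one_add_norm (gradX ψ x ξ)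
    have h2 := hup x ξ
    have h3 : 0 ≤ C₁⁻¹ * japanese ξ := by positivity
    nlinarith
  · have h1 : japanese ξ ≤ C₁⁻¹ * japanese (gradX ψ x ξ) := by
      rw [inv_mul_eq_div, le_div_iff₀ hC₁]
      linarith [hlow x ξ]
    have h3 : 0 ≤ C₂ * japanese (gradX ψ x ξ) := by positivity
    nlinarith

/-- At the scale `⟨ξ⟩^(-1/2)` around the diagonal the exponential of the phase remainder has bounded
jets, also with respect to the base point and to `ξ`. -/
theorem jet_phaseExponential (D : CompositionData ψ b q m₁ m₂ m₃ m₄ t₁ t₂) :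
    JetBound (fun (p : Rn n × Rn n × Rn n) (h : (Rn n × Rn n × Rn n) × Rn n) =>
      Complex.exp (Complex.I * (phaseRemainder ψ (p.1 + h.1.1)
        (p.1 + h.1.1 + japanese p.2.2 ^ (-(1 / 2) : ℝ) • h.2) (p.2.2 + h.1.2.2) : ℂ)))
      fun _ => 1 := by
  let lam : Rn n × Rn n × Rn n → ℝ := fun p => japanese p.2.2 ^ (-(1 / 2) : ℝ)
  have hl0 : ∀ k, 0 < lam k := fun k => Real.rpow_pos_of_pos (japanese_pos _) _
  have hl1 : ∀ k, lam k ≤ 1 := fun k =>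
    Real.rpow_le_one_of_one_le_of_nonpos (one_le_japanese _) (by norm_num)
  have hl2 : ∀ k, japanese k.2.2 * lam k * lam k = 1 := fun k => by
    simp only [lam]
    nth_rewrite 1 [← Real.rpow_one (japanese k.2.2)]
    rw [← Real.rpow_add (japanese_pos _), ← Real.rpow_add (japanese_pos _)]
    norm_num
  let P1 := ContinuousLinearMap.fst ℝ (Rn n) (Rn n × Rn n)
  let P2 := ContinuousLinearMap.snd ℝ (Rn n) (Rn n × Rn n)
  let P3 := ContinuousLinearMap.snd ℝ (Rn n) (Rn n)
  let Q1 := ContinuousLinearMap.fst ℝ (Rn n × Rn n × Rn n) (Rn n)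
  let Q2 := ContinuousLinearMap.snd ℝ (Rn n × Rn n × Rn n) (Rn n)
  have n1 : ‖P1‖ ≤ 1 := ContinuousLinearMap.norm_fst_le _ _ _
  have n2 : ‖P2‖ ≤ 1 := ContinuousLinearMap.norm_snd_le _ _ _
  have n3 : ‖P3‖ ≤ 1 := ContinuousLinearMap.norm_snd_le _ _ _
  have n4 : ‖Q1‖ ≤ 1 := ContinuousLinearMap.norm_fst_le _ _ _
  have n5 : ‖Q2‖ ≤ 1 := ContinuousLinearMap.norm_snd_le _ _ _
  have n6 : ‖P1.comp Q1‖ ≤ 1 := (ContinuousLinearMap.opNorm_comp_le _ _).trans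
    (mul_le_one₀ n1 (norm_nonneg _) n4)
  have n7 : ‖(P3.comp P2).comp Q1‖ ≤ 1 := (ContinuousLinearMap.opNorm_comp_le _ _).trans
    (mul_le_one₀ ((ContinuousLinearMap.opNorm_comp_le _ _).trans
      (mul_le_one₀ n3 (norm_nonneg _) n2)) (norm_nonneg _) n4)
  have n8 : ∀ p, ‖lam p • Q2‖ ≤ lam p := fun p => by
    rw [norm_smul, Real.norm_of_nonneg (hl0 p).le]
    exact mul_le_of_le_one_right (hl0 p).le n5
  have h1 := jetBound_phaseRemainder D.smooth_phase D.jet_grad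
    (fun p : Rn n × Rn n × Rn n => p.1) (fun p => p.2.2) (fun _ => 0)
    (fun _ => P1.comp Q1) (fun _ => (P3.comp P2).comp Q1) (fun p => lam p • Q2) (μ := lam)
    (fun _ => n6) (fun _ => n7) (fun p => (n8 p).trans (hl1 p)) n8
    (fun p => by simpa using (hl0 p).le)
  refine ((h1.mono_one fun p => (hl2 p).le).cexp fun _ => le_rfl).congr' fun p h => ?_
  simp [P1, P2, P3, Q1, Q2, lam]

theorem jet_right_term (D : CompositionData ψ b q m₁ m₂ m₃ m₄ t₁ t₂) (α : MultiIndex n) :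
    JetBound (fun p h : Rn n × Rn n => mderiv α (fun η => q (p.1 + h.1) η)
      (gradX ψ (p.1 + h.1) (p.2 + h.2))) fun p => (japanese (gradX ψ p.1 p.2) ^ α.len)⁻¹ *
        (japanese p.1 ^ t₁ * japanese (gradX ψ p.1 p.2) ^ t₂) := by
  have hf := D.jet_right_comp (fun p : Rn n × Rn n => p.1) (fun p => gradX ψ p.1 p.2)
    (E := (Rn n × Rn n) × Rn n)
    (X := fun _ h => h.1.1) (H := fun _ h => h.2)
    (JetBound.clm_bounded (A := fun _ => (ContinuousLinearMap.fst ℝ (Rn n) (Rn n)).comp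
      (ContinuousLinearMap.fst ℝ (Rn n × Rn n) (Rn n))) fun _ => le_rfl)
    (JetBound.clm_bounded (A := fun _ => ContinuousLinearMap.snd ℝ (Rn n × Rn n) (Rn n))
      fun _ => le_rfl) (by simp) (by simp)
  refine (JetBound.mderiv_comp (f := fun (p h : Rn n × Rn n) η => q (p.1 + h.1) η)
    (fun p => D.smooth_right.comp (by fun_prop : ContDiff ℝ ∞ fun r : (Rn n × Rn n) × Rn n =>
      (p.1 + r.1.1, r.2))) (fun p => gradX ψ p.1 p.2) (fun p => japanese_pos _)
    D.jet_gradIncrement (by simp) hf α).congr' fun p h => ?_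
  rw [smul_smul, mul_inv_cancel₀ (japanese_pos _).ne', one_smul, add_sub_cancel]

theorem jet_left_term (D : CompositionData ψ b q m₁ m₂ m₃ m₄ t₁ t₂) (β : MultiIndex n) :
    JetBound (fun (p : Rn n × Rn n × Rn n) (h : (Rn n × Rn n × Rn n) × Rn n) =>
      mderiv β (fun η => b (p.1 + h.1.1 + japanese p.2.2 ^ (-(1 / 2) : ℝ) • h.2) (p.2.2 + h.1.2.2)
        (p.2.1 + h.1.2.1) η) (gradX ψ (p.1 + h.1.1) (p.2.2 + h.1.2.2)))
      fun p => (japanese (gradX ψ p.1 p.2.2) ^ β.len)⁻¹ *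
        (japanese p.1 ^ m₁ * japanese p.2.2 ^ m₂ * japanese p.2.1 ^ m₃
          * japanese (gradX ψ p.1 p.2.2) ^ m₄) := by
  let lam : Rn n × Rn n × Rn n → ℝ := fun p => japanese p.2.2 ^ (-(1 / 2) : ℝ)
  have hl1 : ∀ k, |lam k| ≤ 1 := fun k => by
    rw [abs_of_pos (Real.rpow_pos_of_pos (japanese_pos _) _)]
    exact Real.rpow_le_one_of_one_le_of_nonpos (one_le_japanese _) (by norm_num)
  let E₁ := (Rn n × Rn n × Rn n) × Rn n
  let a1 : E₁ →L[ℝ] Rn n := (ContinuousLinearMap.fst ℝ (Rn n) (Rn n × Rn n)).comp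
    (ContinuousLinearMap.fst ℝ (Rn n × Rn n × Rn n) (Rn n))
  let a2 : E₁ →L[ℝ] Rn n := ((ContinuousLinearMap.fst ℝ (Rn n) (Rn n)).comp
    (ContinuousLinearMap.snd ℝ (Rn n) (Rn n × Rn n))).comp
      (ContinuousLinearMap.fst ℝ (Rn n × Rn n × Rn n) (Rn n))
  let a3 : E₁ →L[ℝ] Rn n := ((ContinuousLinearMap.snd ℝ (Rn n) (Rn n)).comp
    (ContinuousLinearMap.snd ℝ (Rn n) (Rn n × Rn n))).comp
      (ContinuousLinearMap.fst ℝ (Rn n × Rn n × Rn n) (Rn n))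
  let a4 : E₁ →L[ℝ] Rn n := ContinuousLinearMap.snd ℝ (Rn n × Rn n × Rn n) (Rn n)
  let pr := ContinuousLinearMap.fst ℝ E₁ (Rn n)
  have hY : JetBound (fun p (h : E₁ × Rn n) => a1 h.1 + lam p • a4 h.1) fun _ => 1 :=
    (JetBound.clm_bounded (A := fun _ => a1.comp pr) fun _ => le_rfl).add
      (((JetBound.clm_bounded (A := fun _ : Rn n × Rn n × Rn n => a4.comp pr) fun _ =>
        le_rfl).const_smul lam (K := fun _ => 1) hl1).mono_one fun _ => by simp)
  have hf := D.jet_left_comp (fun p : Rn n × Rn n × Rn n => p.1) (fun p => p.2.2)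
    (fun p => p.2.1) (fun p => gradX ψ p.1 p.2.2) hY
    (JetBound.clm_bounded (A := fun _ => a3.comp pr) fun _ => le_rfl)
    (JetBound.clm_bounded (A := fun _ => a2.comp pr) fun _ => le_rfl)
    (JetBound.clm_bounded (A := fun _ => ContinuousLinearMap.snd ℝ E₁ (Rn n))
      fun _ => le_rfl) (by simp) (by simp) (by simp) (by simp)
  have hH := (D.jet_gradIncrement.reindex fun p : Rn n × Rn n × Rn n => (p.1, p.2.2)).comp_clm
    (fun _ => a1.prod a3) _ fun _ => le_rfl
  refine (JetBound.mderiv_comp (f := fun (p : Rn n × Rn n × Rn n) (h : E₁) η =>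
      b (p.1 + (a1 h + lam p • a4 h)) (p.2.2 + a3 h) (p.2.1 + a2 h) η)
    (fun p => D.smooth_left.comp (by fun_prop : ContDiff ℝ ∞ fun r : E₁ × Rn n =>
      (p.1 + (a1 r.1 + lam p • a4 r.1), p.2.2 + a3 r.1, p.2.1 + a2 r.1, r.2)))
      (fun p => gradX ψ p.1 p.2.2) (fun p => japanese_pos _)
    hH (by simp) hf β).congr' fun p h => ?_
  simp only
  rw [smul_smul, mul_inv_cancel₀ (japanese_pos _).ne', one_smul, add_sub_cancel, ← add_assoc]
  rfl

/-- The terms of the expansion are symbols. A derivative in `η` gains a full power of the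
frequency, and a derivative in `y` of the exponential of the quadratic phase loses half a power. -/
theorem jetBound_compositionTerm (D : CompositionData ψ b q m₁ m₂ m₃ m₄ t₁ t₂)
    (α β : MultiIndex n) :
    JetBound (fun p h : Rn n × Rn n × Rn n => compositionTerm ψ b q α β (p.1 + h.1)
      (p.2.1 + h.2.1) (p.2.2 + h.2.2)) fun p => japanese p.1 ^ (m₁ + t₁) * japanese p.2.1 ^ m₃
        * japanese p.2.2 ^ (m₂ + t₂ + m₄ - ((α.len + β.len : ℕ) : ℝ) / 2) := by
  let lam : Rn n × Rn n × Rn n → ℝ := fun p => japanese p.2.2 ^ (-(1 / 2) : ℝ)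
  let f : Rn n × Rn n × Rn n → Rn n × Rn n × Rn n → Rn n → ℂ := fun p h y =>
    Complex.exp (Complex.I * (phaseRemainder ψ (p.1 + h.1) (p.1 + h.1 + y) (p.2.2 + h.2.2) : ℂ))
      * mderiv β (fun η => b (p.1 + h.1 + y) (p.2.2 + h.2.2) (p.2.1 + h.2.1) η)
        (gradX ψ (p.1 + h.1) (p.2.2 + h.2.2))
  have hs : ∀ p, ContDiff ℝ ∞ fun r : (Rn n × Rn n × Rn n) × Rn n => f p r.1 r.2 := by
    intro p
    have hg : ContDiff ℝ ∞ fun r : (Rn n × Rn n × Rn n) × Rn n =>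
        gradX ψ (p.1 + r.1.1) (p.2.2 + r.1.2.2) :=
      (contDiff_gradMap D.smooth_phase).comp (by fun_prop :
        ContDiff ℝ ∞ fun r : (Rn n × Rn n × Rn n) × Rn n => (p.1 + r.1.1, p.2.2 + r.1.2.2))
    refine ContDiff.mul (Complex.contDiff_exp.comp (contDiff_const.mul
      (Complex.ofRealCLM.contDiff.comp ?_))) ?_
    · exact ((D.smooth_phase.comp (by fun_prop : ContDiff ℝ ∞ fun r : (Rn n × Rn n × Rn n) × Rn n =>
        (p.1 + r.1.1 + r.2, p.2.2 + r.1.2.2))).sub (D.smooth_phase.comp (by fun_prop :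
        ContDiff ℝ ∞ fun r : (Rn n × Rn n × Rn n) × Rn n => (p.1 + r.1.1, p.2.2 + r.1.2.2)))).add
        (ContDiff.inner ℝ (by fun_prop) hg)
    · have h1 : ∀ r : (Rn n × Rn n × Rn n) × Rn n,
          mderiv β (fun η => b (p.1 + r.1.1 + r.2) (p.2.2 + r.1.2.2) (p.2.1 + r.1.2.1) η)
          (gradX ψ (p.1 + r.1.1) (p.2.2 + r.1.2.2)) =
          dirDs ((β.toList.map (euclFrame n).vec).map
            (ContinuousLinearMap.inr ℝ (Rn n × Rn n × Rn n) (Rn n)))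
            (fun r : (Rn n × Rn n × Rn n) × Rn n => b r.1.1 r.1.2.1 r.1.2.2 r.2)
            ((p.1 + r.1.1 + r.2, p.2.2 + r.1.2.2, p.2.1 + r.1.2.1),
              gradX ψ (p.1 + r.1.1) (p.2.2 + r.1.2.2)) := fun r => by
        have := dirDs_snd_scale (f := fun (r : Rn n × Rn n × Rn n) (η : Rn n) =>
            b r.1 r.2.1 r.2.2 η)
          (D.smooth_left.comp (by fun_prop : ContDiff ℝ ∞ fun r : (Rn n × Rn n × Rn n) × Rn n =>
            (r.1.1, r.1.2.1, r.1.2.2, r.2))) 0 1 β ((p.1 + r.1.1 + r.2, p.2.2 + r.1.2.2,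
              p.2.1 + r.1.2.1), gradX ψ (p.1 + r.1.1) (p.2.2 + r.1.2.2))
        simpa using this.symm
      simp only [h1]
      exact ((D.smooth_left.comp (by fun_prop : ContDiff ℝ ∞
        fun r : (Rn n × Rn n × Rn n) × Rn n => (r.1.1, r.1.2.1, r.1.2.2, r.2))).dirDs _).comp
        ((by fun_prop : ContDiff ℝ ∞ fun r : (Rn n × Rn n × Rn n) × Rn n =>
          (p.1 + r.1.1 + r.2, p.2.2 + r.1.2.2, p.2.1 + r.1.2.1)).prodMk hg)
  have hl0 : ∀ k, 0 < lam k := fun k => Real.rpow_pos_of_pos (japanese_pos _) _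
  have h1 := JetBound.mderiv_comp hs (fun _ => 0) hl0 (JetBound.zero (W := fun _ => 1))
    (fun _ => rfl) ((D.jet_phaseExponential.mul (D.jet_left_term β)).congr' fun p h => by
      simp [f, lam]) (α + β)
  have h2 := (D.jet_right_term α).reindex fun p : Rn n × Rn n × Rn n => (p.1, p.2.2)
  have h3 := h2.comp_clm (fun _ => (ContinuousLinearMap.fst ℝ (Rn n) (Rn n × Rn n)).prod
    ((ContinuousLinearMap.snd ℝ (Rn n) (Rn n)).comp
    (ContinuousLinearMap.snd ℝ (Rn n) (Rn n × Rn n)))) _ fun _ => le_rfl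
  set a : ℂ := (Complex.I ^ (α.len + β.len))⁻¹ / ((α.fact : ℂ) * (β.fact : ℂ)) with ha
  have h4 : JetBound (fun (_ : Rn n × Rn n × Rn n) (_ : Rn n × Rn n × Rn n) => a)
      fun _ => ‖a‖ := JetBound.const fun _ => le_rfl
  obtain ⟨K, hK0, hK⟩ := D.japanese_gradX_rpow_le (m₄ + t₂ - (α.len + β.len : ℕ))
  refine ((((h4.mul h3).mul h1).congr' fun p h => ?_).mono (‖a‖ * K) (fun p => ?_) fun p => ?_)
  · rw [compositionTerm]
    simp only [smul_zero, add_zero]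
    congr 1
    simp only [f]
    have hy : ContDiff ℝ ∞ fun y => Complex.exp (Complex.I *
        (phaseRemainder ψ (p.1 + h.1) y (p.2.2 + h.2.2) : ℂ)) *
        mderiv β (fun η => b y (p.2.2 + h.2.2) (p.2.1 + h.2.1) η)
          (gradX ψ (p.1 + h.1) (p.2.2 + h.2.2)) := by
      have := (hs p).comp (by fun_prop : ContDiff ℝ ∞ fun y : Rn n => (h, y - (p.1 + h.1)))
      simpa [f, Function.comp_def] using this
    have := mderiv_comp_add hy (α + β) (p.1 + h.1) 0
    rw [add_zero] at this
    exact this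
  · have p1 := japanese_pos p.1
    have p2 := japanese_pos p.2.1
    have p3 := japanese_pos p.2.2
    have p4 := japanese_pos (gradX ψ p.1 p.2.2)
    have e1 : (lam p ^ (α + β).len)⁻¹ = japanese p.2.2 ^ (((α.len + β.len : ℕ) : ℝ) / 2) := by
      simp only [lam]
      rw [len_add, ← Real.rpow_natCast, ← Real.rpow_mul p3.le, ← Real.rpow_neg p3.le]
      congr 1
      ring
    have e2 : japanese (gradX ψ p.1 p.2.2) ^ (m₄ + t₂ - (α.len + β.len : ℕ))
        = japanese (gradX ψ p.1 p.2.2) ^ m₄ * japanese (gradX ψ p.1 p.2.2) ^ t₂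
          * ((japanese (gradX ψ p.1 p.2.2) ^ α.len)⁻¹
            * (japanese (gradX ψ p.1 p.2.2) ^ β.len)⁻¹) := by
      rw [Real.rpow_sub p4, Real.rpow_add p4, Real.rpow_natCast, pow_add, div_eq_mul_inv, mul_inv]
    have e3 : japanese p.2.2 ^ (m₂ + t₂ + m₄ - ((α.len + β.len : ℕ) : ℝ) / 2)
        = japanese p.2.2 ^ m₂ * japanese p.2.2 ^ (m₄ + t₂ - (α.len + β.len : ℕ))
          * japanese p.2.2 ^ (((α.len + β.len : ℕ) : ℝ) / 2) := by
      rw [← Real.rpow_add p3, ← Real.rpow_add p3]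
      congr 1
      ring
    have h5 := hK p.1 p.2.2
    rw [e1, e3, Real.rpow_add p1]
    rw [e2] at h5
    calc _ = ‖a‖ * (japanese (gradX ψ p.1 p.2.2) ^ m₄ * japanese (gradX ψ p.1 p.2.2) ^ t₂
          * ((japanese (gradX ψ p.1 p.2.2) ^ α.len)⁻¹
            * (japanese (gradX ψ p.1 p.2.2) ^ β.len)⁻¹)) * (japanese p.1 ^ m₁ * japanese p.1 ^ t₁
            * japanese p.2.1 ^ m₃ * japanese p.2.2 ^ m₂
            * japanese p.2.2 ^ (((α.len + β.len : ℕ) : ℝ) / 2)) := by ring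
      _ ≤ ‖a‖ * (K * japanese p.2.2 ^ (m₄ + t₂ - (α.len + β.len : ℕ)))
          * (japanese p.1 ^ m₁ * japanese p.1 ^ t₁
            * japanese p.2.1 ^ m₃ * japanese p.2.2 ^ m₂
            * japanese p.2.2 ^ (((α.len + β.len : ℕ) : ℝ) / 2)) := by gcongr
      _ = _ := by ring
  · have p1 := japanese_pos p.1
    have p2 := japanese_pos p.2.1
    have p3 := japanese_pos p.2.2
    positivity

end CompositionData

end TermEstimates

/-! ### Interpolation of derivatives -/

section Interpolation

variable {E F : Type} [NormedAddCommGroup E] [NormedSpace ℝ E] [NormedAddCommGroup F]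
  [NormedSpace ℝ F]

/-- The derivative at a point is controlled by the values of the function and by its second
derivative in a ball around the point. -/
theorem norm_fderiv_le_of_ball {g : E → F} (hg : ContDiff ℝ ∞ g) (p : E) {A B δ : ℝ}
    (hδ : 0 < δ) (hA : ∀ h, ‖h‖ ≤ δ → ‖g (p + h)‖ ≤ A)
    (hB : ∀ h, ‖h‖ ≤ δ → ‖iteratedFDeriv ℝ 2 g (p + h)‖ ≤ B) :
    ‖fderiv ℝ g p‖ ≤ 2 * A / δ + B * δ := by
  have hA0 : 0 ≤ A := (norm_nonneg _).trans (hA 0 (by simpa using hδ.le))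
  have hB0 : 0 ≤ B := (norm_nonneg _).trans (hB 0 (by simpa using hδ.le))
  have hmem : ∀ y ∈ Metric.closedBall p δ, ‖y - p‖ ≤ δ := fun y hy => by
    rwa [Metric.mem_closedBall, dist_eq_norm] at hy
  have hp : p ∈ Metric.closedBall p δ := Metric.mem_closedBall_self hδ.le
  have hd : ContDiff ℝ ∞ (fderiv ℝ g) := hg.fderiv_right (m := ∞) (by simp)
  have h2 : ∀ y ∈ Metric.closedBall p δ, ‖fderiv ℝ (fderiv ℝ g) y‖ ≤ B := fun y hy => by
    have := hB (y - p) (hmem y hy)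
    rw [add_sub_cancel, ← norm_iteratedFDeriv_fderiv, ← norm_iteratedFDeriv_fderiv,
      norm_iteratedFDeriv_zero] at this
    exact this
  have h1 : ∀ y ∈ Metric.closedBall p δ, ‖fderiv ℝ g y - fderiv ℝ g p‖ ≤ B * δ := fun y hy =>
    ((convex_closedBall p δ).norm_image_sub_le_of_norm_fderiv_le
      (fun y _ => hd.differentiable (by simp) y) h2 hp hy).trans
      (mul_le_mul_of_nonneg_left (hmem y hy) hB0)
  refine ContinuousLinearMap.opNorm_le_of_unit_norm (by positivity) fun v hv => ?_
  have hv' : ‖δ • v‖ = δ := by rw [norm_smul, hv, mul_one, Real.norm_of_nonneg hδ.le]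
  have hy : p + δ • v ∈ Metric.closedBall p δ := by
    rw [Metric.mem_closedBall, dist_eq_norm, add_sub_cancel_left, hv']
  have h3 := (convex_closedBall p δ).norm_image_sub_le_of_norm_fderiv_le'
    (fun y _ => hg.differentiable (by simp) y) h1 hp hy
  rw [add_sub_cancel_left, hv', map_smul] at h3
  have h4 := hA (δ • v) hv'.le
  have h5 := hA 0 (by simpa using hδ.le)
  rw [add_zero] at h5
  have h6 : δ * ‖fderiv ℝ g p v‖ ≤ 2 * A + B * δ * δ := by
    calc δ * ‖fderiv ℝ g p v‖ = ‖δ • fderiv ℝ g p v‖ := by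
          rw [norm_smul, Real.norm_of_nonneg hδ.le]
      _ = ‖(g (p + δ • v) - g p) - (g (p + δ • v) - g p - δ • fderiv ℝ g p v)‖ := by
          congr 1; abel
      _ ≤ ‖g (p + δ • v)‖ + ‖g p‖ + B * δ * δ :=
          (norm_sub_le _ _).trans (add_le_add (norm_sub_le _ _) h3)
      _ ≤ _ := by linarith
  rw [div_add' _ _ _ hδ.ne', le_div_iff₀ hδ]
  linarith

/-- If the functions `f N` decay to any prescribed order for large `N`, while each derivative has
a growth that is bounded independently of `N`, then all derivatives decay to any prescribed
order for large `N`. -/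
theorem eventually_decay_iteratedFDeriv {w r : E → ℝ} {Kw Kr : ℝ} (hw0 : ∀ p, 0 ≤ w p)
    (hr1 : ∀ p, 1 ≤ r p) (hw : ∀ p h, ‖h‖ ≤ 1 → w (p + h) ≤ Kw * w p)
    (hr : ∀ p h, ‖h‖ ≤ 1 → r (p + h) ≤ Kr * r p) (k : ℕ) {f : ℕ → E → F}
    (hf : ∀ N, ContDiff ℝ ∞ (f N))
    (hgrowth : ∀ k, ∃ K : ℝ, ∀ N, ∃ C : ℝ, 0 ≤ C ∧ ∀ p,
      ‖iteratedFDeriv ℝ k (f N) p‖ ≤ C * (w p * r p ^ K))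
    (hdecay : ∀ M : ℝ, ∃ N₀, ∀ N, N₀ ≤ N → ∃ C : ℝ, 0 ≤ C ∧ ∀ p,
      ‖f N p‖ ≤ C * (w p * r p ^ (-M))) (M : ℝ) :
    ∃ N₀, ∀ N, N₀ ≤ N → ∃ C : ℝ, 0 ≤ C ∧ ∀ p,
      ‖iteratedFDeriv ℝ k (f N) p‖ ≤ C * (w p * r p ^ (-M)) := by
  have hr0 : ∀ p, 0 < r p := fun p => one_pos.trans_le (hr1 p)
  have hrs : ∀ (s : ℝ) p h, ‖h‖ ≤ 1 → r (p + h) ^ s ≤ Kr ^ |s| * r p ^ s := fun s p h hh =>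
    rpow_le_of_comparable (hr0 _) (hr0 _) (hr p h hh)
      (by simpa using hr (p + h) (-h) (by simpa using hh)) s
  have hws : ∀ (s : ℝ) p h, ‖h‖ ≤ 1 →
      w (p + h) * r (p + h) ^ s ≤ Kw * Kr ^ |s| * (w p * r p ^ s) := fun s p h hh => by
    have h1 := mul_le_mul (hw p h hh) (hrs s p h hh) (Real.rpow_nonneg (hr0 _).le _)
      ((hw0 _).trans (hw p h hh))
    linarith
  induction k generalizing F M with
  | zero => simpa using hdecay M
  | succ k ih =>
    have hg : ∀ N, ContDiff ℝ ∞ (fderiv ℝ (f N)) := fun N => (hf N).fderiv_right (m := ∞) (by simp)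
    have := ih hg (fun k => by simpa only [norm_iteratedFDeriv_fderiv] using hgrowth (k + 1)) ?_ M
    · simpa only [norm_iteratedFDeriv_fderiv] using this
    intro M
    obtain ⟨K, hK⟩ := hgrowth 2
    obtain ⟨N₀, hN₀⟩ := hdecay (M + (|K| + |M|))
    refine ⟨N₀, fun N hN => ?_⟩
    obtain ⟨C₁, hC₁, h1⟩ := hN₀ N hN
    obtain ⟨C₂, hC₂, h2⟩ := hK N
    refine ⟨2 * |C₁ * (Kw * Kr ^ |-(M + (|K| + |M|))|)| + |C₂ * (Kw * Kr ^ |K|)|, by positivity,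
      fun p => ?_⟩
    set L := |K| + |M| with hL
    have hL0 : 0 ≤ L := by positivity
    have hδ : 0 < r p ^ (-L) := Real.rpow_pos_of_pos (hr0 p) _
    have hδ1 : r p ^ (-L) ≤ 1 := Real.rpow_le_one_of_one_le_of_nonpos (hr1 p) (by linarith)
    have h3 := norm_fderiv_le_of_ball (hf N) p hδ
      (A := |C₁ * (Kw * Kr ^ |-(M + L)|)| * (w p * r p ^ (-(M + L))))
      (B := |C₂ * (Kw * Kr ^ |K|)| * (w p * r p ^ K))
      (fun h hh => by
        have e1 := (h1 (p + h)).trans (mul_le_mul_of_nonneg_left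
          (hws (-(M + L)) p h (hh.trans hδ1)) hC₁)
        rw [← mul_assoc] at e1
        exact e1.trans (mul_le_mul_of_nonneg_right (le_abs_self _)
          (mul_nonneg (hw0 p) (Real.rpow_nonneg (hr0 p).le _))))
      (fun h hh => by
        have e1 := (h2 (p + h)).trans (mul_le_mul_of_nonneg_left
          (hws K p h (hh.trans hδ1)) hC₂)
        rw [← mul_assoc] at e1
        exact e1.trans (mul_le_mul_of_nonneg_right (le_abs_self _)
          (mul_nonneg (hw0 p) (Real.rpow_nonneg (hr0 p).le _))))
    have e1 : r p ^ (-(M + L)) / r p ^ (-L) = r p ^ (-M) := by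
      rw [← Real.rpow_sub (hr0 p)]; congr 1; ring
    have e2 : r p ^ K * r p ^ (-L) ≤ r p ^ (-M) := by
      rw [← Real.rpow_add (hr0 p)]
      refine Real.rpow_le_rpow_of_exponent_le (hr1 p) ?_
      rw [hL]
      linarith [le_abs_self K, le_abs_self M]
    refine h3.trans ?_
    rw [mul_div_assoc, mul_div_assoc, mul_div_assoc, e1, add_mul, mul_assoc, mul_assoc, mul_assoc]
    refine add_le_add le_rfl (mul_le_mul_of_nonneg_left
      (mul_le_mul_of_nonneg_left e2 (hw0 p)) (abs_nonneg _))

end Interpolation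

/-! ### The expansion with all derivatives -/

section Expansion

variable {n : ℕ} {ψ : Rn n → Rn n → ℝ} {b : Rn n → Rn n → Rn n → Rn n → ℂ} {q : Rn n → Rn n → ℂ}
  {m₁ m₂ m₃ m₄ t₁ t₂ : ℝ}

/-- The pairs of multi-indices of total length less than `N`. -/
def indexPairsLT (n N : ℕ) : Finset (MultiIndex n × MultiIndex n) :=
  (Finset.range N).biUnion (indexPairs n)

theorem mem_indexPairsLT {N : ℕ} {p : MultiIndex n × MultiIndex n} :
    p ∈ indexPairsLT n N ↔ p.1.len + p.2.len < N := by
  simp [indexPairsLT, mem_indexPairs]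

theorem sum_indexPairsLT {V : Type*} [AddCommMonoid V] (N : ℕ)
    (f : MultiIndex n × MultiIndex n → V) :
    ∑ γ ∈ indexPairsLT n N, f γ = ∑ k ∈ Finset.range N, ∑ γ ∈ indexPairs n k, f γ := by
  refine Finset.sum_biUnion fun i _ j _ hij => Finset.disjoint_left.2 fun γ h1 h2 => hij ?_
  rw [← mem_indexPairs.1 h1, mem_indexPairs.1 h2]

/-- For bounded frequencies the orders in the frequency are irrelevant. -/
theorem rpow_le_of_le {t R : ℝ} (h1 : 1 ≤ t) (h2 : t ≤ R) (a s : ℝ) :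
    t ^ a ≤ R ^ |a - s| * t ^ s := by
  have h0 : 0 < t := by linarith
  calc t ^ a = t ^ (a - s) * t ^ s := by rw [← Real.rpow_add h0]; congr 1; ring
    _ ≤ R ^ |a - s| * t ^ s := by
      refine mul_le_mul_of_nonneg_right ?_ (Real.rpow_nonneg h0.le _)
      exact (Real.rpow_le_rpow_of_exponent_le h1 (le_abs_self _)).trans
        (Real.rpow_le_rpow h0.le h2 (abs_nonneg _))

/-- A term of the expansion as a function on the product space. -/
def termMap (ψ : Rn n → Rn n → ℝ) (b : Rn n → Rn n → Rn n → Rn n → ℂ) (q : Rn n → Rn n → ℂ)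
    (γ : MultiIndex n × MultiIndex n) (p : Rn n × Rn n × Rn n) : ℂ :=
  compositionTerm ψ b q γ.1 γ.2 p.1 p.2.1 p.2.2

namespace CompositionData

theorem contDiff_termMap (D : CompositionData ψ b q m₁ m₂ m₃ m₄ t₁ t₂)
    (γ : MultiIndex n × MultiIndex n) : ContDiff ℝ ∞ (termMap ψ b q γ) := by
  refine contDiff_iff_contDiffAt.2 fun p => ?_
  have h1 : ContDiffAt ℝ ∞ (fun h => termMap ψ b q γ (p + h)) (p - p) := by
    rw [sub_self]
    exact (D.jetBound_compositionTerm γ.1 γ.2).1 p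
  have h2 := h1.comp (f := fun p' => p' - p) p (contDiffAt_id.sub contDiffAt_const)
  simpa [Function.comp_def] using h2

theorem norm_iteratedFDeriv_termMap_le (D : CompositionData ψ b q m₁ m₂ m₃ m₄ t₁ t₂)
    (γ : MultiIndex n × MultiIndex n) (k : ℕ) : ∃ C : ℝ, 0 ≤ C ∧ ∀ p,
      ‖iteratedFDeriv ℝ k (termMap ψ b q γ) p‖ ≤ C * (japanese p.1 ^ (m₁ + t₁)
        * japanese p.2.1 ^ m₃
        * japanese p.2.2 ^ (m₂ + t₂ + m₄ - ((γ.1.len + γ.2.len : ℕ) : ℝ) / 2)) := by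
  obtain ⟨C, hC0, hC⟩ := (D.jetBound_compositionTerm γ.1 γ.2).2 k
  refine ⟨C, hC0, fun p => ?_⟩
  have h1 : iteratedFDeriv ℝ k (fun h => termMap ψ b q γ (p + h)) 0
      = iteratedFDeriv ℝ k (termMap ψ b q γ) p := by
    rw [iteratedFDeriv_comp_add_left, add_zero]
  rw [← h1]
  exact hC p

theorem norm_iteratedFDeriv_sum_termMap_le (D : CompositionData ψ b q m₁ m₂ m₃ m₄ t₁ t₂)
    (S : Finset (MultiIndex n × MultiIndex n)) (k : ℕ) {M : ℝ}
    (hS : ∀ γ ∈ S, M ≤ ((γ.1.len + γ.2.len : ℕ) : ℝ) / 2) : ∃ C : ℝ, 0 ≤ C ∧ ∀ p,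
      ‖iteratedFDeriv ℝ k (fun p => ∑ γ ∈ S, termMap ψ b q γ p) p‖ ≤
        C * (japanese p.1 ^ (m₁ + t₁) * japanese p.2.1 ^ m₃
          * japanese p.2.2 ^ (m₂ + t₂ + m₄ - M)) := by
  choose C hC0 hC using fun γ => D.norm_iteratedFDeriv_termMap_le γ k
  refine ⟨∑ γ ∈ S, C γ, Finset.sum_nonneg fun γ _ => hC0 γ, fun p => ?_⟩
  rw [iteratedFDeriv_sum fun γ _ => (D.contDiff_termMap γ).of_le (by exact_mod_cast le_top),
    Finset.sum_apply, Finset.sum_mul]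
  refine norm_sum_le_of_le S fun γ hγ => (hC γ p).trans ?_
  have p1 := japanese_pos p.1
  have p2 := japanese_pos p.2.1
  have h1 := Real.rpow_le_rpow_of_exponent_le (one_le_japanese p.2.2)
    (by linarith [hS γ hγ] : m₂ + t₂ + m₄ - ((γ.1.len + γ.2.len : ℕ) : ℝ) / 2 ≤ m₂ + t₂ + m₄ - M)
  have := hC0 γ
  gcongr

/-- The remainders of the expansion, with all derivatives. -/
theorem exists_expansion (D : CompositionData ψ b q m₁ m₂ m₃ m₄ t₁ t₂)
    {c : Rn n × Rn n × Rn n → ℂ}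
    (hc : ∀ p, HasOsc (fun y => fullAmp ψ b q (p, y)) ((((2 * Real.pi) ^ n : ℝ) : ℂ) * c p))
    (hs : ContDiff ℝ ∞ c)
    (hgrowth : ∀ k : ℕ, ∃ (C : ℝ) (K : ℕ), 0 ≤ C ∧ ∀ p, ‖iteratedFDeriv ℝ k c p‖ ≤
      C * (japanese p.1 ^ (m₁ + t₁) * japanese p.2.1 ^ m₃ * japanese p.2.2 ^ m₂
        * japanese p.2.2 ^ K)) (k : ℕ) (M : ℝ) :
    ∃ N₀ : ℕ, ∀ N, N₀ ≤ N → ∃ C : ℝ, 0 ≤ C ∧ ∀ p,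
      ‖iteratedFDeriv ℝ k (fun p => c p - ∑ γ ∈ indexPairsLT n N, termMap ψ b q γ p) p‖ ≤
        C * (japanese p.1 ^ (m₁ + t₁) * japanese p.2.1 ^ m₃ * japanese p.2.2 ^ (-M)) := by
  set s := m₂ + t₂ + m₄ with hs'
  have hsum : ∀ S : Finset (MultiIndex n × MultiIndex n),
      ContDiff ℝ ∞ fun p => ∑ γ ∈ S, termMap ψ b q γ p :=
    fun S => ContDiff.sum fun γ _ => D.contDiff_termMap γ
  have hcrude : ∀ k, ∃ K : ℝ, ∀ N, ∃ C : ℝ, 0 ≤ C ∧ ∀ p,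
      ‖iteratedFDeriv ℝ k (fun p => c p - ∑ γ ∈ indexPairsLT n N, termMap ψ b q γ p) p‖ ≤
      C * (japanese p.1 ^ (m₁ + t₁) * japanese p.2.1 ^ m₃ * japanese p.2.2 ^ K) := by
    intro k
    obtain ⟨C, K, hC0, hC⟩ := hgrowth k
    refine ⟨max (m₂ + K) s, fun N => ?_⟩
    obtain ⟨C', hC'0, hC'⟩ := D.norm_iteratedFDeriv_sum_termMap_le (indexPairsLT n N) k (M := 0)
      fun γ _ => by positivity
    refine ⟨C + C', by positivity, fun p => ?_⟩
    have e : (fun p => c p - ∑ γ ∈ indexPairsLT n N, termMap ψ b q γ p)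
        = c - fun p => ∑ γ ∈ indexPairsLT n N, termMap ψ b q γ p := rfl
    rw [e, iteratedFDeriv_sub_apply (hs.contDiffAt.of_le (by exact_mod_cast le_top))
      ((hsum _).contDiffAt.of_le (by exact_mod_cast le_top)), add_mul]
    have p1 := japanese_pos p.1
    have p2 := japanese_pos p.2.1
    have p3 := japanese_pos p.2.2
    refine (norm_sub_le _ _).trans (add_le_add ((hC p).trans ?_) ((hC' p).trans ?_))
    · rw [mul_assoc (_ * _), ← Real.rpow_natCast, ← Real.rpow_add p3]
      have := Real.rpow_le_rpow_of_exponent_le (one_le_japanese p.2.2) (le_max_left (m₂ + K) s)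
      gcongr
    · have := Real.rpow_le_rpow_of_exponent_le (one_le_japanese p.2.2)
        ((sub_zero s).le.trans (le_max_right (m₂ + K) s))
      gcongr
  refine eventually_decay_iteratedFDeriv (E := Rn n × Rn n × Rn n)
    (w := fun p => japanese p.1 ^ (m₁ + t₁) * japanese p.2.1 ^ m₃)
    (r := fun p => japanese p.2.2) (Kw := (2 ^ |m₁ + t₁| * 2 ^ |m₁ + t₁|) * (2 ^ |m₃| * 2 ^ |m₃|))
    (Kr := 4) (fun p => ?_) (fun p => one_le_japanese _) (fun p h hh => ?_) (fun p h hh => ?_) k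
    (f := fun N p => c p - ∑ γ ∈ indexPairsLT n N, termMap ψ b q γ p)
    (fun N => hs.sub (hsum _)) hcrude (fun M => ?_) M
  · have p1 := japanese_pos p.1
    have p2 := japanese_pos p.2.1
    positivity
  · have hx : ∀ v : Rn n, ‖v‖ ≤ 1 → japanese v ≤ 2 := fun v hv =>
      (japanese_le_one_add_norm v).trans (by linarith)
    have e : ∀ (s : ℝ) (u v : Rn n), ‖v‖ ≤ 1 →
        japanese (u + v) ^ s ≤ 2 ^ |s| * 2 ^ |s| * japanese u ^ s := fun s u v hv => by
      refine (japanese_add_rpow_le u v s).trans ?_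
      have h1 := Real.rpow_le_rpow (japanese_pos v).le (hx v hv) (abs_nonneg s)
      have h2 := Real.rpow_nonneg (japanese_pos u).le s
      calc _ ≤ 2 ^ |s| * (japanese u ^ s * 2 ^ |s|) := by gcongr
        _ = _ := by ring
    have p1 := Real.rpow_nonneg (japanese_pos (p + h).2.1).le m₃
    have p2 := Real.rpow_nonneg (japanese_pos p.1).le (m₁ + t₁)
    calc _ ≤ ((2 ^ |m₁ + t₁| * 2 ^ |m₁ + t₁|) * japanese p.1 ^ (m₁ + t₁)) *
          ((2 ^ |m₃| * 2 ^ |m₃|) * japanese p.2.1 ^ m₃) :=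
        mul_le_mul (e _ _ _ ((norm_fst_le h).trans hh))
          (e _ _ _ (((norm_fst_le h.2).trans (norm_snd_le h)).trans hh)) p1 (by positivity)
      _ = _ := by ring
  · have h1 := japanese_add_le p.2.2 h.2.2
    have h2 : japanese h.2.2 ≤ 2 := (japanese_le_one_add_norm _).trans
      (by linarith [((norm_snd_le h.2).trans (norm_snd_le h)).trans hh])
    have h3 := japanese_pos p.2.2
    change japanese (p.2.2 + h.2.2) ≤ _
    nlinarith
  -- decay of the remainders without derivatives
  · obtain ⟨R, χ, hR, hgrad, hpt⟩ := D.exists_pointwise_expansion hc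
    obtain ⟨N₀, hN₀⟩ := exists_nat_ge (2 * (s + M))
    refine ⟨N₀, fun N hN => ?_⟩
    obtain ⟨C, hC0, hC⟩ := hpt N
    obtain ⟨K, hK⟩ := hcrude 0
    obtain ⟨C', hC'0, hC'⟩ := hK N
    refine ⟨C + C' * R ^ |K - -M|, by positivity, fun p => ?_⟩
    have p1 := japanese_pos p.1
    have p2 := japanese_pos p.2.1
    have p3 := japanese_pos p.2.2
    rcases le_or_gt R (japanese p.2.2) with h | h
    · have h1 := hC p.1 p.2.1 p.2.2 h
      simp only [D.sum_compositionTerm χ p.1 p.2.1 p.2.2 (hgrad _ _ h)] at h1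
      rw [← sum_indexPairsLT] at h1
      refine (show _ from h1).trans ?_
      have h2 : (N₀ : ℝ) ≤ N := by exact_mod_cast hN
      have h3 := Real.rpow_le_rpow_of_exponent_le (one_le_japanese p.2.2)
        (by linarith : s - (N : ℝ) / 2 ≤ -M)
      have h4 : 0 ≤ C' * R ^ |K - -M| := by positivity
      calc _ ≤ C * (japanese p.1 ^ (m₁ + t₁) * japanese p.2.1 ^ m₃ * japanese p.2.2 ^ (-M)) := by
            gcongr
        _ ≤ _ := mul_le_mul_of_nonneg_right (by linarith) (by positivity)
    · have h1 := hC' p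
      rw [norm_iteratedFDeriv_zero] at h1
      refine h1.trans ?_
      have h2 := rpow_le_of_le (one_le_japanese p.2.2) h.le K (-M)
      calc _ ≤ C' * (japanese p.1 ^ (m₁ + t₁) * japanese p.2.1 ^ m₃
            * (R ^ |K - -M| * japanese p.2.2 ^ (-M))) := by gcongr
        _ = C' * R ^ |K - -M| * (japanese p.1 ^ (m₁ + t₁) * japanese p.2.1 ^ m₃
            * japanese p.2.2 ^ (-M)) := by ring
        _ ≤ _ := mul_le_mul_of_nonneg_right (by linarith) (by positivity)

end CompositionData

end Expansion

/-! ### The composition theorem -/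

theorem lemmal (n : ℕ) (m₁ m₂ m₃ m₄ t₁ t₂ : ℝ)
    (ψ : Rn n → Rn n → ℝ)
    (hψ : ContDiff ℝ ∞ (fun p : Rn n × Rn n => ψ p.1 p.2))
    (hψ_grad : ∃ C₁ C₂ : ℝ, 0 < C₁ ∧ 0 < C₂ ∧ ∀ x ξ : Rn n,
      C₁ * japanese ξ ≤ japanese (gradX ψ x ξ) ∧ japanese (gradX ψ x ξ) ≤ C₂ * japanese ξ)
    (hψ_x : ∀ α : MultiIndex n, 1 ≤ α.len → ∃ C : ℝ, ∀ x ξ : Rn n,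
      |mderiv α (fun x' => ψ x' ξ) x| ≤ C * japanese ξ)
    (hψ_xξ : ∀ α β : MultiIndex n, 1 ≤ α.len → 1 ≤ β.len → ∃ C : ℝ, ∀ x ξ : Rn n,
      |mderiv₂ α β ψ x ξ| ≤ C)
    (b : Rn n → Rn n → Rn n → Rn n → ℂ)
    (hb : ContDiff ℝ ∞ (fun p : Rn n × Rn n × Rn n × Rn n => b p.1 p.2.1 p.2.2.1 p.2.2.2))
    (hb_est : ∀ α β γ δ : MultiIndex n, ∃ C : ℝ, ∀ y ξ z η : Rn n,
      ‖mderiv₄ α β γ δ b y ξ z η‖ ≤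
        C * japanese y ^ m₁ * japanese ξ ^ m₂ * japanese z ^ m₃ *
          japanese η ^ (m₄ - (δ.len : ℝ)))
    (q : Rn n → Rn n → ℂ)
    (hq : ContDiff ℝ ∞ (fun p : Rn n × Rn n => q p.1 p.2))
    (hq_est : ∀ α β : MultiIndex n, ∃ C : ℝ, ∀ x η : Rn n,
      ‖mderiv₂ α β q x η‖ ≤ C * japanese x ^ t₁ * japanese η ^ (t₂ - (β.len : ℝ))) :
    ∃ c : Rn n → Rn n → Rn n → ℂ,
      (∀ x z ξ : Rn n,
        HasOscIntegral (fun y η => ψ y ξ - ψ x ξ + inner ℝ (x - y) η)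
          (fun y η => b y ξ z η * q x η) (c x z ξ)) ∧
      ContDiff ℝ ∞ (fun p : Rn n × Rn n × Rn n => c p.1 p.2.1 p.2.2) ∧
      (∀ α β γ : MultiIndex n, ∃ C : ℝ, ∀ x z ξ : Rn n,
        ‖mderiv₃ α β γ c x z ξ‖ ≤
          C * japanese x ^ (m₁ + t₁) * japanese z ^ m₃ * japanese ξ ^ (m₂ + t₂ + m₄)) ∧
      ExpansionImprovingInXi (m₁ + t₁) m₃ (m₂ + t₂ + m₄) c (compositionTerm ψ b q) := by
  have D := compositionData_of_estimates hψ hψ_grad hψ_x hψ_xξ hb hb_est hq hq_est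
  obtain ⟨c, hosc, hint, hs, hgrowth⟩ := D.exists_composition
  have hle : ∀ k : ℕ, ((k : ℕ∞) : WithTop ℕ∞) ≤ ∞ := fun k => by exact_mod_cast le_top
  have hsum : ∀ S : Finset (MultiIndex n × MultiIndex n),
      ContDiff ℝ ∞ fun p => ∑ γ ∈ S, termMap ψ b q γ p :=
    fun S => ContDiff.sum fun γ _ => D.contDiff_termMap γ
  refine ⟨fun x z ξ => c (x, z, ξ), hint, hs, fun α β γ => ?_, fun μ ν ρ M => ?_⟩
  · set k := α.len + (β.len + γ.len) with hk
    obtain ⟨N, hN⟩ := D.exists_expansion hosc hs hgrowth k (-(m₂ + t₂ + m₄))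
    obtain ⟨C, hC0, hC⟩ := hN N le_rfl
    obtain ⟨C', hC'0, hC'⟩ := D.norm_iteratedFDeriv_sum_termMap_le (indexPairsLT n N) k (M := 0)
      fun γ _ => by positivity
    refine ⟨C + C', fun x z ξ => ?_⟩
    refine (norm_mderiv₃_le (f := fun x z ξ => c (x, z, ξ)) hs α β γ x z ξ).trans ?_
    have e : c = (fun p => c p - ∑ γ ∈ indexPairsLT n N, termMap ψ b q γ p)
        + fun p => ∑ γ ∈ indexPairsLT n N, termMap ψ b q γ p := by
      funext p; simp
    change ‖iteratedFDeriv ℝ k c (x, z, ξ)‖ ≤ _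
    rw [e, iteratedFDeriv_add_apply ((hs.sub (hsum _)).contDiffAt.of_le (hle k))
      ((hsum _).contDiffAt.of_le (hle k))]
    have h1 := hC (x, z, ξ)
    have h2 := hC' (x, z, ξ)
    simp only [neg_neg, sub_zero] at h1 h2
    refine (norm_add_le _ _).trans ((add_le_add h1 h2).trans (le_of_eq ?_))
    ring
  · set k := μ.len + (ν.len + ρ.len) with hk
    obtain ⟨N₀, hN₀⟩ := D.exists_expansion hosc hs hgrowth k (-(m₂ + t₂ + m₄ - M))
    obtain ⟨N₁, hN₁⟩ := exists_nat_ge (2 * M)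
    refine ⟨max N₀ N₁, fun S hS => ?_⟩
    set N := max N₀ N₁ with hN
    obtain ⟨C, hC0, hC⟩ := hN₀ N (le_max_left _ _)
    obtain ⟨C', hC'0, hC'⟩ := D.norm_iteratedFDeriv_sum_termMap_le (S \ indexPairsLT n N) k (M := M)
      fun γ hγ => by
        have h1 := (Finset.mem_sdiff.1 hγ).2
        rw [mem_indexPairsLT, not_lt] at h1
        have h2 : (N₁ : ℝ) ≤ ((γ.1.len + γ.2.len : ℕ) : ℝ) := by
          exact_mod_cast (le_max_right N₀ N₁).trans h1
        linarith
    refine ⟨C + C', fun x z ξ => ?_⟩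
    have e : (fun p => c p - ∑ γ ∈ S, termMap ψ b q γ p)
        = (fun p => c p - ∑ γ ∈ indexPairsLT n N, termMap ψ b q γ p)
          - fun p => ∑ γ ∈ S \ indexPairsLT n N, termMap ψ b q γ p := by
      funext p
      rw [Pi.sub_apply, ← Finset.sum_sdiff (s₁ := indexPairsLT n N) (s₂ := S)
        fun γ hγ => hS γ (mem_indexPairsLT.1 hγ)]
      ring
    refine (norm_mderiv₃_le (f := fun x z ξ => c (x, z, ξ)
      - ∑ γ ∈ S, compositionTerm ψ b q γ.1 γ.2 x z ξ) (hs.sub (hsum S)) μ ν ρ x z ξ).trans ?_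
    change ‖iteratedFDeriv ℝ k (fun p => c p - ∑ γ ∈ S, termMap ψ b q γ p) (x, z, ξ)‖ ≤ _
    rw [e, iteratedFDeriv_sub_apply ((hs.sub (hsum _)).contDiffAt.of_le (hle k))
      ((hsum _).contDiffAt.of_le (hle k))]
    have h1 := hC (x, z, ξ)
    have h2 := hC' (x, z, ξ)
    simp only [neg_neg] at h1 h2
    refine (norm_sub_le _ _).trans ((add_le_add h1 h2).trans (le_of_eq ?_))
    ring

end
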